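/- **Setting.** For $n\le l,m$ let $\Pi_{n,m}$ be the $n\times m$ matrix with entries $\delta_{ij}$, let $K_l=\mathrm U(l)$ carry its normalized Haar measure $d^*k$, and let $G_n=\mathrm{GL}_n(\mathbb C)$ and the set $H_n$ of invertible Hermitian $n\times n$ matrices carry their flat Lebesgue measures. Let $G_{l,m}^{(n)}$ be the set of complex $l\times m$ matrices of rank $n$, with the image of the measure $d^*k\,dg\,d^*\tilde k$ under $(k,g,\tilde k)\mapsto k\Pi_{l,n}g\Pi_{n,m}\tilde k^*$, and let $H_l^{(n)}$ be the set of Hermitian $l\times l$ matrices of rank $n$, with the image of $d^*k\,dx$ under $(k,x)\mapsto k\Pi_{l,n}x\Pi_{n,l}k^*$. Let $L^{1,K}(G_{l,m}^{(n)})$ and $L^{1,K}(H_l^{(n)})$ be the complex integrable functions $f$ with $f(k_1gk_2)=f(g)$ for all $k_1\in K_l$, $k_2\in K_m$, respectively $f(kxk^*)=f(x)$ for all $k\in K_l$ (as identities in $L^1$). **Spherical functions.** For $s\in\mathbb C^n$ and $L\in\mathbb Z_2^n$ put $s_{n+1}=L_{n+1}=-1$ and, if $\mathrm{Re}(s_j-s_{j+1})\ge1$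 for $j=1,\dots,n$, $$C_{l,n}(s)=\int_{K_l}d^*k\prod_{j=1}^n|\det\Pi_{j,l}k\Pi_{l,n}\Pi_{n,l}k^*\Pi_{l,j}|^{s_j-s_{j+1}-1},$$ $$\Phi(s,L;x)=\frac1{C_{l,n}(s)}\int_{K_l}d^*k\prod_{j=1}^n\mathrm{sign}[\det\Pi_{j,l}kxk^*\Pi_{l,j}]^{L_j-L_{j+1}-1}\,|\det\Pi_{j,l}kxk^*\Pi_{l,j}|^{s_j-s_{j+1}-1}\qquad(x\in H_l^{(n)}),$$ where the exponents of the signs are read modulo 2. For other $s$ both are defined by analytic continuation in $s$, where it exists. Let $L^{(n)}=(n-1,n-2,\dots,0)$ modulo 2, $s^{(n)}=(n-1,n-2,\dots,0)$, and $\Psi(s;g)=\Phi(s,L^{(n)};gg^*)$ for $g\in G_{l,m}^{(n)}$. The spherical transforms are $$\mathcal S_\Phi f(s,L)=\int_{H_l^{(n)}}f(x)\,\Phi(s,L;x)\,dx,\qquad \mathcal S_\Psi f(s)=\int_{G_{l,m}^{(n)}}f(g)\,\Psi(s;g)\,dg,$$ for those $s$ for which the integrand is defined wherever $f\ne0$ (up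 to a null set) and is integrable. **Convolutions.** Let $n_1\le l,m$ and $n_2\le m$ be positive integers, $r=\min\{n_1,n_2\}$, $d=|n_1-n_2|$, and $P\in L^{1,K}(G_{l,m}^{(n_1)})$. For $Q\in L^{1,K}(H_m^{(n_2)})$ let $P\circledast Q$ be the density, with respect to the measure of $H_l^{(r)}$, of the image of the complex measure $P(g)Q(x)\,dg\,dx$ under $(g,x)\mapsto gxg^*$. For $Q\in L^{1,K}(G_{m,o}^{(n_2)})$, with $n_2\le o$, let $P\circledast Q$ be the density, with respect to the measure of $G_{l,o}^{(r)}$, of the image of $P(g_1)Q(g_2)\,dg_1\,dg_2$ under $(g_1,g_2)\mapsto g_1g_2$. For $s\in\mathbb C^r$ and $L\in\mathbb Z_2^r$ put $$\tilde s=(s_1+d,\dots,s_r+d,s^{(d)})\in\mathbb C^{r+d},\qquad \tilde L=(L_1+d,\dots,L_r+d,L^{(d)})\in\mathbb Z_2^{r+d}.$$ **Claim.** 1. Let $Q\in L^{1,K}(H_m^{(n_2)})$. The density $P\circledast Q$ exists and lies in $L^{1,K}(H_l^{(r)})$. For all $s\in\mathbb C^r$ and $L\in\mathbb Z_2^r$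 for which the transforms and $C_{m,r+d}(\tilde s)$ on the right-hand side below exist, and for which the double integral $\iint\Phi(s,L;gxg^*)P(g)Q(x)\,dg\,dx$, to which $\mathcal S_\Phi[P\circledast Q](s,L)$ unfolds, exists as an absolutely convergent integral (its integrand being defined for almost all $(g,x)$ with $P(g)Q(x)\ne0$), the transform $\mathcal S_\Phi[P\circledast Q](s,L)$ exists and $$\mathcal S_\Phi[P\circledast Q](s,L)=C_{m,r+|n_1-n_2|}(\tilde s)\begin{cases}\mathcal S_\Psi P(s)\,\mathcal S_\Phi Q(\tilde s,\tilde L),&n_1=r,\\ \mathcal S_\Psi P(\tilde s)\,\mathcal S_\Phi Q(s,L),&n_2=r.\end{cases}$$ 2. Let $n_2\le o$ and $Q\in L^{1,K}(G_{m,o}^{(n_2)})$. The density $P\circledast Q$ exists and lies in $L^{1,K}(G_{l,o}^{(r)})$. For all $s\in\mathbb C^r$ for which the transforms and $C_{m,r+d}(\tilde s)$ on the right-hand side below exist, and for which the double integral $\iint\Psi(s;g_1g_2)P(g_1)Q(g_2)\,dg_1\,dg_2$ exists in the same sense, the transform $\mathcal S_\Psi[P\circledast Q](s)$ exists and $$\mathcal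 S_\Psi[P\circledast Q](s)=C_{m,r+|n_1-n_2|}(\tilde s)\begin{cases}\mathcal S_\Psi P(s)\,\mathcal S_\Psi Q(\tilde s),&n_1=r,\\ \mathcal S_\Psi P(\tilde s)\,\mathcal S_\Psi Q(s),&n_2=r.\end{cases}$$ -/

import Mathlib

open MeasureTheory Matrix

noncomputable section

namespace SphericalTransform

/-! ### Matrices, the unitary group and the reference measures -/

/-- The Borel sigma-algebra on complex matrices (product of the Borel sigma-algebras of the
entries). -/
instance instMeasurableSpaceMatrix (l m : ℕ) : MeasurableSpace (Matrix (Fin l) (Fin m) ℂ) :=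
  inferInstanceAs (MeasurableSpace (Fin l → Fin m → ℂ))

instance instBorelSpaceMatrix (l m : ℕ) : BorelSpace (Matrix (Fin l) (Fin m) ℂ) :=
  inferInstanceAs (BorelSpace (Fin l → Fin m → ℂ))

/-- The unitary group `K_n = U(n)`. -/
abbrev K (n : ℕ) : Type := Matrix.unitaryGroup (Fin n) ℂ

instance instCompactSpaceK (n : ℕ) : CompactSpace (K n) := by
  have hK : IsCompact
      (Set.pi Set.univ fun _ : Fin n => Set.pi Set.univ fun _ : Fin n =>
        Metric.closedBall (0 : ℂ) 1) :=
    isCompact_univ_pi fun _ => isCompact_univ_pi fun _ => isCompact_closedBall 0 1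
  have hcl : IsClosed ((Matrix.unitaryGroup (Fin n) ℂ : Set (Matrix (Fin n) (Fin n) ℂ))) :=
    isClosed_unitary
  refine isCompact_iff_compactSpace.mp (hK.of_isClosed_subset hcl ?_)
  intro U hU i _ j _
  rw [mem_closedBall_zero_iff]
  exact entry_norm_bound_of_unitary hU i j

/-- The normalized Haar measure `d^*k` on `U(n)`. -/
def haarK (n : ℕ) : Measure (K n) := Measure.haarMeasure ⊤

/-- The projection / inclusion matrix `Π_{n,m}` of size `n × m`. -/
def Proj (n m : ℕ) : Matrix (Fin n) (Fin m) ℂ :=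
  Matrix.of fun i j => if (i : ℕ) = (j : ℕ) then 1 else 0

/-- The flat Lebesgue measure on `G_n = GL_n(ℂ)`, as a measure on all complex `n × n` matrices:
the product of the differentials of the real and imaginary parts of all entries. -/
def lebG (n : ℕ) : Measure (Matrix (Fin n) (Fin n) ℂ) :=
  (Measure.map (fun t : Fin n → Fin n → ℂ => Matrix.of t) volume).restrict {g | IsUnit g.det}

/-- The Hermitian matrix with diagonal entries `t i i`, and with entries
`t i j + √-1 * t j i` in the positions `i < j`. -/
def hermOf (n : ℕ) (t : Fin n → Fin n → ℝ) : Matrix (Fin n) (Fin n) ℂ :=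
  Matrix.of fun i j =>
    if i = j then (t i i : ℂ)
    else if i < j then (t i j : ℂ) + (t j i : ℂ) * Complex.I
    else (t j i : ℂ) - (t i j : ℂ) * Complex.I

/-- The flat Lebesgue measure on the set `H_n` of invertible Hermitian `n × n` matrices: the product
of the differentials of the diagonal entries and of the real and imaginary parts of the entries
above the diagonal. -/
def lebH (n : ℕ) : Measure (Matrix (Fin n) (Fin n) ℂ) :=
  (Measure.map (hermOf n) volume).restrict {x | IsUnit x.det}

/-- The reference measure on the set `G_{l,m}^{(n)}` of complex `l × m` matrices of rank `n`, as
a measure on all `l × m` matrices: the image of `d^*k dg d^*k'` under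
`(k, g, k') ↦ k Π_{l,n} g Π_{n,m} k'^*`. -/
def measG (l m n : ℕ) : Measure (Matrix (Fin l) (Fin m) ℂ) :=
  Measure.map
    (fun p : K l × Matrix (Fin n) (Fin n) ℂ × K m =>
      (p.1 : Matrix (Fin l) (Fin l) ℂ) * Proj l n * p.2.1 * Proj n m *
        (p.2.2 : Matrix (Fin m) (Fin m) ℂ)ᴴ)
    ((haarK l).prod ((lebG n).prod (haarK m)))

/-- The reference measure on the set `H_l^{(n)}` of Hermitian `l × l` matrices of rank `n`, as
a measure on all `l × l` matrices: the image of `d^*k dx` under `(k, x) ↦ k Π_{l,n} x Π_{n,l} k^*`.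
-/
def measH (l n : ℕ) : Measure (Matrix (Fin l) (Fin l) ℂ) :=
  Measure.map
    (fun p : K l × Matrix (Fin n) (Fin n) ℂ =>
      (p.1 : Matrix (Fin l) (Fin l) ℂ) * Proj l n * p.2 * Proj n l *
        (p.1 : Matrix (Fin l) (Fin l) ℂ)ᴴ)
    ((haarK l).prod (lebH n))

/-- `L^{1,K}(G_{l,m}^{(n)})`: integrable functions `f` with `f (k₁ g k₂) = f g` for all unitary
`k₁`, `k₂`, as an identity of elements of `L¹`, that is, for almost every `g`. -/
structure IsL1KG (l m n : ℕ) (f : Matrix (Fin l) (Fin m) ℂ → ℂ) : Prop where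
  integrable : Integrable f (measG l m n)
  invariant : ∀ (k₁ : K l) (k₂ : K m), ∀ᵐ g ∂(measG l m n),
    f ((k₁ : Matrix (Fin l) (Fin l) ℂ) * g * (k₂ : Matrix (Fin m) (Fin m) ℂ)) = f g

/-- `L^{1,K}(H_l^{(n)})`: integrable functions `f` with `f (k x k^*) = f x` for all unitary
`k`, as an identity of elements of `L¹`, that is, for almost every `x`. -/
structure IsL1KH (l n : ℕ) (f : Matrix (Fin l) (Fin l) ℂ → ℂ) : Prop where
  integrable : Integrable f (measH l n)
  invariant : ∀ k : K l, ∀ᵐ x ∂(measH l n),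
    f ((k : Matrix (Fin l) (Fin l) ℂ) * x * (k : Matrix (Fin l) (Fin l) ℂ)ᴴ) = f x

/-! ### The multiplicative convolutions -/

/-- The complex measure `∫∫ dg dx δ(· - g x g^*) P(g) Q(x)`, that is, the image of
`P(g) Q(x) dg dx` under `(g, x) ↦ g x g^*`. -/
def convMeasH (l m n₁ n₂ : ℕ) (P : Matrix (Fin l) (Fin m) ℂ → ℂ)
    (Q : Matrix (Fin m) (Fin m) ℂ → ℂ) : ComplexMeasure (Matrix (Fin l) (Fin l) ℂ) :=
  (((measG l m n₁).prod (measH m n₂)).withDensityᵥ (fun p => P p.1 * Q p.2)).map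
    (fun p => p.1 * p.2 * p.1ᴴ)

/-- The convolution `P ⊛ Q` on `H_l^{(r)}`, `r = min n₁ n₂`: the density of `convMeasH` with respect
to the reference measure on `H_l^{(r)}`. -/
def convH (l m n₁ n₂ : ℕ) (P : Matrix (Fin l) (Fin m) ℂ → ℂ)
    (Q : Matrix (Fin m) (Fin m) ℂ → ℂ) : Matrix (Fin l) (Fin l) ℂ → ℂ :=
  (convMeasH l m n₁ n₂ P Q).rnDeriv (measH l (min n₁ n₂))

/-- The complex measure `∫∫ dg₁ dg₂ δ(· - g₁ g₂) P(g₁) Q(g₂)`, that is, the image of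
`P(g₁) Q(g₂) dg₁ dg₂` under `(g₁, g₂) ↦ g₁ g₂`. -/
def convMeasG (l m o n₁ n₂ : ℕ) (P : Matrix (Fin l) (Fin m) ℂ → ℂ)
    (Q : Matrix (Fin m) (Fin o) ℂ → ℂ) : ComplexMeasure (Matrix (Fin l) (Fin o) ℂ) :=
  (((measG l m n₁).prod (measG m o n₂)).withDensityᵥ (fun p => P p.1 * Q p.2)).map
    (fun p => p.1 * p.2)

/-- The convolution `P ⊛ Q` on `G_{l,o}^{(r)}`, `r = min n₁ n₂`: the density of `convMeasG` with
respect to the reference measure on `G_{l,o}^{(r)}`. -/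
def convG (l m o n₁ n₂ : ℕ) (P : Matrix (Fin l) (Fin m) ℂ → ℂ)
    (Q : Matrix (Fin m) (Fin o) ℂ → ℂ) : Matrix (Fin l) (Fin o) ℂ → ℂ :=
  (convMeasG l m o n₁ n₂ P Q).rnDeriv (measG l o (min n₁ n₂))

/-! ### Spherical functions -/

/-- The exponent `s_j - s_{j+1} - 1`, where `s_{n+1} = -1`. -/
def expS {n : ℕ} (s : Fin n → ℂ) (j : Fin n) : ℂ :=
  s j - (if h : (j : ℕ) + 1 < n then s ⟨(j : ℕ) + 1, h⟩ else -1) - 1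

/-- The exponent `L_j - L_{j+1} - 1` modulo 2, where `L_{n+1} = -1`. -/
def expL {n : ℕ} (L : Fin n → ZMod 2) (j : Fin n) : ZMod 2 :=
  L j - (if h : (j : ℕ) + 1 < n then L ⟨(j : ℕ) + 1, h⟩ else -1) - 1

/-- The domain `Re (s_j - s_{j+1}) ≥ 1` for `j = 1, …, n`, where `s_{n+1} = -1`. -/
def baseDomain (n : ℕ) : Set (Fin n → ℂ) := {s | ∀ j, 0 ≤ (expS s j).re}

/-- `sign(y)^e` for an exponent `e` modulo 2. -/
def signPow (y : ℝ) (e : ZMod 2) : ℂ := ((SignType.sign y : ℤ) : ℂ) ^ e.val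

/-- The minor `det (Π_{j,l} x Π_{l,j})`, the `j`-th leading principal minor of `x`. -/
def minor {l : ℕ} (j : ℕ) (x : Matrix (Fin l) (Fin l) ℂ) : ℂ := (Proj j l * x * Proj l j).det

/-- The normalization `C_{l,n}(s)` as an integral over the unitary group. -/
def normIntegral (l n : ℕ) (s : Fin n → ℂ) : ℂ :=
  ∫ k : K l, ∏ j : Fin n,
    ((‖minor ((j : ℕ) + 1) ((k : Matrix (Fin l) (Fin l) ℂ) * Proj l n * Proj n l *
      (k : Matrix (Fin l) (Fin l) ℂ)ᴴ)‖ : ℝ) : ℂ) ^ expS s j ∂(haarK l)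

/-- The quotient of integrals over the unitary group that defines the spherical function
`Φ(s, L; x)` on `H_l^{(n)}` for `s ∈ baseDomain n`. -/
def phiIntegral {l n : ℕ} (L : Fin n → ZMod 2) (x : Matrix (Fin l) (Fin l) ℂ) (s : Fin n → ℂ) : ℂ :=
  (∫ k : K l, ∏ j : Fin n,
    (signPow (minor ((j : ℕ) + 1) ((k : Matrix (Fin l) (Fin l) ℂ) * x *
        (k : Matrix (Fin l) (Fin l) ℂ)ᴴ)).re (expL L j) *
      ((‖minor ((j : ℕ) + 1) ((k : Matrix (Fin l) (Fin l) ℂ) * x *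
        (k : Matrix (Fin l) (Fin l) ℂ)ᴴ)‖ : ℝ) : ℂ) ^ expS s j) ∂(haarK l)) /
  normIntegral l n s

/-- `w` is the value at `s` of an analytic continuation of `f` from `D`: there is an analytic
function on a connected open set containing `D` and `s` that agrees with `f` on `D` and takes the
value `w` at `s`. -/
def IsContinuationValue {n : ℕ} (f : (Fin n → ℂ) → ℂ) (D : Set (Fin n → ℂ)) (s : Fin n → ℂ)
    (w : ℂ) : Prop :=
  ∃ (U : Set (Fin n → ℂ)) (F : (Fin n → ℂ) → ℂ), IsOpen U ∧ IsPreconnected U ∧ D ⊆ U ∧ s ∈ U ∧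
    AnalyticOnNhd ℂ F U ∧ Set.EqOn F f D ∧ F s = w

/-- `f` can be continued analytically from `D` to `s`. -/
def ContinuesTo {n : ℕ} (f : (Fin n → ℂ) → ℂ) (D : Set (Fin n → ℂ)) (s : Fin n → ℂ) : Prop :=
  ∃ w, IsContinuationValue f D s w

open Classical in
/-- The value at `s` of the analytic continuation of `f` from `D` (and `0` if there is none). -/
def continuation {n : ℕ} (f : (Fin n → ℂ) → ℂ) (D : Set (Fin n → ℂ)) (s : Fin n → ℂ) : ℂ :=
  if h : ContinuesTo f D s then h.choose else 0

/-- The normalization `C_{l,n}(s)`, continued analytically in `s`. -/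
def normC (l n : ℕ) (s : Fin n → ℂ) : ℂ := continuation (normIntegral l n) (baseDomain n) s

/-- `s` is in the domain of the analytic continuation of `C_{l,n}`. -/
def NormCDefined (l n : ℕ) (s : Fin n → ℂ) : Prop :=
  ContinuesTo (normIntegral l n) (baseDomain n) s

/-- The spherical function `Φ(s, L; x)` on `H_l^{(n)}`, continued analytically in `s`. -/
def Phi {l n : ℕ} (s : Fin n → ℂ) (L : Fin n → ZMod 2) (x : Matrix (Fin l) (Fin l) ℂ) : ℂ :=
  continuation (phiIntegral L x) (baseDomain n) s

/-- `s` is in the domain of the analytic continuation of `Φ(·, L; x)`. -/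
def PhiDefined {l n : ℕ} (s : Fin n → ℂ) (L : Fin n → ZMod 2) (x : Matrix (Fin l) (Fin l) ℂ) :
    Prop :=
  ContinuesTo (phiIntegral L x) (baseDomain n) s

/-- `L^{(n)} = (n-1, n-2, …, 1, 0)` modulo 2. -/
def Lstd (n : ℕ) : Fin n → ZMod 2 := fun j => ((n - 1 - (j : ℕ) : ℕ) : ZMod 2)

/-- The spherical function `Ψ(s; g) = Φ(s, L^{(n)}; g g^*)` on `G_{l,m}^{(n)}`. -/
def Psi {l m n : ℕ} (s : Fin n → ℂ) (g : Matrix (Fin l) (Fin m) ℂ) : ℂ :=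
  Phi s (Lstd n) (g * gᴴ)

/-- `s` is in the domain of the analytic continuation of `Ψ(·; g)`. -/
def PsiDefined {l m n : ℕ} (s : Fin n → ℂ) (g : Matrix (Fin l) (Fin m) ℂ) : Prop :=
  PhiDefined s (Lstd n) (g * gᴴ)

/-- `s̃ = (s_1 + (N-n), …, s_n + (N-n), N-n-1, …, 1, 0)` for `n ≤ N`. -/
def tildeS {n : ℕ} (N : ℕ) (s : Fin n → ℂ) : Fin N → ℂ := fun j =>
  if h : (j : ℕ) < n then s ⟨j, h⟩ + ((N - n : ℕ) : ℂ) else ((N - 1 - (j : ℕ) : ℕ) : ℂ)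

/-- `L̃ = (L_1 + (N-n), …, L_n + (N-n), N-n-1, …, 1, 0)` modulo 2, for `n ≤ N`. -/
def tildeL {n : ℕ} (N : ℕ) (L : Fin n → ZMod 2) : Fin N → ZMod 2 := fun j =>
  if h : (j : ℕ) < n then L ⟨j, h⟩ + ((N - n : ℕ) : ZMod 2)
  else ((N - 1 - (j : ℕ) : ℕ) : ZMod 2)

/-! ### Spherical transforms -/

/-- The integral defining a transform exists: with respect to `μ`, for almost every `x` with
`f x ≠ 0` the kernel is defined at `x`, and `f` times the kernel is integrable. -/
def TransformExists {X : Type} [MeasurableSpace X] (μ : Measure X) (f : X → ℂ)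
    (kerDefined : X → Prop) (ker : X → ℂ) : Prop :=
  (∀ᵐ x ∂μ, f x ≠ 0 → kerDefined x) ∧ Integrable (fun x => f x * ker x) μ

/-- The spherical transform `S_Φ f (s, L)` of a function on `H_l^{(n)}`. -/
def SPhi (l : ℕ) {n : ℕ} (f : Matrix (Fin l) (Fin l) ℂ → ℂ) (s : Fin n → ℂ) (L : Fin n → ZMod 2) :
    ℂ :=
  ∫ x, f x * Phi s L x ∂(measH l n)

/-- The integral defining `S_Φ f (s, L)` exists. -/
def SPhiExists (l : ℕ) {n : ℕ} (f : Matrix (Fin l) (Fin l) ℂ → ℂ) (s : Fin n → ℂ)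
    (L : Fin n → ZMod 2) : Prop :=
  TransformExists (measH l n) f (PhiDefined s L) (Phi s L)

/-- The spherical transform `S_Ψ f (s)` of a function on `G_{l,m}^{(n)}`. -/
def SPsi (l m : ℕ) {n : ℕ} (f : Matrix (Fin l) (Fin m) ℂ → ℂ) (s : Fin n → ℂ) : ℂ :=
  ∫ g, f g * Psi s g ∂(measG l m n)

/-- The integral defining `S_Ψ f (s)` exists. -/
def SPsiExists (l m : ℕ) {n : ℕ} (f : Matrix (Fin l) (Fin m) ℂ → ℂ) (s : Fin n → ℂ) : Prop :=
  TransformExists (measG l m n) f (PsiDefined s) (Psi s)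

/-- The double integral `∫∫ dg dx Φ(s, L; g x g^*) P(g) Q(x)` to which `S_Φ[P ⊛ Q](s, L)` unfolds
exists (as an absolutely convergent integral). -/
def SPhiConvExists (l m n₁ n₂ : ℕ) {n : ℕ} (P : Matrix (Fin l) (Fin m) ℂ → ℂ)
    (Q : Matrix (Fin m) (Fin m) ℂ → ℂ) (s : Fin n → ℂ) (L : Fin n → ZMod 2) : Prop :=
  TransformExists ((measG l m n₁).prod (measH m n₂)) (fun p => P p.1 * Q p.2)
    (fun p => PhiDefined s L (p.1 * p.2 * p.1ᴴ)) (fun p => Phi s L (p.1 * p.2 * p.1ᴴ))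

/-- The double integral `∫∫ dg₁ dg₂ Ψ(s; g₁ g₂) P(g₁) Q(g₂)` to which `S_Ψ[P ⊛ Q](s)` unfolds
exists (as an absolutely convergent integral). -/
def SPsiConvExists (l m o n₁ n₂ : ℕ) {n : ℕ} (P : Matrix (Fin l) (Fin m) ℂ → ℂ)
    (Q : Matrix (Fin m) (Fin o) ℂ → ℂ) (s : Fin n → ℂ) : Prop :=
  TransformExists ((measG l m n₁).prod (measG m o n₂)) (fun p => P p.1 * Q p.2)
    (fun p => PsiDefined s (p.1 * p.2)) (fun p => Psi s (p.1 * p.2))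

end SphericalTransform

end

open SphericalTransform

/-!
Convolution inserts an average over `U(m)` between its factors: since `Q` is invariant, the double
integral `∫∫ Φ(s, L; g x gᴴ) P(g) Q(x)` does not change if `Φ(s, L; g x gᴴ)` is replaced by
`∫ Φ(s, L; g k x kᴴ gᴴ) dk` (`integral_prod_of_average`). So everything rests on a product formula for
this average, which has to hold for all `s` at which the functions involved have continuations, and
on the passage from the double integral to the density of the convolution.

*Product formula on the base domain.* Where the spherical functions are given by convergent integrals,
the first rows of `u g`, for `u` in `U(l)`, are `T Π q` with `T` lower triangular and `q` unitary. The
leading minors split off those of `T`, and the Haar measure absorbs `q`. Hence the average is the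
product of two spherical integrals (`integral_sphInt_conj`), of which the one for the factor of higher
rank has parameters that are completed by `tildeS` (`sphInt_Proj`, `sphInt_tilde`).

*Explicit formula.* On the base domain a spherical integral at a matrix with spectrum `a` is, up to a
constant, `det(sign(a_i)^{L_j} |a_i|^{s_j}) / (∏_{i<j} (s_i - s_j) Δ(a))` with the Vandermonde
determinant `Δ` (`sphInt_diagonal`). This is an induction over the size: the spectrum of the leading
corner of a randomly rotated matrix interlaces `a` with a density proportional to `|Δ(b)| / |Δ(a)|`
(`integral_corner`), as the squared moduli of a row of a random unitary matrix are uniformly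
distributed on the simplex. The formula identifies the analytic continuations, and it gives the
normalization in closed form (`exists_normIntegral_eq`).

*Continuation of the product formula.* Existence of the continuations and of the average at a single
`s` says nothing about integrability at nearby parameters, so that the average need not be analytic
in `s`. The remedy is the twist `s + t (1, …, 1)`, which multiplies the numerator of the explicit
formula by `|det|^t`. For large real `t` the line through the twisted point in a direction with
decreasing entries meets the base domain at one end, and its reversal at the other end. The numerator
is alternating in `s`, and therefore bounded on two vertical lines uniformly in the spectrum; by the
Phragmén–Lindelöf principle it is bounded between them (`exists_uniform_bound`), and the identity
extends to a neighborhood of the twisted point. Circle averages along this line remove the zeros of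
`∏_{i<j} (s_i - s_j)`. Both sides are then holomorphic in `t` for `re t > 0`, so that they agree there,
and `t → 0` yields the claim by dominated convergence (`integral_germ_eq`). The results are
`integral_Phi_conj_left` and `integral_Phi_conj_right`, one for each order of the ranks.

*Densities.* After conditioning on the unitary variables between the factors, `g x gᴴ` and `g₁ g₂`
depend on the remaining variables through surjective linear maps, so that the image measures are
absolutely continuous (`map_conj_absolutelyContinuous`, `map_mul_absolutelyContinuous`). Integrals
against the density unfold for kernels that are limits of measurable functions where they are defined
(`IsImageDensity.integral_kernel`). This applies to `Φ`: almost every matrix of the reference measures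
has simple nonzero spectrum, and there the explicit formula exhibits `Φ` as such a limit
(`exists_measurable_tendsto_Phi`).
-/

noncomputable section

namespace SphericalTransform

/-! ### Haar measure on the unitary group -/

instance instIsHaarMeasureHaarK (n : ℕ) : (haarK n).IsHaarMeasure := by
  unfold haarK; infer_instance

instance instIsProbabilityMeasureHaarK (n : ℕ) : IsProbabilityMeasure (haarK n) := by
  constructor
  have h := Measure.haarMeasure_self (K₀ := (⊤ : TopologicalSpace.PositiveCompacts (K n)))
  simpa [haarK] using h

instance instIsMulRightInvariantHaarK (n : ℕ) : (haarK n).IsMulRightInvariant := by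
  constructor
  intro g
  have h := Measure.isMulInvariant_eq_smul_of_compactSpace
    (Measure.map (· * g) (haarK n)) (haarK n)
  have h1 := congrArg (fun μ : Measure (K n) => μ Set.univ) h
  simp only [Measure.smul_apply, measure_univ] at h1
  rw [Measure.map_apply (measurable_mul_const g) MeasurableSet.univ] at h1
  simp only [Set.preimage_univ, measure_univ] at h1
  rw [h]
  have h2 : Measure.haarScalarFactor (Measure.map (· * g) (haarK n)) (haarK n) = 1 := by
    have : (1 : ENNReal) = (Measure.haarScalarFactor
      (Measure.map (· * g) (haarK n)) (haarK n) : ENNReal) := by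
      simpa [ENNReal.smul_def] using h1
    exact_mod_cast this.symm
  rw [h2, one_smul]

instance instIsInvInvariantHaarK (n : ℕ) : (haarK n).IsInvInvariant := by
  constructor
  have h := Measure.isMulInvariant_eq_smul_of_compactSpace (haarK n).inv (haarK n)
  have h1 := congrArg (fun μ : Measure (K n) => μ Set.univ) h
  simp only [Measure.smul_apply, measure_univ] at h1
  rw [Measure.inv_apply] at h1
  simp only [Set.inv_univ, measure_univ] at h1
  rw [h]
  have h2 : Measure.haarScalarFactor (haarK n).inv (haarK n) = 1 := by
    have : (1 : ENNReal) = (Measure.haarScalarFactor (haarK n).inv (haarK n) : ENNReal) := by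
      simpa [ENNReal.smul_def] using h1
    exact_mod_cast this.symm
  rw [h2, one_smul]

lemma continuous_coeK (n : ℕ) : Continuous (fun k : K n => (k : Matrix (Fin n) (Fin n) ℂ)) :=
  continuous_subtype_val

lemma coeK_mul_conjTranspose {n : ℕ} (k : K n) :
    (k : Matrix (Fin n) (Fin n) ℂ) * (k : Matrix (Fin n) (Fin n) ℂ)ᴴ = 1 :=
  Matrix.mem_unitaryGroup_iff.mp k.2

lemma coeK_conjTranspose_mul {n : ℕ} (k : K n) :
    (k : Matrix (Fin n) (Fin n) ℂ)ᴴ * (k : Matrix (Fin n) (Fin n) ℂ) = 1 :=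
  Matrix.mem_unitaryGroup_iff'.mp k.2

lemma coeK_inv {n : ℕ} (k : K n) :
    ((k⁻¹ : K n) : Matrix (Fin n) (Fin n) ℂ) = (k : Matrix (Fin n) (Fin n) ℂ)ᴴ := rfl

lemma coeK_mul {n : ℕ} (k k' : K n) :
    ((k * k' : K n) : Matrix (Fin n) (Fin n) ℂ) = (k : Matrix (Fin n) (Fin n) ℂ) * k' := rfl

lemma norm_coeK_le {n : ℕ} (k : K n) (i j : Fin n) :
    ‖(k : Matrix (Fin n) (Fin n) ℂ) i j‖ ≤ 1 := entry_norm_bound_of_unitary k.2 i j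

lemma det_coeK_ne_zero {n : ℕ} (k : K n) : (k : Matrix (Fin n) (Fin n) ℂ).det ≠ 0 := by
  intro h
  have := congrArg Matrix.det (coeK_mul_conjTranspose k)
  rw [Matrix.det_mul, h, zero_mul, Matrix.det_one] at this
  exact zero_ne_one this

/-! ### The truncation matrices -/

lemma Proj_apply (n m : ℕ) (i : Fin n) (j : Fin m) :
    Proj n m i j = if (i : ℕ) = (j : ℕ) then 1 else 0 := rfl

lemma Proj_conjTranspose (n m : ℕ) : (Proj n m)ᴴ = Proj m n := by
  ext i j
  simp only [conjTranspose_apply, Proj_apply, eq_comm]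
  split_ifs <;> simp

lemma Proj_self (n : ℕ) : Proj n n = 1 := by
  ext i j
  simp [Proj_apply, Matrix.one_apply, Fin.ext_iff]

lemma Proj_mul_apply {n m : ℕ} {ι : Type*} (h : n ≤ m) (x : Matrix (Fin m) ι ℂ) (i : Fin n)
    (j : ι) : (Proj n m * x) i j = x (Fin.castLE h i) j := by
  rw [Matrix.mul_apply, Finset.sum_eq_single (Fin.castLE h i)]
  · simp [Proj_apply]
  · intro b _ hb
    have : (i : ℕ) ≠ b := fun hh => hb (Fin.ext (by simp [hh]))
    simp [Proj_apply, this]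
  · simp

lemma mul_Proj_apply {n m : ℕ} {ι : Type*} (h : n ≤ m) (x : Matrix ι (Fin m) ℂ) (i : ι)
    (j : Fin n) : (x * Proj m n) i j = x i (Fin.castLE h j) := by
  rw [Matrix.mul_apply, Finset.sum_eq_single (Fin.castLE h j)]
  · simp [Proj_apply]
  · intro b _ hb
    have : (b : ℕ) ≠ j := fun hh => hb (Fin.ext (by simp [hh]))
    simp [Proj_apply, this]
  · simp

lemma Proj_mul_Proj {a b c : ℕ} (h : a ≤ b ∨ c ≤ b) : Proj a b * Proj b c = Proj a c := by
  rcases h with h | h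
  · ext i j
    rw [Proj_mul_apply h, Proj_apply, Proj_apply]; rfl
  · ext i j
    rw [mul_Proj_apply h, Proj_apply, Proj_apply]; rfl

/-- `T` is lower triangular. -/
def IsLower {n : ℕ} (T : Matrix (Fin n) (Fin n) ℂ) : Prop := ∀ i j, i < j → T i j = 0

lemma IsLower.Proj_mul {r m : ℕ} (h : r ≤ m) {T : Matrix (Fin m) (Fin m) ℂ} (hT : IsLower T) :
    Proj r m * T = (Proj r m * T * Proj m r) * Proj r m := by
  ext i j
  rw [Proj_mul_apply h]
  by_cases hj : (j : ℕ) < r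
  · have : (Proj r m * T * Proj m r * Proj r m) i j
        = (Proj r m * T * (Proj m r * Proj r m)) i j := by rw [Matrix.mul_assoc _ (Proj m r)]
    rw [Matrix.mul_apply, Finset.sum_eq_single (⟨j, hj⟩ : Fin r)]
    · rw [mul_Proj_apply h, Proj_mul_apply h]; simp [Proj_apply]
    · intro b _ hb
      have : (b : ℕ) ≠ j := fun hh => hb (Fin.ext (by simp [hh]))
      simp [Proj_apply, this]
    · simp
  · rw [hT _ _ (by rw [Fin.lt_def]; simp; omega), Matrix.mul_apply, Finset.sum_eq_zero]
    intro b _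
    have : (b : ℕ) ≠ j := by omega
    simp [Proj_apply, this]

/-- The inclusion `U(n) → U(m)` as the upper left block, for `n ≤ m`. -/
def extK {n m : ℕ} (h : n ≤ m) (u : K n) : K m :=
  ⟨Proj m n * u.1 * Proj n m + (1 - Proj m n * Proj n m), by
    rw [Matrix.mem_unitaryGroup_iff, star_eq_conjTranspose]
    -- with the isometry `J = Π_{m,n}` the block matrix is `J u Jᴴ + (1 - J Jᴴ)`, and `Jᴴ J = 1`
    have h1 : Proj n m * Proj m n = 1 := by rw [Proj_mul_Proj (Or.inl h), Proj_self]
    have h2 := coeK_mul_conjTranspose u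
    simp only [conjTranspose_add, conjTranspose_sub, conjTranspose_mul, Proj_conjTranspose,
      conjTranspose_one]
    have e1 : (Proj m n * (u : Matrix (Fin n) (Fin n) ℂ) * Proj n m) *
        (Proj m n * ((u : Matrix (Fin n) (Fin n) ℂ)ᴴ * Proj n m)) = Proj m n * Proj n m := by
      calc _ = Proj m n * ((u : Matrix (Fin n) (Fin n) ℂ) * (Proj n m * Proj m n) *
            (u : Matrix (Fin n) (Fin n) ℂ)ᴴ) * Proj n m := by simp only [Matrix.mul_assoc]
        _ = _ := by rw [h1, Matrix.mul_one, h2, Matrix.mul_one]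
    have e2 : (Proj m n * (u : Matrix (Fin n) (Fin n) ℂ) * Proj n m) *
        (Proj m n * Proj n m) = Proj m n * (u : Matrix (Fin n) (Fin n) ℂ) * Proj n m := by
      calc _ = Proj m n * (u : Matrix (Fin n) (Fin n) ℂ) * (Proj n m * Proj m n) * Proj n m := by
            simp only [Matrix.mul_assoc]
        _ = _ := by rw [h1, Matrix.mul_one]
    have e3 : (Proj m n * Proj n m) * (Proj m n * ((u : Matrix (Fin n) (Fin n) ℂ)ᴴ * Proj n m))
        = Proj m n * ((u : Matrix (Fin n) (Fin n) ℂ)ᴴ * Proj n m) := by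
      calc _ = Proj m n * (Proj n m * Proj m n) * ((u : Matrix (Fin n) (Fin n) ℂ)ᴴ * Proj n m) := by
            simp only [Matrix.mul_assoc]
        _ = _ := by rw [h1, Matrix.mul_one]
    have e4 : (Proj m n * Proj n m) * (Proj m n * Proj n m) = Proj m n * Proj n m := by
      calc _ = Proj m n * (Proj n m * Proj m n) * Proj n m := by
            simp only [Matrix.mul_assoc]
        _ = _ := by rw [h1, Matrix.mul_one]
    simp only [Matrix.add_mul, Matrix.mul_add, Matrix.sub_mul, Matrix.mul_sub, e1, e2, e3, e4,
      Matrix.mul_one, Matrix.one_mul]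
    abel⟩

lemma Proj_mul_extK {n m : ℕ} (h : n ≤ m) (u : K n) :
    Proj n m * (extK h u : Matrix (Fin m) (Fin m) ℂ) = u.1 * Proj n m := by
  have h1 : Proj n m * Proj m n = 1 := by rw [Proj_mul_Proj (Or.inl h), Proj_self]
  simp only [extK, Matrix.mul_add, Matrix.mul_sub, Matrix.mul_one, ← Matrix.mul_assoc, h1,
    Matrix.one_mul]
  abel

lemma extK_mul_Proj {n m : ℕ} (h : n ≤ m) (u : K n) :
    (extK h u : Matrix (Fin m) (Fin m) ℂ) * Proj m n = Proj m n * u.1 := by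
  have h1 : Proj n m * Proj m n = 1 := by rw [Proj_mul_Proj (Or.inl h), Proj_self]
  simp only [extK, Matrix.add_mul, Matrix.sub_mul, Matrix.one_mul, Matrix.mul_assoc, h1,
    Matrix.mul_one]
  abel

/-! ### Triangular factorizations -/

/-- Every square matrix is the product of a lower triangular and a unitary matrix. -/
lemma exists_lower_mul_unitary {n : ℕ} (A : Matrix (Fin n) (Fin n) ℂ) :
    ∃ (T : Matrix (Fin n) (Fin n) ℂ) (q : K n), IsLower T ∧ A = T * q.1 := by
  -- Gram-Schmidt for the conjugated rows of `A`
  let f : Fin n → EuclideanSpace ℂ (Fin n) := fun i => WithLp.toLp 2 (fun j => star (A i j))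
  have hc : Module.finrank ℂ (EuclideanSpace ℂ (Fin n)) = Fintype.card (Fin n) := by simp
  let b := InnerProductSpace.gramSchmidtOrthonormalBasis hc f
  let q : Matrix (Fin n) (Fin n) ℂ := Matrix.of fun i j => star (b i j)
  have hq : q * qᴴ = 1 := by
    ext i j
    have h1 := orthonormal_iff_ite.mp b.orthonormal i j
    rw [Matrix.mul_apply, Matrix.one_apply, ← h1, PiLp.inner_apply]
    simp [q, mul_comm]
  have hqU : q ∈ Matrix.unitaryGroup (Fin n) ℂ := by
    rw [Matrix.mem_unitaryGroup_iff]; exact hq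
  have hq' : qᴴ * q = 1 := by
    have := Matrix.mem_unitaryGroup_iff'.mp hqU
    exact this
  refine ⟨A * qᴴ, ⟨q, hqU⟩, ?_, ?_⟩
  · intro i j hij
    have h1 := InnerProductSpace.gramSchmidtOrthonormalBasis_inv_triangular hc f hij
    rw [PiLp.inner_apply] at h1
    rw [Matrix.mul_apply]
    have h2 := congrArg star h1
    rw [star_zero, star_sum] at h2
    rw [← h2]
    refine Finset.sum_congr rfl fun x _ => ?_
    simp [q, f, b]
  · rw [Matrix.mul_assoc, hq', Matrix.mul_one]

/-- Every `r × m` matrix, `r ≤ m`, is `T Π_{r,m} q` with a lower triangular `T` and a unitary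
`q`. -/
lemma exists_lower_mul_Proj_mul_unitary {r m : ℕ} (h : r ≤ m) (B : Matrix (Fin r) (Fin m) ℂ) :
    ∃ (T : Matrix (Fin r) (Fin r) ℂ) (q : K m), IsLower T ∧ B = T * Proj r m * q.1 := by
  obtain ⟨T, q, hT, hA⟩ := exists_lower_mul_unitary (Proj m r * B)
  have h1 : Proj r m * Proj m r = 1 := by rw [Proj_mul_Proj (Or.inl h), Proj_self]
  refine ⟨Proj r m * T * Proj m r, q, ?_, ?_⟩
  · intro i j hij
    rw [mul_Proj_apply h, Proj_mul_apply h]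
    exact hT _ _ (by simpa using hij)
  · rw [← hT.Proj_mul h, Matrix.mul_assoc, ← hA, ← Matrix.mul_assoc, h1, Matrix.one_mul]

lemma exists_unitary_mul_Proj_mul {r l : ℕ} (h : r ≤ l) (B : Matrix (Fin l) (Fin r) ℂ) :
    ∃ (w : K l) (c : Matrix (Fin r) (Fin r) ℂ), B = w.1 * Proj l r * c := by
  obtain ⟨T, q, -, hB⟩ := exists_lower_mul_Proj_mul_unitary h Bᴴ
  refine ⟨q⁻¹, Tᴴ, ?_⟩
  rw [← conjTranspose_conjTranspose B, hB]
  simp only [conjTranspose_mul, Proj_conjTranspose, coeK_inv, Matrix.mul_assoc]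

/-! ### Leading principal minors -/

lemma minor_lower_mul {n j : ℕ} (hj : j ≤ n) {T : Matrix (Fin n) (Fin n) ℂ} (hT : IsLower T)
    (X : Matrix (Fin n) (Fin n) ℂ) :
    minor j (T * X * Tᴴ) = ((‖minor j T‖ ^ 2 : ℝ) : ℂ) * minor j X := by
  have h1 := hT.Proj_mul hj
  have h2 : Tᴴ * Proj n j = Proj n j * (Proj j n * T * Proj n j)ᴴ := by
    have := congrArg conjTranspose h1
    simpa only [conjTranspose_mul, Proj_conjTranspose] using this
  set S := Proj j n * T * Proj n j with hS
  have h3 : Proj j n * (T * X * Tᴴ) * Proj n j = S * (Proj j n * X * Proj n j) * Sᴴ := by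
    calc _ = (Proj j n * T) * X * (Tᴴ * Proj n j) := by simp only [Matrix.mul_assoc]
      _ = _ := by rw [h1, h2]; simp only [Matrix.mul_assoc]
  unfold minor
  rw [h3, det_mul, det_mul, det_conjTranspose, ← hS]
  have : S.det * star S.det = ((‖S.det‖ ^ 2 : ℝ) : ℂ) := by
    rw [Complex.star_def, Complex.mul_conj, Complex.normSq_eq_norm_sq]
  rw [← this]; ring

lemma minor_lower_ne_zero {n j : ℕ} (hj : j ≤ n) {T : Matrix (Fin n) (Fin n) ℂ} (hT : IsLower T)
    (hd : T.det ≠ 0) : minor j T ≠ 0 := by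
  have key : ∀ (m : ℕ) (S : Matrix (Fin m) (Fin m) ℂ), IsLower S → S.det = ∏ i, S i i := by
    intro m S hS
    apply Matrix.det_of_isLowerTriangular
    intro i j hij
    exact hS i j (by simpa using hij)
  rw [key n T hT, Finset.prod_ne_zero_iff] at hd
  unfold minor
  rw [key j _ (fun a b hab => by
    rw [mul_Proj_apply hj, Proj_mul_apply hj]; exact hT _ _ (by simpa using hab)),
    Finset.prod_ne_zero_iff]
  intro i _
  rw [mul_Proj_apply hj, Proj_mul_apply hj]
  exact hd _ (Finset.mem_univ _)

lemma minor_Proj {j r l : ℕ} (hjr : j ≤ r) (X : Matrix (Fin l) (Fin l) ℂ) :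
    minor j (Proj r l * X * Proj l r) = minor j X := by
  unfold minor
  congr 1
  calc _ = (Proj j r * Proj r l) * X * (Proj l r * Proj r j) := by simp only [Matrix.mul_assoc]
    _ = _ := by rw [Proj_mul_Proj (Or.inl hjr), Proj_mul_Proj (Or.inr hjr)]

lemma continuous_minor {l : ℕ} (j : ℕ) :
    Continuous (minor j : Matrix (Fin l) (Fin l) ℂ → ℂ) := by
  unfold minor
  exact ((continuous_const.matrix_mul continuous_id).matrix_mul continuous_const).matrix_det

/-! ### Null sets of polynomial conditions -/

/-- A set that meets every line through some point in a countable set is a null set. -/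
lemma addHaar_null_of_countable_lines {V : Type*} [NormedAddCommGroup V] [NormedSpace ℝ V]
    [FiniteDimensional ℝ V] [MeasurableSpace V] [BorelSpace V] (μ : Measure V)
    [μ.IsAddHaarMeasure] {Z : Set V} (hZ : MeasurableSet Z) (x₀ : V)
    (h : ∀ x, {t : ℝ | x₀ + t • x ∈ Z}.Countable) : μ Z = 0 := by
  have hm : MeasurableSet {z : V × ℝ | ¬ (x₀ + z.2 • z.1 ∈ Z)} := by
    have : Measurable (fun z : V × ℝ => x₀ + z.2 • z.1) := by fun_prop
    exact (this hZ).compl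
  -- by Fubini some dilate `{x | x₀ + t x ∈ Z}` with `t ≠ 0` is a null set, hence so is `Z`
  have h1 : ∀ᵐ x ∂μ, ∀ᵐ t ∂(volume : Measure ℝ), ¬ (x₀ + t • x ∈ Z) := by
    refine Filter.Eventually.of_forall fun x => ?_
    rw [ae_iff]
    simpa using (h x).measure_zero volume
  rw [Measure.ae_ae_comm hm] at h1
  have h2 : ∃ t : ℝ, t ≠ 0 ∧ ∀ᵐ x ∂μ, ¬ (x₀ + t • x ∈ Z) := by
    have h3 : ∀ᵐ t ∂(volume : Measure ℝ), t ≠ 0 := by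
      rw [ae_iff]; simp
    exact (h3.and h1).exists
  obtain ⟨t, ht, h3⟩ := h2
  rw [ae_iff] at h3
  simp only [not_not] at h3
  have h4 : {a | x₀ + t • a ∈ Z} = (fun a => t • a) ⁻¹' ((fun a => x₀ + a) ⁻¹' Z) := rfl
  rw [h4, Measure.addHaar_preimage_smul μ ht, measure_preimage_add] at h3
  rcases mul_eq_zero.mp h3 with h5 | h5
  · exfalso
    have : (0 : ℝ) < |(t ^ Module.finrank ℝ V)⁻¹| := by positivity
    rw [ENNReal.ofReal_eq_zero] at h5
    linarith
  · exact h5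

instance instSecondCountableTopologyMatrix (a b : ℕ) :
    SecondCountableTopology (Matrix (Fin a) (Fin b) ℂ) :=
  inferInstanceAs (SecondCountableTopology (Fin a → Fin b → ℂ))

instance instSecondCountableTopologyK (n : ℕ) : SecondCountableTopology (K n) :=
  TopologicalSpace.Subtype.secondCountableTopology _

/-- A matrix-valued function of a real variable with polynomial entries. -/
def IsPolyCurve {a b : ℕ} (F : ℝ → Matrix (Fin a) (Fin b) ℂ) : Prop :=
  ∃ M : Matrix (Fin a) (Fin b) (Polynomial ℂ), ∀ t : ℝ,
    F t = M.map (Polynomial.evalRingHom (t : ℂ))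

/-- A complex-valued function of a real variable given by a polynomial. -/
def IsPolyFun (f : ℝ → ℂ) : Prop := ∃ q : Polynomial ℂ, ∀ t : ℝ, f t = q.eval (t : ℂ)

lemma isPolyCurve_const {a b : ℕ} (A : Matrix (Fin a) (Fin b) ℂ) : IsPolyCurve fun _ => A :=
  ⟨A.map Polynomial.C, fun t => by ext; simp⟩

lemma IsPolyCurve.mul {a b c : ℕ} {F : ℝ → Matrix (Fin a) (Fin b) ℂ}
    {G : ℝ → Matrix (Fin b) (Fin c) ℂ} (hF : IsPolyCurve F) (hG : IsPolyCurve G) :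
    IsPolyCurve fun t => F t * G t := by
  obtain ⟨M, hM⟩ := hF
  obtain ⟨M', hM'⟩ := hG
  exact ⟨M * M', fun t => by simp only [hM, hM', Matrix.map_mul]⟩

lemma IsPolyCurve.conjTranspose {a b : ℕ} {F : ℝ → Matrix (Fin a) (Fin b) ℂ}
    (hF : IsPolyCurve F) : IsPolyCurve fun t => (F t)ᴴ := by
  obtain ⟨M, hM⟩ := hF
  refine ⟨Mᵀ.map (Polynomial.map (starRingEnd ℂ)), fun t => ?_⟩
  ext i j
  simp only [hM, conjTranspose_apply, map_apply, transpose_apply, Polynomial.coe_evalRingHom]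
  rw [← Complex.conj_ofReal t, Polynomial.eval_map, Polynomial.eval₂_at_apply]
  simp

lemma isPolyCurve_pow {a : ℕ} {F : ℝ → Matrix (Fin a) (Fin a) ℂ} (hF : IsPolyCurve F) (n : ℕ) :
    IsPolyCurve fun t => F t ^ n := by
  induction n with
  | zero => simpa using isPolyCurve_const (1 : Matrix (Fin a) (Fin a) ℂ)
  | succ n ih => simpa [pow_succ] using ih.mul hF

lemma isPolyCurve_line {a b : ℕ} (A B : Matrix (Fin a) (Fin b) ℂ) :
    IsPolyCurve fun t => A + t • B :=
  ⟨A.map Polynomial.C + B.map (fun z => Polynomial.X * Polynomial.C z), fun t => by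
    ext i j; simp [mul_comm (t : ℂ)]⟩

lemma IsPolyCurve.det {a : ℕ} {F : ℝ → Matrix (Fin a) (Fin a) ℂ} (hF : IsPolyCurve F) :
    IsPolyFun fun t => (F t).det := by
  obtain ⟨M, hM⟩ := hF
  exact ⟨M.det, fun t => by
    simp only [hM]
    rw [← Polynomial.coe_evalRingHom, RingHom.map_det]; rfl⟩

lemma IsPolyCurve.trace {a : ℕ} {F : ℝ → Matrix (Fin a) (Fin a) ℂ} (hF : IsPolyCurve F) :
    IsPolyFun fun t => (F t).trace := by
  obtain ⟨M, hM⟩ := hF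
  exact ⟨M.trace, fun t => by
    simp only [hM]
    simp [Matrix.trace, Polynomial.eval_finsetSum]⟩

lemma isPolyCurve_of {a b : ℕ} {f : Fin a → Fin b → ℝ → ℂ} (hf : ∀ i j, IsPolyFun (f i j)) :
    IsPolyCurve fun t => Matrix.of fun i j => f i j t := by
  choose q hq using hf
  exact ⟨Matrix.of q, fun t => by ext; simp [hq]⟩

lemma IsPolyFun.countable_zeros {f : ℝ → ℂ} (hf : IsPolyFun f) {t₀ : ℝ} (h0 : f t₀ ≠ 0) :
    {t : ℝ | f t = 0}.Countable := by
  obtain ⟨q, hq⟩ := hf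
  have hq0 : q ≠ 0 := by rintro rfl; simp [hq] at h0
  have h1 : {z : ℂ | q.eval z = 0}.Finite := by
    refine (Finset.finite_toSet q.roots.toFinset).subset fun z hz => ?_
    simpa [hq0] using hz
  have h2 : {t : ℝ | f t = 0} ⊆ (fun t : ℝ => (t : ℂ)) ⁻¹' {z : ℂ | q.eval z = 0} := by
    intro t ht
    simpa [hq] using ht
  exact ((h1.preimage (Complex.ofReal_injective.injOn)).subset h2).countable

/-- The measure of all complex matrices underlying `lebG`. -/
def volG (n : ℕ) : Measure (Matrix (Fin n) (Fin n) ℂ) :=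
  Measure.map (fun t : Fin n → Fin n → ℂ => Matrix.of t) volume

/-- The measure of all Hermitian matrices underlying `lebH`. -/
def volH (n : ℕ) : Measure (Matrix (Fin n) (Fin n) ℂ) :=
  Measure.map (hermOf n) volume

lemma measurable_matrixOf (n : ℕ) :
    Measurable (fun t : Fin n → Fin n → ℂ => (Matrix.of t : Matrix (Fin n) (Fin n) ℂ)) :=
  measurable_id

lemma continuous_hermOf (n : ℕ) : Continuous (hermOf n) := by
  refine continuous_matrix fun i j => ?_
  simp only [hermOf, Matrix.of_apply]
  split_ifs <;> fun_prop

lemma measurable_hermOf (n : ℕ) : Measurable (hermOf n) := (continuous_hermOf n).measurable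

lemma hermOf_isHermitian {n : ℕ} (t : Fin n → Fin n → ℝ) : (hermOf n t)ᴴ = hermOf n t := by
  ext i j
  simp only [conjTranspose_apply, hermOf, Matrix.of_apply]
  rcases lt_trichotomy i j with h | h | h
  · simp [h.ne, h, h.ne', h.not_gt, sub_eq_add_neg]
  · subst h; simp
  · simp [h.ne, h, h.ne', h.not_gt, sub_eq_add_neg]

lemma hermOf_add_smul {n : ℕ} (x y : Fin n → Fin n → ℝ) (t : ℝ) :
    hermOf n (x + t • y) = hermOf n x + t • hermOf n y := by
  ext i j
  simp only [hermOf, Matrix.of_apply, Matrix.add_apply, Matrix.smul_apply, Pi.add_apply,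
    Pi.smul_apply, smul_eq_mul, Complex.real_smul]
  split_ifs <;> push_cast <;> ring

instance instIsAddHaarVolumePiComplex (n : ℕ) :
    (volume : Measure (Fin n → Fin n → ℂ)).IsAddHaarMeasure := by
  have : (volume : Measure (Fin n → ℂ)).IsAddHaarMeasure := inferInstance
  exact Measure.pi.isAddHaarMeasure _

instance instIsAddHaarVolumePiReal (n : ℕ) :
    (volume : Measure (Fin n → Fin n → ℝ)).IsAddHaarMeasure := by
  have : (volume : Measure (Fin n → ℝ)).IsAddHaarMeasure := inferInstance
  exact Measure.pi.isAddHaarMeasure _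

lemma volG_ae_ne_zero {n : ℕ} {p : Matrix (Fin n) (Fin n) ℂ → ℂ} (hp : Continuous p)
    (hpoly : ∀ F : ℝ → Matrix (Fin n) (Fin n) ℂ, IsPolyCurve F → IsPolyFun fun t => p (F t))
    (x₀ : Matrix (Fin n) (Fin n) ℂ) (h0 : p x₀ ≠ 0) : ∀ᵐ x ∂(volG n), p x ≠ 0 := by
  have hm : MeasurableSet {x : Matrix (Fin n) (Fin n) ℂ | p x ≠ 0} :=
    (hp.measurable (measurableSet_singleton 0)).compl
  rw [volG, ae_map_iff (measurable_matrixOf n).aemeasurable hm, ae_iff]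
  simp only [not_not]
  refine addHaar_null_of_countable_lines volume
    (measurable_matrixOf n (hp.measurable (measurableSet_singleton 0))) (fun i j => x₀ i j) ?_
  intro x
  refine (hpoly _ (isPolyCurve_line x₀ (Matrix.of x))).countable_zeros (t₀ := 0) ?_
  simpa using h0

lemma volH_ae_ne_zero {n : ℕ} {p : Matrix (Fin n) (Fin n) ℂ → ℂ} (hp : Continuous p)
    (hpoly : ∀ F : ℝ → Matrix (Fin n) (Fin n) ℂ, IsPolyCurve F → IsPolyFun fun t => p (F t))
    (x₀ : Fin n → Fin n → ℝ) (h0 : p (hermOf n x₀) ≠ 0) : ∀ᵐ x ∂(volH n), p x ≠ 0 := by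
  have hm : MeasurableSet {x : Matrix (Fin n) (Fin n) ℂ | p x ≠ 0} :=
    (hp.measurable (measurableSet_singleton 0)).compl
  rw [volH, ae_map_iff (measurable_hermOf n).aemeasurable hm, ae_iff]
  simp only [not_not]
  refine addHaar_null_of_countable_lines volume
    (measurable_hermOf n (hp.measurable (measurableSet_singleton 0))) x₀ ?_
  intro x
  refine ((hpoly _ (isPolyCurve_line (hermOf n x₀) (hermOf n x))).countable_zeros (t₀ := 0)
    (by simpa using h0)).mono fun t ht => ?_
  have h1 : p (hermOf n (x₀ + t • x)) = 0 := ht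
  rwa [hermOf_add_smul] at h1

lemma hermOf_diagonal {n : ℕ} (a : Fin n → ℝ) :
    hermOf n (Matrix.diagonal a) = Matrix.diagonal fun i => (a i : ℂ) := by
  ext i j
  simp only [hermOf, Matrix.of_apply, Matrix.diagonal_apply]
  by_cases h : i = j
  · simp [h]
  · have h' : ¬ j = i := fun hh => h hh.symm
    simp [h, h']

lemma volG_ae_isUnit_det (n : ℕ) : ∀ᵐ x ∂(volG n), IsUnit x.det := by
  have := volG_ae_ne_zero (n := n) (p := fun x => x.det) (by fun_prop) (fun F hF => hF.det) 1
    (by simp)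
  simpa [isUnit_iff_ne_zero] using this

lemma volH_ae_isUnit_det (n : ℕ) : ∀ᵐ x ∂(volH n), IsUnit x.det := by
  have := volH_ae_ne_zero (n := n) (p := fun x => x.det) (by fun_prop) (fun F hF => hF.det)
    (Matrix.diagonal 1) (by rw [hermOf_diagonal]; simp)
  simpa [isUnit_iff_ne_zero] using this

lemma lebG_eq_volG (n : ℕ) : lebG n = volG n := by
  unfold lebG
  exact Measure.restrict_eq_self_of_ae_mem (volG_ae_isUnit_det n)

lemma lebH_eq_volH (n : ℕ) : lebH n = volH n := by
  unfold lebH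
  exact Measure.restrict_eq_self_of_ae_mem (volH_ae_isUnit_det n)

instance instSigmaFiniteVolG (n : ℕ) : SigmaFinite (volG n) :=
  (MeasurableEquiv.refl (Fin n → Fin n → ℂ)).sigmaFinite_map

/-- The determinant of the Hankel matrix of power sums: for a diagonalizable matrix this is the
discriminant of the characteristic polynomial. -/
def hankel {n : ℕ} (y : Matrix (Fin n) (Fin n) ℂ) : ℂ :=
  (Matrix.of fun i j : Fin n => (y ^ ((i : ℕ) + (j : ℕ))).trace).det

lemma continuous_hankel (n : ℕ) : Continuous (hankel : Matrix (Fin n) (Fin n) ℂ → ℂ) := by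
  unfold hankel
  refine Continuous.matrix_det (continuous_matrix fun i j => ?_)
  simp only [Matrix.of_apply]
  exact (continuous_id.pow _).matrix_trace

lemma IsPolyCurve.hankel {n : ℕ} {F : ℝ → Matrix (Fin n) (Fin n) ℂ} (hF : IsPolyCurve F) :
    IsPolyFun fun t => hankel (F t) :=
  (isPolyCurve_of fun _ _ => (isPolyCurve_pow hF _).trace).det

lemma hankel_diagonal {n : ℕ} (a : Fin n → ℂ) :
    hankel (Matrix.diagonal a) = (vandermonde a).det ^ 2 := by
  have : (Matrix.of fun i j : Fin n => ((Matrix.diagonal a) ^ ((i : ℕ) + (j : ℕ))).trace)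
      = (vandermonde a)ᵀ * vandermonde a := by
    ext i j
    simp [Matrix.diagonal_pow, Matrix.trace_diagonal, Matrix.mul_apply, vandermonde_apply, pow_add]
  rw [hankel, this, det_mul, det_transpose, sq]

lemma hankel_conj {n : ℕ} (u : K n) (y : Matrix (Fin n) (Fin n) ℂ) :
    hankel (u.1 * y * u.1ᴴ) = hankel y := by
  have h1 : ∀ m : ℕ, (u.1 * y * u.1ᴴ) ^ m = u.1 * y ^ m * u.1ᴴ := by
    intro m
    induction m with
    | zero => simp [coeK_mul_conjTranspose]
    | succ m ih =>
      rw [pow_succ, ih, pow_succ]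
      calc _ = u.1 * y ^ m * (u.1ᴴ * u.1) * y * u.1ᴴ := by simp only [Matrix.mul_assoc]
        _ = _ := by rw [coeK_conjTranspose_mul, Matrix.mul_one]; simp only [Matrix.mul_assoc]
  unfold hankel
  congr 2
  ext i j
  simp only [h1]
  rw [Matrix.trace_mul_comm, ← Matrix.mul_assoc, coeK_conjTranspose_mul, Matrix.one_mul]

/-- The zero set of a polynomial function on square matrices is a Haar null set in the unitary
group if it is stable under left division by invertible lower triangular matrices. -/
lemma haarK_ae_ne_zero {l : ℕ} {p : Matrix (Fin l) (Fin l) ℂ → ℂ} (hp : Continuous p)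
    (hpoly : ∀ F : ℝ → Matrix (Fin l) (Fin l) ℂ, IsPolyCurve F → IsPolyFun fun t => p (F t))
    (hlow : ∀ T A : Matrix (Fin l) (Fin l) ℂ, IsLower T → T.det ≠ 0 → p (T * A) ≠ 0 → p A ≠ 0)
    (A₀ : Matrix (Fin l) (Fin l) ℂ) (h0 : p A₀ ≠ 0) : ∀ᵐ u ∂(haarK l), p u.1 ≠ 0 := by
  -- by Fubini some invertible `A = T q` has `p (A u) ≠ 0` for almost all `u`; the stability under
  -- `T` and the invariance under `q` remove `A`
  have h1 : ∀ᵐ u ∂(haarK l), ∀ᵐ A ∂(volG l), p (A * u.1) ≠ 0 := by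
    refine Filter.Eventually.of_forall fun u => ?_
    refine volG_ae_ne_zero (p := fun A => p (A * u.1)) (by fun_prop)
      (fun F hF => hpoly _ (hF.mul (isPolyCurve_const _))) (A₀ * u.1ᴴ) ?_
    simpa [Matrix.mul_assoc, coeK_conjTranspose_mul] using h0
  have hm : MeasurableSet {z : K l × Matrix (Fin l) (Fin l) ℂ | p (z.2 * z.1.1) ≠ 0} := by
    have : Continuous fun z : K l × Matrix (Fin l) (Fin l) ℂ => p (z.2 * z.1.1) := by
      refine hp.comp (continuous_snd.matrix_mul ((continuous_coeK l).comp continuous_fst))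
    exact this.measurable (measurableSet_singleton (0 : ℂ)).compl
  rw [Measure.ae_ae_comm hm] at h1
  have : (volG l) ≠ 0 := by
    intro h
    have h2 := congrArg (fun μ => μ Set.univ) h
    simp only [volG, Measure.map_apply (measurable_matrixOf l) MeasurableSet.univ,
      Set.preimage_univ] at h2
    exact isOpen_univ.measure_ne_zero volume Set.univ_nonempty h2
  have : (ae (volG l)).NeBot := ae_neBot.mpr this
  obtain ⟨A, hA, hA'⟩ := (h1.and (volG_ae_isUnit_det l)).exists
  obtain ⟨T, q, hT, rfl⟩ := exists_lower_mul_unitary A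
  have hTd : T.det ≠ 0 := by
    intro h; simp [Matrix.det_mul, h] at hA'
  have h3 : ∀ᵐ u ∂(haarK l), p (q * u).1 ≠ 0 := by
    filter_upwards [hA] with u hu
    refine hlow T _ hT hTd ?_
    rwa [coeK_mul, ← Matrix.mul_assoc]
  have h4 := (measurePreserving_mul_left (haarK l) q⁻¹).quasiMeasurePreserving.ae h3
  filter_upwards [h4] with u hu
  simpa [← mul_assoc] using hu

/-! ### Spherical integrals and their product formula -/

/-- The signed power `sign(Re y)^e |y|^w`. -/
def sp (y : ℂ) (e : ZMod 2) (w : ℂ) : ℂ := signPow y.re e * ((‖y‖ : ℝ) : ℂ) ^ w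

/-- The numerator of `phiIntegral`. -/
def sphInt {l n : ℕ} (s : Fin n → ℂ) (L : Fin n → ZMod 2) (x : Matrix (Fin l) (Fin l) ℂ) : ℂ :=
  ∫ k : K l, ∏ j : Fin n, sp (minor ((j : ℕ) + 1) (k.1 * x * k.1ᴴ)) (expL L j) (expS s j) ∂(haarK l)

/-- The spherical integral without signs. -/
def sphNorm {l n : ℕ} (s : Fin n → ℂ) (x : Matrix (Fin l) (Fin l) ℂ) : ℂ :=
  ∫ k : K l, ∏ j : Fin n,
    ((‖minor ((j : ℕ) + 1) (k.1 * x * k.1ᴴ)‖ : ℝ) : ℂ) ^ expS s j ∂(haarK l)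

lemma phiIntegral_eq {l n : ℕ} (s : Fin n → ℂ) (L : Fin n → ZMod 2)
    (x : Matrix (Fin l) (Fin l) ℂ) :
    phiIntegral L x s = sphInt s L x / normIntegral l n s := rfl

lemma normIntegral_eq (l n : ℕ) (s : Fin n → ℂ) :
    normIntegral l n s = sphNorm s (Proj l n * Proj n l) := by
  simp only [normIntegral, sphNorm, Matrix.mul_assoc]

lemma measurable_signPow (e : ZMod 2) : Measurable fun y : ℝ => signPow y e := by
  have h1 : (fun y : ℝ => signPow y e) = fun y : ℝ => if 0 < y then (1 : ℂ) else
      if y < 0 then (-1) ^ e.val else 0 ^ e.val := by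
    funext y
    rcases lt_trichotomy y 0 with h | h | h
    · simp [signPow, h, h.not_gt]
    · simp [signPow, h]
    · simp [signPow, h]
  rw [h1]
  exact Measurable.ite measurableSet_Ioi measurable_const
    (Measurable.ite measurableSet_Iio measurable_const measurable_const)

lemma measurable_sp (e : ZMod 2) (w : ℂ) : Measurable fun y : ℂ => sp y e w := by
  unfold sp
  refine ((measurable_signPow e).comp Complex.measurable_re).mul ?_
  exact (Complex.measurable_ofReal.comp measurable_norm).pow_const w

lemma norm_signPow_le (y : ℝ) (e : ZMod 2) : ‖signPow y e‖ ≤ 1 := by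
  unfold signPow
  rw [norm_pow]
  refine pow_le_one₀ (norm_nonneg _) ?_
  rcases lt_trichotomy y 0 with h | h | h <;> simp [h]

lemma norm_sp_le {y : ℂ} {e : ZMod 2} {w : ℂ} {R : ℝ} (hR : 1 ≤ R) (hy : ‖y‖ ≤ R)
    (hw : 0 ≤ w.re) : ‖sp y e w‖ ≤ R ^ w.re := by
  unfold sp
  rw [norm_mul]
  have h1 : ‖(((‖y‖ : ℝ) : ℂ)) ^ w‖ ≤ R ^ w.re := by
    rcases eq_or_ne y 0 with rfl | h
    · rcases eq_or_ne w 0 with rfl | h0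
      · simp
      · simp [Complex.zero_cpow h0]; positivity
    · rw [Complex.norm_cpow_eq_rpow_re_of_pos (norm_pos_iff.mpr h)]
      exact Real.rpow_le_rpow (norm_nonneg _) hy hw
  calc _ ≤ 1 * R ^ w.re := mul_le_mul (norm_signPow_le _ _) h1 (norm_nonneg _) zero_le_one
    _ = _ := one_mul _

lemma norm_prod_sp_le {n : ℕ} {y : Fin n → ℂ} {e : Fin n → ZMod 2} {w : Fin n → ℂ} {R : ℝ}
    (hR : 1 ≤ R) (hy : ∀ j, ‖y j‖ ≤ R) (hw : ∀ j, 0 ≤ (w j).re) :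
    ‖∏ j, sp (y j) (e j) (w j)‖ ≤ ∏ j, R ^ (w j).re := by
  rw [norm_prod]
  exact Finset.prod_le_prod (fun _ _ => norm_nonneg _) fun j _ => norm_sp_le hR (hy j) (hw j)

lemma sp_mul_pos {c : ℝ} (hc : 0 < c) (y : ℂ) (e : ZMod 2) (w : ℂ) :
    sp ((c : ℂ) * y) e w = (c : ℂ) ^ w * sp y e w := by
  unfold sp
  have h1 : signPow ((c : ℂ) * y).re e = signPow y.re e := by
    simp [signPow, sign_mul, sign_pos hc]
  rw [h1, norm_mul, Complex.norm_real, Real.norm_of_nonneg hc.le, Complex.ofReal_mul,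
    Complex.mul_cpow_ofReal_nonneg hc.le (norm_nonneg _)]
  ring

lemma sp_zero (y : ℂ) : sp y 0 0 = 1 := by
  simp [sp, signPow]

lemma sp_of_pos {y : ℂ} (hy : 0 < y.re) (e : ZMod 2) (w : ℂ) :
    sp y e w = ((‖y‖ : ℝ) : ℂ) ^ w := by
  simp [sp, signPow, sign_pos hy]

lemma integrable_prod_sp {X : Type*} [TopologicalSpace X] [CompactSpace X] [MeasurableSpace X]
    [OpensMeasurableSpace X] (μ : Measure X) [IsFiniteMeasure μ] {n : ℕ} {y : Fin n → X → ℂ}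
    (hy : ∀ j, Continuous (y j)) {e : Fin n → ZMod 2} {w : Fin n → ℂ} (hw : ∀ j, 0 ≤ (w j).re) :
    Integrable (fun x => ∏ j, sp (y j x) (e j) (w j)) μ := by
  have hb : ∀ j, ∃ R, ∀ x, ‖y j x‖ ≤ R := fun j => by
    obtain ⟨R, hR⟩ := isCompact_univ.exists_bound_of_continuousOn (hy j).continuousOn
    exact ⟨R, fun x => hR x (Set.mem_univ x)⟩
  choose R hR using hb
  refine Integrable.of_bound (C := ∏ j, (1 + ∑ i, |R i|) ^ (w j).re) ?_ ?_
  · exact (Finset.measurable_prod _ fun j _ =>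
      (measurable_sp _ _).comp (hy j).measurable).aestronglyMeasurable
  · refine Filter.Eventually.of_forall fun x => norm_prod_sp_le ?_ (fun j => ?_) hw
    · have : 0 ≤ ∑ i, |R i| := Finset.sum_nonneg fun i _ => abs_nonneg _
      linarith
    · have h1 := Finset.single_le_sum (f := fun i => |R i|) (fun i _ => abs_nonneg _)
        (Finset.mem_univ j)
      have h2 := hR j x
      have h3 := le_abs_self (R j)
      linarith

lemma minor_one {l j : ℕ} (h : j ≤ l) : minor j (1 : Matrix (Fin l) (Fin l) ℂ) = 1 := by
  unfold minor
  rw [Matrix.mul_one, Proj_mul_Proj (Or.inl h), Proj_self, det_one]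

lemma minor_self {n : ℕ} (X : Matrix (Fin n) (Fin n) ℂ) : minor n X = X.det := by
  simp [minor, Proj_self]

lemma sphInt_conj {l n : ℕ} (s : Fin n → ℂ) (L : Fin n → ZMod 2)
    (x : Matrix (Fin l) (Fin l) ℂ) (u : K l) : sphInt s L (u.1 * x * u.1ᴴ) = sphInt s L x := by
  unfold sphInt
  conv_rhs => rw [← integral_mul_right_eq_self _ u]
  simp only [coeK_mul, conjTranspose_mul, Matrix.mul_assoc]

lemma exists_unitary_sp_minor_conj {l m r : ℕ} (hrm : r ≤ m) (e : Fin r → ZMod 2)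
    (w : Fin r → ℂ) (g : Matrix (Fin l) (Fin m) ℂ) (u : K l)
    (hu : minor r (u.1 * (g * gᴴ) * u.1ᴴ) ≠ 0) :
    ∃ q : K m, ∀ (y : Matrix (Fin m) (Fin m) ℂ) (j : Fin r),
      sp (minor ((j : ℕ) + 1) (u.1 * (g * y * gᴴ) * u.1ᴴ)) (e j) (w j) =
      ((‖minor ((j : ℕ) + 1) (u.1 * (g * gᴴ) * u.1ᴴ)‖ : ℝ) : ℂ) ^ w j *
        sp (minor ((j : ℕ) + 1) (q.1 * y * q.1ᴴ)) (e j) (w j) := by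
  -- the minors up to order `r` see only the first `r` rows `T Π q` of `u g`; by triangularity they
  -- are the minors of `q y qᴴ`, multiplied by `|minor_j T|²`
  obtain ⟨T, q, hT, hB⟩ := exists_lower_mul_Proj_mul_unitary hrm (Proj r l * u.1 * g)
  have hB' : gᴴ * u.1ᴴ * Proj l r = q.1ᴴ * Proj m r * Tᴴ := by
    have := congrArg conjTranspose hB
    simpa only [conjTranspose_mul, Proj_conjTranspose, Matrix.mul_assoc] using this
  have h1 : ∀ (j : ℕ), j ≤ r → ∀ y : Matrix (Fin m) (Fin m) ℂ,
      minor j (u.1 * (g * y * gᴴ) * u.1ᴴ) =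
        ((‖minor j T‖ ^ 2 : ℝ) : ℂ) * minor j (q.1 * y * q.1ᴴ) := by
    intro j hj y
    rw [← minor_Proj hj]
    have : Proj r l * (u.1 * (g * y * gᴴ) * u.1ᴴ) * Proj l r =
        T * (Proj r m * (q.1 * y * q.1ᴴ) * Proj m r) * Tᴴ := by
      calc _ = (Proj r l * u.1 * g) * y * (gᴴ * u.1ᴴ * Proj l r) := by
            simp only [Matrix.mul_assoc]
        _ = _ := by rw [hB, hB']; simp only [Matrix.mul_assoc]
    rw [this, minor_lower_mul hj hT, minor_Proj hj]
  have h2 : ∀ (j : ℕ), j ≤ r → minor j (u.1 * (g * gᴴ) * u.1ᴴ) = ((‖minor j T‖ ^ 2 : ℝ) : ℂ) := by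
    intro j hj
    have := h1 j hj 1
    rwa [Matrix.mul_one, Matrix.mul_one, coeK_mul_conjTranspose, minor_one (hj.trans hrm),
      mul_one] at this
  have hTd : T.det ≠ 0 := by
    intro h
    apply hu
    rw [h2 r le_rfl, minor_self, h]; simp
  have h3 : ∀ j, j ≤ r → 0 < ‖minor j T‖ ^ 2 := fun j hj => by
    have := norm_pos_iff.mpr (minor_lower_ne_zero hj hT hTd); positivity
  refine ⟨q, fun y j => ?_⟩
  have hj : (j : ℕ) + 1 ≤ r := j.2
  rw [h1 _ hj, h2 _ hj, sp_mul_pos (h3 _ hj), Complex.norm_real, Real.norm_of_nonneg (h3 _ hj).le]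

lemma integrable_prod_sp_conj {l m r : ℕ} {s : Fin r → ℂ} (hs : s ∈ baseDomain r)
    (L : Fin r → ZMod 2) (g : Matrix (Fin l) (Fin m) ℂ) (x : Matrix (Fin m) (Fin m) ℂ) :
    Integrable (fun p : K m × K l => ∏ j : Fin r,
      sp (minor ((j : ℕ) + 1) (p.2.1 * (g * (p.1.1 * x * p.1.1ᴴ) * gᴴ) * p.2.1ᴴ))
        (expL L j) (expS s j)) ((haarK m).prod (haarK l)) := by
  have c1 : Continuous fun p : K m × K l => p.1.1 := (continuous_coeK m).comp continuous_fst
  have c2 : Continuous fun p : K m × K l => p.2.1 := (continuous_coeK l).comp continuous_snd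
  have c3 : Continuous fun p : K m × K l =>
      p.2.1 * (g * (p.1.1 * x * p.1.1ᴴ) * gᴴ) * p.2.1ᴴ :=
    (c2.matrix_mul ((continuous_const.matrix_mul
      ((c1.matrix_mul continuous_const).matrix_mul c1.matrix_conjTranspose)).matrix_mul
        continuous_const)).matrix_mul c2.matrix_conjTranspose
  exact integrable_prod_sp (y := fun (j : Fin r) (p : K m × K l) =>
    minor ((j : ℕ) + 1) (p.2.1 * (g * (p.1.1 * x * p.1.1ᴴ) * gᴴ) * p.2.1ᴴ)) _
    (fun j => (continuous_minor _).comp c3) hs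

/-- The product formula: averaging `g k x k^* g^*` over the unitary group factorizes spherical
integrals. The first `r` rows of `u g` are `T Π q` with `T` lower triangular and `q` unitary; the
leading minors split off those of `T`, and `q` is absorbed by the Haar measure. -/
theorem integral_sphInt_conj {l m r : ℕ} (hrm : r ≤ m) {s : Fin r → ℂ}
    (hs : s ∈ baseDomain r) (L : Fin r → ZMod 2) (g : Matrix (Fin l) (Fin m) ℂ)
    (x : Matrix (Fin m) (Fin m) ℂ) (hg : ∀ᵐ u ∂(haarK l), minor r (u.1 * (g * gᴴ) * u.1ᴴ) ≠ 0) :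
    ∫ k : K m, sphInt s L (g * (k.1 * x * k.1ᴴ) * gᴴ) ∂(haarK m) =
      sphNorm s (g * gᴴ) * sphInt s L x := by
  calc _ = ∫ u : K l, ∫ k : K m, ∏ j : Fin r,
      sp (minor ((j : ℕ) + 1) (u.1 * (g * (k.1 * x * k.1ᴴ) * gᴴ) * u.1ᴴ))
        (expL L j) (expS s j) ∂(haarK m) ∂(haarK l) :=
        integral_integral_swap (integrable_prod_sp_conj hs L g x)
    _ = ∫ u : K l, (∏ j : Fin r,
      ((‖minor ((j : ℕ) + 1) (u.1 * (g * gᴴ) * u.1ᴴ)‖ : ℝ) : ℂ) ^ expS s j) * sphInt s L x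
        ∂(haarK l) := by
        refine integral_congr_ae ?_
        filter_upwards [hg] with u hu
        -- `q` depends on `u` only, so that it disappears in the inner integral
        obtain ⟨q, hq⟩ := exists_unitary_sp_minor_conj hrm (expL L) (expS s) g u hu
        have e : ∀ k : K m, ∏ j : Fin r,
            sp (minor ((j : ℕ) + 1) (u.1 * (g * (k.1 * x * k.1ᴴ) * gᴴ) * u.1ᴴ))
              (expL L j) (expS s j) = (∏ j : Fin r,
            ((‖minor ((j : ℕ) + 1) (u.1 * (g * gᴴ) * u.1ᴴ)‖ : ℝ) : ℂ) ^ expS s j) *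
            ∏ j : Fin r, sp (minor ((j : ℕ) + 1) ((q * k).1 * x * (q * k).1ᴴ))
              (expL L j) (expS s j) := by
          intro k
          rw [← Finset.prod_mul_distrib]
          refine Finset.prod_congr rfl fun j _ => ?_
          rw [hq, coeK_mul, conjTranspose_mul]
          simp only [Matrix.mul_assoc]
        rw [integral_congr_ae (Filter.Eventually.of_forall e), integral_const_mul,
          integral_mul_left_eq_self (μ := haarK m) (fun k : K m => ∏ j : Fin r,
            sp (minor ((j : ℕ) + 1) (k.1 * x * k.1ᴴ)) (expL L j) (expS s j)) q]
        rfl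
    _ = _ := integral_mul_const _ _

lemma minor_conj_ae_ne_zero {l r : ℕ} (hr : r ≤ l) (x A₀ : Matrix (Fin l) (Fin l) ℂ)
    (h0 : minor r (A₀ * x * A₀ᴴ) ≠ 0) : ∀ᵐ u ∂(haarK l), minor r (u.1 * x * u.1ᴴ) ≠ 0 := by
  refine haarK_ae_ne_zero (p := fun A => minor r (A * x * Aᴴ)) ?_ ?_ ?_ A₀ h0
  · exact (continuous_minor r).comp ((continuous_id.matrix_mul continuous_const).matrix_mul
      continuous_id.matrix_conjTranspose)
  · intro F hF
    exact (((isPolyCurve_const _).mul ((hF.mul (isPolyCurve_const _)).mul hF.conjTranspose)).mul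
      (isPolyCurve_const _)).det
  · intro T A hT hTd h
    have : T * A * x * (T * A)ᴴ = T * (A * x * Aᴴ) * Tᴴ := by
      simp only [conjTranspose_mul, Matrix.mul_assoc]
    rw [this, minor_lower_mul hr hT] at h
    exact right_ne_zero_of_mul h

open scoped ComplexOrder in
/-- For a Gram matrix with nonvanishing minors the signs play no role. -/
lemma sphInt_gram {l m r : ℕ} (s : Fin r → ℂ) (L : Fin r → ZMod 2)
    (g : Matrix (Fin l) (Fin m) ℂ)
    (hg : ∀ j ≤ r, ∀ᵐ u ∂(haarK l), minor j (u.1 * (g * gᴴ) * u.1ᴴ) ≠ 0) :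
    sphInt s L (g * gᴴ) = sphNorm s (g * gᴴ) := by
  unfold sphInt sphNorm
  refine integral_congr_ae ?_
  have h1 : ∀ᵐ u ∂(haarK l), ∀ j : Fin r, minor ((j : ℕ) + 1) (u.1 * (g * gᴴ) * u.1ᴴ) ≠ 0 :=
    ae_all_iff.mpr fun j => hg _ j.2
  filter_upwards [h1] with u hu
  refine Finset.prod_congr rfl fun j _ => sp_of_pos ?_ _ _
  have h2 : Proj ((j : ℕ) + 1) l * (u.1 * (g * gᴴ) * u.1ᴴ) * Proj l ((j : ℕ) + 1) =
      (Proj ((j : ℕ) + 1) l * u.1 * g) * (Proj ((j : ℕ) + 1) l * u.1 * g)ᴴ := by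
    simp only [conjTranspose_mul, Proj_conjTranspose, Matrix.mul_assoc]
  have h3 : 0 ≤ minor ((j : ℕ) + 1) (u.1 * (g * gᴴ) * u.1ᴴ) := by
    unfold minor
    rw [h2]
    exact (Matrix.posSemidef_self_mul_conjTranspose _).det_nonneg
  rw [Complex.nonneg_iff] at h3
  refine lt_of_le_of_ne h3.1 fun h4 => hu j (Complex.ext h4.symm ?_)
  simpa using h3.2.symm

lemma expS_tildeS {n N : ℕ} (hn : n ≤ N) (s : Fin n → ℂ) (j : Fin N) :
    expS (tildeS N s) j = if h : (j : ℕ) < n then expS s ⟨j, h⟩ else 0 := by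
  have hj := j.2
  unfold expS tildeS
  by_cases h1 : (j : ℕ) + 1 < n
  · have h2 : (j : ℕ) + 1 < N := by omega
    have h3 : (j : ℕ) < n := by omega
    simp [h1, h2, h3]
  · by_cases h3 : (j : ℕ) < n
    · by_cases h2 : (j : ℕ) + 1 < N
      · have e : N - n = (N - 1 - ((j : ℕ) + 1)) + 1 := by omega
        simp only [h1, h2, h3, dif_pos, dite_false, e]
        push_cast; ring
      · have e : N - n = 0 := by omega
        simp [h1, h2, h3, e]
    · by_cases h2 : (j : ℕ) + 1 < N
      · have e : N - 1 - (j : ℕ) = (N - 1 - ((j : ℕ) + 1)) + 1 := by omega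
        simp only [h1, h2, h3, dif_pos, dite_false, e]
        push_cast; ring
      · have e : N - 1 - (j : ℕ) = 0 := by omega
        simp [h2, h3, e]

lemma expL_tildeL {n N : ℕ} (hn : n ≤ N) (L : Fin n → ZMod 2) (j : Fin N) :
    expL (tildeL N L) j = if h : (j : ℕ) < n then expL L ⟨j, h⟩ else 0 := by
  have hj := j.2
  unfold expL tildeL
  by_cases h1 : (j : ℕ) + 1 < n
  · have h2 : (j : ℕ) + 1 < N := by omega
    have h3 : (j : ℕ) < n := by omega
    simp [h1, h2, h3]
  · by_cases h3 : (j : ℕ) < n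
    · by_cases h2 : (j : ℕ) + 1 < N
      · have e : N - n = (N - 1 - ((j : ℕ) + 1)) + 1 := by omega
        simp only [h1, h2, h3, dif_pos, dite_false, e]
        push_cast; ring
      · have e : N - n = 0 := by omega
        simp [h1, h2, h3, e]
    · by_cases h2 : (j : ℕ) + 1 < N
      · have e : N - 1 - (j : ℕ) = (N - 1 - ((j : ℕ) + 1)) + 1 := by omega
        simp only [h1, h2, h3, dif_pos, dite_false, e]
        push_cast; ring
      · have e : N - 1 - (j : ℕ) = 0 := by omega
        simp [h2, h3, e]

lemma tildeS_mem_baseDomain {n N : ℕ} (hn : n ≤ N) {s : Fin n → ℂ} (hs : s ∈ baseDomain n) :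
    tildeS N s ∈ baseDomain N := by
  intro j
  rw [expS_tildeS hn]
  split_ifs with h
  · exact hs _
  · simp

lemma prod_fin_extend {n N : ℕ} (hn : n ≤ N) (f : Fin N → ℂ) (g : Fin n → ℂ)
    (h1 : ∀ (j : Fin N) (h : (j : ℕ) < n), f j = g ⟨j, h⟩)
    (h2 : ∀ j : Fin N, ¬ (j : ℕ) < n → f j = 1) : ∏ j, f j = ∏ j, g j := by
  obtain ⟨d, rfl⟩ := Nat.exists_eq_add_of_le hn
  rw [Fin.prod_univ_add, Finset.prod_congr rfl (fun i _ => h1 (Fin.castAdd d i) i.2),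
    Finset.prod_eq_one (s := Finset.univ) (f := fun i => f (Fin.natAdd n i))
      (fun i _ => h2 _ (by simp)), mul_one]
  rfl

lemma sphInt_tilde {l n N : ℕ} (hn : n ≤ N) (s : Fin n → ℂ) (L : Fin n → ZMod 2)
    (x : Matrix (Fin l) (Fin l) ℂ) : sphInt (tildeS N s) (tildeL N L) x = sphInt s L x := by
  unfold sphInt
  refine integral_congr_ae (Filter.Eventually.of_forall fun k => ?_)
  refine prod_fin_extend hn _ _ (fun j h => ?_) (fun j h => ?_)
  · rw [expS_tildeS hn, expL_tildeL hn, dif_pos h, dif_pos h]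
  · rw [expS_tildeS hn, expL_tildeL hn, dif_neg h, dif_neg h, sp_zero]

lemma sphNorm_tilde {l n N : ℕ} (hn : n ≤ N) (s : Fin n → ℂ)
    (x : Matrix (Fin l) (Fin l) ℂ) : sphNorm (tildeS N s) x = sphNorm s x := by
  unfold sphNorm
  refine integral_congr_ae (Filter.Eventually.of_forall fun k => ?_)
  refine prod_fin_extend hn _ _ (fun j h => ?_) (fun j h => ?_)
  · rw [expS_tildeS hn, dif_pos h]
  · rw [expS_tildeS hn, dif_neg h, Complex.cpow_zero]

lemma Proj_gram_minor_ae {l n j : ℕ} (hj : j ≤ n) (hn : n ≤ l) :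
    ∀ᵐ u ∂(haarK l), minor j (u.1 * (Proj l n * (Proj l n)ᴴ) * u.1ᴴ) ≠ 0 := by
  refine minor_conj_ae_ne_zero (hj.trans hn) _ 1 ?_
  have : minor j (1 * (Proj l n * (Proj l n)ᴴ) * 1ᴴ) = 1 := by
    simp only [Matrix.one_mul, conjTranspose_one, Matrix.mul_one, Proj_conjTranspose]
    unfold minor
    rw [← Matrix.mul_assoc, Proj_mul_Proj (Or.inl (hj.trans hn)), Matrix.mul_assoc,
      Proj_mul_Proj (Or.inr (hj.trans hn)), Proj_mul_Proj (Or.inl hj), Proj_self, det_one]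
  rw [this]; exact one_ne_zero

/-- The spherical integral of a matrix of lower rank reduces to the invertible block. -/
theorem sphInt_Proj {l n r : ℕ} (hrn : r ≤ n) (hnl : n ≤ l) {s : Fin r → ℂ}
    (hs : s ∈ baseDomain r) (L : Fin r → ZMod 2) (y : Matrix (Fin n) (Fin n) ℂ) :
    sphInt s L (Proj l n * y * Proj n l) =
      normIntegral l n (tildeS n s) * sphInt s L y := by
  have h1 := integral_sphInt_conj hrn hs L (Proj l n) y
    (Proj_gram_minor_ae hrn hnl)
  rw [normIntegral_eq, sphNorm_tilde hrn, ← Proj_conjTranspose l n, ← h1]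
  have h2 : ∀ k : K n, sphInt s L (Proj l n * (k.1 * y * k.1ᴴ) * (Proj l n)ᴴ) =
      sphInt s L (Proj l n * y * (Proj l n)ᴴ) := by
    intro k
    rw [← sphInt_conj s L (Proj l n * y * (Proj l n)ᴴ) (extK hnl k)]
    congr 1
    have e1 := extK_mul_Proj hnl k
    have e2 := congrArg conjTranspose e1
    simp only [conjTranspose_mul] at e2
    calc _ = (Proj l n * k.1) * y * (k.1ᴴ * (Proj l n)ᴴ) := by simp only [Matrix.mul_assoc]
      _ = _ := by rw [← e1, ← e2]; simp only [Matrix.mul_assoc]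
  simp only [h2, integral_const, probReal_univ, one_smul]

lemma sphInt_Proj_gram {l n : ℕ} (hn : n ≤ l) (s : Fin n → ℂ) (L : Fin n → ZMod 2) :
    sphInt s L (Proj l n * Proj n l) = normIntegral l n s := by
  rw [normIntegral_eq]
  have h := sphInt_gram s L (Proj l n) (fun j hj => Proj_gram_minor_ae hj hn)
  rwa [Proj_conjTranspose] at h

/-- The chain rule for the normalizations. -/
lemma normIntegral_chain {l n r : ℕ} (hrn : r ≤ n) (hnl : n ≤ l) {s : Fin r → ℂ}
    (hs : s ∈ baseDomain r) :
    normIntegral l r s = normIntegral l n (tildeS n s) * normIntegral n r s := by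
  have h := sphInt_Proj hrn hnl hs 0 (Proj n r * Proj r n)
  rw [sphInt_Proj_gram hrn] at h
  rw [← h, ← sphInt_Proj_gram (hrn.trans hnl) s 0]
  congr 1
  rw [← Matrix.mul_assoc, Proj_mul_Proj (Or.inr hrn), Matrix.mul_assoc, Proj_mul_Proj (Or.inl hrn)]

lemma normIntegral_self (n : ℕ) (s : Fin n → ℂ) : normIntegral n n s = 1 := by
  rw [normIntegral_eq, Proj_self]
  simp only [sphNorm, Matrix.mul_one, coeK_mul_conjTranspose]
  have : ∀ j : Fin n, minor ((j : ℕ) + 1) (1 : Matrix (Fin n) (Fin n) ℂ) = 1 :=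
    fun j => minor_one j.2
  simp [this]

/-! ### The distribution of a row of a random unitary matrix -/

/-- The unitary matrix that permutes the rows by `σ`. -/
def permK {n : ℕ} (σ : Equiv.Perm (Fin n)) : K n :=
  ⟨Matrix.of fun i j => if σ i = j then 1 else 0, by
    rw [Matrix.mem_unitaryGroup_iff]
    ext i j
    simp [Matrix.mul_apply, Matrix.star_apply, Matrix.one_apply]⟩

lemma permK_mul_apply {n : ℕ} {ι : Type*} (σ : Equiv.Perm (Fin n)) (X : Matrix (Fin n) ι ℂ)
    (i : Fin n) (j : ι) : ((permK σ).1 * X) i j = X (σ i) j := by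
  simp [permK, Matrix.mul_apply]

lemma permK_conj_diagonal {n : ℕ} (σ : Equiv.Perm (Fin n)) (a : Fin n → ℂ) :
    (permK σ).1 * Matrix.diagonal a * (permK σ).1ᴴ = Matrix.diagonal (a ∘ σ) := by
  have h : (permK σ).1 * Matrix.diagonal a = Matrix.diagonal (a ∘ σ) * (permK σ).1 := by
    ext i j
    rw [permK_mul_apply, Matrix.diagonal_mul, Matrix.diagonal_apply]
    by_cases hij : σ i = j <;> simp [permK, hij]
  rw [h, Matrix.mul_assoc, coeK_mul_conjTranspose, Matrix.mul_one]

/-- `z ↦ π |z|²` maps the Lebesgue measure of the plane to that of the half-line. -/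
lemma measurePreserving_pi_mul_norm_sq :
    MeasurePreserving (fun z : ℂ => Real.pi * ‖z‖ ^ 2) volume (volume.restrict (Set.Ioi 0)) := by
  have hm : Measurable fun z : ℂ => Real.pi * ‖z‖ ^ 2 := by fun_prop
  refine ⟨hm, ?_⟩
  have hIic : ∀ a : ℝ, Measure.map (fun z : ℂ => Real.pi * ‖z‖ ^ 2) volume (Set.Iic a) =
      ENNReal.ofReal a := by
    intro a
    rw [Measure.map_apply hm measurableSet_Iic]
    rcases le_or_gt 0 a with ha | ha
    · have h1 : (fun z : ℂ => Real.pi * ‖z‖ ^ 2) ⁻¹' Set.Iic a =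
          Metric.closedBall 0 (√(a / Real.pi)) := by
        ext z
        simp only [Set.mem_preimage, Set.mem_Iic, mem_closedBall_zero_iff]
        rw [Real.le_sqrt (norm_nonneg _) (by positivity), le_div_iff₀ Real.pi_pos, mul_comm]
      rw [h1, Complex.volume_closedBall, ← ENNReal.ofReal_pow (Real.sqrt_nonneg _),
        Real.sq_sqrt (by positivity)]
      have h2 : (NNReal.pi : ENNReal) = ENNReal.ofReal Real.pi := by
        rw [← NNReal.coe_real_pi, ENNReal.ofReal_coe_nnreal]
      rw [h2, ← ENNReal.ofReal_mul (by positivity), div_mul_cancel₀ _ Real.pi_ne_zero]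
    · have h1 : (fun z : ℂ => Real.pi * ‖z‖ ^ 2) ⁻¹' Set.Iic a = ∅ := by
        ext z
        simp only [Set.mem_preimage, Set.mem_Iic, Set.mem_empty_iff_false, iff_false, not_le]
        have := Real.pi_pos
        have : 0 ≤ Real.pi * ‖z‖ ^ 2 := by positivity
        linarith
      rw [h1, measure_empty, ENNReal.ofReal_of_nonpos ha.le]
  have hIic' : ∀ a : ℝ, (volume.restrict (Set.Ioi (0 : ℝ))) (Set.Iic a) = ENNReal.ofReal a := by
    intro a
    rw [Measure.restrict_apply measurableSet_Iic, Set.inter_comm, Set.Ioi_inter_Iic,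
      Real.volume_Ioc, sub_zero]
  have hIoc : ∀ μ : Measure ℝ, (∀ a, μ (Set.Iic a) = ENNReal.ofReal a) → ∀ a b : ℝ, a < b →
      μ (Set.Ioc a b) = ENNReal.ofReal b - ENNReal.ofReal a := by
    intro μ hμ a b hab
    have h1 : Set.Ioc a b = Set.Iic b \ Set.Iic a := by
      ext t; simp [and_comm]
    rw [h1, measure_sdiff (Set.Iic_subset_Iic.mpr hab.le)
      measurableSet_Iic.nullMeasurableSet (by rw [hμ]; exact ENNReal.ofReal_ne_top), hμ, hμ]
  -- both measures are determined by their distribution functions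
  refine Measure.ext_of_Ioc' _ _ (fun a b hab => ?_) (fun a b hab => ?_)
  · rw [hIoc _ hIic a b hab]; exact ne_top_of_le_ne_top ENNReal.ofReal_ne_top tsub_le_self
  · rw [hIoc _ hIic a b hab, hIoc _ hIic' a b hab]

/-- The open corner of the positive orthant below the standard simplex. -/
def openCorner (N : ℕ) : Set (Fin N → ℝ) := {t | (∀ i, 0 < t i) ∧ ∑ i, t i < 1}

lemma isOpen_openCorner (N : ℕ) : IsOpen (openCorner N) := by
  have h : openCorner N = (⋂ i, {t | 0 < t i}) ∩ {t | ∑ i, t i < 1} := by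
    ext t; simp [openCorner]
  rw [h]
  exact (isOpen_iInter_of_finite fun i => isOpen_lt continuous_const (continuous_apply i)).inter
    (isOpen_lt (by fun_prop) continuous_const)

lemma openCorner_nonempty (N : ℕ) : (openCorner N).Nonempty := by
  refine ⟨fun _ => 1 / ((N : ℝ) + 1), fun i => by positivity, ?_⟩
  simp only [Finset.sum_const, Finset.card_univ, Fintype.card_fin, nsmul_eq_mul]
  rw [mul_one_div, div_lt_one (by positivity)]
  linarith

lemma volume_openCorner_ne_top (N : ℕ) : volume (openCorner N) ≠ ⊤ := by
  refine (lt_of_le_of_lt (measure_mono (t := Set.Icc (0 : Fin N → ℝ) 1) ?_)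
    (isCompact_Icc.measure_lt_top)).ne
  intro t ht
  refine ⟨fun i => (ht.1 i).le, fun i => ?_⟩
  have h1 := Finset.single_le_sum (f := t) (fun i _ => (ht.1 i).le) (Finset.mem_univ i)
  have h2 := ht.2
  simp only [Pi.one_apply]; linarith

/-- The ball in `ℂ^N` that is mapped to `openCorner` by `z ↦ (π |z_i|²)_i`. -/
def complexBall (N : ℕ) : Set (Fin N → ℂ) := {z | ∑ i, Real.pi * ‖z i‖ ^ 2 < 1}

lemma isOpen_complexBall (N : ℕ) : IsOpen (complexBall N) :=
  isOpen_lt (by fun_prop) continuous_const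

lemma measurePreserving_complexBall (N : ℕ) :
    MeasurePreserving (fun (z : Fin N → ℂ) i => Real.pi * ‖z i‖ ^ 2)
      (volume.restrict (complexBall N)) (volume.restrict (openCorner N)) := by
  have h1 := measurePreserving_pi (fun _ : Fin N => (volume : Measure ℂ))
    (fun _ : Fin N => (volume : Measure ℝ).restrict (Set.Ioi 0))
    (fun _ => measurePreserving_pi_mul_norm_sq)
  rw [← Measure.restrict_pi_pi, ← volume_pi, ← volume_pi] at h1
  have h2 : MeasurableSet {t : Fin N → ℝ | ∑ i, t i < 1} :=
    (isOpen_lt (by fun_prop) continuous_const).measurableSet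
  have h3 := h1.restrict_preimage h2
  rw [Measure.restrict_restrict h2] at h3
  have h4 : openCorner N = {t | ∑ i, t i < 1} ∩ Set.univ.pi fun _ => Set.Ioi 0 := by
    ext t
    simp [openCorner, and_comm]
  rw [h4]
  exact h3

lemma sum_norm_sq_mulVec {N : ℕ} (k : K N) (z : Fin N → ℂ) :
    ∑ i, ‖(k.1 *ᵥ z) i‖ ^ 2 = ∑ i, ‖z i‖ ^ 2 := by
  have h : ∀ w : Fin N → ℂ, ((∑ i, ‖w i‖ ^ 2 : ℝ) : ℂ) = star w ⬝ᵥ w := by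
    intro w
    push_cast
    refine Finset.sum_congr rfl fun i _ => ?_
    rw [Pi.star_apply, Complex.star_def, ← Complex.normSq_eq_conj_mul_self,
      Complex.normSq_eq_norm_sq]
    push_cast; rfl
  have h2 : ((∑ i, ‖(k.1 *ᵥ z) i‖ ^ 2 : ℝ) : ℂ) = ((∑ i, ‖z i‖ ^ 2 : ℝ) : ℂ) := by
    rw [h, h, Matrix.star_mulVec, ← Matrix.dotProduct_mulVec, Matrix.mulVec_mulVec,
      coeK_conjTranspose_mul, Matrix.one_mulVec]
  exact_mod_cast h2

lemma measurePreserving_mulVec {N : ℕ} (k : K N) :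
    MeasurePreserving (fun z : Fin N → ℂ => k.1 *ᵥ z) (volume.restrict (complexBall N))
      (volume.restrict (complexBall N)) := by
  let f : K N → ((Fin N → ℂ) →ₗ[ℝ] (Fin N → ℂ)) := fun k =>
    (Matrix.mulVecLin k.1).restrictScalars ℝ
  -- the Jacobian is `1` because `k` preserves a set of positive finite volume
  have hdet : LinearMap.det (f k) ≠ 0 := by
    have h1 : f k⁻¹ ∘ₗ f k = LinearMap.id := by
      refine LinearMap.ext fun z => ?_
      change (k⁻¹).1 *ᵥ (k.1 *ᵥ z) = z
      rw [Matrix.mulVec_mulVec, coeK_inv, coeK_conjTranspose_mul, Matrix.one_mulVec]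
    have h2 := congrArg LinearMap.det h1
    rw [LinearMap.det_comp, LinearMap.det_id] at h2
    exact right_ne_zero_of_mul_eq_one h2
  have hmap := Measure.map_linearMap_addHaar_eq_smul_addHaar
    (volume : Measure (Fin N → ℂ)) hdet
  have hc : Continuous (f k) := (f k).continuous_of_finiteDimensional
  have hpre : (f k) ⁻¹' complexBall N = complexBall N := by
    ext z
    change ∑ i, Real.pi * ‖(k.1 *ᵥ z) i‖ ^ 2 < 1 ↔ ∑ i, Real.pi * ‖z i‖ ^ 2 < 1
    rw [← Finset.mul_sum, ← Finset.mul_sum, sum_norm_sq_mulVec]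
  have hv : volume (complexBall N) = volume (openCorner N) := by
    have := congrArg (fun μ => μ Set.univ) (measurePreserving_complexBall N).map_eq
    simpa [Measure.map_apply (measurePreserving_complexBall N).measurable] using this
  have hv0 : volume (complexBall N) ≠ 0 := by
    rw [hv]; exact (isOpen_openCorner N).measure_ne_zero _ (openCorner_nonempty N)
  have hv1 : volume (complexBall N) ≠ ⊤ := by
    rw [hv]; exact volume_openCorner_ne_top N
  have hc1 : ENNReal.ofReal |(LinearMap.det (f k))⁻¹| = 1 := by
    have h1 := congrArg (fun μ => μ (complexBall N)) hmap
    simp only [Measure.smul_apply, smul_eq_mul] at h1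
    rw [Measure.map_apply hc.measurable (isOpen_complexBall N).measurableSet, hpre] at h1
    exact ((ENNReal.mul_left_inj hv0 hv1).mp (by rw [one_mul, ← h1])).symm
  rw [hc1, one_smul] at hmap
  have h3 : MeasurePreserving (f k) (volume : Measure (Fin N → ℂ)) volume :=
    ⟨hc.measurable, hmap⟩
  have h4 := h3.restrict_preimage (isOpen_complexBall N).measurableSet
  rw [hpre] at h4
  exact h4

/-- The squared moduli of a row of a Haar distributed unitary matrix are uniformly distributed on
the simplex; for functions that are homogeneous of degree zero, the simplex may be replaced by
the region below it. -/
theorem integral_row_norm_sq {n : ℕ} {h : (Fin (n + 1) → ℝ) → ℂ} (hm : Measurable h)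
    (hb : ∃ C, ∀ t, ‖h t‖ ≤ C) (hh : ∀ c : ℝ, 0 < c → ∀ t, h (c • t) = h t) :
    (∫ k : K (n + 1), h (fun i => ‖k.1 (Fin.last n) i‖ ^ 2) ∂(haarK (n + 1))) *
      (volume.real (openCorner (n + 1)) : ℂ) = ∫ t in openCorner (n + 1), h t := by
  set J := ∫ k : K (n + 1), h (fun i => ‖k.1 (Fin.last n) i‖ ^ 2) ∂(haarK (n + 1)) with hJ
  obtain ⟨C, hC⟩ := hb
  set φ : (Fin (n + 1) → ℂ) → ℂ := fun z => h (fun i => Real.pi * ‖z i‖ ^ 2) with hφ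
  have hφm : Measurable φ := hm.comp (measurable_pi_lambda _ fun i => by fun_prop)
  have hmp := measurePreserving_complexBall (n + 1)
  have hfin : IsFiniteMeasure ((volume : Measure (Fin (n + 1) → ℂ)).restrict
      (complexBall (n + 1))) := by
    have h0 := hmp.measure_preimage (s := Set.univ) nullMeasurableSet_univ
    refine ⟨?_⟩
    rw [Set.preimage_univ] at h0
    rw [h0, Measure.restrict_apply_univ]
    exact (volume_openCorner_ne_top _).lt_top
  have hcorner : ∫ t in openCorner (n + 1), h t = ∫ z in complexBall (n + 1), φ z := by
    rw [← hmp.map_eq, integral_map hmp.measurable.aemeasurable hm.aestronglyMeasurable]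
  have hinv : ∀ k : K (n + 1), ∫ z in complexBall (n + 1), φ (k.1 *ᵥ z) =
      ∫ z in complexBall (n + 1), φ z := by
    intro k
    have h1 := measurePreserving_mulVec k
    conv_rhs => rw [← h1.map_eq, integral_map h1.measurable.aemeasurable
      hφm.aestronglyMeasurable]
  -- a vector `z ≠ 0` is a multiple of the first column of some unitary `w`, which the Haar measure
  -- absorbs; inversion and a permutation turn the first column of `k` into its last row
  have hinner : ∀ z : Fin (n + 1) → ℂ, z ≠ 0 →
      ∫ k : K (n + 1), φ (k.1 *ᵥ z) ∂(haarK (n + 1)) = J := by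
    intro z hz
    obtain ⟨w, c, hwc⟩ := exists_unitary_mul_Proj_mul (Nat.le_add_left 1 n)
      (Matrix.of fun i (_ : Fin 1) => z i)
    have hzc : ∀ i, z i = w.1 i 0 * c 0 0 := by
      intro i
      have h1 := congrFun (congrFun hwc i) 0
      rw [Matrix.mul_apply] at h1
      simp only [Matrix.of_apply, Fin.sum_univ_one, Fin.isValue] at h1
      rw [h1, mul_Proj_apply (Nat.le_add_left 1 n)]
      rfl
    have hc0 : c 0 0 ≠ 0 := by
      intro h0
      exact hz (funext fun i => by rw [hzc, h0, mul_zero]; rfl)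
    have h1 : ∀ k : K (n + 1), φ (k.1 *ᵥ z) = h (fun i => ‖(k * w).1 i 0‖ ^ 2) := by
      intro k
      have h2 : ∀ i, (k.1 *ᵥ z) i = (k * w).1 i 0 * c 0 0 := by
        intro i
        rw [coeK_mul, Matrix.mul_apply, Finset.sum_mul]
        simp only [Matrix.mulVec, dotProduct]
        exact Finset.sum_congr rfl fun j _ => by rw [hzc]; ring
      rw [← hh (Real.pi * ‖c 0 0‖ ^ 2) (by have := Real.pi_pos; positivity)]
      simp only [hφ]
      congr 1
      funext i
      rw [h2, norm_mul]
      simp only [Pi.smul_apply, smul_eq_mul]; ring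
    simp only [h1]
    rw [integral_mul_right_eq_self (μ := haarK (n + 1))
      (fun k : K (n + 1) => h (fun i => ‖k.1 i 0‖ ^ 2)) w,
      ← integral_inv_eq_self, hJ, ← integral_mul_left_eq_self (μ := haarK (n + 1))
      (fun k : K (n + 1) => h (fun i => ‖k.1 (Fin.last n) i‖ ^ 2))
      (permK (Equiv.swap (Fin.last n) 0))]
    refine integral_congr_ae (Filter.Eventually.of_forall fun k => ?_)
    simp only [coeK_mul, permK_mul_apply, Equiv.swap_apply_left, coeK_inv, conjTranspose_apply,
      norm_star]
  have hjoint : Integrable (fun p : K (n + 1) × (Fin (n + 1) → ℂ) => φ (p.1.1 *ᵥ p.2))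
      ((haarK (n + 1)).prod (volume.restrict (complexBall (n + 1)))) := by
    refine Integrable.of_bound (C := C) ?_ (Filter.Eventually.of_forall fun p => hC _)
    have hcont : Continuous fun p : K (n + 1) × (Fin (n + 1) → ℂ) => p.1.1 *ᵥ p.2 :=
      ((continuous_coeK _).comp continuous_fst).matrix_mulVec continuous_snd
    exact (hφm.comp hcont.measurable).aestronglyMeasurable
  -- the average of `φ (k z)` over `k` and `z` is evaluated in both orders
  have hswap := integral_integral_swap (μ := haarK (n + 1))
    (ν := volume.restrict (complexBall (n + 1)))
    (f := fun (k : K (n + 1)) (z : Fin (n + 1) → ℂ) => φ (k.1 *ᵥ z)) hjoint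
  simp only [hinv, integral_const, probReal_univ, one_smul] at hswap
  have hne : ∀ᵐ z ∂((volume : Measure (Fin (n + 1) → ℂ)).restrict (complexBall (n + 1))),
      z ≠ 0 := by
    refine ae_restrict_of_ae ?_
    rw [ae_iff]; simp
  rw [hcorner, hswap, integral_congr_ae (hne.mono fun z hz => hinner z hz), integral_const]
  have hvol : ((volume : Measure (Fin (n + 1) → ℂ)).restrict (complexBall (n + 1))).real Set.univ
      = volume.real (openCorner (n + 1)) := by
    have h0 := hmp.measure_preimage (s := Set.univ) nullMeasurableSet_univ
    rw [Set.preimage_univ, Measure.restrict_apply_univ (s := openCorner (n + 1))] at h0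
    rw [Measure.real, h0, Measure.real]
  rw [hvol, Complex.real_smul, mul_comm]

/-! ### Interlacing eigenvalues as coordinates -/

section Interlacing

open Polynomial

variable {n : ℕ}

/-- The polynomial `∑ p_i ∏_{i' ≠ i} (X - a_{i'})`. -/
def nodePoly (a p : Fin (n + 1) → ℝ) : ℝ[X] :=
  ∑ i, C (p i) * ∏ i' ∈ Finset.univ.erase i, (X - C (a i'))

/-- The product `∏_{i' ≠ i} (a_i - a_{i'})`. -/
def nodeW {N : ℕ} (a : Fin N → ℝ) (i : Fin N) : ℝ := ∏ i' ∈ Finset.univ.erase i, (a i - a i')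

/-- The monic polynomial with roots `b_j`. -/
def rootPoly (b : Fin n → ℝ) : ℝ[X] := ∏ j, (X - C (b j))

lemma nodeW_ne_zero {N : ℕ} {a : Fin N → ℝ} (ha : Function.Injective a) (i : Fin N) :
    nodeW a i ≠ 0 := by
  refine Finset.prod_ne_zero_iff.mpr fun j hj => sub_ne_zero.mpr fun h => ?_
  exact (Finset.ne_of_mem_erase hj) (ha h).symm

lemma eval_nodePoly (a p : Fin (n + 1) → ℝ) (i : Fin (n + 1)) :
    (nodePoly a p).eval (a i) = p i * nodeW a i := by
  rw [nodePoly, eval_finsetSum, Finset.sum_eq_single i]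
  · simp [eval_prod, nodeW]
  · intro j _ hj
    rw [eval_mul, eval_prod, Finset.prod_eq_zero (i := i)]
    · simp
    · simp [hj.symm]
    · simp
  · simp

lemma degree_nodePoly_lt (a p : Fin (n + 1) → ℝ) : (nodePoly a p).degree < (n + 1 : ℕ) := by
  refine lt_of_le_of_lt (degree_sum_le _ _) ?_
  rw [Finset.sup_lt_iff (by exact_mod_cast WithBot.bot_lt_coe (n + 1))]
  intro i _
  have h1 : (∏ i' ∈ Finset.univ.erase i, (X - C (a i'))).degree = (n : WithBot ℕ) := by
    rw [degree_prod]; simp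
  refine lt_of_le_of_lt (degree_mul_le _ _) (lt_of_le_of_lt
    (add_le_add degree_C_le h1.le) ?_)
  rw [zero_add]
  exact_mod_cast Nat.lt_succ_self n

lemma coeff_nodePoly (a p : Fin (n + 1) → ℝ) : (nodePoly a p).coeff n = ∑ i, p i := by
  rw [nodePoly, finsetSum_coeff]
  refine Finset.sum_congr rfl fun i _ => ?_
  have h1 : (∏ i' ∈ Finset.univ.erase i, (X - C (a i'))).Monic := monic_prod_X_sub_C _ _
  have h2 : (∏ i' ∈ Finset.univ.erase i, (X - C (a i'))).natDegree = n := by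
    rw [natDegree_prod_of_monic _ _ fun i _ => monic_X_sub_C _]; simp
  rw [coeff_C_mul]
  have h3 := h1.coeff_natDegree
  rw [h2] at h3
  rw [h3, mul_one]

lemma monic_rootPoly (b : Fin n → ℝ) : (rootPoly b).Monic := monic_prod_X_sub_C _ _

lemma natDegree_rootPoly (b : Fin n → ℝ) : (rootPoly b).natDegree = n := by
  rw [rootPoly, natDegree_prod_of_monic _ _ fun i _ => monic_X_sub_C _]; simp

lemma degree_rootPoly (b : Fin n → ℝ) : (rootPoly b).degree = n := by
  rw [degree_eq_natDegree (monic_rootPoly b).ne_zero, natDegree_rootPoly]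

lemma eval_rootPoly (b : Fin n → ℝ) (x : ℝ) : (rootPoly b).eval x = ∏ j, (x - b j) := by
  simp [rootPoly, eval_prod]

lemma nodePoly_eq_rootPoly {a p : Fin (n + 1) → ℝ} (ha : Function.Injective a) {b : Fin n → ℝ}
    (h : ∀ i, p i * nodeW a i = (rootPoly b).eval (a i)) : nodePoly a p = rootPoly b := by
  refine eq_of_degrees_lt_of_eval_index_eq (v := a) (s := Finset.univ) ha.injOn ?_ ?_ ?_
  · simpa using degree_nodePoly_lt a p
  · rw [degree_rootPoly]; simp; exact_mod_cast Nat.lt_succ_self n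
  · intro i _; rw [eval_nodePoly, h]

lemma sum_eq_one_of_eval {a p : Fin (n + 1) → ℝ} (ha : Function.Injective a) {b : Fin n → ℝ}
    (h : ∀ i, p i * nodeW a i = (rootPoly b).eval (a i)) : ∑ i, p i = 1 := by
  rw [← coeff_nodePoly a p, nodePoly_eq_rootPoly ha h]
  have := (monic_rootPoly b).coeff_natDegree
  rwa [natDegree_rootPoly] at this

/-- The box of pairs `(ρ, b)` with `0 < ρ < 1` and `b` strictly interlacing `a`. -/
def interBox (a : Fin (n + 1) → ℝ) : Set (Fin (n + 1) → ℝ) :=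
  Set.univ.pi fun i => Set.Ioo ((Fin.cons 0 (fun j : Fin n => a j.castSucc) : Fin (n + 1) → ℝ) i)
    ((Fin.cons 1 (fun j : Fin n => a j.succ) : Fin (n + 1) → ℝ) i)

lemma mem_interBox {a y : Fin (n + 1) → ℝ} : y ∈ interBox a ↔
    (0 < y 0 ∧ y 0 < 1) ∧ ∀ j : Fin n, a j.castSucc < y j.succ ∧ y j.succ < a j.succ := by
  simp [interBox, Set.mem_pi, Fin.forall_fin_succ]

lemma isOpen_interBox (a : Fin (n + 1) → ℝ) : IsOpen (interBox a) :=
  isOpen_set_pi Set.finite_univ fun _ _ => isOpen_Ioo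

/-- The change of variables from `(ρ, b)` to the vector of weights `ρ p`, where
`∑ p_i ∏_{i' ≠ i} (X - a_{i'})` has the roots `b`. -/
def weightMap (a y : Fin (n + 1) → ℝ) : Fin (n + 1) → ℝ := fun i =>
  y 0 * (∏ j : Fin n, (a i - y j.succ)) * (nodeW a i)⁻¹

/-- The matrix whose columns are the polynomials `∏ (X - b_j)` and `∏_{j' ≠ j} (X - b_{j'})`,
evaluated at the points `c_i`. -/
def rootMat (b : Fin n → ℝ) (c : Fin (n + 1) → ℝ) : Matrix (Fin (n + 1)) (Fin (n + 1)) ℝ :=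
  Matrix.of fun i => Fin.cons (∏ j, (c i - b j))
    fun j => ∏ j' ∈ Finset.univ.erase j, (c i - b j')

lemma abs_prod_nodeW {N : ℕ} (a : Fin N → ℝ) :
    |∏ i, nodeW a i| = |(vandermonde a).det| ^ 2 := by
  have h := Finset.prod_prod_Ioi_mul_eq_prod_prod_off_diag (fun i j : Fin N => |a j - a i|)
  rw [Finset.abs_prod, det_vandermonde, Finset.abs_prod, ← Finset.prod_pow]
  have h1 : ∀ i, |nodeW a i| = ∏ j ∈ {i}ᶜ, |a i - a j| := by
    intro i
    rw [nodeW, Finset.abs_prod]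
    refine Finset.prod_congr ?_ fun _ _ => rfl
    ext j; simp
  simp only [h1, ← h]
  refine Finset.prod_congr rfl fun i _ => ?_
  rw [Finset.abs_prod, ← Finset.prod_pow]
  refine Finset.prod_congr rfl fun j _ => ?_
  rw [abs_sub_comm (a i), sq]

lemma abs_det_rootMat {b : Fin n → ℝ} (hb : Function.Injective b) (c : Fin (n + 1) → ℝ) :
    |(rootMat b c).det| = |(vandermonde c).det| * |(vandermonde b).det| := by
  -- both sides have the form `det(Vandermonde) * det(coefficients)`; the second factor is
  -- computed at the nodes `(x, b)`, where `rootMat` is triangular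
  let q : Fin (n + 1) → ℝ[X] := Fin.cons (rootPoly b)
    fun j => ∏ j' ∈ Finset.univ.erase j, (X - C (b j'))
  have hdeg : ∀ k, (q k).natDegree < n + 1 := by
    intro k
    refine Fin.cases ?_ (fun j => ?_) k
    · simp [q, natDegree_rootPoly]
    · simp only [q, Fin.cons_succ]
      rw [natDegree_prod_of_monic _ _ fun i _ => monic_X_sub_C _]
      simp
  let Q : Matrix (Fin (n + 1)) (Fin (n + 1)) ℝ := Matrix.of fun i k => (q k).coeff i
  have hfac : ∀ c : Fin (n + 1) → ℝ, rootMat b c = vandermonde c * Q := by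
    intro c
    ext i k
    have h1 : rootMat b c i k = (q k).eval (c i) := by
      refine Fin.cases ?_ (fun j => ?_) k
      · simp [q, rootMat, eval_rootPoly]
      · simp [q, rootMat, eval_prod]
    rw [h1, eval_eq_sum_range' (hdeg k), Matrix.mul_apply, Finset.sum_range]
    refine Finset.sum_congr rfl fun m _ => ?_
    simp [Q, vandermonde_apply, mul_comm]
  obtain ⟨x, hx⟩ : ∃ x : ℝ, ∀ j, x ≠ b j := by
    obtain ⟨x, hx⟩ := (Set.finite_range b).infinite_compl.nonempty
    exact ⟨x, fun j h => hx ⟨j, h.symm⟩⟩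
  have hdetb : (vandermonde b).det ≠ 0 := det_vandermonde_ne_zero_iff.mpr hb
  have hx0 : ∏ j, (x - b j) ≠ 0 := Finset.prod_ne_zero_iff.mpr fun j _ => sub_ne_zero.mpr (hx j)
  have h2 : (rootMat b (Fin.cons x b : Fin (n + 1) → ℝ)).det =
      (∏ j, (x - b j)) * ∏ j, nodeW b j := by
    rw [Matrix.det_of_isUpperTriangular, Fin.prod_univ_succ]
    · simp [rootMat, nodeW]
    · intro i k hik
      have hi : i ≠ 0 := by rintro rfl; exact absurd hik (by simp)
      obtain ⟨i, rfl⟩ := Fin.exists_succ_eq.mpr hi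
      revert hik
      refine Fin.cases (fun _ => ?_) (fun j hik => ?_) k
      · simp only [rootMat, Matrix.of_apply, Fin.cons_succ, Fin.cons_zero]
        exact Finset.prod_eq_zero (Finset.mem_univ i) (sub_self _)
      · have hij : i ≠ j := by rintro rfl; exact lt_irrefl _ hik
        simp only [rootMat, Matrix.of_apply, Fin.cons_succ]
        exact Finset.prod_eq_zero (i := i) (by simp [hij]) (sub_self _)
  have h3 : |(vandermonde (Fin.cons x b : Fin (n + 1) → ℝ)).det| =
      |∏ j, (x - b j)| * |(vandermonde b).det| := by
    rw [det_vandermonde, Fin.prod_univ_succ, Fin.prod_Ioi_zero, abs_mul]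
    congr 1
    · simp only [Fin.cons_succ, Fin.cons_zero, Finset.abs_prod]
      exact Finset.prod_congr rfl fun j _ => abs_sub_comm _ _
    · rw [det_vandermonde]
      congr 1
      refine Finset.prod_congr rfl fun i _ => ?_
      rw [Fin.prod_Ioi_succ]
      simp only [Fin.cons_succ]
  have h4 : |Q.det| = |(vandermonde b).det| := by
    have h5 := congrArg abs h2
    rw [hfac, det_mul, abs_mul, h3, abs_mul, abs_prod_nodeW] at h5
    have h6 : 0 < |∏ j, (x - b j)| := abs_pos.mpr hx0
    have h7 : 0 < |(vandermonde b).det| := abs_pos.mpr hdetb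
    have h8 : |∏ j, (x - b j)| * |(vandermonde b).det| * |Q.det| =
        |∏ j, (x - b j)| * |(vandermonde b).det| * |(vandermonde b).det| := by rw [h5]; ring
    exact mul_left_cancel₀ (by positivity) h8
  rw [hfac, det_mul, abs_mul, h4]

/-- The Jacobian matrix of `weightMap a`. -/
def weightJac (a y : Fin (n + 1) → ℝ) : Matrix (Fin (n + 1)) (Fin (n + 1)) ℝ :=
  Matrix.diagonal (fun i => (nodeW a i)⁻¹) * rootMat (fun j => y j.succ) a *
    Matrix.diagonal (Fin.cons 1 fun _ => -y 0)

lemma hasFDerivAt_weightMap (a y : Fin (n + 1) → ℝ) :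
    HasFDerivAt (weightMap a) (LinearMap.toContinuousLinearMap (Matrix.toLin' (weightJac a y)))
      y := by
  rw [hasFDerivAt_pi']
  intro i
  have h0 : ∀ k : Fin (n + 1), HasFDerivAt (fun z : Fin (n + 1) → ℝ => z k)
      (ContinuousLinearMap.proj (R := ℝ) (φ := fun _ : Fin (n + 1) => ℝ) k) y :=
    fun k => (ContinuousLinearMap.proj (R := ℝ) (φ := fun _ : Fin (n + 1) => ℝ) k).hasFDerivAt
  have h1 := HasFDerivAt.finsetProd (u := Finset.univ) (x := y)
    (g := fun (j : Fin n) (z : Fin (n + 1) → ℝ) => a i - z j.succ)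
    (fun j _ => (h0 j.succ).const_sub (a i))
  have h2 := ((h0 0).mul h1).mul_const (nodeW a i)⁻¹
  refine h2.congr_fderiv ?_
  ext v
  simp [weightJac, rootMat, Matrix.mulVec, dotProduct, Fin.sum_univ_succ, Matrix.mul_apply,
    Matrix.diagonal_apply, Finset.mul_sum]
  rw [add_comm, mul_assoc]
  congr 2
  exact Finset.sum_congr rfl fun j _ => by ring

lemma abs_det_weightJac {a y : Fin (n + 1) → ℝ} (ha : Function.Injective a)
    (hy : Function.Injective fun j : Fin n => y j.succ) (hy0 : 0 < y 0) :
    |(weightJac a y).det| =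
      y 0 ^ n * |(vandermonde fun j : Fin n => y j.succ).det| * |(vandermonde a).det|⁻¹ := by
  have h1 : 0 < |(vandermonde a).det| := abs_pos.mpr (det_vandermonde_ne_zero_iff.mpr ha)
  rw [weightJac, det_mul, det_mul, abs_mul, abs_mul, abs_det_rootMat hy, det_diagonal,
    det_diagonal, Finset.prod_inv_distrib, abs_inv, abs_prod_nodeW, Fin.prod_univ_succ]
  simp only [Fin.cons_zero, Fin.cons_succ, Finset.prod_const, Finset.card_univ, Fintype.card_fin,
    one_mul, abs_pow, abs_neg, abs_of_pos hy0]
  field_simp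

lemma strictMono_of_mem_interBox {n : ℕ} {a y : Fin (n + 1) → ℝ} (ha : StrictMono a)
    (hy : y ∈ interBox a) : StrictMono fun j : Fin n => y j.succ := by
  have h := (mem_interBox.mp hy).2
  intro i j hij
  have h1 := (h i).2
  have h2 := (h j).1
  have h3 : a i.succ ≤ a j.castSucc := ha.monotone (by
    rw [Fin.le_def]; simp only [Fin.val_succ, Fin.val_castSucc]; exact hij)
  simp only; linarith

lemma weightMap_eval {a y : Fin (n + 1) → ℝ} (ha : Function.Injective a) (i : Fin (n + 1)) :
    weightMap a y i * nodeW a i = y 0 * (rootPoly fun j : Fin n => y j.succ).eval (a i) := by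
  rw [weightMap, eval_rootPoly, inv_mul_cancel_right₀ (nodeW_ne_zero ha i)]

lemma sum_weightMap {a y : Fin (n + 1) → ℝ} (ha : Function.Injective a) :
    ∑ i, weightMap a y i = y 0 := by
  have h : ∑ i, (∏ j : Fin n, (a i - y j.succ)) * (nodeW a i)⁻¹ = 1 := by
    refine sum_eq_one_of_eval ha (b := fun j => y j.succ) fun i => ?_
    rw [eval_rootPoly, inv_mul_cancel_right₀ (nodeW_ne_zero ha i)]
  simp only [weightMap, mul_assoc, ← Finset.mul_sum]
  rw [h, mul_one]

lemma injOn_weightMap {a : Fin (n + 1) → ℝ} (ha : StrictMono a) :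
    Set.InjOn (weightMap a) (interBox a) := by
  intro y hy z hz hyz
  have h0 : y 0 = z 0 := by
    rw [← sum_weightMap (y := y) ha.injective, ← sum_weightMap (y := z) ha.injective, hyz]
  have hy' := mem_interBox.mp hy
  have hz' := mem_interBox.mp hz
  -- the weights determine the monic polynomial of degree `n` by its values at the `a_i`; its
  -- roots are then told apart by the intervals in which they lie
  have h1 : rootPoly (fun j : Fin n => y j.succ) = rootPoly fun j : Fin n => z j.succ := by
    refine eq_of_degrees_lt_of_eval_index_eq (v := a) (s := Finset.univ)
      ha.injective.injOn ?_ ?_ fun i _ => ?_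
    · rw [degree_rootPoly]; simp; exact_mod_cast Nat.lt_succ_self n
    · rw [degree_rootPoly]; simp; exact_mod_cast Nat.lt_succ_self n
    · have h2 := weightMap_eval (y := y) ha.injective i
      rw [hyz, weightMap_eval (y := z) ha.injective i, h0] at h2
      exact (mul_left_cancel₀ hz'.1.1.ne' h2).symm
  funext i
  refine Fin.cases h0 (fun j => ?_) i
  have h2 : (rootPoly fun j : Fin n => z j.succ).eval (y j.succ) = 0 := by
    rw [← h1, eval_rootPoly]
    exact Finset.prod_eq_zero (Finset.mem_univ j) (sub_self _)
  rw [eval_rootPoly, Finset.prod_eq_zero_iff] at h2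
  obtain ⟨k, -, hk⟩ := h2
  have hk' : y j.succ = z k.succ := sub_eq_zero.mp hk
  have hjk : j = k := by
    have e1 := hy'.2 j
    have e2 := hz'.2 k
    rw [hk'] at e1
    rcases lt_trichotomy j k with h | h | h
    · have := ha.monotone (show j.succ ≤ k.castSucc by
        rw [Fin.le_def]; simp only [Fin.val_succ, Fin.val_castSucc]; exact h)
      linarith
    · exact h
    · have := ha.monotone (show k.succ ≤ j.castSucc by
        rw [Fin.le_def]; simp only [Fin.val_succ, Fin.val_castSucc]; exact h)
      linarith
  rw [hk', hjk]

lemma nodeW_mul_neg {a : Fin (n + 1) → ℝ} (ha : StrictMono a) (j : Fin n) :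
    nodeW a j.castSucc * nodeW a j.succ < 0 := by
  have hne : j.castSucc ≠ j.succ := (Fin.castSucc_lt_succ).ne
  have e1 : nodeW a j.castSucc = (a j.castSucc - a j.succ) *
      ∏ i ∈ (Finset.univ.erase j.castSucc).erase j.succ, (a j.castSucc - a i) := by
    rw [nodeW, Finset.mul_prod_erase _ (fun i => a j.castSucc - a i) (by simp [hne.symm])]
  have e2 : nodeW a j.succ = (a j.succ - a j.castSucc) *
      ∏ i ∈ (Finset.univ.erase j.castSucc).erase j.succ, (a j.succ - a i) := by
    rw [nodeW, Finset.erase_right_comm,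
      Finset.mul_prod_erase _ (fun i => a j.succ - a i) (by simp [hne])]
  have h1 : a j.castSucc < a j.succ := ha Fin.castSucc_lt_succ
  -- `a_j` and `a_{j+1}` are neighbours, so that they lie on the same side of any other `a_i`
  have h2 : 0 < (∏ i ∈ (Finset.univ.erase j.castSucc).erase j.succ, (a j.castSucc - a i)) *
      ∏ i ∈ (Finset.univ.erase j.castSucc).erase j.succ, (a j.succ - a i) := by
    rw [← Finset.prod_mul_distrib]
    refine Finset.prod_pos fun i hi => ?_
    simp only [Finset.mem_erase, Finset.mem_univ, and_true] at hi
    rcases lt_or_ge i j.castSucc with h | h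
    · have e3 := ha h
      exact mul_pos (by linarith) (by linarith)
    · have h3 : j.succ < i := by
        refine lt_of_le_of_ne ?_ (Ne.symm hi.1)
        have h4 : j.castSucc < i := lt_of_le_of_ne h (Ne.symm hi.2)
        rw [Fin.lt_def] at h4; rw [Fin.le_def]
        simpa using h4
      have e3 := ha h3
      exact mul_pos_of_neg_of_neg (by linarith) (by linarith)
  rw [e1, e2]
  have h5 : (a j.castSucc - a j.succ) * (a j.succ - a j.castSucc) < 0 :=
    mul_neg_of_neg_of_pos (by linarith) (by linarith)
  calc _ = ((a j.castSucc - a j.succ) * (a j.succ - a j.castSucc)) * _ := by ring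
    _ < 0 := mul_neg_of_neg_of_pos h5 h2

lemma image_weightMap {a : Fin (n + 1) → ℝ} (ha : StrictMono a) :
    weightMap a '' interBox a = openCorner (n + 1) := by
  ext t
  constructor
  · rintro ⟨y, hy, rfl⟩
    have hy' := mem_interBox.mp hy
    refine ⟨fun i => ?_, by rw [sum_weightMap ha.injective]; exact hy'.1.2⟩
    -- each factor `(a_i - b_j)` has the sign of the corresponding factor of `nodeW a i`
    have h1 : nodeW a i = ∏ j : Fin n, (a i - a (i.succAbove j)) := by
      rw [nodeW]
      have : Finset.univ.erase i = Finset.univ.image i.succAbove := by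
        ext k; simp [eq_comm]
      rw [this, Finset.prod_image Fin.succAbove_right_injective.injOn]
    rw [weightMap, h1, mul_assoc, ← Finset.prod_inv_distrib, ← Finset.prod_mul_distrib]
    refine mul_pos hy'.1.1 (Finset.prod_pos fun j _ => ?_)
    have e1 := hy'.2 j
    rcases lt_or_ge j.castSucc i with h | h
    · rw [Fin.succAbove_of_castSucc_lt _ _ h]
      have e2 := ha.monotone (show j.succ ≤ i by
        rw [Fin.lt_def] at h; rw [Fin.le_def]; simpa using h)
      have e3 : 0 < a i - a j.castSucc := by linarith
      have e4 : 0 < a i - y j.succ := by linarith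
      positivity
    · rw [Fin.succAbove_of_le_castSucc _ _ h]
      have e2 := ha.monotone h
      have e3 : a i - a j.succ < 0 := by linarith
      have e4 : a i - y j.succ < 0 := by linarith
      exact mul_pos_of_neg_of_neg e4 (inv_lt_zero.mpr e3)
  · rintro ⟨ht0, ht1⟩
    set ρ := ∑ i, t i with hρ
    have hρ0 : 0 < ρ := Finset.sum_pos (fun i _ => ht0 i) Finset.univ_nonempty
    set p : Fin (n + 1) → ℝ := fun i => t i / ρ with hp
    have hp1 : ∑ i, p i = 1 := by
      rw [hp, ← Finset.sum_div, ← hρ, div_self hρ0.ne']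
    have hp0 : ∀ i, 0 < p i := fun i => div_pos (ht0 i) hρ0
    -- the polynomial with the weights `t / ρ` changes sign between neighbouring nodes
    have hroot : ∀ j : Fin n, ∃ x ∈ Set.Ioo (a j.castSucc) (a j.succ),
        (nodePoly a p).eval x = 0 := by
      intro j
      have hlt : a j.castSucc < a j.succ := ha Fin.castSucc_lt_succ
      have hcont : ContinuousOn (fun x => (nodePoly a p).eval x)
        (Set.Icc (a j.castSucc) (a j.succ)) := (nodePoly a p).continuous.continuousOn
      have hneg : (nodePoly a p).eval (a j.castSucc) * (nodePoly a p).eval (a j.succ) < 0 := by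
        rw [eval_nodePoly, eval_nodePoly]
        calc _ = (p j.castSucc * p j.succ) * (nodeW a j.castSucc * nodeW a j.succ) := by ring
          _ < 0 := mul_neg_of_pos_of_neg (mul_pos (hp0 _) (hp0 _)) (nodeW_mul_neg ha j)
      rcases mul_neg_iff.mp hneg with ⟨h1, h2⟩ | ⟨h1, h2⟩
      · obtain ⟨x, hx, hx0⟩ := intermediate_value_Ioo' hlt.le hcont ⟨h2, h1⟩
        exact ⟨x, hx, hx0⟩
      · obtain ⟨x, hx, hx0⟩ := intermediate_value_Ioo hlt.le hcont ⟨h1, h2⟩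
        exact ⟨x, hx, hx0⟩
    choose b hb hb0 using hroot
    have hy : (Fin.cons ρ b : Fin (n + 1) → ℝ) ∈ interBox a := by
      rw [mem_interBox]
      simp only [Fin.cons_zero, Fin.cons_succ]
      exact ⟨⟨hρ0, ht1⟩, fun j => hb j⟩
    have hbinj : Function.Injective b := by
      have := (strictMono_of_mem_interBox ha hy).injective
      simpa only [Fin.cons_succ] using this
    have hmonic : (nodePoly a p).Monic := by
      refine monic_of_natDegree_le_of_coeff_eq_one n ?_ (by rw [coeff_nodePoly, hp1])
      exact Nat.lt_succ_iff.mp ((natDegree_lt_iff_degree_lt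
        (by intro h; have := coeff_nodePoly a p; rw [h, hp1] at this; simp at this)).mpr
          (degree_nodePoly_lt a p))
    have hnd : (nodePoly a p).natDegree = n := by
      refine le_antisymm ?_ (le_natDegree_of_ne_zero (by rw [coeff_nodePoly, hp1]; exact one_ne_zero))
      exact Nat.lt_succ_iff.mp ((natDegree_lt_iff_degree_lt hmonic.ne_zero).mpr
          (degree_nodePoly_lt a p))
    -- a monic polynomial of degree `n` with the `n` roots `b_j`
    have hpoly : nodePoly a p = rootPoly b := by
      refine eq_of_degree_sub_lt_of_eval_index_eq (v := b) (s := Finset.univ)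
        hbinj.injOn ?_ fun j _ => ?_
      · have h1 : (nodePoly a p).degree = (rootPoly b).degree := by
          rw [degree_rootPoly, degree_eq_natDegree hmonic.ne_zero, hnd]
        have h2 := degree_sub_lt_left h1 hmonic.ne_zero
          (by rw [hmonic.leadingCoeff, (monic_rootPoly b).leadingCoeff])
        rw [degree_eq_natDegree hmonic.ne_zero, hnd] at h2
        simpa using h2
      · rw [hb0, eval_rootPoly]
        exact (Finset.prod_eq_zero (Finset.mem_univ j) (sub_self _)).symm
    refine ⟨Fin.cons ρ b, hy, ?_⟩
    funext i
    have h1 := weightMap_eval (y := (Fin.cons ρ b : Fin (n + 1) → ℝ)) ha.injective i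
    simp only [Fin.cons_zero, Fin.cons_succ] at h1
    rw [← hpoly, eval_nodePoly, ← mul_assoc] at h1
    rw [mul_right_cancel₀ (nodeW_ne_zero ha.injective i) h1, hp, mul_div_cancel₀ _ hρ0.ne']

end Interlacing

/-! ### The leading corner of a randomly rotated Hermitian matrix -/

lemma exists_unitary_conj_of_charpoly_eq {n : ℕ} {B B' : Matrix (Fin n) (Fin n) ℂ}
    (hB : B.IsHermitian) (hB' : B'.IsHermitian) (h : B.charpoly = B'.charpoly) :
    ∃ u : K n, B = u.1 * B' * u.1ᴴ := by
  have key : ∀ {A : Matrix (Fin n) (Fin n) ℂ} (hA : A.IsHermitian), ∃ u : K n,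
      A = u.1 * diagonal (RCLike.ofReal ∘ hA.eigenvalues) * u.1ᴴ := by
    intro A hA
    refine ⟨hA.eigenvectorUnitary, ?_⟩
    have h1 := hA.spectral_theorem
    rw [Unitary.conjStarAlgAut_apply] at h1
    exact h1
  obtain ⟨u, hu⟩ := key hB
  obtain ⟨v, hv⟩ := key hB'
  have he : hB.eigenvalues = hB'.eigenvalues :=
    (hB.eigenvalues_eq_eigenvalues_iff hB').mpr h
  rw [he] at hu
  refine ⟨u * v⁻¹, ?_⟩
  have h2 : v.1ᴴ * B' * v.1 = diagonal (RCLike.ofReal ∘ hB'.eigenvalues) := by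
    conv_lhs => rw [hv]
    calc _ = (v.1ᴴ * v.1) * diagonal (RCLike.ofReal ∘ hB'.eigenvalues) * (v.1ᴴ * v.1) := by
          simp only [Matrix.mul_assoc]
      _ = _ := by rw [coeK_conjTranspose_mul, Matrix.one_mul, Matrix.mul_one]
  rw [hu, ← h2, coeK_mul, coeK_inv]
  simp only [conjTranspose_mul, conjTranspose_conjTranspose, Matrix.mul_assoc]

lemma isHermitian_conj {l m : ℕ} (A : Matrix (Fin l) (Fin m) ℂ) {X : Matrix (Fin m) (Fin m) ℂ}
    (hX : Xᴴ = X) : (A * X * Aᴴ).IsHermitian := by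
  rw [Matrix.IsHermitian]
  simp only [conjTranspose_mul, conjTranspose_conjTranspose, hX, Matrix.mul_assoc]

lemma diagonal_ofReal_conjTranspose {n : ℕ} (a : Fin n → ℝ) :
    (diagonal fun i => (a i : ℂ))ᴴ = diagonal fun i => (a i : ℂ) := by
  rw [diagonal_conjTranspose]
  congr 1
  funext i; simp

open Polynomial in
/-- The characteristic polynomial of the leading corner is a convex combination of the
polynomials `∏_{i' ≠ i} (X - a_{i'})`, with the squared moduli of the last row as weights. -/
lemma charpoly_corner {n : ℕ} (k : K (n + 1)) (a : Fin (n + 1) → ℝ) :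
    (Proj n (n + 1) * (k.1 * (diagonal fun i => (a i : ℂ)) * k.1ᴴ) * Proj (n + 1) n).charpoly =
      (nodePoly a fun i => ‖k.1 (Fin.last n) i‖ ^ 2).map Complex.ofRealHom := by
  refine Polynomial.funext fun x => ?_
  set D := diagonal fun i => (a i : ℂ) with hD
  set X := k.1 * D * k.1ᴴ with hX
  have h1 : scalar (Fin n) x - Proj n (n + 1) * X * Proj (n + 1) n =
      (scalar (Fin (n + 1)) x - X).submatrix (Fin.last n).succAbove (Fin.last n).succAbove := by
    ext i j
    rw [Matrix.sub_apply, mul_Proj_apply (Nat.le_succ n), Proj_mul_apply (Nat.le_succ n)]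
    simp only [Fin.succAbove_last, submatrix_apply, Matrix.sub_apply, scalar_apply,
      diagonal_apply, Fin.castSucc_inj]
    rfl
  have h2 : (scalar (Fin (n + 1)) x - X) = k.1 * (diagonal fun i => x - a i) * k.1ᴴ := by
    have e1 : (diagonal fun i => x - (a i : ℂ)) = x • (1 : Matrix (Fin (n + 1)) (Fin (n + 1)) ℂ) - D := by
      ext i j
      by_cases hij : i = j <;> simp [hD, hij]
    rw [e1, Matrix.mul_sub, Matrix.sub_mul, Matrix.mul_smul, Matrix.mul_one, Matrix.smul_mul,
      coeK_mul_conjTranspose, hX]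
    congr 1
    ext i j
    by_cases hij : i = j <;> simp [hij]
  have h3 : adjugate k.1 = k.1.det • k.1ᴴ := by
    calc adjugate k.1 = adjugate k.1 * (k.1 * k.1ᴴ) := by
          rw [coeK_mul_conjTranspose, Matrix.mul_one]
      _ = _ := by rw [← Matrix.mul_assoc, adjugate_mul, Matrix.smul_mul, Matrix.one_mul]
  have h4 : adjugate k.1ᴴ = k.1ᴴ.det • k.1 := by
    calc adjugate k.1ᴴ = adjugate k.1ᴴ * (k.1ᴴ * k.1) := by
          rw [coeK_conjTranspose_mul, Matrix.mul_one]
      _ = _ := by rw [← Matrix.mul_assoc, adjugate_mul, Matrix.smul_mul, Matrix.one_mul]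
  have h5 : k.1.det * k.1ᴴ.det = 1 := by
    rw [← det_mul, coeK_mul_conjTranspose, det_one]
  -- the characteristic polynomial of the corner is the last diagonal entry of the adjugate of
  -- `x - X`, and taking adjugates commutes with unitary conjugation
  have h6 : adjugate (scalar (Fin (n + 1)) x - X) =
      k.1 * adjugate (diagonal fun i => x - (a i : ℂ)) * k.1ᴴ := by
    rw [h2, adjugate_mul_distrib, adjugate_mul_distrib, h3, h4]
    simp only [Matrix.smul_mul, Matrix.mul_smul, smul_smul, h5, one_smul, Matrix.mul_assoc]
  rw [eval_charpoly, h1]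
  have h7 := adjugate_fin_succ_eq_det_submatrix (scalar (Fin (n + 1)) x - X) (Fin.last n)
    (Fin.last n)
  rw [Even.neg_one_pow ⟨_, rfl⟩, one_mul] at h7
  rw [← h7, h6, adjugate_diagonal, Matrix.mul_apply]
  simp only [Matrix.mul_diagonal, nodePoly, Polynomial.map_sum, eval_finsetSum]
  refine Finset.sum_congr rfl fun i _ => ?_
  simp only [conjTranspose_apply, Polynomial.map_mul, Polynomial.map_prod, Polynomial.map_sub,
    map_X, map_C, eval_mul, eval_C, eval_prod, eval_sub, eval_X, Complex.ofRealHom_eq_coe]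
  have h8 : k.1 (Fin.last n) i * star (k.1 (Fin.last n) i) =
      ((‖k.1 (Fin.last n) i‖ ^ 2 : ℝ) : ℂ) := by
    rw [Complex.star_def, Complex.mul_conj, Complex.normSq_eq_norm_sq]
  rw [← h8]; ring

open Polynomial in
lemma charpoly_diagonal_ofReal {n : ℕ} (b : Fin n → ℝ) :
    (diagonal fun i => (b i : ℂ)).charpoly = (rootPoly b).map Complex.ofRealHom := by
  rw [charpoly_diagonal, rootPoly, Polynomial.map_prod]
  simp

/-- The law of the spectrum of the leading corner: the eigenvalues `b` of the corner of a uniformly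
rotated matrix with spectrum `a` have a density proportional to `|Δ(b)| / |Δ(a)|` on the
sequences interlacing `a`. -/
theorem integral_corner {n : ℕ} {a : Fin (n + 1) → ℝ} (ha : StrictMono a)
    {G : Matrix (Fin n) (Fin n) ℂ → ℂ} (hGm : Measurable G)
    (hGinv : ∀ (u : K n) B, G (u.1 * B * u.1ᴴ) = G B)
    (hGb : ∃ C, ∀ y ∈ interBox a, ‖G (diagonal fun j => (y j.succ : ℂ))‖ ≤ C) :
    (∫ k : K (n + 1), G (Proj n (n + 1) * (k.1 * (diagonal fun i => (a i : ℂ)) * k.1ᴴ) *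
      Proj (n + 1) n) ∂(haarK (n + 1))) * (volume.real (openCorner (n + 1)) : ℂ) =
    ∫ y in interBox a, ((y 0 ^ n * |(vandermonde fun j : Fin n => y j.succ).det| *
      |(vandermonde a).det|⁻¹ : ℝ) : ℂ) * G (diagonal fun j => (y j.succ : ℂ)) := by
  obtain ⟨C, hC⟩ := hGb
  have hSm : MeasurableSet (interBox a) := (isOpen_interBox a).measurableSet
  have hder : ∀ y ∈ interBox a, HasFDerivWithinAt (weightMap a)
      (LinearMap.toContinuousLinearMap (Matrix.toLin' (weightJac a y))) (interBox a) y :=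
    fun y _ => (hasFDerivAt_weightMap a y).hasFDerivWithinAt
  have hinj := injOn_weightMap ha
  have hemb := measurableEmbedding_of_fderivWithin (f := weightMap a) hSm hder hinj
  -- `G` of the interlacing spectrum, as a function of the weights
  let g : interBox a → ℂ := fun y => G (diagonal fun j => (y.1 j.succ : ℂ))
  have hgm : Measurable g := by
    refine hGm.comp (Continuous.measurable ?_)
    refine Continuous.matrix_diagonal (continuous_pi fun j => ?_)
    exact Complex.continuous_ofReal.comp ((continuous_apply _).comp continuous_subtype_val)
  let h₀ : (Fin (n + 1) → ℝ) → ℂ := Function.extend ((interBox a).domRestrict (weightMap a)) g 0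
  have hh₀m : Measurable h₀ := hemb.measurable_extend hgm measurable_const
  have hh₀ : ∀ y ∈ interBox a, h₀ (weightMap a y) = G (diagonal fun j => (y j.succ : ℂ)) :=
    fun y hy => hemb.injective.extend_apply g 0 ⟨y, hy⟩
  have hC0 : ∀ t, ‖h₀ t‖ ≤ max C 0 := by
    intro t
    by_cases ht : ∃ y, (interBox a).domRestrict (weightMap a) y = t
    · obtain ⟨y, rfl⟩ := ht
      rw [show h₀ _ = g y from hemb.injective.extend_apply g 0 y]
      exact (hC y.1 y.2).trans (le_max_left _ _)
    · rw [show h₀ t = 0 from Function.extend_apply' _ _ _ ht]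
      simp
  -- the extension that is homogeneous of degree zero
  let h : (Fin (n + 1) → ℝ) → ℂ := fun t => h₀ (fun i => t i / (2 * ∑ i, t i))
  have hhm : Measurable h := hh₀m.comp (by fun_prop)
  have hhb : ∃ C, ∀ t, ‖h t‖ ≤ C := ⟨_, fun t => hC0 _⟩
  have hhom : ∀ c : ℝ, 0 < c → ∀ t, h (c • t) = h t := by
    intro c hc t
    simp only [h]
    congr 1
    funext i
    simp only [Pi.smul_apply, smul_eq_mul, ← Finset.mul_sum]
    rw [mul_left_comm, mul_div_mul_left _ _ hc.ne']
  -- the normalization by `2 ∑ t_i` moves every point to the section `ρ = 1 / 2` of the box, which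
  -- lies in its interior, whereas `ρ = 1` does not
  have hhalf : ∀ y ∈ interBox a, (Fin.cons (1 / 2) (fun j => y j.succ) : Fin (n + 1) → ℝ) ∈
      interBox a := by
    intro y hy
    rw [mem_interBox] at hy ⊢
    simp only [Fin.cons_zero, Fin.cons_succ]
    exact ⟨by norm_num, hy.2⟩
  have hval : ∀ y ∈ interBox a, h (weightMap a y) = G (diagonal fun j => (y j.succ : ℂ)) := by
    intro y hy
    have hy0 := (mem_interBox.mp hy).1.1
    have h1 := hh₀ _ (hhalf y hy)
    simp only [Fin.cons_succ] at h1
    rw [← h1]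
    simp only [h]
    congr 1
    funext i
    rw [sum_weightMap ha.injective]
    simp only [weightMap, Fin.cons_zero, Fin.cons_succ]
    field_simp
  -- the uniform distribution on the simplex does not charge its faces
  have hpos : ∀ᵐ k ∂(haarK (n + 1)), ∀ i, k.1 (Fin.last n) i ≠ 0 := by
    rw [ae_all_iff]
    intro i
    have h1 := integral_row_norm_sq (n := n)
      (h := Set.indicator {t : Fin (n + 1) → ℝ | t i = 0} 1)
      (measurable_one.indicator (measurable_pi_apply i (measurableSet_singleton 0)))
      ⟨1, fun t => by
        by_cases ht : t ∈ {t : Fin (n + 1) → ℝ | t i = 0} <;> simp [Set.indicator, ht]⟩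
      (fun c hc t => by
        by_cases ht : t i = 0 <;> simp [Set.indicator, ht, hc.ne'])
    have h2 : ∫ t in openCorner (n + 1), Set.indicator {t : Fin (n + 1) → ℝ | t i = 0}
        (1 : (Fin (n + 1) → ℝ) → ℂ) t = 0 := by
      rw [setIntegral_eq_zero_of_forall_eq_zero]
      intro t ht
      simp [Set.indicator, (ht.1 i).ne']
    have hvol : (volume.real (openCorner (n + 1)) : ℂ) ≠ 0 := by
      rw [Complex.ofReal_ne_zero, measureReal_ne_zero_iff (volume_openCorner_ne_top _)]
      exact (isOpen_openCorner _).measure_ne_zero _ (openCorner_nonempty _)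
    rw [h2, mul_eq_zero, or_iff_left hvol] at h1
    have hms : MeasurableSet {k : K (n + 1) | k.1 (Fin.last n) i = 0} := by
      have : Continuous fun k : K (n + 1) => k.1 (Fin.last n) i :=
        (continuous_coeK _).matrix_elem _ _
      exact this.measurable (measurableSet_singleton 0)
    have h3 : ∫ k : K (n + 1), Set.indicator {k : K (n + 1) | k.1 (Fin.last n) i = 0}
        (fun _ => (1 : ℂ)) k ∂(haarK (n + 1)) = 0 := by
      refine Eq.trans ?_ h1
      refine integral_congr_ae (Filter.Eventually.of_forall fun k => ?_)
      by_cases hk : k.1 (Fin.last n) i = 0 <;> simp [Set.indicator, hk]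
    rw [integral_indicator_const _ hms] at h3
    simp only [Complex.real_smul, mul_one, Complex.ofReal_eq_zero] at h3
    rw [measureReal_eq_zero_iff] at h3
    rw [ae_iff]
    simpa using h3
  -- the spectrum of the corner consists of the roots that belong to the last row of `k` as weights
  have hrow : ∀ᵐ k ∂(haarK (n + 1)), G (Proj n (n + 1) *
      (k.1 * (diagonal fun i => (a i : ℂ)) * k.1ᴴ) * Proj (n + 1) n) =
      h (fun i => ‖k.1 (Fin.last n) i‖ ^ 2) := by
    filter_upwards [hpos] with k hk
    have hsum : ∑ i, ‖k.1 (Fin.last n) i‖ ^ 2 = 1 := by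
      have h1 := congrFun (congrFun (coeK_mul_conjTranspose k) (Fin.last n)) (Fin.last n)
      rw [Matrix.mul_apply, Matrix.one_apply_eq] at h1
      have h2 : ((∑ i, ‖k.1 (Fin.last n) i‖ ^ 2 : ℝ) : ℂ) = 1 := by
        rw [← h1]
        push_cast
        refine Finset.sum_congr rfl fun i _ => ?_
        rw [conjTranspose_apply, Complex.star_def, Complex.mul_conj, Complex.normSq_eq_norm_sq]
        push_cast; rfl
      exact_mod_cast h2
    have hmem : (fun i => ‖k.1 (Fin.last n) i‖ ^ 2 / 2) ∈ openCorner (n + 1) := by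
      refine ⟨fun i => ?_, ?_⟩
      · have := norm_pos_iff.mpr (hk i); positivity
      · rw [← Finset.sum_div, hsum]; norm_num
    rw [← image_weightMap ha] at hmem
    obtain ⟨y, hy, hyt⟩ := hmem
    have h1 : h (fun i => ‖k.1 (Fin.last n) i‖ ^ 2) = G (diagonal fun j => (y j.succ : ℂ)) := by
      rw [← hval y hy, hyt, ← hhom (1 / 2) (by norm_num)]
      congr 1
      funext i
      simp only [Pi.smul_apply, smul_eq_mul]; ring
    have hy0 : y 0 = 1 / 2 := by
      rw [← sum_weightMap (y := y) ha.injective, hyt, ← Finset.sum_div, hsum]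
    have h2 : nodePoly a (fun i => ‖k.1 (Fin.last n) i‖ ^ 2) =
        rootPoly fun j : Fin n => y j.succ := by
      refine nodePoly_eq_rootPoly ha.injective fun i => ?_
      have h3 := weightMap_eval (y := y) ha.injective i
      rw [hyt, hy0] at h3
      simp only at h3
      linarith
    have hherm : (Proj n (n + 1) * (k.1 * (diagonal fun i => (a i : ℂ)) * k.1ᴴ) *
        Proj (n + 1) n).IsHermitian := by
      have := isHermitian_conj (Proj n (n + 1))
        (isHermitian_conj k.1 (diagonal_ofReal_conjTranspose a))
      rwa [Proj_conjTranspose] at this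
    obtain ⟨u, hu⟩ := exists_unitary_conj_of_charpoly_eq hherm
      (diagonal_ofReal_conjTranspose fun j : Fin n => y j.succ)
      (by rw [charpoly_corner, charpoly_diagonal_ofReal, h2])
    rw [hu, hGinv, h1]
  rw [integral_congr_ae hrow, integral_row_norm_sq hhm hhb hhom, ← image_weightMap ha,
    integral_image_eq_integral_abs_det_fderiv_smul volume hSm hder hinj]
  refine setIntegral_congr_fun hSm fun y hy => ?_
  have hdet : |(LinearMap.toContinuousLinearMap (Matrix.toLin' (weightJac a y))).det| =
      y 0 ^ n * |(vandermonde fun j : Fin n => y j.succ).det| * |(vandermonde a).det|⁻¹ := by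
    rw [← abs_det_weightJac ha.injective (strictMono_of_mem_interBox ha hy).injective
      (mem_interBox.mp hy).1.1]
    congr 1
    change LinearMap.det (Matrix.toLin' (weightJac a y)) = _
    rw [LinearMap.det_toLin']
  simp only [hdet, hval y hy, Complex.real_smul]

/-! ### The explicit formula for spherical integrals -/

lemma sp_mul_ofReal (x y : ℝ) (e : ZMod 2) (w : ℂ) :
    sp ((x * y : ℝ) : ℂ) e w = sp (x : ℂ) e w * sp (y : ℂ) e w := by
  unfold sp
  have h1 : signPow (x * y) e = signPow x e * signPow y e := by
    simp only [signPow, sign_mul, SignType.coe_mul, Int.cast_mul, mul_pow]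
  rw [Complex.ofReal_re, h1, Complex.ofReal_re, Complex.ofReal_re, Complex.norm_real,
    Complex.norm_real, Complex.norm_real, norm_mul, Complex.ofReal_mul,
    Complex.mul_cpow_ofReal_nonneg (norm_nonneg _) (norm_nonneg _)]
  ring

lemma sp_prod_ofReal {ι : Type*} (S : Finset ι) (x : ι → ℝ) (e : ZMod 2) (w : ℂ) :
    sp ((∏ i ∈ S, x i : ℝ) : ℂ) e w = ∏ i ∈ S, sp (x i : ℂ) e w := by
  classical
  induction S using Finset.induction_on with
  | empty => simp [sp, signPow]
  | insert i S hi ih => rw [Finset.prod_insert hi, Finset.prod_insert hi, sp_mul_ofReal, ih]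

lemma sp_ofReal_zero (e : ZMod 2) {w : ℂ} (hw : w ≠ 0) : sp ((0 : ℝ) : ℂ) e w = 0 := by
  simp [sp, Complex.zero_cpow hw]

lemma signPow_add {x : ℝ} (hx : x ≠ 0) (e e' : ZMod 2) :
    signPow x (e + e') = signPow x e * signPow x e' := by
  unfold signPow
  rcases hx.lt_or_gt with h | h
  · simp only [sign_neg h, SignType.coe_neg, SignType.coe_one, Int.cast_neg, Int.cast_one]
    rw [ZMod.val_add, ← neg_one_pow_eq_pow_mod_two, pow_add]
  · simp [sign_pos h]

lemma sp_add {x : ℝ} (hx : x ≠ 0) (e e' : ZMod 2) (w w' : ℂ) :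
    sp (x : ℂ) (e + e') (w + w') = sp (x : ℂ) e w * sp (x : ℂ) e' w' := by
  unfold sp
  rw [Complex.cpow_add, Complex.ofReal_re, signPow_add hx]
  · ring
  · simpa using hx

/-- The alternating determinant with entries `sign(a_i)^{L_j} |a_i|^{s_j}`. -/
def altDet {n : ℕ} (s : Fin n → ℂ) (L : Fin n → ZMod 2) (a : Fin n → ℝ) : ℂ :=
  (Matrix.of fun i j => sp (a i : ℂ) (L j) (s j)).det

/-- The product `∏_{i < j} (s_i - s_j)`. -/
def gapProd {n : ℕ} (s : Fin n → ℂ) : ℂ := ∏ i, ∏ j, if i < j then s i - s j else 1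

lemma gapProd_succ {n : ℕ} (s : Fin (n + 1) → ℂ) (c : ℂ) :
    gapProd s = gapProd (fun j : Fin n => s j.castSucc - c) *
      ∏ j : Fin n, (s j.castSucc - s (Fin.last n)) := by
  unfold gapProd
  rw [Fin.prod_univ_castSucc, Finset.prod_eq_one (s := Finset.univ)
    (f := fun j => if Fin.last n < j then s (Fin.last n) - s j else 1)
    (fun j _ => if_neg (Fin.le_last j).not_gt), mul_one, ← Finset.prod_mul_distrib]
  refine Finset.prod_congr rfl fun i _ => ?_
  rw [Fin.prod_univ_castSucc]
  simp [Fin.castSucc_lt_last]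

lemma expS_last {n : ℕ} (s : Fin (n + 1) → ℂ) : expS s (Fin.last n) = s (Fin.last n) := by
  simp [expS]

lemma expL_last {n : ℕ} (L : Fin (n + 1) → ZMod 2) : expL L (Fin.last n) = L (Fin.last n) := by
  unfold expL
  rw [dif_neg (by simp)]
  ring

lemma expS_castSucc {n : ℕ} (s : Fin (n + 1) → ℂ) (j : Fin n) :
    expS s j.castSucc = expS (fun j : Fin n => s j.castSucc - (s (Fin.last n) + 1)) j := by
  unfold expS
  by_cases h : (j : ℕ) + 1 < n
  · have h' : (j : ℕ) + 1 < n + 1 := by omega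
    simp only [Fin.val_castSucc, h, h', dif_pos]
    rw [show (⟨(j : ℕ) + 1, h'⟩ : Fin (n + 1)) = Fin.castSucc ⟨(j : ℕ) + 1, h⟩ from rfl]
    ring
  · have h' : (j : ℕ) + 1 < n + 1 := by omega
    simp only [Fin.val_castSucc, h, h', dif_pos, dite_false]
    rw [show (⟨(j : ℕ) + 1, h'⟩ : Fin (n + 1)) = Fin.last n from
      Fin.ext (by simp only [Fin.val_last]; omega)]
    ring

lemma expL_castSucc {n : ℕ} (L : Fin (n + 1) → ZMod 2) (j : Fin n) :
    expL L j.castSucc = expL (fun j : Fin n => L j.castSucc - (L (Fin.last n) + 1)) j := by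
  unfold expL
  by_cases h : (j : ℕ) + 1 < n
  · have h' : (j : ℕ) + 1 < n + 1 := by omega
    simp only [Fin.val_castSucc, h, h', dif_pos]
    rw [show (⟨(j : ℕ) + 1, h'⟩ : Fin (n + 1)) = Fin.castSucc ⟨(j : ℕ) + 1, h⟩ from rfl]
    ring
  · have h' : (j : ℕ) + 1 < n + 1 := by omega
    simp only [Fin.val_castSucc, h, h', dif_pos, dite_false]
    rw [show (⟨(j : ℕ) + 1, h'⟩ : Fin (n + 1)) = Fin.last n from
      Fin.ext (by simp only [Fin.val_last]; omega)]
    ring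

lemma baseDomain_castSucc {n : ℕ} {s : Fin (n + 1) → ℂ} (hs : s ∈ baseDomain (n + 1)) :
    (fun j : Fin n => s j.castSucc - (s (Fin.last n) + 1)) ∈ baseDomain n := fun j => by
  rw [← expS_castSucc]; exact hs _

lemma re_nonneg_of_mem_baseDomain {n : ℕ} {s : Fin n → ℂ} (hs : s ∈ baseDomain n) (j : Fin n) :
    0 ≤ (s j).re := by
  induction n with
  | zero => exact j.elim0
  | succ n ih =>
    have h0 : 0 ≤ (s (Fin.last n)).re := (expS_last s) ▸ hs _
    induction j using Fin.lastCases with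
    | last => exact h0
    | cast j =>
      have := ih (baseDomain_castSucc hs) j
      simp only [Complex.sub_re, Complex.add_re, Complex.one_re] at this
      linarith

lemma measurable_sphInt {l n : ℕ} (s : Fin n → ℂ) (L : Fin n → ZMod 2) :
    Measurable (sphInt s L : Matrix (Fin l) (Fin l) ℂ → ℂ) := by
  have h : Measurable fun p : Matrix (Fin l) (Fin l) ℂ × K l =>
      ∏ j : Fin n, sp (minor ((j : ℕ) + 1) (p.2.1 * p.1 * p.2.1ᴴ)) (expL L j) (expS s j) := by
    refine Finset.measurable_prod _ fun j _ => (measurable_sp _ _).comp ?_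
    have c2 : Continuous fun p : Matrix (Fin l) (Fin l) ℂ × K l => p.2.1 :=
      (continuous_coeK l).comp continuous_snd
    exact ((continuous_minor _).comp ((c2.matrix_mul continuous_fst).matrix_mul
      c2.matrix_conjTranspose)).measurable
  exact (h.stronglyMeasurable.integral_prod_right' (ν := haarK l)).measurable

lemma norm_sphInt_le {l n : ℕ} {s : Fin n → ℂ} (hs : s ∈ baseDomain n) (L : Fin n → ZMod 2)
    {x : Matrix (Fin l) (Fin l) ℂ} {R : ℝ} (hR : 1 ≤ R)
    (hx : ∀ (k : K l) (j : Fin n), ‖minor ((j : ℕ) + 1) (k.1 * x * k.1ᴴ)‖ ≤ R) :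
    ‖sphInt s L x‖ ≤ ∏ j, R ^ (expS s j).re := by
  have h := norm_integral_le_of_norm_le_const (μ := haarK l) (C := ∏ j, R ^ (expS s j).re)
    (Filter.Eventually.of_forall fun k : K l => norm_prod_sp_le (e := expL L) hR (hx k) hs)
  simpa [sphInt] using h

/-- A bound for the minors of all rotations of diagonal matrices with entries from `[-ρ, ρ]`. -/
lemma exists_minor_diagonal_le (l n : ℕ) (ρ : ℝ) : ∃ R : ℝ, 1 ≤ R ∧ ∀ a : Fin l → ℝ,
    (∀ i, |a i| ≤ ρ) → ∀ (k : K l) (j : Fin n),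
      ‖minor ((j : ℕ) + 1) (k.1 * (diagonal fun i => (a i : ℂ)) * k.1ᴴ)‖ ≤ R := by
  have h : ∀ j : Fin n, ∃ R : ℝ, ∀ p ∈ (Set.Icc (fun _ => -ρ) (fun _ => ρ) : Set (Fin l → ℝ)) ×ˢ
      (Set.univ : Set (K l)),
      ‖minor ((j : ℕ) + 1) (p.2.1 * (diagonal fun i => (p.1 i : ℂ)) * p.2.1ᴴ)‖ ≤ R := by
    intro j
    refine (isCompact_Icc.prod isCompact_univ).exists_bound_of_continuousOn
      (Continuous.continuousOn ?_)
    have c2 : Continuous fun p : (Fin l → ℝ) × K l => p.2.1 :=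
      (continuous_coeK l).comp continuous_snd
    have c1 : Continuous fun p : (Fin l → ℝ) × K l => diagonal fun i => (p.1 i : ℂ) := by
      refine Continuous.matrix_diagonal (continuous_pi fun i => ?_)
      exact Complex.continuous_ofReal.comp ((continuous_apply i).comp continuous_fst)
    exact (continuous_minor _).comp ((c2.matrix_mul c1).matrix_mul c2.matrix_conjTranspose)
  choose R hR using h
  refine ⟨1 + ∑ j, |R j|, ?_, fun a ha k j => ?_⟩
  · have : 0 ≤ ∑ j, |R j| := Finset.sum_nonneg fun i _ => abs_nonneg _
    linarith
  · have h1 := Finset.single_le_sum (f := fun i => |R i|) (fun i _ => abs_nonneg _)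
      (Finset.mem_univ j)
    have h2 := hR j (a, k) ⟨⟨fun i => (abs_le.mp (ha i)).1, fun i => (abs_le.mp (ha i)).2⟩,
      Set.mem_univ _⟩
    have h3 := le_abs_self (R j)
    simp only at h1 h2
    linarith

lemma hasDerivAt_sp {x : ℝ} (hx : x ≠ 0) (e : ZMod 2) (w : ℂ) :
    HasDerivAt (fun x : ℝ => sp (x : ℂ) (e + 1) (w + 1)) ((w + 1) * sp (x : ℂ) e w) x := by
  have key : ∀ y : ℝ, 0 < y → HasDerivAt (fun y : ℝ => (y : ℂ) ^ (w + 1)) ((w + 1) * (y : ℂ) ^ w) y := by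
    intro y hy
    have h1 : HasDerivAt (fun z : ℂ => z ^ (w + 1)) ((w + 1) * (y : ℂ) ^ w) (y : ℂ) := by
      have := (hasDerivAt_id (y : ℂ)).cpow_const (c := w + 1)
        (Or.inl (by simpa using hy))
      simpa using this
    exact h1.comp_ofReal
  rcases hx.lt_or_gt with h | h
  · have h1 : HasDerivAt (fun x : ℝ => signPow (-1) (e + 1) * ((-x : ℝ) : ℂ) ^ (w + 1))
        ((w + 1) * sp (x : ℂ) e w) x := by
      have h2 := ((key (-x) (by linarith)).scomp x (hasDerivAt_neg x)).const_mul
        (signPow (-1) (e + 1))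
      refine h2.congr_deriv ?_
      have h3 : signPow x e = signPow (-1) e := by simp [signPow, sign_neg h]
      have h4 : signPow (-1) 1 = -1 := by
        simp only [signPow, ZMod.val_one 2]; simp
      simp only [sp, Complex.ofReal_re, h3, Complex.norm_real, Real.norm_of_nonpos h.le,
        signPow_add (show (-1 : ℝ) ≠ 0 by norm_num), h4, neg_smul, one_smul]
      ring
    refine h1.congr_of_eventuallyEq ?_
    filter_upwards [eventually_lt_nhds h] with y hy
    simp only [sp, Complex.ofReal_re, Complex.norm_real, Real.norm_of_nonpos hy.le]
    simp [signPow, sign_neg hy]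
  · have h1 : HasDerivAt (fun x : ℝ => (x : ℂ) ^ (w + 1)) ((w + 1) * sp (x : ℂ) e w) x := by
      refine (key x h).congr_deriv ?_
      rw [sp_of_pos (by simpa using h), Complex.norm_real, Real.norm_of_nonneg h.le]
    refine h1.congr_of_eventuallyEq ?_
    filter_upwards [eventually_gt_nhds h] with y hy
    rw [sp_of_pos (by simpa using hy), Complex.norm_real, Real.norm_of_nonneg hy.le]

lemma continuous_sp {w : ℂ} (hw : 0 < w.re) (e : ZMod 2) :
    Continuous fun x : ℝ => sp (x : ℂ) e w := by
  have h1 : Continuous fun x : ℝ => ((|x| : ℝ) : ℂ) ^ w :=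
    (Complex.continuous_ofReal_cpow_const hw).comp continuous_abs
  rw [continuous_iff_continuousAt]
  intro x
  rcases eq_or_ne x 0 with rfl | hx
  · rw [ContinuousAt, sp_ofReal_zero e (by rintro rfl; simp at hw)]
    refine squeeze_zero_norm (a := fun x : ℝ => ‖((|x| : ℝ) : ℂ) ^ w‖) (fun y => ?_) ?_
    · rw [sp, norm_mul, Complex.norm_real, Real.norm_eq_abs]
      exact mul_le_of_le_one_left (norm_nonneg _) (norm_signPow_le _ _)
    · have := (h1.norm.tendsto 0)
      rwa [abs_zero, Complex.ofReal_zero, Complex.zero_cpow (by rintro rfl; simp at hw),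
        norm_zero] at this
  · have h2 := (hasDerivAt_sp hx (e - 1) (w - 1)).continuousAt
    simpa using h2

lemma intervalIntegrable_sp {w : ℂ} (hw : 0 ≤ w.re) (e : ZMod 2) (p q : ℝ) :
    IntervalIntegrable (fun x : ℝ => sp (x : ℂ) e w) volume p q := by
  refine (intervalIntegrable_const (c := (1 + |p| + |q|) ^ w.re)).mono_fun ((measurable_sp e w).comp
      Complex.measurable_ofReal).aestronglyMeasurable ?_
  filter_upwards [ae_restrict_mem measurableSet_uIoc] with x hx
  have hx' : |x| ≤ 1 + |p| + |q| := by
    rw [Set.mem_uIoc] at hx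
    rw [abs_le]
    have := le_abs_self p; have := neg_abs_le p
    have := le_abs_self q; have := neg_abs_le q
    rcases hx with h | h <;> constructor <;> linarith
  have h1 : (1 : ℝ) ≤ 1 + |p| + |q| := by
    have := abs_nonneg p; have := abs_nonneg q; linarith
  refine (norm_sp_le h1 (by rwa [Complex.norm_real]) hw).trans (le_abs_self _)

lemma integral_sp {w : ℂ} (hw : 0 ≤ w.re) (e : ZMod 2) {p q : ℝ} (hpq : p ≤ q) :
    (w + 1) * ∫ x in Set.Ioo p q, sp (x : ℂ) e w =
      sp (q : ℂ) (e + 1) (w + 1) - sp (p : ℂ) (e + 1) (w + 1) := by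
  rw [← integral_Ioc_eq_integral_Ioo, ← intervalIntegral.integral_of_le hpq,
    ← intervalIntegral.integral_const_mul]
  refine integral_eq_of_hasDerivAt_off_countable (fun x : ℝ => sp (x : ℂ) (e + 1) (w + 1)) _
    (Set.countable_singleton (0 : ℝ)) ?_ ?_ ?_
  · exact (continuous_sp (by simp; linarith) _).continuousOn
  · intro x hx
    exact hasDerivAt_sp hx.2 e w
  · exact (intervalIntegrable_sp hw e p q).const_mul _

lemma det_of_last_column_eq_one {n : ℕ} {M : Matrix (Fin (n + 1)) (Fin (n + 1)) ℂ}
    (hM : ∀ i, M i (Fin.last n) = 1) :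
    M.det = (-1) ^ n * (Matrix.of fun i j : Fin n =>
      M i.succ j.castSucc - M i.castSucc j.castSucc).det := by
  have h1 : M.det = (Matrix.of (Fin.cons (M 0) fun (i : Fin n) j =>
      M i.succ j - M i.castSucc j)).det := by
    refine det_eq_of_forall_row_eq_smul_add_pred (fun _ => 1) (fun j => by simp) fun i j => ?_
    simp
  rw [h1, det_succ_column _ (Fin.last n), Fin.sum_univ_succ, Finset.sum_eq_zero (s := Finset.univ)
    (fun i _ => by simp [hM]), add_zero]
  simp only [Fin.val_zero, zero_add, Fin.val_last, of_apply, Fin.cons_zero, hM, mul_one]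
  congr 2
  ext i j
  simp

/-- Andréief-type evaluation: integrating an alternating determinant over a box integrates its
entries. -/
lemma integral_interBox {n : ℕ} {a : Fin (n + 1) → ℝ} {s : Fin n → ℂ}
    (hs : ∀ j, 0 ≤ (s j).re) (L : Fin n → ZMod 2) :
    ∫ y in interBox a, ((y 0 ^ n : ℝ) : ℂ) * altDet s L (fun j => y j.succ) =
      ((n : ℂ) + 1)⁻¹ * (Matrix.of fun i j : Fin n =>
        ∫ x in Set.Ioo (a i.castSucc) (a i.succ), sp (x : ℂ) (L j) (s j)).det := by
  -- the box is a product of intervals, and each term of the determinant is a product of functions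
  -- of one variable
  have hr : (volume : Measure (Fin (n + 1) → ℝ)).restrict (interBox a) =
      Measure.pi fun i => (volume : Measure ℝ).restrict
        (Set.Ioo ((Fin.cons 0 (fun j : Fin n => a j.castSucc) : Fin (n + 1) → ℝ) i)
          ((Fin.cons 1 (fun j : Fin n => a j.succ) : Fin (n + 1) → ℝ) i)) :=
    Measure.restrict_pi_pi _ _
  let f : Equiv.Perm (Fin n) → Fin (n + 1) → ℝ → ℂ := fun σ =>
    Fin.cons (fun x => ((x ^ n : ℝ) : ℂ)) fun i x => sp (x : ℂ) (L (σ i)) (s (σ i))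
  have hf : ∀ (y : Fin (n + 1) → ℝ), ((y 0 ^ n : ℝ) : ℂ) * altDet s L (fun j => y j.succ) =
      ∑ σ : Equiv.Perm (Fin n), ((Equiv.Perm.sign σ : ℤ) : ℂ) * ∏ i, f σ i (y i) := by
    intro y
    rw [altDet, ← det_transpose, det_apply', Finset.mul_sum]
    refine Finset.sum_congr rfl fun σ _ => ?_
    simp only [f, Fin.prod_univ_succ, Fin.cons_zero, Fin.cons_succ, transpose_apply, of_apply]
    ring
  have hint : ∀ (σ : Equiv.Perm (Fin n)) (i : Fin (n + 1)), Integrable (f σ i)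
      ((volume : Measure ℝ).restrict
        (Set.Ioo ((Fin.cons 0 (fun j : Fin n => a j.castSucc) : Fin (n + 1) → ℝ) i)
          ((Fin.cons 1 (fun j : Fin n => a j.succ) : Fin (n + 1) → ℝ) i))) := by
    intro σ i
    refine Fin.cases ?_ (fun i => ?_) i
    · refine IntegrableOn.mono_set (t := Set.Icc 0 1) ?_ Set.Ioo_subset_Icc_self
      exact Continuous.integrableOn_Icc (by simp only [f, Fin.cons_zero]; fun_prop)
    · have := (intervalIntegrable_sp (hs (σ i)) (L (σ i)) (a i.castSucc) (a i.succ)).1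
      exact this.mono_set Set.Ioo_subset_Ioc_self
  simp only [hf, hr]
  rw [integral_finsetSum _ fun σ _ => (Integrable.fintype_prod (hint σ)).const_mul _]
  rw [← det_transpose, det_apply', Finset.mul_sum]
  refine Finset.sum_congr rfl fun σ _ => ?_
  rw [integral_const_mul, integral_fintype_prod_eq_prod, Fin.prod_univ_succ]
  have h0 : ∫ x in Set.Ioo (0 : ℝ) 1, ((x ^ n : ℝ) : ℂ) = ((n : ℂ) + 1)⁻¹ := by
    rw [integral_complex_ofReal, ← integral_Ioc_eq_integral_Ioo,
      ← intervalIntegral.integral_of_le zero_le_one, integral_pow]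
    simp
  simp only [f, Fin.cons_zero, Fin.cons_succ, h0, transpose_apply, of_apply]
  ring

lemma det_vandermonde_pos {n : ℕ} {a : Fin n → ℝ} (ha : StrictMono a) :
    0 < (vandermonde a).det := by
  rw [det_vandermonde]
  exact Finset.prod_pos fun i _ => Finset.prod_pos fun j hj =>
    sub_pos.mpr (ha (Finset.mem_Ioi.mp hj))

/-- The constant of the explicit formula. -/
def altConst : ℕ → ℂ
  | 0 => 1
  | n + 1 => altConst n * ((-1) ^ n * ((n : ℂ) + 1)⁻¹ * (volume.real (openCorner (n + 1)) : ℂ)⁻¹)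

lemma volume_openCorner_ne_zero (N : ℕ) : (volume.real (openCorner N) : ℂ) ≠ 0 := by
  rw [Complex.ofReal_ne_zero, measureReal_ne_zero_iff (volume_openCorner_ne_top _)]
  exact (isOpen_openCorner _).measure_ne_zero _ (openCorner_nonempty _)

lemma altConst_ne_zero (n : ℕ) : altConst n ≠ 0 := by
  induction n with
  | zero => exact one_ne_zero
  | succ n ih =>
    refine mul_ne_zero ih (mul_ne_zero (mul_ne_zero (by simp) ?_)
      (inv_ne_zero (volume_openCorner_ne_zero _)))
    exact inv_ne_zero (Nat.cast_add_one_ne_zero n)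

/-- Expanding along the corners: the integrand of a spherical integral splits off the determinant,
and the smaller minors are those of the leading corner. -/
lemma sphInt_succ {n : ℕ} {s : Fin (n + 1) → ℂ} (hs : s ∈ baseDomain (n + 1))
    (L : Fin (n + 1) → ZMod 2) (x : Matrix (Fin (n + 1)) (Fin (n + 1)) ℂ) :
    sphInt s L x = sp x.det (L (Fin.last n)) (s (Fin.last n)) *
      ∫ k : K (n + 1), sphInt (fun j : Fin n => s j.castSucc - (s (Fin.last n) + 1))
        (fun j : Fin n => L j.castSucc - (L (Fin.last n) + 1))
        (Proj n (n + 1) * (k.1 * x * k.1ᴴ) * Proj (n + 1) n) ∂(haarK (n + 1)) := by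
  have hdet : ∀ k : K (n + 1), minor (n + 1) (k.1 * x * k.1ᴴ) = x.det := by
    intro k
    rw [minor_self, det_mul, det_mul, mul_right_comm, ← det_mul, coeK_mul_conjTranspose, det_one,
      one_mul]
  have hs' := baseDomain_castSucc hs
  let F : Matrix (Fin n) (Fin n) ℂ → ℂ := fun B => ∏ j : Fin n,
    sp (minor ((j : ℕ) + 1) B) (expL L j.castSucc) (expS s j.castSucc)
  have h1 : sphInt s L x = sp x.det (L (Fin.last n)) (s (Fin.last n)) *
      ∫ k : K (n + 1), F (Proj n (n + 1) * (k.1 * x * k.1ᴴ) * Proj (n + 1) n)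
        ∂(haarK (n + 1)) := by
    unfold sphInt
    rw [← integral_const_mul]
    refine integral_congr_ae (Filter.Eventually.of_forall fun k => ?_)
    simp only [F]
    rw [Fin.prod_univ_castSucc, mul_comm]
    congr 1
    · rw [expS_last, expL_last, Fin.val_last, hdet]
    · refine Finset.prod_congr rfl fun j _ => ?_
      rw [minor_Proj j.2, Fin.val_castSucc]
  -- the subgroup `U(n)` acts on the corner by conjugation, so that the average over it can be inserted
  have h2 : ∀ u : K n, ∫ k : K (n + 1), F (u.1 * (Proj n (n + 1) * (k.1 * x * k.1ᴴ) *
      Proj (n + 1) n) * u.1ᴴ) ∂(haarK (n + 1)) =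
      ∫ k : K (n + 1), F (Proj n (n + 1) * (k.1 * x * k.1ᴴ) * Proj (n + 1) n)
        ∂(haarK (n + 1)) := by
    intro u
    rw [← integral_mul_left_eq_self (fun k : K (n + 1) =>
      F (Proj n (n + 1) * (k.1 * x * k.1ᴴ) * Proj (n + 1) n)) (extK n.le_succ u)]
    refine integral_congr_ae (Filter.Eventually.of_forall fun k => ?_)
    simp only
    congr 1
    have e1 := Proj_mul_extK n.le_succ u
    have e2 := congrArg conjTranspose e1
    simp only [conjTranspose_mul, Proj_conjTranspose] at e2
    calc _ = (u.1 * Proj n (n + 1)) * (k.1 * x * k.1ᴴ) * (Proj (n + 1) n * u.1ᴴ) := by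
          simp only [Matrix.mul_assoc]
      _ = _ := by
          rw [← e1, ← e2, coeK_mul]; simp only [conjTranspose_mul, Matrix.mul_assoc]
  have h3 : Integrable (fun p : K n × K (n + 1) => F (p.1.1 * (Proj n (n + 1) *
      (p.2.1 * x * p.2.1ᴴ) * Proj (n + 1) n) * p.1.1ᴴ)) ((haarK n).prod (haarK (n + 1))) := by
    have c1 : Continuous fun p : K n × K (n + 1) => p.1.1 :=
      (continuous_coeK n).comp continuous_fst
    have c2 : Continuous fun p : K n × K (n + 1) => p.2.1 :=
      (continuous_coeK (n + 1)).comp continuous_snd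
    have c3 : Continuous fun p : K n × K (n + 1) => p.1.1 * (Proj n (n + 1) *
        (p.2.1 * x * p.2.1ᴴ) * Proj (n + 1) n) * p.1.1ᴴ :=
      (c1.matrix_mul ((continuous_const.matrix_mul ((c2.matrix_mul continuous_const).matrix_mul
        c2.matrix_conjTranspose)).matrix_mul continuous_const)).matrix_mul
        c1.matrix_conjTranspose
    exact integrable_prod_sp (y := fun (j : Fin n) (p : K n × K (n + 1)) =>
      minor ((j : ℕ) + 1) (p.1.1 * (Proj n (n + 1) *
        (p.2.1 * x * p.2.1ᴴ) * Proj (n + 1) n) * p.1.1ᴴ)) _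
      (fun j => (continuous_minor _).comp c3) (fun j => hs _)
  rw [h1]
  congr 1
  calc _ = ∫ u : K n, ∫ k : K (n + 1), F (u.1 * (Proj n (n + 1) * (k.1 * x * k.1ᴴ) *
      Proj (n + 1) n) * u.1ᴴ) ∂(haarK (n + 1)) ∂(haarK n) := by
        simp only [h2, integral_const, probReal_univ, one_smul]
    _ = _ := by
        rw [integral_integral_swap h3]
        refine integral_congr_ae (Filter.Eventually.of_forall fun k => ?_)
        simp only [F, sphInt, expS_castSucc, expL_castSucc]

lemma sp_mul_altDet {n : ℕ} {s : Fin (n + 1) → ℂ} (hs : s ∈ baseDomain (n + 1))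
    (L : Fin (n + 1) → ZMod 2) (a : Fin (n + 1) → ℝ) :
    (∏ i, sp (a i : ℂ) (L (Fin.last n)) (s (Fin.last n))) *
      altDet (fun j => s j - s (Fin.last n)) (fun j => L j - L (Fin.last n)) a = altDet s L a := by
  rw [altDet, ← det_mul_column, altDet]
  congr 1
  ext i j
  simp only [of_apply]
  -- a zero eigenvalue is allowed: then both sides vanish, unless the exponent is zero
  rcases eq_or_ne (a i) 0 with h0 | h0
  · induction j using Fin.lastCases with
    | last => rw [sub_self, sub_self, sp_zero, mul_one]
    | cast j =>
      have h1 := re_nonneg_of_mem_baseDomain (baseDomain_castSucc hs) j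
      have h2 := re_nonneg_of_mem_baseDomain hs (Fin.last n)
      simp only [Complex.sub_re, Complex.add_re, Complex.one_re] at h1
      rw [h0, sp_ofReal_zero _ (w := s j.castSucc - s (Fin.last n)),
        sp_ofReal_zero _ (w := s j.castSucc), mul_zero]
      · intro h
        rw [h, Complex.zero_re] at h1
        linarith
      · intro h
        have := congrArg Complex.re h
        simp only [Complex.sub_re, Complex.zero_re] at this
        linarith
  · rw [← sp_add h0]
    congr 1 <;> ring

/-- The explicit formula, for increasing eigenvalues. -/
lemma sphInt_diagonal_of_strictMono {n : ℕ} {s : Fin n → ℂ} (hs : s ∈ baseDomain n)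
    (L : Fin n → ZMod 2) {a : Fin n → ℝ} (ha : StrictMono a) :
    sphInt s L (diagonal fun i => (a i : ℂ)) * gapProd s * ((vandermonde a).det : ℂ) =
      altConst n * altDet s L a := by
  induction n with
  | zero => simp [sphInt, gapProd, altDet, altConst]
  | succ n ih =>
    -- the shifted exponents of the corner, see `sphInt_succ`
    set s' : Fin n → ℂ := fun j => s j.castSucc - (s (Fin.last n) + 1) with hs'_def
    set L' : Fin n → ZMod 2 := fun j => L j.castSucc - (L (Fin.last n) + 1) with hL'_def
    have hs' : s' ∈ baseDomain n := baseDomain_castSucc hs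
    have hre : ∀ j, 0 ≤ (s' j).re := re_nonneg_of_mem_baseDomain hs'
    obtain ⟨R, hR, hRb⟩ := exists_minor_diagonal_le n n (∑ i, |a i|)
    have hbox : ∀ y ∈ interBox a, ∀ j : Fin n, |y j.succ| ≤ ∑ i, |a i| := by
      intro y hy j
      have h1 := (mem_interBox.mp hy).2 j
      have h2 := Finset.single_le_sum (f := fun i => |a i|) (fun i _ => abs_nonneg _)
        (Finset.mem_univ j.castSucc)
      have h3 := Finset.single_le_sum (f := fun i => |a i|) (fun i _ => abs_nonneg _)
        (Finset.mem_univ j.succ)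
      rw [abs_le]
      have h4 := neg_abs_le (a j.castSucc)
      have h5 := le_abs_self (a j.succ)
      constructor <;> linarith
    have hcorner := integral_corner ha (measurable_sphInt s' L') (fun u B => sphInt_conj s' L' B u)
      ⟨∏ j, R ^ (expS s' j).re, fun y hy => norm_sphInt_le hs' L' hR (hRb _ (hbox y hy))⟩
    have hva := det_vandermonde_pos ha
    -- the Vandermonde determinant of the corner law cancels that of the induction hypothesis
    have hI : gapProd s' * ((vandermonde a).det : ℂ) * ∫ y in interBox a,
        ((y 0 ^ n * |(vandermonde fun j : Fin n => y j.succ).det| *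
        |(vandermonde a).det|⁻¹ : ℝ) : ℂ) * sphInt s' L' (diagonal fun j => (y j.succ : ℂ)) =
        altConst n * ∫ y in interBox a, ((y 0 ^ n : ℝ) : ℂ) *
          altDet s' L' (fun j => y j.succ) := by
      rw [← integral_const_mul, ← integral_const_mul]
      refine setIntegral_congr_fun (isOpen_interBox a).measurableSet fun y hy => ?_
      have h1 := ih hs' L' (strictMono_of_mem_interBox ha hy)
      have h2 : ((vandermonde a).det : ℂ) ≠ 0 := Complex.ofReal_ne_zero.mpr hva.ne'
      rw [abs_of_pos hva, abs_of_pos (det_vandermonde_pos (strictMono_of_mem_interBox ha hy)),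
        mul_left_comm (altConst n), ← h1]
      push_cast
      field_simp
    rw [integral_interBox hre] at hI
    have hgap := gapProd_succ s (s (Fin.last n) + 1)
    -- differences of primitives between neighbouring nodes: row operations recover the
    -- alternating determinant with an additional column of ones
    have hprod : (∏ j : Fin n, (s j.castSucc - s (Fin.last n))) * (Matrix.of fun i j : Fin n =>
        ∫ x in Set.Ioo (a i.castSucc) (a i.succ), sp (x : ℂ) (L' j) (s' j)).det =
        (-1) ^ n * altDet (fun j => s j - s (Fin.last n)) (fun j => L j - L (Fin.last n)) a := by
      rw [altDet, det_of_last_column_eq_one (fun i => by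
          simp only [of_apply, sub_self]; exact sp_zero _), ← mul_assoc, ← pow_add,
        Even.neg_one_pow ⟨n, rfl⟩, one_mul, ← det_mul_row]
      congr 1
      ext i j
      have h1 := integral_sp (hre j) (L' j) (ha (Fin.castSucc_lt_succ (i := i))).le
      have e1 : s' j + 1 = s j.castSucc - s (Fin.last n) := by simp only [s']; ring
      have e2 : L' j + 1 = L j.castSucc - L (Fin.last n) := by simp only [L']; ring
      rw [e1, e2] at h1
      simpa only [of_apply] using h1
    have hdet : (diagonal fun i => (a i : ℂ)).det = ((∏ i, a i : ℝ) : ℂ) := by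
      rw [det_diagonal]; push_cast; rfl
    have hV := volume_openCorner_ne_zero (n + 1)
    have hn1 : ((n : ℂ) + 1) ≠ 0 := Nat.cast_add_one_ne_zero n
    rw [sphInt_succ hs, hdet, sp_prod_ofReal, ← sp_mul_altDet hs L a, hgap, altConst]
    refine mul_right_cancel₀ hV ?_
    set J := ∫ k : K (n + 1), sphInt s' L' (Proj n (n + 1) *
      (k.1 * (diagonal fun i => (a i : ℂ)) * k.1ᴴ) * Proj (n + 1) n) ∂(haarK (n + 1))
    rw [← hcorner] at hI
    have e : ∀ p d D A v c W : ℂ, gapProd s' * v * (J * W) = altConst n * (c * D) →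
        d * D = (-1) ^ n * A → p * J * (gapProd s' * d) * v * W =
        p * (altConst n * (c * ((-1) ^ n * A))) := by
      intro p d D A v c W h1 h2
      rw [← h2]
      linear_combination p * d * h1
    rw [e _ _ _ _ _ _ _ hI hprod]
    field_simp

/-- The explicit formula: on matrices with simple spectrum the spherical integrals are quotients of
alternating determinants. -/
theorem sphInt_diagonal {n : ℕ} {s : Fin n → ℂ} (hs : s ∈ baseDomain n)
    (L : Fin n → ZMod 2) {a : Fin n → ℝ} (ha : Function.Injective a) :
    sphInt s L (diagonal fun i => (a i : ℂ)) * gapProd s * ((vandermonde a).det : ℂ) =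
      altConst n * altDet s L a := by
  have hm : StrictMono (a ∘ Tuple.sort a) :=
    (Tuple.monotone_sort a).strictMono_of_injective (ha.comp (Tuple.sort a).injective)
  have h1 := sphInt_diagonal_of_strictMono hs L hm
  have h2 : (diagonal fun i => ((a ∘ Tuple.sort a) i : ℂ)) =
      (permK (Tuple.sort a)).1 * (diagonal fun i => (a i : ℂ)) * (permK (Tuple.sort a)).1ᴴ := by
    rw [permK_conj_diagonal]; rfl
  have h3 : (vandermonde (a ∘ Tuple.sort a)).det =
      (Equiv.Perm.sign (Tuple.sort a) : ℤ) * (vandermonde a).det := by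
    rw [← det_permute]; rfl
  have h4 : altDet s L (a ∘ Tuple.sort a) =
      (Equiv.Perm.sign (Tuple.sort a) : ℤ) * altDet s L a := by
    rw [altDet, altDet, ← det_permute]; rfl
  rw [h2, sphInt_conj, h3, h4] at h1
  have h5 : (((Equiv.Perm.sign (Tuple.sort a) : ℤ) : ℂ)) ≠ 0 := by
    rcases Int.units_eq_one_or (Equiv.Perm.sign (Tuple.sort a)) with h | h <;> simp [h]
  refine mul_left_cancel₀ h5 ?_
  push_cast at h1
  linear_combination h1

/-! ### The normalization in closed form -/

lemma one_le_re_sub_of_mem_baseDomain {n : ℕ} {s : Fin n → ℂ} (hs : s ∈ baseDomain n)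
    {i j : Fin n} (hij : i < j) : 1 ≤ (s i - s j).re := by
  induction n with
  | zero => exact i.elim0
  | succ n ih =>
    have hs' := baseDomain_castSucc hs
    induction i using Fin.lastCases with
    | last => exact absurd hij (Fin.le_last j).not_gt
    | cast i =>
      induction j using Fin.lastCases with
      | last =>
        have := re_nonneg_of_mem_baseDomain hs' i
        simp only [Complex.sub_re, Complex.add_re, Complex.one_re] at this ⊢
        linarith
      | cast j =>
        have := ih hs' (Fin.castSucc_lt_castSucc_iff.mp hij)
        simp only [Complex.sub_re, Complex.add_re, Complex.one_re] at this ⊢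
        linarith

lemma gapProd_ne_zero_iff {n : ℕ} {s : Fin n → ℂ} : gapProd s ≠ 0 ↔ Function.Injective s := by
  constructor
  · intro h
    have key : ∀ i j, i < j → s i ≠ s j := by
      intro i j hij he
      refine h (Finset.prod_eq_zero (Finset.mem_univ i)
        (Finset.prod_eq_zero (Finset.mem_univ j) ?_))
      rw [if_pos hij, he, sub_self]
    intro i j he
    by_contra hne
    rcases lt_or_gt_of_ne hne with h1 | h1
    · exact key _ _ h1 he
    · exact key _ _ h1 he.symm
  · intro h
    refine Finset.prod_ne_zero_iff.mpr fun i _ => Finset.prod_ne_zero_iff.mpr fun j _ => ?_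
    split_ifs with hij
    · exact sub_ne_zero.mpr fun he => hij.ne (h he)
    · exact one_ne_zero

lemma gapProd_ne_zero_of_mem_baseDomain {n : ℕ} {s : Fin n → ℂ} (hs : s ∈ baseDomain n) :
    gapProd s ≠ 0 := by
  refine gapProd_ne_zero_iff.mpr fun i j he => ?_
  by_contra hne
  rcases lt_or_gt_of_ne hne with h1 | h1 <;>
  · have := one_le_re_sub_of_mem_baseDomain hs h1
    rw [he, sub_self, Complex.zero_re] at this
    linarith

lemma tildeS_self {n : ℕ} (s : Fin n → ℂ) : tildeS n s = s := by
  funext j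
  simp [tildeS]

lemma tildeS_tildeS {r n N : ℕ} (hrn : r ≤ n) (hnN : n ≤ N) (s : Fin r → ℂ) :
    tildeS N (tildeS n s) = tildeS N s := by
  funext j
  have hj := j.2
  unfold tildeS
  by_cases h1 : (j : ℕ) < r
  · have h2 : (j : ℕ) < n := by omega
    have e : N - r = (n - r) + (N - n) := by omega
    simp only [h1, h2, dif_pos, e]
    push_cast; ring
  · by_cases h2 : (j : ℕ) < n
    · have e : N - 1 - (j : ℕ) = (n - 1 - (j : ℕ)) + (N - n) := by omega
      simp only [h1, h2, dif_pos, dite_false, e]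
      push_cast; ring
    · simp [h1, h2]

lemma tildeL_Lstd {n N : ℕ} (hnN : n ≤ N) : tildeL N (Lstd n) = Lstd N := by
  funext j
  have hj := j.2
  unfold tildeL Lstd
  by_cases h2 : (j : ℕ) < n
  · have e : N - 1 - (j : ℕ) = (n - 1 - (j : ℕ)) + (N - n) := by omega
    simp only [h2, dif_pos, e]
    push_cast; ring
  · simp [h2]

/-- Powers of two as spectrum turn the alternating determinant into a Vandermonde determinant. -/
lemma altDet_two_pow_ne_zero {n : ℕ} {s : Fin n → ℂ} (hs : s ∈ baseDomain n)
    (L : Fin n → ZMod 2) : altDet s L (fun i => (2 : ℝ) ^ (i : ℕ)) ≠ 0 := by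
  have h1 : altDet s L (fun i => (2 : ℝ) ^ (i : ℕ)) = (vandermonde fun j => (2 : ℂ) ^ s j).det := by
    rw [altDet, ← det_transpose]
    congr 1
    ext i j
    have h2 : sp (((2 : ℝ) ^ (j : ℕ) : ℝ) : ℂ) (L i) (s i) =
        sp ((2 : ℝ) : ℂ) (L i) (s i) ^ (j : ℕ) := by
      have := sp_prod_ofReal (Finset.range (j : ℕ)) (fun _ => (2 : ℝ)) (L i) (s i)
      simpa only [Finset.prod_const, Finset.card_range] using this
    rw [transpose_apply, of_apply, vandermonde_apply, h2, sp_of_pos (by simp)]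
    simp
  rw [h1, det_vandermonde_ne_zero_iff]
  intro i j he
  by_contra hne
  have h2 : (s i).re = (s j).re := by
    have h3 := congrArg norm he
    simp only at h3
    rw [show (2 : ℂ) = ((2 : ℝ) : ℂ) by norm_num, Complex.norm_cpow_eq_rpow_re_of_pos two_pos,
      Complex.norm_cpow_eq_rpow_re_of_pos two_pos] at h3
    exact (Real.rpow_right_inj two_pos (by norm_num)).mp h3
  rcases lt_or_gt_of_ne hne with h | h <;>
  · have := one_le_re_sub_of_mem_baseDomain hs h
    rw [Complex.sub_re, h2, sub_self] at this
    linarith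

lemma altDet_snoc_zero {n : ℕ} {s : Fin n → ℂ} (hs : s ∈ baseDomain n) (L : Fin n → ZMod 2)
    {a : Fin n → ℝ} (ha : ∀ i, 0 < a i) :
    altDet (tildeS (n + 1) s) (tildeL (n + 1) L) (Fin.snoc a 0) =
      (∏ i, (a i : ℂ)) * altDet s L a := by
  have hS : ∀ j : Fin n, tildeS (n + 1) s j.castSucc = s j + 1 := fun j => by simp [tildeS]
  have hL : ∀ j : Fin n, tildeL (n + 1) L j.castSucc = L j + 1 := fun j => by simp [tildeL]
  have hS' : tildeS (n + 1) s (Fin.last n) = 0 := by simp [tildeS]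
  have hL' : tildeL (n + 1) L (Fin.last n) = 0 := by simp [tildeL]
  have hne : ∀ j, s j + 1 ≠ 0 := by
    intro j h
    have h1 := re_nonneg_of_mem_baseDomain hs j
    have h2 := congrArg Complex.re h
    simp only [Complex.add_re, Complex.one_re, Complex.zero_re] at h2
    linarith
  rw [altDet, det_succ_row _ (Fin.last n), Fin.sum_univ_castSucc,
    Finset.sum_eq_zero (s := Finset.univ) (fun j _ => by
      simp only [of_apply, Fin.snoc_last, hS]
      rw [sp_ofReal_zero _ (hne j)]; simp), zero_add]
  simp only [of_apply, Fin.snoc_last, hS', hL', sp_zero, mul_one, Fin.val_last]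
  rw [Even.neg_one_pow ⟨n, rfl⟩, one_mul, altDet, ← det_mul_column]
  congr 1
  ext i j
  simp only [submatrix_apply, Fin.succAbove_last, of_apply, Fin.snoc_castSucc, hS, hL]
  rw [sp_add (ha i).ne', mul_comm, sp_of_pos (e := 1) (by simpa using ha i)]
  rw [Complex.norm_real, Real.norm_of_nonneg (ha i).le, Complex.cpow_one]

lemma det_vandermonde_eq_gapProd {n : ℕ} (a : Fin n → ℝ) :
    ((vandermonde a).det : ℂ) = gapProd fun i => -(a i : ℂ) := by
  rw [det_vandermonde, gapProd, Complex.ofReal_prod]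
  refine Finset.prod_congr rfl fun i _ => ?_
  rw [← Finset.filter_lt_eq_Ioi, Finset.prod_filter, Complex.ofReal_prod]
  refine Finset.prod_congr rfl fun j _ => ?_
  split_ifs
  · push_cast; ring
  · simp

lemma Proj_diagonal_Proj {l n : ℕ} (a : Fin n → ℂ) :
    Proj l n * diagonal a * Proj n l =
      diagonal fun i : Fin l => if h : (i : ℕ) < n then a ⟨i, h⟩ else 0 := by
  ext i j
  rw [Matrix.mul_apply, diagonal_apply]
  simp only [Matrix.mul_diagonal, Proj_apply]
  by_cases h : (i : ℕ) < n
  · rw [Finset.sum_eq_single ⟨i, h⟩ (fun k _ hk => by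
      rw [if_neg fun he => hk (Fin.ext he.symm)]; simp) (by simp)]
    by_cases hij : i = j
    · subst hij; simp [h]
    · have : ¬ (i : ℕ) = j := fun he => hij (Fin.ext he)
      simp [hij, this]
  · rw [Finset.sum_eq_zero fun k _ => by
      have : ¬ (i : ℕ) = (k : ℕ) := fun he => h (by rw [he]; exact k.2)
      rw [if_neg this]; simp]
    simp [h]

lemma normIntegral_succ {n : ℕ} {s : Fin n → ℂ} (hs : s ∈ baseDomain n) :
    normIntegral (n + 1) n s * gapProd (tildeS (n + 1) s) =
      altConst (n + 1) * (-1) ^ n * (altConst n)⁻¹ * gapProd s := by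
  -- the spherical integral of `diag(a, 0)` is evaluated by the explicit formula of size `n + 1`, and
  -- by reduction to the block of size `n`; powers of two make the common factor nonzero
  set a : Fin n → ℝ := fun i => (2 : ℝ) ^ (i : ℕ) with ha
  have hpos : ∀ i, 0 < a i := fun i => by simp only [ha]; positivity
  have hinj : Function.Injective a := fun i j h =>
    Fin.ext (pow_right_injective₀ two_pos (by norm_num) h)
  have hinj' : Function.Injective (Fin.snoc a 0 : Fin (n + 1) → ℝ) := by
    intro i j h
    induction i using Fin.lastCases with
    | last =>
      induction j using Fin.lastCases with
      | last => rfl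
      | cast j => rw [Fin.snoc_last, Fin.snoc_castSucc] at h; exact absurd h (hpos j).ne
    | cast i =>
      induction j using Fin.lastCases with
      | last => rw [Fin.snoc_last, Fin.snoc_castSucc] at h; exact absurd h (hpos i).ne'
      | cast j => rw [Fin.snoc_castSucc, Fin.snoc_castSucc] at h; rw [hinj h]
  have h1 := sphInt_diagonal (tildeS_mem_baseDomain n.le_succ hs) (tildeL (n + 1) (0 : Fin n → ZMod 2)) hinj'
  have h2 : (diagonal fun i => ((Fin.snoc a 0 : Fin (n + 1) → ℝ) i : ℂ)) =
      Proj (n + 1) n * (diagonal fun i => (a i : ℂ)) * Proj n (n + 1) := by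
    rw [Proj_diagonal_Proj]
    congr 1
    funext i
    induction i using Fin.lastCases with
    | last => simp
    | cast i => simp
  have h3 : ((vandermonde (Fin.snoc a 0 : Fin (n + 1) → ℝ)).det : ℂ) =
      ((vandermonde a).det : ℂ) * ((-1) ^ n * ∏ i, (a i : ℂ)) := by
    rw [det_vandermonde_eq_gapProd, gapProd_succ _ 0, det_vandermonde_eq_gapProd]
    simp [Fin.snoc_castSucc, Fin.snoc_last, Finset.prod_neg]
  rw [h2, sphInt_tilde n.le_succ, sphInt_Proj le_rfl n.le_succ hs, tildeS_self, h3,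
    altDet_snoc_zero hs _ hpos] at h1
  have h4 := sphInt_diagonal hs 0 hinj
  have h5 : ((vandermonde a).det : ℂ) ≠ 0 :=
    Complex.ofReal_ne_zero.mpr (det_vandermonde_ne_zero_iff.mpr hinj)
  have h6 : (∏ i, (a i : ℂ)) ≠ 0 :=
    Finset.prod_ne_zero_iff.mpr fun i _ => Complex.ofReal_ne_zero.mpr (hpos i).ne'
  have h7 := altDet_two_pow_ne_zero hs 0
  have h8 := altConst_ne_zero n
  have h9 : ((-1 : ℂ) ^ n) * (-1) ^ n = 1 := by rw [← pow_add, Even.neg_one_pow ⟨n, rfl⟩]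
  have h10 : (altConst n)⁻¹ * altConst n = 1 := inv_mul_cancel₀ h8
  refine mul_right_cancel₀ (mul_ne_zero h6 (mul_ne_zero h8 h7)) ?_
  set S : ℂ := sphInt s 0 (diagonal fun i => (a i : ℂ))
  set T := gapProd (tildeS (n + 1) s)
  set e : ℂ := (-1) ^ n
  linear_combination -(normIntegral (n + 1) n s * T * ∏ i, (a i : ℂ)) * h4 + e * gapProd s * h1 -
    normIntegral (n + 1) n s * S * T * ((vandermonde a).det : ℂ) * (∏ i, (a i : ℂ)) *
      gapProd s * h9 -
    altConst (n + 1) * e * gapProd s * (∏ i, (a i : ℂ)) * altDet s 0 a * h10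

/-- The normalization in closed form. -/
theorem exists_normIntegral_eq {l n : ℕ} (hnl : n ≤ l) : ∃ κ : ℂ, κ ≠ 0 ∧ ∀ s ∈ baseDomain n,
    normIntegral l n s * gapProd (tildeS l s) = κ * gapProd s := by
  induction l, hnl using Nat.le_induction with
  | base => exact ⟨1, one_ne_zero, fun s hs => by rw [normIntegral_self, tildeS_self]⟩
  | succ l hl ih =>
    obtain ⟨κ, hκ, h⟩ := ih
    refine ⟨altConst (l + 1) * (-1) ^ l * (altConst l)⁻¹ * κ, ?_, fun s hs => ?_⟩
    · exact mul_ne_zero (mul_ne_zero (mul_ne_zero (altConst_ne_zero _) (by simp))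
        (inv_ne_zero (altConst_ne_zero _))) hκ
    · have h1 := normIntegral_succ (tildeS_mem_baseDomain hl hs)
      rw [tildeS_tildeS hl l.le_succ] at h1
      rw [normIntegral_chain hl l.le_succ hs, mul_right_comm, h1, mul_assoc _ κ, ← h s hs]
      ring

lemma normIntegral_ne_zero {l n : ℕ} (hnl : n ≤ l) {s : Fin n → ℂ} (hs : s ∈ baseDomain n) :
    normIntegral l n s ≠ 0 := by
  obtain ⟨κ, hκ, h⟩ := exists_normIntegral_eq hnl
  intro h0
  have := h s hs
  rw [h0, zero_mul] at this
  exact mul_ne_zero hκ (gapProd_ne_zero_of_mem_baseDomain hs) this.symm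

/-! ### Analytic continuation of the spherical functions -/

/-- The spherical integral of a matrix with spectrum `a`, freed of its poles: on `baseDomain n`
this is `gapProd s` times the spherical integral, and it is an entire function of `s`. -/
def altNum {n : ℕ} (s : Fin n → ℂ) (L : Fin n → ZMod 2) (a : Fin n → ℝ) : ℂ :=
  altConst n * altDet s L a / ((vandermonde a).det : ℂ)

/-- The factor `|det|^t` in terms of the spectrum. -/
def absPow {n : ℕ} (t : ℂ) (a : Fin n → ℝ) : ℂ := ∏ i, ((|a i| : ℝ) : ℂ) ^ t

lemma sphInt_mul_gapProd {n : ℕ} {s : Fin n → ℂ} (hs : s ∈ baseDomain n)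
    (L : Fin n → ZMod 2) {a : Fin n → ℝ} (ha : Function.Injective a) :
    sphInt s L (diagonal fun i => (a i : ℂ)) * gapProd s = altNum s L a := by
  rw [altNum, eq_div_iff, sphInt_diagonal hs L ha]
  exact Complex.ofReal_ne_zero.mpr (det_vandermonde_ne_zero_iff.mpr ha)

lemma analyticAt_altNum {n : ℕ} (L : Fin n → ZMod 2) {a : Fin n → ℝ} (ha : ∀ i, a i ≠ 0)
    (s₀ : Fin n → ℂ) : AnalyticAt ℂ (fun s => altNum s L a) s₀ := by
  have h1 : ∀ i j, AnalyticAt ℂ (fun s : Fin n → ℂ => sp (a i : ℂ) (L j) (s j)) s₀ := by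
    intro i j
    have h2 : ((‖(a i : ℂ)‖ : ℝ) : ℂ) ≠ 0 := by simpa using ha i
    simp only [sp, Complex.cpow_def_of_ne_zero h2]
    have h3 : AnalyticAt ℂ (fun s : Fin n → ℂ => s j) s₀ :=
      (ContinuousLinearMap.proj (R := ℂ) (φ := fun _ : Fin n => ℂ) j).analyticAt s₀
    exact analyticAt_const.mul ((analyticAt_const.mul h3).cexp)
  unfold altNum altDet
  simp only [det_apply', div_eq_mul_inv, of_apply]
  refine (analyticAt_const.mul ?_).mul analyticAt_const
  exact Finset.analyticAt_fun_sum _ fun σ _ => analyticAt_const.mul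
    (Finset.analyticAt_fun_prod _ fun i _ => h1 _ _)

lemma analyticAt_gapProd {n : ℕ} (s₀ : Fin n → ℂ) : AnalyticAt ℂ (gapProd (n := n)) s₀ := by
  have h3 : ∀ j, AnalyticAt ℂ (fun s : Fin n → ℂ => s j) s₀ := fun j =>
    (ContinuousLinearMap.proj (R := ℂ) (φ := fun _ : Fin n => ℂ) j).analyticAt s₀
  unfold gapProd
  refine Finset.analyticAt_fun_prod _ fun i _ => Finset.analyticAt_fun_prod _ fun j _ => ?_
  by_cases hij : i < j
  · simp only [hij, if_true]; exact (h3 i).sub (h3 j)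
  · simp only [hij, if_false]; exact analyticAt_const

lemma analyticAt_tildeS {n : ℕ} (N : ℕ) (s₀ : Fin n → ℂ) :
    AnalyticAt ℂ (fun s : Fin n → ℂ => tildeS N s) s₀ := by
  rw [analyticAt_pi_iff]
  intro j
  unfold tildeS
  by_cases h : (j : ℕ) < n
  · simp only [h, dif_pos]
    exact ((ContinuousLinearMap.proj (R := ℂ) (φ := fun _ : Fin n => ℂ) ⟨j, h⟩).analyticAt
      s₀).add analyticAt_const
  · simp only [h, dite_false]; exact analyticAt_const

lemma altDet_add {n : ℕ} (s : Fin n → ℂ) (L : Fin n → ZMod 2) {a : Fin n → ℝ}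
    (ha : ∀ i, a i ≠ 0) (t : ℂ) :
    altDet (fun j => s j + t) L a = absPow t a * altDet s L a := by
  rw [absPow, altDet, altDet, ← det_mul_column]
  congr 1
  ext i j
  simp only [of_apply, sp]
  rw [Complex.cpow_add _ _ (by simpa using ha i), Complex.norm_real, Real.norm_eq_abs]
  ring

lemma altNum_add {n : ℕ} (s : Fin n → ℂ) (L : Fin n → ZMod 2) {a : Fin n → ℝ}
    (ha : ∀ i, a i ≠ 0) (t : ℂ) :
    altNum (fun j => s j + t) L a = absPow t a * altNum s L a := by
  rw [altNum, altDet_add s L ha, altNum]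
  ring

lemma altNum_comp_perm {n : ℕ} (s : Fin n → ℂ) (L : Fin n → ZMod 2) (a : Fin n → ℝ)
    (σ : Equiv.Perm (Fin n)) :
    altNum (s ∘ σ) (L ∘ σ) a = ((Equiv.Perm.sign σ : ℤ) : ℂ) * altNum s L a := by
  have h : altDet (s ∘ σ) (L ∘ σ) a = ((Equiv.Perm.sign σ : ℤ) : ℂ) * altDet s L a := by
    rw [altDet, altDet, ← det_permute']; rfl
  rw [altNum, altNum, h]
  ring

lemma measurable_altNum_uncurry {n : ℕ} (L : Fin n → ZMod 2) :
    Measurable fun p : (Fin n → ℂ) × (Fin n → ℝ) => altNum p.1 L p.2 := by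
  have h1 : ∀ i j, Measurable fun p : (Fin n → ℂ) × (Fin n → ℝ) =>
      sp (p.2 i : ℂ) (L j) (p.1 j) := by
    intro i j
    have h2 : Measurable fun p : (Fin n → ℂ) × (Fin n → ℝ) => p.2 i :=
      (measurable_pi_apply i).comp measurable_snd
    have h3 : Measurable fun p : (Fin n → ℂ) × (Fin n → ℝ) => p.1 j :=
      (measurable_pi_apply j).comp measurable_fst
    simp only [sp, Complex.ofReal_re, Complex.norm_real]
    exact ((measurable_signPow _).comp h2).mul
      ((Complex.measurable_ofReal.comp (measurable_norm.comp h2)).pow h3)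
  have h4 : Continuous fun a : Fin n → ℝ => vandermonde a := by
    refine continuous_matrix fun i j => ?_
    simp only [vandermonde_apply]
    fun_prop
  unfold altNum
  refine Measurable.div (Measurable.const_mul ?_ _) ?_
  · simp only [altDet, det_apply', of_apply]
    refine Finset.measurable_sum _ fun σ _ => ?_
    exact (Finset.measurable_prod _ fun i _ => h1 _ _).const_mul _
  · exact Complex.measurable_ofReal.comp (h4.matrix_det.measurable.comp measurable_snd)

lemma measurable_altNum {n : ℕ} {X : Type*} [MeasurableSpace X] {f : X → Fin n → ℂ}
    {g : X → Fin n → ℝ} (hf : Measurable f) (hg : Measurable g) (L : Fin n → ZMod 2) :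
    Measurable fun x => altNum (f x) L (g x) := by
  have h := (measurable_altNum_uncurry L).comp (hf.prodMk hg)
  simpa only [Function.comp_def] using h

lemma measurable_absPow {n : ℕ} (t : ℂ) : Measurable fun a : Fin n → ℝ => absPow t a := by
  unfold absPow
  refine Finset.measurable_prod _ fun i _ => ?_
  exact (Complex.measurable_ofReal.comp (measurable_norm.comp (measurable_pi_apply i))).pow_const t

lemma norm_altNum_le {n : ℕ} {s : Fin n → ℂ} (hs : s ∈ baseDomain n) (L : Fin n → ZMod 2)
    {a : Fin n → ℝ} (ha : Function.Injective a) {R : ℝ} (hR : 1 ≤ R)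
    (hx : ∀ (k : K n) (j : Fin n),
      ‖minor ((j : ℕ) + 1) (k.1 * (diagonal fun i => (a i : ℂ)) * k.1ᴴ)‖ ≤ R) :
    ‖altNum s L a‖ ≤ (∏ j, R ^ (expS s j).re) * ‖gapProd s‖ := by
  rw [← sphInt_mul_gapProd hs L ha, norm_mul]
  exact mul_le_mul_of_nonneg_right (norm_sphInt_le hs L hR hx) (norm_nonneg _)

lemma exists_mem_interior_baseDomain (n : ℕ) : ∃ s : Fin n → ℂ, s ∈ interior (baseDomain n) := by
  have hc : ∀ j, Continuous fun s : Fin n → ℂ => (expS s j).re := by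
    intro j
    unfold expS
    refine Complex.continuous_re.comp ?_
    by_cases h : (j : ℕ) + 1 < n
    · simp only [h, dif_pos]; fun_prop
    · simp only [h, dite_false]; fun_prop
  refine ⟨fun j => 2 * ((n - 1 - (j : ℕ) : ℕ) : ℂ) + 1, mem_interior.mpr
    ⟨{s | ∀ j, 0 < (expS s j).re}, fun s hs j => (hs j).le, ?_, fun j => ?_⟩⟩
  · rw [Set.ofPred_forall]
    exact isOpen_iInter_of_finite fun j => isOpen_lt continuous_const (hc j)
  · unfold expS
    have hj := j.2
    by_cases h : (j : ℕ) + 1 < n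
    · have e : n - 1 - (j : ℕ) = (n - 1 - ((j : ℕ) + 1)) + 1 := by omega
      simp only [h, dif_pos, e]
      have : (2 * ((n - 1 - ((j : ℕ) + 1) + 1 : ℕ) : ℂ) + 1 -
          (2 * ((n - 1 - ((j : ℕ) + 1) : ℕ) : ℂ) + 1) - 1) = 1 := by push_cast; ring
      rw [this]; simp
    · have e : n - 1 - (j : ℕ) = 0 := by omega
      simp [h, e]

/-- If `f` is a quotient `N / G` of entire functions on the base domain, then so are its
continuations. -/
lemma exists_germ_of_continuesTo {n : ℕ} {f G N : (Fin n → ℂ) → ℂ} (hG : ∀ s, AnalyticAt ℂ G s)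
    (hN : ∀ s, AnalyticAt ℂ N s) (hf : ∀ s ∈ baseDomain n, f s * G s = N s) {s₀ : Fin n → ℂ}
    (h : ContinuesTo f (baseDomain n) s₀) :
    ∃ F : (Fin n → ℂ) → ℂ, AnalyticAt ℂ F s₀ ∧ (∀ᶠ s in nhds s₀, F s * G s = N s) ∧
      F s₀ = continuation f (baseDomain n) s₀ := by
  rw [continuation, dif_pos h]
  obtain ⟨U, F, hU, hUc, hDU, hsU, hF, hFf, hw⟩ := h.choose_spec
  refine ⟨F, hF s₀ hsU, ?_, hw⟩
  obtain ⟨p, hp⟩ := exists_mem_interior_baseDomain n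
  have h1 : Set.EqOn (fun s => F s * G s) N U := by
    refine AnalyticOnNhd.eqOn_of_preconnected_of_eventuallyEq
      (fun s hs => (hF s hs).mul (hG s)) (fun s _ => hN s) hUc (hDU (interior_subset hp)) ?_
    filter_upwards [mem_interior_iff_mem_nhds.mp hp] with s hs
    rw [hFf hs, hf s hs]
  filter_upwards [hU.mem_nhds hsU] with s hs using h1 hs

/-- A matrix of rank `n` with simple nonzero spectrum `a`. -/
lemma sphInt_conj_Proj_diagonal {l n : ℕ} (hnl : n ≤ l) {s : Fin n → ℂ} (hs : s ∈ baseDomain n)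
    (L : Fin n → ZMod 2) (k : K l) (a : Fin n → ℂ) :
    sphInt s L (k.1 * (Proj l n * diagonal a * Proj n l) * k.1ᴴ) =
      normIntegral l n s * sphInt s L (diagonal a) := by
  rw [sphInt_conj, sphInt_Proj le_rfl hnl hs, tildeS_self]

lemma exists_germ_Phi {l n : ℕ} (hnl : n ≤ l) {s₀ : Fin n → ℂ} {L : Fin n → ZMod 2} {k : K l}
    {a : Fin n → ℝ} (ha : Function.Injective a) (ha0 : ∀ i, a i ≠ 0)
    (h : PhiDefined s₀ L (k.1 * (Proj l n * (diagonal fun i => (a i : ℂ)) * Proj n l) * k.1ᴴ)) :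
    ∃ F : (Fin n → ℂ) → ℂ, AnalyticAt ℂ F s₀ ∧
      (∀ᶠ s in nhds s₀, F s * gapProd s = altNum s L a) ∧
      F s₀ = Phi s₀ L (k.1 * (Proj l n * (diagonal fun i => (a i : ℂ)) * Proj n l) * k.1ᴴ) := by
  refine exists_germ_of_continuesTo analyticAt_gapProd (analyticAt_altNum L ha0)
    (fun s hs => ?_) h
  rw [phiIntegral_eq, sphInt_conj_Proj_diagonal hnl hs,
    mul_div_cancel_left₀ _ (normIntegral_ne_zero hnl hs), sphInt_mul_gapProd hs L ha]

lemma exists_germ_normC {l n : ℕ} {κ : ℂ} (hκ : ∀ s ∈ baseDomain n,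
      normIntegral l n s * gapProd (tildeS l s) = κ * gapProd s) {s₀ : Fin n → ℂ}
    (h : NormCDefined l n s₀) :
    ∃ F : (Fin n → ℂ) → ℂ, AnalyticAt ℂ F s₀ ∧
      (∀ᶠ s in nhds s₀, F s * gapProd (tildeS l s) = κ * gapProd s) ∧
      F s₀ = normC l n s₀ :=
  exists_germ_of_continuesTo
    (fun s => (analyticAt_gapProd _).comp (analyticAt_tildeS l s))
    (fun s => analyticAt_const.mul (analyticAt_gapProd s)) hκ h

/-! ### Holomorphic dependence on parameters -/

/-- An integral of holomorphic functions that is locally dominated is holomorphic. -/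
lemma differentiableOn_integral {Ω : Type*} [MeasurableSpace Ω] {μ : Measure Ω} {U : Set ℂ}
    (hU : IsOpen U) {f : Ω → ℂ → ℂ} (hm : ∀ u ∈ U, AEStronglyMeasurable (fun ω => f ω u) μ)
    (hd : ∀ᵐ ω ∂μ, DifferentiableOn ℂ (f ω) U)
    (hb : ∀ u ∈ U, ∃ ε > 0, ∃ C : Ω → ℝ, Integrable C μ ∧
      ∀ᵐ ω ∂μ, ∀ z ∈ Metric.ball u ε, ‖f ω z‖ ≤ C ω) :
    DifferentiableOn ℂ (fun u => ∫ ω, f ω u ∂μ) U := by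
  intro u hu
  obtain ⟨ε, hε, C, hC, hfC⟩ := hb u hu
  obtain ⟨ε', hε', hball⟩ := Metric.isOpen_iff.mp hU u hu
  set δ := min ε ε' / 3 with hδ
  have hmin : 0 < min ε ε' := lt_min hε hε'
  have hδ0 : 0 < δ := by positivity
  have hsub : ∀ x ∈ Metric.ball u δ, ∀ z ∈ Metric.closedBall x δ,
      z ∈ Metric.ball u ε ∧ z ∈ U := by
    intro x hx z hz
    have h1 : dist z u < min ε ε' := by
      have := dist_triangle z x u
      have h2 := Metric.mem_ball.mp hx
      have h3 := Metric.mem_closedBall.mp hz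
      linarith
    exact ⟨lt_of_lt_of_le h1 (min_le_left _ _), hball (lt_of_lt_of_le h1 (min_le_right _ _))⟩
  have hda : ∀ᵐ ω ∂μ, ∀ x ∈ Metric.ball u δ, HasDerivAt (f ω) (deriv (f ω) x) x := by
    filter_upwards [hd] with ω hω x hx
    exact ((hω x (hsub x hx x (Metric.mem_closedBall_self hδ0.le)).2).differentiableAt
      (hU.mem_nhds (hsub x hx x (Metric.mem_closedBall_self hδ0.le)).2)).hasDerivAt
  have huU : ∀ᶠ x in nhds u, x ∈ U := hU.mem_nhds hu
  have hself : u ∈ Metric.ball u δ := Metric.mem_ball_self hδ0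
  -- the derivative is measurable in `ω` as a limit of difference quotients
  have hderm : AEStronglyMeasurable (fun ω => deriv (f ω) u) μ := by
    let v : ℕ → ℂ := fun n => u + ((δ / (n + 2) : ℝ) : ℂ)
    have hvpos : ∀ n : ℕ, 0 < δ / ((n : ℝ) + 2) := fun n => by positivity
    have hv0 : Filter.Tendsto (fun n : ℕ => δ / ((n : ℝ) + 2)) Filter.atTop (nhds 0) := by
      refine Filter.Tendsto.div_atTop tendsto_const_nhds ?_
      exact Filter.tendsto_atTop_add_const_right _ _ tendsto_natCast_atTop_atTop
    have hv : Filter.Tendsto v Filter.atTop (nhdsWithin u {u}ᶜ) := by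
      refine tendsto_nhdsWithin_iff.mpr ⟨?_, Filter.Eventually.of_forall fun n => ?_⟩
      · have := (tendsto_const_nhds (x := u)).add
          ((Complex.continuous_ofReal.tendsto 0).comp hv0)
        simpa [v] using this
      · simp only [v, Set.mem_compl_iff, Set.mem_singleton_iff, add_eq_left]
        exact Complex.ofReal_ne_zero.mpr (hvpos n).ne'
    have hvU : ∀ n, v n ∈ U := by
      intro n
      refine (hsub u hself (v n) ?_).2
      rw [Metric.mem_closedBall, dist_eq_norm]
      simp only [v, add_sub_cancel_left]
      rw [Complex.norm_real, Real.norm_of_nonneg (hvpos n).le]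
      refine div_le_self hδ0.le ?_
      have : (0 : ℝ) ≤ n := Nat.cast_nonneg n
      linarith
    refine aestronglyMeasurable_of_tendsto_ae Filter.atTop
      (f := fun n ω => slope (f ω) u (v n)) (fun n => ?_) ?_
    · simp only [slope, vsub_eq_sub]
      exact ((hm _ (hvU n)).sub (hm u hu)).const_smul (v n - u)⁻¹
    · filter_upwards [hda] with ω hω
      exact (hasDerivAt_iff_tendsto_slope.mp (hω u hself)).comp hv
  refine (hasDerivAt_integral_of_dominated_loc_of_deriv_le (F := fun x ω => f ω x)
    (F' := fun x ω => deriv (f ω) x) (bound := fun ω => C ω / δ)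
    (Metric.ball_mem_nhds u hδ0) ?_ ?_ hderm ?_ (hC.div_const δ) ?_).2.differentiableAt.differentiableWithinAt
  · filter_upwards [huU] with x hx using hm x hx
  · refine hC.mono' (hm u hu) ?_
    filter_upwards [hfC] with ω hω using hω u (Metric.mem_ball_self hε)
  -- the Cauchy estimate bounds the derivative by the dominating function
  · filter_upwards [hd, hfC] with ω h1 h2 x hx
    refine Complex.norm_deriv_le_of_forall_mem_sphere_norm_le hδ0 ?_ fun z hz =>
      h2 z (hsub x hx z (Metric.sphere_subset_closedBall hz)).1
    exact h1.diffContOnCl_ball fun z hz => (hsub x hx z hz).2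
  · filter_upwards [hda] with ω hω x hx using hω x hx

/-- The mean value property across a removable singularity at the center. -/
lemma circleAverage_div_eq {H p F : ℂ → ℂ} {ρ : ℝ} (hρ : 0 < ρ) (hH : Differentiable ℂ H)
    (hp : Differentiable ℂ p) (hp0 : ∀ u, u ≠ 0 → ‖u‖ ≤ ρ → p u ≠ 0)
    (hF : DifferentiableAt ℂ F 0) (hFp : ∀ᶠ u in nhds 0, F u * p u = H u) :
    Real.circleAverage (fun u => H u / p u) 0 ρ = F 0 := by
  have hG : ∀ u, u ≠ 0 → Function.update (fun u => H u / p u) 0 (F 0) u = H u / p u :=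
    fun u hu => Function.update_of_ne hu _ _
  -- the quotient, with its value at the center replaced by `F 0`, is holomorphic on the disc
  have h1 : DifferentiableOn ℂ (Function.update (fun u => H u / p u) 0 (F 0))
      (Metric.closedBall 0 ρ) := by
    intro u hu
    refine DifferentiableAt.differentiableWithinAt ?_
    rcases eq_or_ne u 0 with rfl | h0
    · refine hF.congr_of_eventuallyEq ?_
      filter_upwards [hFp, Metric.ball_mem_nhds (0 : ℂ) hρ] with w hw hwρ
      rcases eq_or_ne w 0 with rfl | hw0
      · simp
      · rw [hG w hw0, ← hw, mul_div_cancel_right₀]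
        exact hp0 w hw0 (by simpa using (Metric.mem_ball.mp hwρ).le)
    · have : DifferentiableAt ℂ (fun u => H u / p u) u :=
        (hH u).div (hp u) (hp0 u h0 (by simpa using hu))
      refine this.congr_of_eventuallyEq ?_
      filter_upwards [eventually_ne_nhds h0] with w hw using hG w hw
  have h2 : DiffContOnCl ℂ (Function.update (fun u => H u / p u) 0 (F 0))
      (Metric.ball 0 |ρ|) := by
    rw [abs_of_pos hρ]
    exact h1.diffContOnCl_ball subset_rfl
  have h3 := h2.circleAverage
  rw [Function.update_self] at h3
  rw [← h3]
  refine Real.circleAverage_congr_sphere fun u hu => (hG u ?_).symm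
  rintro rfl
  rw [mem_sphere_zero_iff_norm, norm_zero, abs_of_pos hρ] at hu
  exact hρ.ne hu

lemma eventually_punctured_ne (c : ℂ) : ∀ᶠ t in nhdsWithin (0 : ℂ) {0}ᶜ, t ≠ c := by
  rcases eq_or_ne c 0 with rfl | hc
  · exact self_mem_nhdsWithin
  · exact (eventually_ne_nhds hc.symm).filter_mono nhdsWithin_le_nhds

lemma eventually_linear_ne_zero (b : ℂ) {c : ℂ} (hc : c ≠ 0) :
    ∀ᶠ t in nhdsWithin (0 : ℂ) {0}ᶜ, b + t * c ≠ 0 := by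
  filter_upwards [eventually_punctured_ne (-b / c)] with t ht h
  apply ht
  rw [eq_div_iff hc]
  linear_combination h

/-- The factors that `gapProd` gains from the entries added by `tildeS`. -/
lemma exists_gapProd_tildeS {r N : ℕ} (hrN : r ≤ N) : ∃ Q : (Fin r → ℂ) → ℂ,
    (∀ s, AnalyticAt ℂ Q s) ∧ (∀ s, gapProd (tildeS N s) = gapProd s * Q s) ∧
    ∀ s : Fin r → ℂ, ∀ᶠ t in nhdsWithin (0 : ℂ) {0}ᶜ, Q (fun j => s j + t) ≠ 0 := by
  obtain ⟨d, rfl⟩ := Nat.exists_eq_add_of_le hrN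
  have e1 : ∀ (s : Fin r → ℂ) (i : Fin r), tildeS (r + d) s (Fin.castAdd d i) = s i + d := by
    intro s i; simp [tildeS]
  have e2 : ∀ (s : Fin r → ℂ) (c : Fin d), tildeS (r + d) s (Fin.natAdd r c) =
      ((d - 1 - (c : ℕ) : ℕ) : ℂ) := by
    intro s c
    have : r + d - 1 - (r + (c : ℕ)) = d - 1 - (c : ℕ) := by omega
    simp [tildeS, this]
  refine ⟨fun s => (∏ i : Fin r, ∏ c : Fin d, (s i + (d - ((d - 1 - (c : ℕ) : ℕ) : ℂ)))) *
    gapProd fun c : Fin d => ((d - 1 - (c : ℕ) : ℕ) : ℂ), fun s => ?_, fun s => ?_, fun s => ?_⟩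
  · refine AnalyticAt.mul (Finset.analyticAt_fun_prod _ fun i _ =>
      Finset.analyticAt_fun_prod _ fun c _ => ?_) analyticAt_const
    exact ((ContinuousLinearMap.proj (R := ℂ) (φ := fun _ : Fin r => ℂ) i).analyticAt s).add
      analyticAt_const
  · have h1 : ∀ i j : Fin r, Fin.castAdd d i < Fin.castAdd d j ↔ i < j := fun i j => Iff.rfl
    have h2 : ∀ (i : Fin r) (c : Fin d), Fin.castAdd d i < Fin.natAdd r c := fun i c => by
      rw [Fin.lt_def]; simp only [Fin.val_castAdd, Fin.val_natAdd]; have := i.2; omega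
    have h3 : ∀ (i : Fin r) (c : Fin d), ¬ Fin.natAdd r c < Fin.castAdd d i := fun i c =>
      (h2 i c).not_gt
    have h4 : ∀ c c' : Fin d, Fin.natAdd r c < Fin.natAdd r c' ↔ c < c' := fun c c' => by
      rw [Fin.lt_def, Fin.lt_def]; simp only [Fin.val_natAdd]; omega
    simp only [gapProd, Fin.prod_univ_add, e1, e2, h1, h2, h3, h4, if_true, if_false,
      Finset.prod_const_one, add_sub_add_right_eq_sub, Finset.prod_mul_distrib]
    simp only [add_sub_assoc]
    ring
  · have h5 : gapProd (fun c : Fin d => ((d - 1 - (c : ℕ) : ℕ) : ℂ)) ≠ 0 := by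
      refine gapProd_ne_zero_iff.mpr fun c c' h => Fin.ext ?_
      have h6 : d - 1 - (c : ℕ) = d - 1 - (c' : ℕ) := by exact_mod_cast h
      have := c.2; have := c'.2
      omega
    have h7 : ∀ᶠ t in nhdsWithin (0 : ℂ) {0}ᶜ, ∀ (i : Fin r) (c : Fin d),
        (s i + (d - ((d - 1 - (c : ℕ) : ℕ) : ℂ))) + t * 1 ≠ 0 :=
      Filter.eventually_all.mpr fun i => Filter.eventually_all.mpr fun c =>
        eventually_linear_ne_zero _ one_ne_zero
    filter_upwards [h7] with t ht
    refine mul_ne_zero (Finset.prod_ne_zero_iff.mpr fun i _ =>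
      Finset.prod_ne_zero_iff.mpr fun c _ => ?_) h5
    have := ht i c
    rw [mul_one] at this
    intro h
    apply this
    linear_combination h

/-! ### Bounds in vertical strips -/

/-- The complex line through `s₀ + t (1, …, 1)` in the direction `(r, r - 1, …, 1)`. -/
def slice {r : ℕ} (s₀ : Fin r → ℂ) (t u : ℂ) : Fin r → ℂ :=
  fun j => s₀ j + t + u * ((r - (j : ℕ) : ℕ) : ℂ)

lemma slice_eq_add {r : ℕ} (s₀ : Fin r → ℂ) (t u : ℂ) :
    slice s₀ t u = fun j => slice s₀ 0 u j + t := by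
  funext j; simp only [slice]; ring

lemma gapProd_add {r : ℕ} (s : Fin r → ℂ) (t : ℂ) : gapProd (fun j => s j + t) = gapProd s := by
  simp only [gapProd, add_sub_add_right_eq_sub]

lemma gapProd_slice {r : ℕ} (s₀ : Fin r → ℂ) (t u : ℂ) :
    gapProd (slice s₀ t u) = gapProd (slice s₀ 0 u) := by
  rw [slice_eq_add, gapProd_add]

lemma differentiable_slice {r : ℕ} (s₀ : Fin r → ℂ) (t : ℂ) :
    Differentiable ℂ fun u => slice s₀ t u := by
  unfold slice
  fun_prop

lemma differentiable_slice_left {r : ℕ} (s₀ : Fin r → ℂ) (u : ℂ) :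
    Differentiable ℂ fun t => slice s₀ t u := by
  unfold slice
  fun_prop

lemma continuous_slice {r : ℕ} (s₀ : Fin r → ℂ) :
    Continuous fun p : ℂ × ℂ => slice s₀ p.1 p.2 := by
  unfold slice
  fun_prop

lemma eventually_gapProd_slice_ne_zero {r : ℕ} (s₀ : Fin r → ℂ) :
    ∀ᶠ u in nhdsWithin (0 : ℂ) {0}ᶜ, gapProd (slice s₀ 0 u) ≠ 0 := by
  have h : ∀ᶠ u in nhdsWithin (0 : ℂ) {0}ᶜ, ∀ i j : Fin r, i ≠ j →
      (s₀ i - s₀ j) + u * (((r - (i : ℕ) : ℕ) : ℂ) - ((r - (j : ℕ) : ℕ) : ℂ)) ≠ 0 := by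
    refine Filter.eventually_all.mpr fun i => Filter.eventually_all.mpr fun j =>
      Filter.eventually_imp_distrib_left.mpr fun hij => eventually_linear_ne_zero _ ?_
    refine sub_ne_zero.mpr fun he => hij (Fin.ext ?_)
    have h6 : r - (i : ℕ) = r - (j : ℕ) := by exact_mod_cast he
    have := i.2; have := j.2
    omega
  filter_upwards [h] with u hu
  refine gapProd_ne_zero_iff.mpr fun i j he => ?_
  by_contra hij
  apply hu i j hij
  simp only [slice] at he
  linear_combination he

lemma re_slice {r : ℕ} (s₀ : Fin r → ℂ) (t u : ℂ) (j : Fin r) :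
    (slice s₀ t u j).re = (s₀ j).re + t.re + u.re * ((r - (j : ℕ) : ℕ) : ℝ) := by
  simp only [slice, Complex.add_re, Complex.mul_re, Complex.natCast_re, Complex.natCast_im]
  ring

lemma mem_baseDomain_of_gaps {r : ℕ} {s : Fin r → ℂ}
    (h1 : ∀ i j : Fin r, i < j → 1 ≤ (s i).re - (s j).re) (h2 : ∀ j, 0 ≤ (s j).re) :
    s ∈ baseDomain r := by
  intro j
  unfold expS
  by_cases h : (j : ℕ) + 1 < r
  · simp only [h, dif_pos, Complex.sub_re, Complex.one_re]
    have := h1 j ⟨(j : ℕ) + 1, h⟩ (by rw [Fin.lt_def]; simp)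
    linarith
  · simp only [h, dite_false, Complex.sub_re, Complex.one_re, Complex.neg_re]
    have := h2 j
    linarith

/-- Far to the right in the strip, slices lie in the base domain, and far to the left they do so
after reversing the order. -/
lemma exists_slice_mem_baseDomain {r : ℕ} (s₀ : Fin r → ℂ) : ∃ U₀ : ℝ, 1 ≤ U₀ ∧ ∀ U, U₀ ≤ U →
    ∃ T : ℝ, ∀ t : ℝ, T ≤ t → (∀ u : ℂ, U₀ ≤ u.re → u.re ≤ U → slice s₀ t u ∈ baseDomain r) ∧
      (∀ u : ℂ, u.re ≤ -U₀ → -U ≤ u.re → slice s₀ t u ∘ Fin.rev ∈ baseDomain r) := by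
  set B := ∑ i, |(s₀ i).re| with hB
  have hB1 : ∀ i, |(s₀ i).re| ≤ B := fun i =>
    Finset.single_le_sum (f := fun i => |(s₀ i).re|) (fun i _ => abs_nonneg _) (Finset.mem_univ i)
  have hB0 : 0 ≤ B := Finset.sum_nonneg fun i _ => abs_nonneg _
  have hgap : ∀ i j : Fin r, i < j → (1 : ℝ) ≤ ((r - (i : ℕ) : ℕ) : ℝ) - ((r - (j : ℕ) : ℕ) : ℝ) := by
    intro i j hij
    have h2 : (r - (j : ℕ)) + 1 ≤ r - (i : ℕ) := by
      have := i.2; have := j.2; rw [Fin.lt_def] at hij; omega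
    have h3 : (((r - (j : ℕ)) + 1 : ℕ) : ℝ) ≤ ((r - (i : ℕ) : ℕ) : ℝ) := by exact_mod_cast h2
    push_cast at h3
    linarith
  have hv : ∀ j : Fin r, (0 : ℝ) ≤ ((r - (j : ℕ) : ℕ) : ℝ) ∧ ((r - (j : ℕ) : ℕ) : ℝ) ≤ r := by
    intro j
    exact ⟨Nat.cast_nonneg _, by exact_mod_cast Nat.sub_le _ _⟩
  -- `re u ≥ 1 + 2 B` opens gaps of size at least one; `t ≥ B + U r` makes all entries nonnegative
  refine ⟨1 + 2 * B, by linarith, fun U hU => ⟨B + U * r, fun t ht => ⟨?_, ?_⟩⟩⟩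
  · intro u hu1 hu2
    refine mem_baseDomain_of_gaps (fun i j hij => ?_) fun j => ?_
    · rw [re_slice, re_slice]
      have h1 := abs_le.mp (hB1 i)
      have h2 := abs_le.mp (hB1 j)
      have h3 := hgap i j hij
      nlinarith
    · rw [re_slice, Complex.ofReal_re]
      have h1 := abs_le.mp (hB1 j)
      have h2 : 0 ≤ u.re * ((r - (j : ℕ) : ℕ) : ℝ) := mul_nonneg (by linarith) (hv j).1
      have h3 : 0 ≤ U * (r : ℝ) := mul_nonneg (by linarith) (Nat.cast_nonneg _)
      linarith
  · intro u hu1 hu2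
    refine mem_baseDomain_of_gaps (fun i j hij => ?_) fun j => ?_
    · simp only [Function.comp_apply]
      rw [re_slice, re_slice]
      have h1 := abs_le.mp (hB1 (Fin.rev i))
      have h2 := abs_le.mp (hB1 (Fin.rev j))
      have h3 := hgap (Fin.rev j) (Fin.rev i) (Fin.rev_lt_rev.mpr hij)
      nlinarith
    · simp only [Function.comp_apply]
      rw [re_slice, Complex.ofReal_re]
      have h1 := abs_le.mp (hB1 (Fin.rev j))
      have h2 := hv (Fin.rev j)
      have h3 : -(U * r) ≤ u.re * ((r - (Fin.rev j : ℕ) : ℕ) : ℝ) := by nlinarith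
      linarith

lemma norm_exp_sq (u : ℂ) : ‖Complex.exp (u ^ 2)‖ = Real.exp (u.re ^ 2 - u.im ^ 2) := by
  rw [Complex.norm_exp]
  congr 1
  simp [pow_two, Complex.mul_re]

/-- The Gaussian factor `exp(u²)` dominates the polynomial `gapProd` in vertical strips. -/
lemma exists_gapProd_slice_le {r : ℕ} (s₀ : Fin r → ℂ) (U : ℝ) : ∃ C : ℝ, ∀ t u : ℂ,
    |u.re| ≤ U → ‖gapProd (slice s₀ t u)‖ * ‖Complex.exp (u ^ 2)‖ ≤ C := by
  set M : Fin r → Fin r → ℝ := fun i j => 1 + ‖s₀ i - s₀ j‖ +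
    ‖((r - (i : ℕ) : ℕ) : ℂ) - ((r - (j : ℕ) : ℕ) : ℂ)‖ with hM
  have hM1 : ∀ i j, 1 ≤ M i j := fun i j => by
    have := norm_nonneg (s₀ i - s₀ j)
    have := norm_nonneg (((r - (i : ℕ) : ℕ) : ℂ) - ((r - (j : ℕ) : ℕ) : ℂ))
    simp only [hM]; linarith
  have h1 : ∀ t u : ℂ, ‖gapProd (slice s₀ t u)‖ ≤
      (∏ i, ∏ j, M i j) * (1 + ‖u‖) ^ (r * r) := by
    intro t u
    have e : (∏ i, ∏ j, M i j) * (1 + ‖u‖) ^ (r * r) = ∏ i, ∏ j, (M i j * (1 + ‖u‖)) := by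
      simp only [Finset.prod_mul_distrib, Finset.prod_const, Finset.card_univ, Fintype.card_fin,
        pow_mul]
    rw [gapProd, e, norm_prod]
    refine Finset.prod_le_prod (fun _ _ => norm_nonneg _) fun i _ => ?_
    rw [norm_prod]
    refine Finset.prod_le_prod (fun _ _ => norm_nonneg _) fun j _ => ?_
    have hu := norm_nonneg u
    split_ifs
    · have e2 : slice s₀ t u i - slice s₀ t u j = (s₀ i - s₀ j) +
          u * (((r - (i : ℕ) : ℕ) : ℂ) - ((r - (j : ℕ) : ℕ) : ℂ)) := by
        simp only [slice]; ring
      rw [e2]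
      refine (norm_add_le _ _).trans ?_
      rw [norm_mul]
      have := norm_nonneg (s₀ i - s₀ j)
      have := norm_nonneg (((r - (i : ℕ) : ℕ) : ℂ) - ((r - (j : ℕ) : ℕ) : ℂ))
      simp only [hM]
      nlinarith
    · rw [norm_one]
      have := hM1 i j
      nlinarith
  have hP : 0 ≤ ∏ i, ∏ j, M i j := Finset.prod_nonneg fun i _ => Finset.prod_nonneg fun j _ =>
    zero_le_one.trans (hM1 i j)
  refine ⟨(∏ i, ∏ j, M i j) * ((r * r).factorial * Real.exp (2 + U + U ^ 2)), fun t u hu => ?_⟩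
  -- in the strip `‖u‖ ≤ U + |im u|`, and `|im u| - (im u)² ≤ 1`
  have h2 : (1 + ‖u‖) ^ (r * r) ≤ (r * r).factorial * Real.exp (1 + ‖u‖) := by
    have := Real.pow_div_factorial_le_exp (1 + ‖u‖) (by have := norm_nonneg u; linarith) (r * r)
    rwa [div_le_iff₀' (by positivity)] at this
  have h3 : Real.exp (1 + ‖u‖) * Real.exp (u.re ^ 2 - u.im ^ 2) ≤ Real.exp (2 + U + U ^ 2) := by
    rw [← Real.exp_add]
    refine Real.exp_le_exp.mpr ?_
    have h4 := Complex.norm_le_abs_re_add_abs_im u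
    have h5 : u.re ^ 2 ≤ U ^ 2 := by rw [← sq_abs u.re]; exact pow_le_pow_left₀ (abs_nonneg _) hu 2
    have h6 : |u.im| - u.im ^ 2 ≤ 1 := by rw [← sq_abs u.im]; nlinarith [sq_nonneg (|u.im| - 1), abs_nonneg u.im]
    linarith
  rw [norm_exp_sq]
  calc _ ≤ (∏ i, ∏ j, M i j) * (1 + ‖u‖) ^ (r * r) * Real.exp (u.re ^ 2 - u.im ^ 2) :=
        mul_le_mul_of_nonneg_right (h1 t u) (Real.exp_pos _).le
    _ ≤ (∏ i, ∏ j, M i j) * ((r * r).factorial * Real.exp (1 + ‖u‖)) *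
        Real.exp (u.re ^ 2 - u.im ^ 2) :=
        mul_le_mul_of_nonneg_right (mul_le_mul_of_nonneg_left h2 hP) (Real.exp_pos _).le
    _ = (∏ i, ∏ j, M i j) * ((r * r).factorial * (Real.exp (1 + ‖u‖) *
        Real.exp (u.re ^ 2 - u.im ^ 2))) := by ring
    _ ≤ _ := mul_le_mul_of_nonneg_left (mul_le_mul_of_nonneg_left h3 (by positivity)) hP

lemma norm_gapProd_comp_perm {n : ℕ} (s : Fin n → ℂ) (σ : Equiv.Perm (Fin n)) :
    ‖gapProd (s ∘ σ)‖ = ‖gapProd s‖ := by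
  have h : ∀ s : Fin n → ℂ, gapProd s = (vandermonde fun i => -s i).det := by
    intro s
    rw [det_vandermonde, gapProd]
    refine Finset.prod_congr rfl fun i _ => ?_
    rw [← Finset.filter_lt_eq_Ioi, Finset.prod_filter]
    refine Finset.prod_congr rfl fun j _ => ?_
    split_ifs
    · ring
    · rfl
  have h2 : (vandermonde fun i => -(s ∘ σ) i).det =
      ((Equiv.Perm.sign σ : ℤ) : ℂ) * (vandermonde fun i => -s i).det := by
    rw [← det_permute]; rfl
  rw [h, h, h2, norm_mul]
  rcases Int.units_eq_one_or (Equiv.Perm.sign σ) with h | h <;> simp [h]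

/-- For a fixed spectrum `altNum` is bounded in vertical strips. -/
lemma exists_altNum_slice_le {r : ℕ} (s₀ : Fin r → ℂ) (L : Fin r → ZMod 2) {a : Fin r → ℝ}
    (ha : ∀ i, a i ≠ 0) (t : ℂ) (U : ℝ) : ∃ C : ℝ, ∀ u : ℂ, |u.re| ≤ U →
      ‖altNum (slice s₀ t u) L a‖ ≤ C := by
  let g : ℝ → ℝ := fun x => ‖altConst r‖ * (∑ σ : Equiv.Perm (Fin r), ∏ i,
    |a (σ i)| ^ ((s₀ i).re + t.re + x * ((r - (i : ℕ) : ℕ) : ℝ))) / ‖((vandermonde a).det : ℂ)‖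
  have hg : Continuous g := by
    refine Continuous.div_const (continuous_const.mul (continuous_finsetSum _ fun σ _ =>
      continuous_finsetProd _ fun i _ => ?_)) _
    exact Continuous.rpow continuous_const (by fun_prop) fun x => Or.inl (abs_ne_zero.mpr (ha _))
  obtain ⟨C, hC⟩ := (isCompact_Icc (a := -U) (b := U)).exists_bound_of_continuousOn
    hg.continuousOn
  refine ⟨C, fun u hu => le_trans ?_ (hC u.re ⟨(abs_le.mp hu).1, (abs_le.mp hu).2⟩)⟩
  refine le_trans ?_ (le_abs_self _)
  rw [altNum, norm_div, norm_mul]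
  refine div_le_div_of_nonneg_right (mul_le_mul_of_nonneg_left ?_ (norm_nonneg _)) (norm_nonneg _)
  rw [altDet, det_apply']
  refine (norm_sum_le _ _).trans (Finset.sum_le_sum fun σ _ => ?_)
  rw [norm_mul, norm_prod]
  have h1 : ‖((Equiv.Perm.sign σ : ℤ) : ℂ)‖ = 1 := by
    rcases Int.units_eq_one_or (Equiv.Perm.sign σ) with h | h <;> simp [h]
  rw [h1, one_mul]
  refine Finset.prod_le_prod (fun _ _ => norm_nonneg _) fun i _ => ?_
  rw [of_apply, sp, norm_mul, Complex.norm_real, Real.norm_eq_abs,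
    Complex.norm_cpow_eq_rpow_re_of_pos (abs_pos.mpr (ha _)), re_slice]
  exact mul_le_of_le_one_left (Real.rpow_nonneg (abs_nonneg _) _) (norm_signPow_le _ _)

lemma differentiable_altNum_slice {r : ℕ} (s₀ : Fin r → ℂ) (L : Fin r → ZMod 2) {a : Fin r → ℝ}
    (ha : ∀ i, a i ≠ 0) (t : ℂ) : Differentiable ℂ fun u => altNum (slice s₀ t u) L a :=
  fun u => ((analyticAt_altNum L ha _).differentiableAt).comp u (differentiable_slice s₀ t u)

/-- The Phragmén–Lindelöf principle turns the bounds on the base domain and on its reversal into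
a bound that is uniform in the spectrum. -/
theorem exists_uniform_bound {r : ℕ} (s₀ : Fin r → ℂ) (L : Fin r → ZMod 2) (ρ : ℝ) {U₀ U T t : ℝ}
    (hU₀ : 1 ≤ U₀) (hU : U₀ ≤ U) (hT : T ≤ t)
    (h1 : ∀ t : ℝ, T ≤ t → (∀ u : ℂ, U₀ ≤ u.re → u.re ≤ U → slice s₀ t u ∈ baseDomain r) ∧
      (∀ u : ℂ, u.re ≤ -U₀ → -U ≤ u.re → slice s₀ t u ∘ Fin.rev ∈ baseDomain r)) :
    ∃ C : ℝ, ∀ a : Fin r → ℝ, Function.Injective a → (∀ i, a i ≠ 0) → (∀ i, |a i| ≤ ρ) →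
      ∀ u : ℂ, |u.re| ≤ U → ‖altNum (slice s₀ t u) L a * Complex.exp (u ^ 2)‖ ≤ C := by
  obtain ⟨R, hR, hRa⟩ := exists_minor_diagonal_le r r ρ
  obtain ⟨D, hD⟩ := exists_gapProd_slice_le s₀ U
  obtain ⟨h2, h3⟩ := h1 t hT
  have hUpos : 0 < U := by linarith
  have hE : ∀ {s s' : Fin r → ℂ}, (∀ j, (s j).re = (s' j).re) →
      ∀ j, (expS s j).re = (expS s' j).re := by
    intro s s' h j
    unfold expS
    by_cases hj : (j : ℕ) + 1 < r
    · simp only [hj, dif_pos, Complex.sub_re, h]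
    · simp only [hj, dite_false, Complex.sub_re, h]
  -- the bounds for the spherical integrals depend on the real parts only, so that they are constant
  -- along the two edges
  set E₁ := ∏ j, R ^ (expS (slice s₀ t U) j).re
  set E₂ := ∏ j, R ^ (expS (slice s₀ t (-U : ℝ) ∘ Fin.rev) j).re
  have hE₁ : 0 ≤ E₁ := Finset.prod_nonneg fun j _ => Real.rpow_nonneg (by linarith) _
  have hE₂ : 0 ≤ E₂ := Finset.prod_nonneg fun j _ => Real.rpow_nonneg (by linarith) _
  refine ⟨max (E₁ * D) (E₂ * D), fun a ha ha0 haρ u hu => ?_⟩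
  have hdiff : Differentiable ℂ fun u : ℂ => altNum (slice s₀ t u) L a * Complex.exp (u ^ 2) :=
    (differentiable_altNum_slice s₀ L ha0 t).mul (by fun_prop)
  refine PhragmenLindelof.vertical_strip (a := -U) (b := U)
    (f := fun u : ℂ => altNum (slice s₀ t u) L a * Complex.exp (u ^ 2))
    hdiff.diffContOnCl ⟨0, div_pos Real.pi_pos (by linarith), 0, ?_⟩ ?_ ?_ (abs_le.mp hu).1 (abs_le.mp hu).2
  -- the growth condition: for a fixed spectrum the function is bounded, but not uniformly in `a`
  · obtain ⟨C, hC⟩ := exists_altNum_slice_le s₀ L ha0 t U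
    refine Asymptotics.IsBigO.of_bound (C * Real.exp (U ^ 2)) ?_
    refine Filter.Eventually.filter_mono inf_le_right ?_
    rw [Filter.eventually_principal]
    intro w hw
    have hw' : |w.re| ≤ U := abs_le.mpr ⟨hw.1.le, hw.2.le⟩
    rw [zero_mul, Real.exp_zero, norm_one, mul_one, norm_mul, norm_exp_sq]
    refine mul_le_mul (hC w hw') (Real.exp_le_exp.mpr ?_) (Real.exp_pos _).le
      ((norm_nonneg _).trans (hC w hw'))
    have h5 : w.re ^ 2 ≤ U ^ 2 := by
      rw [← sq_abs w.re]; exact pow_le_pow_left₀ (abs_nonneg _) hw' 2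
    nlinarith [sq_nonneg w.im]
  -- on the left edge the reversed parameters lie in the base domain; reversing costs a sign only
  · intro w hw
    refine le_trans ?_ (le_max_right _ _)
    have hb := h3 w (by rw [hw]; linarith) hw.ge
    have h4 := norm_altNum_le hb (L ∘ Fin.rev) ha hR (hRa a haρ)
    have h5 : ∀ s : Fin r → ℂ, ‖altNum (s ∘ Fin.rev) (L ∘ Fin.rev) a‖ = ‖altNum s L a‖ := by
      intro s
      have := altNum_comp_perm s L a Fin.revPerm
      rw [show s ∘ Fin.rev = s ∘ Fin.revPerm from rfl, show L ∘ Fin.rev = L ∘ Fin.revPerm from rfl,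
        this, norm_mul]
      rcases Int.units_eq_one_or (Equiv.Perm.sign (Fin.revPerm (n := r))) with h | h <;> simp [h]
    have h6 : ‖gapProd (slice s₀ t w ∘ Fin.rev)‖ = ‖gapProd (slice s₀ t w)‖ :=
      norm_gapProd_comp_perm _ Fin.revPerm
    rw [h5, h6, Finset.prod_congr rfl fun j _ => congrArg (fun x => R ^ x) (hE (s := slice s₀ t w ∘ Fin.rev)
      (s' := slice s₀ t (-U : ℝ) ∘ Fin.rev) (fun j => by
        simp only [Function.comp_apply]
        simp only [re_slice, hw, Complex.ofReal_re]) j)] at h4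
    rw [norm_mul]
    calc _ ≤ E₂ * ‖gapProd (slice s₀ t w)‖ * ‖Complex.exp (w ^ 2)‖ :=
          mul_le_mul_of_nonneg_right h4 (norm_nonneg _)
      _ = E₂ * (‖gapProd (slice s₀ t w)‖ * ‖Complex.exp (w ^ 2)‖) := by ring
      _ ≤ _ := mul_le_mul_of_nonneg_left (hD t w (by rw [hw, abs_neg, abs_of_pos hUpos])) hE₂
  · intro w hw
    refine le_trans ?_ (le_max_left _ _)
    have hb := h2 w (by rw [hw]; linarith) hw.le
    have h4 := norm_altNum_le hb L ha hR (hRa a haρ)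
    rw [Finset.prod_congr rfl fun j _ => congrArg (fun x => R ^ x) (hE (s := slice s₀ t w)
      (s' := slice s₀ t U) (fun j => by simp only [re_slice, hw, Complex.ofReal_re]) j)] at h4
    rw [norm_mul]
    calc _ ≤ E₁ * ‖gapProd (slice s₀ t w)‖ * ‖Complex.exp (w ^ 2)‖ :=
          mul_le_mul_of_nonneg_right h4 (norm_nonneg _)
      _ = E₁ * (‖gapProd (slice s₀ t w)‖ * ‖Complex.exp (w ^ 2)‖) := by ring
      _ ≤ _ := mul_le_mul_of_nonneg_left (hD t w (by rw [hw, abs_of_pos hUpos])) hE₁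

/-! ### Extending averaged identities from the base domain -/

section Extension

variable {Ω : Type*} [MeasurableSpace Ω] {μ : Measure Ω} [IsFiniteMeasure μ] {r : ℕ}
  {z : Ω → Fin r → ℝ} {ρ : ℝ}

/-- An identity for averages of `altNum` on the base domain persists around any point, after
translating that point far enough in the direction `(1, …, 1)`. -/
lemma exists_integral_altNum_slice (hz : Measurable z) (hzρ : ∀ᵐ ω ∂μ, ∀ i, |z ω i| ≤ ρ)
    (hzi : ∀ᵐ ω ∂μ, Function.Injective (z ω)) (hz0 : ∀ᵐ ω ∂μ, ∀ i, z ω i ≠ 0)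
    {L : Fin r → ZMod 2} {G R : (Fin r → ℂ) → ℂ} (hG : ∀ s, AnalyticAt ℂ G s)
    (hR : ∀ s, AnalyticAt ℂ R s)
    (hbase : ∀ s ∈ baseDomain r, G s * ∫ ω, altNum s L (z ω) ∂μ = R s) (s₀ : Fin r → ℂ) :
    ∃ T : ℝ, ∀ t : ℝ, T ≤ t →
      (∃ C : ℝ, ∀ᵐ ω ∂μ, ∀ u : ℂ, ‖u‖ ≤ 1 → ‖altNum (slice s₀ t u) L (z ω)‖ ≤ C) ∧
      ∀ u : ℂ, ‖u‖ ≤ 1 → G (slice s₀ t u) * ∫ ω, altNum (slice s₀ t u) L (z ω) ∂μ =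
        R (slice s₀ t u) := by
  -- the identity holds in `U₀ < re u < U₀ + 2`, where the slice lies in the base domain, and spreads
  -- over the strip `|re u| < U₀ + 2`, where the uniform bound makes the average holomorphic
  obtain ⟨U₀, hU₀, h⟩ := exists_slice_mem_baseDomain s₀
  obtain ⟨T, hT⟩ := h (U₀ + 2) (by linarith)
  refine ⟨T, fun t ht => ?_⟩
  obtain ⟨C, hC⟩ := exists_uniform_bound s₀ L ρ hU₀ (by linarith) ht hT
  have hCω : ∀ᵐ ω ∂μ, ∀ u : ℂ, |u.re| ≤ U₀ + 2 →
      ‖altNum (slice s₀ t u) L (z ω) * Complex.exp (u ^ 2)‖ ≤ C := by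
    filter_upwards [hzρ, hzi, hz0] with ω h1 h2 h3 using hC _ h2 h3 h1
  have hre : ∀ u : ℂ, ‖u‖ ≤ 1 → |u.re| ≤ 1 := fun u hu => (Complex.abs_re_le_norm u).trans hu
  constructor
  · refine ⟨C * Real.exp 1, ?_⟩
    filter_upwards [hCω] with ω hω u hu
    have h1 := hω u (by have := hre u hu; linarith)
    rw [norm_mul, norm_exp_sq] at h1
    have h2 : Real.exp (-1) ≤ Real.exp (u.re ^ 2 - u.im ^ 2) := by
      refine Real.exp_le_exp.mpr ?_
      have h3 := (Complex.abs_im_le_norm u).trans hu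
      have h4 : u.im ^ 2 ≤ 1 := by rw [← sq_abs]; exact pow_le_one₀ (abs_nonneg _) h3
      nlinarith [sq_nonneg u.re]
    have h5 : ‖altNum (slice s₀ t u) L (z ω)‖ * Real.exp (-1) ≤ C :=
      (mul_le_mul_of_nonneg_left h2 (norm_nonneg _)).trans h1
    calc _ = ‖altNum (slice s₀ t u) L (z ω)‖ * Real.exp (-1) * Real.exp 1 := by
          rw [mul_assoc, ← Real.exp_add]; simp
      _ ≤ _ := mul_le_mul_of_nonneg_right h5 (Real.exp_pos _).le
  · set S : Set ℂ := Complex.re ⁻¹' Set.Ioo (-(U₀ + 2)) (U₀ + 2) with hS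
    have hSo : IsOpen S := isOpen_Ioo.preimage Complex.continuous_re
    have hSc : IsPreconnected S :=
      ((convex_Ioo _ _).linear_preimage Complex.reLm).isPreconnected
    have hM : DifferentiableOn ℂ (fun u => ∫ ω, altNum (slice s₀ t u) L (z ω) *
        Complex.exp (u ^ 2) ∂μ) S := by
      refine differentiableOn_integral hSo (fun u _ => ?_) ?_ fun u hu => ?_
      · exact ((measurable_altNum measurable_const hz L).mul_const _).aestronglyMeasurable
      · filter_upwards [hz0] with ω h3
        exact ((differentiable_altNum_slice s₀ L h3 t).mul (by fun_prop)).differentiableOn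
      · obtain ⟨ε, hε, hball⟩ := Metric.isOpen_iff.mp hSo u hu
        refine ⟨ε, hε, fun _ => C, integrable_const C, ?_⟩
        filter_upwards [hCω] with ω hω w hw
        exact hω w (abs_le.mpr ⟨(hball hw).1.le, (hball hw).2.le⟩)
    have hsl : ∀ {f : (Fin r → ℂ) → ℂ}, (∀ s, AnalyticAt ℂ f s) →
        Differentiable ℂ fun u => f (slice s₀ t u) := fun hf u =>
      (hf _).differentiableAt.comp u (differentiable_slice s₀ t u)
    have heq : Set.EqOn (fun u => G (slice s₀ t u) * ∫ ω, altNum (slice s₀ t u) L (z ω) *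
        Complex.exp (u ^ 2) ∂μ) (fun u => R (slice s₀ t u) * Complex.exp (u ^ 2)) S := by
      refine AnalyticOnNhd.eqOn_of_preconnected_of_eventuallyEq (z₀ := ((U₀ + 1 : ℝ) : ℂ))
        (((hsl hG).differentiableOn.mul hM).analyticOnNhd hSo)
        (((hsl hR).mul (by fun_prop)).differentiableOn.analyticOnNhd hSo) hSc ?_ ?_
      · simp only [hS, Set.mem_preimage, Complex.ofReal_re, Set.mem_Ioo]
        constructor <;> linarith
      · have hV : IsOpen (Complex.re ⁻¹' Set.Ioo U₀ (U₀ + 2)) :=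
          isOpen_Ioo.preimage Complex.continuous_re
        filter_upwards [hV.mem_nhds (show ((U₀ + 1 : ℝ) : ℂ) ∈ Complex.re ⁻¹' Set.Ioo U₀ (U₀ + 2) by
          simp only [Set.mem_preimage, Complex.ofReal_re, Set.mem_Ioo]
          constructor <;> linarith)] with u hu
        rw [integral_mul_const, ← mul_assoc,
          hbase _ ((hT t ht).1 u hu.1.le hu.2.le)]
    intro u hu
    have h1 := abs_le.mp (hre u hu)
    have h2 := heq (show u ∈ S from ⟨by linarith [h1.1], by linarith [h1.2]⟩)
    simp only [integral_mul_const, ← mul_assoc] at h2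
    exact mul_right_cancel₀ (Complex.exp_ne_zero _) h2

lemma integral_circleAverage {R : ℝ} {g : Ω → ℂ → ℂ}
    (hm : Measurable fun p : Ω × ℝ => g p.1 (circleMap 0 R p.2))
    (hb : ∃ C : ℝ, ∀ᵐ ω ∂μ, ∀ u ∈ Metric.sphere (0 : ℂ) |R|, ‖g ω u‖ ≤ C) :
    ∫ ω, Real.circleAverage (g ω) 0 R ∂μ = Real.circleAverage (fun u => ∫ ω, g ω u ∂μ) 0 R := by
  obtain ⟨C, hC⟩ := hb
  simp only [Real.circleAverage, intervalIntegral.integral_of_le Real.two_pi_pos.le]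
  rw [integral_smul]
  congr 1
  refine integral_integral_swap (f := fun ω θ => g ω (circleMap 0 R θ))
    (Integrable.of_bound (C := C) hm.aestronglyMeasurable ?_)
  have h1 := (Measure.quasiMeasurePreserving_fst (μ := μ)
    (ν := volume.restrict (Set.Ioc 0 (2 * Real.pi)))).ae hC
  filter_upwards [h1] with p hp
  exact hp _ (circleMap_mem_sphere' _ _ _)

lemma norm_absPow_le {a : Fin r → ℝ} (ha : ∀ i, a i ≠ 0) (haρ : ∀ i, |a i| ≤ ρ) {t : ℂ} {x : ℝ}
    (ht : 0 ≤ t.re) (htx : t.re ≤ x) : ‖absPow t a‖ ≤ ((1 + |ρ|) ^ x) ^ r := by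
  rw [absPow, norm_prod]
  have h1 : (1 : ℝ) ≤ 1 + |ρ| := by have := abs_nonneg ρ; linarith
  calc _ ≤ ∏ _i : Fin r, (1 + |ρ|) ^ x := by
        refine Finset.prod_le_prod (fun _ _ => norm_nonneg _) fun i _ => ?_
        rw [Complex.norm_cpow_eq_rpow_re_of_pos (abs_pos.mpr (ha i))]
        refine (Real.rpow_le_rpow (abs_nonneg _) ?_ ht).trans
          (Real.rpow_le_rpow_of_exponent_le h1 htx)
        have := haρ i
        have := le_abs_self ρ
        linarith
    _ = _ := by simp

lemma differentiable_absPow {a : Fin r → ℝ} (ha : ∀ i, a i ≠ 0) :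
    Differentiable ℂ fun t => absPow t a := by
  unfold absPow
  refine Differentiable.fun_finsetProd fun i _ => ?_
  exact differentiable_id.const_cpow (Or.inl (by simpa using ha i))

lemma slice_zero_zero (s₀ : Fin r → ℂ) : slice s₀ 0 0 = s₀ := by
  funext j; simp [slice]

/-- The main extension step: an identity on the base domain between averages of spherical integrals
extends to every point at which all its constituents have analytic continuations and the averaged
continuation is integrable. The twist by `|det|^t` leads to a region where the averages are
uniformly bounded, and back to `t = 0`; circle averages in the direction of `slice` take care of
the zeros of `gapProd`. -/
theorem integral_germ_eq {N m : ℕ} (hrN : r ≤ N) (hrm : r ≤ m) (hNm : N ≤ m) (hz : Measurable z)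
    (hzρ : ∀ᵐ ω ∂μ, ∀ i, |z ω i| ≤ ρ) (hzi : ∀ᵐ ω ∂μ, Function.Injective (z ω))
    (hz0 : ∀ᵐ ω ∂μ, ∀ i, z ω i ≠ 0) {L La : Fin r → ZMod 2} {Lb : Fin N → ZMod 2}
    {a : Fin r → ℝ} {b : Fin N → ℝ} (ha : ∀ i, a i ≠ 0) (hb : ∀ i, b i ≠ 0) {κ : ℂ}
    (hbase : ∀ s ∈ baseDomain r, gapProd (tildeS m s) * ∫ ω, altNum s L (z ω) ∂μ =
      κ * (altNum s La a * altNum (tildeS N s) Lb b)) {s₀ : Fin r → ℂ} {F : Ω → ℂ}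
    (hF : Integrable F μ) (hFg : ∀ᵐ ω ∂μ, ∃ f : (Fin r → ℂ) → ℂ, AnalyticAt ℂ f s₀ ∧
      (∀ᶠ s in nhds s₀, f s * gapProd s = altNum s L (z ω)) ∧ f s₀ = F ω)
    {fa : (Fin r → ℂ) → ℂ} (hfa : AnalyticAt ℂ fa s₀)
    (hfa' : ∀ᶠ s in nhds s₀, fa s * gapProd s = altNum s La a)
    {fb : (Fin N → ℂ) → ℂ} (hfb : AnalyticAt ℂ fb (tildeS N s₀))
    (hfb' : ∀ᶠ s in nhds (tildeS N s₀), fb s * gapProd s = altNum s Lb b)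
    {c : (Fin N → ℂ) → ℂ} (hc : AnalyticAt ℂ c (tildeS N s₀))
    (hc' : ∀ᶠ s in nhds (tildeS N s₀), c s * gapProd (tildeS m s) = κ * gapProd s) :
    ∫ ω, F ω ∂μ = c (tildeS N s₀) * (fa s₀ * fb (tildeS N s₀)) := by
  obtain ⟨QN, hQNa, hQN, -⟩ := exists_gapProd_tildeS hrN
  obtain ⟨Qm, hQma, hQm, hQm0⟩ := exists_gapProd_tildeS hrm
  set p : ℂ → ℂ := fun u => gapProd (slice s₀ 0 u) with hp
  have hsl : ∀ {f : (Fin r → ℂ) → ℂ}, (∀ s, AnalyticAt ℂ f s) → ∀ t : ℂ,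
      Differentiable ℂ fun u => f (slice s₀ t u) := fun hf t u =>
    (hf _).differentiableAt.comp u (differentiable_slice s₀ t u)
  have hsl' : ∀ {f : (Fin r → ℂ) → ℂ}, (∀ s, AnalyticAt ℂ f s) → ∀ u : ℂ,
      Differentiable ℂ fun t => f (slice s₀ t u) := fun hf u t =>
    (hf _).differentiableAt.comp t (differentiable_slice_left s₀ u t)
  have hslc : ∀ {f : (Fin r → ℂ) → ℂ}, (∀ s, AnalyticAt ℂ f s) →
      Continuous f := fun hf => continuous_iff_continuousAt.mpr fun s => (hf s).continuousAt
  have hpd : Differentiable ℂ p := hsl analyticAt_gapProd 0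
  -- a radius that separates the zero of `p` at the origin from the others
  obtain ⟨δ, hδ, hδ1, hpδ⟩ : ∃ δ : ℝ, 0 < δ ∧ δ ≤ 1 ∧ ∀ u, u ≠ 0 → ‖u‖ ≤ δ → p u ≠ 0 := by
    have h := eventually_gapProd_slice_ne_zero s₀
    rw [eventually_nhdsWithin_iff, Metric.eventually_nhds_iff] at h
    obtain ⟨ε, hε, h⟩ := h
    refine ⟨min (ε / 2) 1, by positivity, min_le_right _ _, fun u hu huδ => h ?_ hu⟩
    rw [dist_zero_right]
    have := huδ.trans (min_le_left _ _)
    linarith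
  have hsphere : ∀ u ∈ Metric.sphere (0 : ℂ) |δ|, u ≠ 0 ∧ ‖u‖ = δ := by
    intro u hu
    rw [mem_sphere_zero_iff_norm, abs_of_pos hδ] at hu
    exact ⟨fun h => by rw [h, norm_zero] at hu; exact hδ.ne hu, hu⟩
  have hslice0 : ∀ {P : (Fin r → ℂ) → Prop}, (∀ᶠ s in nhds s₀, P s) →
      ∀ᶠ u in nhds (0 : ℂ), P (slice s₀ 0 u) := by
    intro P hP
    have h1 := (differentiable_slice s₀ 0).continuous.tendsto 0
    rw [slice_zero_zero] at h1
    exact h1.eventually hP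
  have hshift0 : ∀ {P : (Fin N → ℂ) → Prop}, (∀ᶠ s in nhds (tildeS N s₀), P s) →
      ∀ᶠ t in nhds (0 : ℂ), P (tildeS N (slice s₀ t 0)) := by
    intro P hP
    have h1 := (analyticAt_tildeS N s₀).continuousAt.tendsto
    have h2 := (differentiable_slice_left s₀ 0).continuous.tendsto 0
    rw [slice_zero_zero] at h2
    exact (h1.comp h2).eventually hP
  have htilde : ∀ (t : ℂ), Filter.Tendsto (fun u => tildeS N (slice s₀ t u)) (nhds 0)
      (nhds (tildeS N (slice s₀ t 0))) := fun t =>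
    ((analyticAt_tildeS N _).continuousAt.tendsto).comp
      ((differentiable_slice s₀ t).continuous.tendsto 0)
  have hNb : ∀ s, AnalyticAt ℂ (fun s : Fin r → ℂ => altNum (tildeS N s) Lb b) s := fun s =>
    AnalyticAt.fun_comp (g := fun s => altNum s Lb b) (analyticAt_altNum Lb hb _)
      (analyticAt_tildeS N s)
  have hNa := analyticAt_altNum La ha
  set Rf : (Fin r → ℂ) → ℂ := fun s => κ * (altNum s La a * altNum (tildeS N s) Lb b) with hRf
  have hRfa : ∀ s, AnalyticAt ℂ Rf s := fun s => analyticAt_const.mul ((hNa s).mul (hNb s))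
  set A : ℂ → ℂ := fun t => ∫ ω, absPow t (z ω) * F ω ∂μ with hA
  set B : ℂ → ℂ := fun t => Real.circleAverage (fun u => Rf (slice s₀ t u) / p u ^ 2) 0 δ with hB
  -- the identity for large `t`
  obtain ⟨T, hT⟩ := exists_integral_altNum_slice hz hzρ hzi hz0
    (G := fun s => gapProd (tildeS m s))
    (fun s => AnalyticAt.fun_comp (g := gapProd) (analyticAt_gapProd _) (analyticAt_tildeS m s))
    hRfa hbase s₀
  have hlarge : ∀ t : ℝ, T ≤ t → Qm (slice s₀ t 0) * A t = B t := by
    intro t ht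
    obtain ⟨⟨C, hC⟩, hid⟩ := hT t ht
    -- for fixed `ω` the circle average gives the value of the germ at the center
    have h1 : ∀ᵐ ω ∂μ, Real.circleAverage (fun u => Qm (slice s₀ t u) *
        altNum (slice s₀ t u) L (z ω) / p u) 0 δ =
        Qm (slice s₀ t 0) * (absPow t (z ω) * F ω) := by
      filter_upwards [hFg, hz0] with ω ⟨f, hfan, hfe, hfv⟩ h0
      have h2 := circleAverage_div_eq (H := fun u => Qm (slice s₀ t u) *
        altNum (slice s₀ t u) L (z ω)) (p := p)
        (F := fun u => Qm (slice s₀ t u) * (absPow t (z ω) * f (slice s₀ 0 u))) hδ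
        ((hsl hQma t).mul (differentiable_altNum_slice s₀ L h0 t)) hpd hpδ ?_ ?_
      · simp only [slice_zero_zero, hfv] at h2
        exact h2
      · refine (hsl hQma t 0).mul (DifferentiableAt.const_mul ?_ _)
        refine DifferentiableAt.comp 0 ?_ (differentiable_slice s₀ 0 0)
        rw [slice_zero_zero]; exact hfan.differentiableAt
      · filter_upwards [hslice0 hfe] with u hu
        rw [slice_eq_add s₀ t u, altNum_add _ _ h0, ← hu]
        ring
    have h3 : ∫ ω, Real.circleAverage (fun u => Qm (slice s₀ t u) *
        altNum (slice s₀ t u) L (z ω) / p u) 0 δ ∂μ = Qm (slice s₀ t 0) * A t := by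
      rw [integral_congr_ae h1, integral_const_mul]
    rw [← h3, integral_circleAverage]
    · refine Real.circleAverage_congr_sphere fun u hu => ?_
      obtain ⟨hu0, huδ⟩ := hsphere u hu
      have hpu := hpδ u hu0 huδ.le
      have h4 := hid u (huδ.le.trans hδ1)
      rw [hQm, gapProd_slice] at h4
      rw [integral_div, integral_const_mul, ← h4, div_eq_div_iff hpu (pow_ne_zero 2 hpu)]
      simp only [hp]
      ring
    · have c1 : Measurable fun q : Ω × ℝ => circleMap 0 δ q.2 :=
        (continuous_circleMap 0 δ).measurable.comp measurable_snd
      refine Measurable.div (((hsl hQma t).continuous.measurable.comp c1).mul ?_)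
        (hpd.continuous.measurable.comp c1)
      exact measurable_altNum ((differentiable_slice s₀ t).continuous.measurable.comp c1)
        (hz.comp measurable_fst) L
    · have h5 : ContinuousOn (fun u => Qm (slice s₀ t u) / p u) (Metric.sphere 0 |δ|) :=
        (hsl hQma t).continuous.continuousOn.div hpd.continuous.continuousOn
          fun u hu => hpδ u (hsphere u hu).1 (hsphere u hu).2.le
      obtain ⟨D, hD⟩ := (isCompact_sphere (0 : ℂ) |δ|).exists_bound_of_continuousOn h5
      refine ⟨D * C, ?_⟩
      filter_upwards [hC] with ω hω u hu
      rw [mul_div_right_comm, norm_mul]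
      exact mul_le_mul (hD u hu) (hω u ((hsphere u hu).2.le.trans hδ1)) (norm_nonneg _)
        ((norm_nonneg _).trans (hD u hu))
  -- both sides are holomorphic in the half plane
  have hAd : DifferentiableOn ℂ A {t | 0 < t.re} := by
    refine differentiableOn_integral (isOpen_lt continuous_const Complex.continuous_re)
      (fun t _ => ?_) ?_ fun t ht => ?_
    · exact ((measurable_absPow t).comp hz).aestronglyMeasurable.mul hF.aestronglyMeasurable
    · filter_upwards [hz0] with ω h0
      exact ((differentiable_absPow h0).mul_const _).differentiableOn
    · refine ⟨t.re, ht, fun ω => ((1 + |ρ|) ^ (2 * t.re)) ^ r * ‖F ω‖, hF.norm.const_mul _, ?_⟩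
      filter_upwards [hz0, hzρ] with ω h0 h1 w hw
      rw [norm_mul]
      refine mul_le_mul_of_nonneg_right ?_ (norm_nonneg _)
      have h2 : |(w - t).re| < t.re :=
        (Complex.abs_re_le_norm _).trans_lt (by rwa [← dist_eq_norm])
      rw [Complex.sub_re, abs_lt] at h2
      exact norm_absPow_le h0 h1 (by linarith) (by linarith)
  have hBd : Differentiable ℂ B := by
    have hcm : ∀ θ : ℝ, p (circleMap 0 δ θ) ≠ 0 := fun θ => by
      obtain ⟨h1, h2⟩ := hsphere _ (circleMap_mem_sphere' 0 δ θ)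
      exact hpδ _ h1 h2.le
    have hcont : Continuous fun q : ℝ × ℂ => Rf (slice s₀ q.2 (circleMap 0 δ q.1)) /
        p (circleMap 0 δ q.1) ^ 2 := by
      have c1 : Continuous fun q : ℝ × ℂ => circleMap 0 δ q.1 :=
        (continuous_circleMap 0 δ).comp continuous_fst
      refine Continuous.div ((hslc hRfa).comp ((continuous_slice s₀).comp
        (continuous_snd.prodMk c1))) ((hpd.continuous.comp c1).pow 2)
        fun q => pow_ne_zero 2 (hcm q.1)
    have h1 : DifferentiableOn ℂ (fun t => ∫ θ in Set.Ioc 0 (2 * Real.pi),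
        Rf (slice s₀ t (circleMap 0 δ θ)) / p (circleMap 0 δ θ) ^ 2) Set.univ := by
      refine differentiableOn_integral isOpen_univ (fun t _ => ?_) ?_ fun t _ => ?_
      · have c2 : Continuous fun θ : ℝ => ((θ, t) : ℝ × ℂ) := by fun_prop
        exact (hcont.comp c2).aestronglyMeasurable
      · exact Filter.Eventually.of_forall fun θ =>
          ((hsl' hRfa _).div_const _).differentiableOn
      · obtain ⟨C, hC⟩ := ((isCompact_Icc (a := (0 : ℝ)) (b := 2 * Real.pi)).prod
          (isCompact_closedBall t 1)).exists_bound_of_continuousOn hcont.continuousOn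
        refine ⟨1, one_pos, fun _ => C, integrable_const C, ?_⟩
        filter_upwards [ae_restrict_mem measurableSet_Ioc] with θ hθ w hw
        exact hC (θ, w) ⟨Set.Ioc_subset_Icc_self hθ, Metric.ball_subset_closedBall hw⟩
    intro t
    have h2 := (h1 t (Set.mem_univ t)).differentiableAt Filter.univ_mem
    simp only [hB, Real.circleAverage, intervalIntegral.integral_of_le Real.two_pi_pos.le]
    exact h2.const_smul _
  have hhalf : ∀ t : ℂ, 0 < t.re → Qm (slice s₀ t 0) * A t = B t := by
    have hUo : IsOpen {t : ℂ | 0 < t.re} := isOpen_lt continuous_const Complex.continuous_re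
    set T' : ℝ := max T 0 + 1
    have hT' : T ≤ T' ∧ 0 < T' := ⟨by have := le_max_left T 0; linarith, by positivity⟩
    have h := AnalyticOnNhd.eqOn_of_preconnected_of_frequently_eq (z₀ := (T' : ℂ))
      (((hsl' hQma 0).differentiableOn.mul hAd).analyticOnNhd hUo)
      (hBd.differentiableOn.analyticOnNhd hUo)
      ((convex_halfSpace_re_gt 0).isPreconnected) (by simpa using hT'.2) ?_
    · exact fun t ht => h ht
    · have h1 : Filter.Tendsto (fun ε : ℝ => ((T' + ε : ℝ) : ℂ)) (nhdsWithin 0 (Set.Ioi 0))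
          (nhdsWithin (T' : ℂ) {(T' : ℂ)}ᶜ) := by
        refine tendsto_nhdsWithin_iff.mpr ⟨?_, ?_⟩
        · have h2 : Continuous fun ε : ℝ => ((T' + ε : ℝ) : ℂ) := by fun_prop
          have h3 := h2.tendsto 0
          rw [add_zero] at h3
          exact h3.mono_left nhdsWithin_le_nhds
        · filter_upwards [self_mem_nhdsWithin] with ε hε
          simp only [Set.mem_compl_iff, Set.mem_singleton_iff, Complex.ofReal_inj, add_eq_left]
          exact (Set.mem_Ioi.mp hε).ne'
      refine h1.frequently (Filter.Eventually.frequently ?_)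
      filter_upwards [self_mem_nhdsWithin] with ε hε
      exact hlarge _ (by have := Set.mem_Ioi.mp hε; linarith [hT'.1])
  -- the value of the circle average for small `t`
  have hsmall : ∀ᶠ t in nhds (0 : ℂ), B t = κ * (absPow t a * fa s₀) *
      (fb (tildeS N (slice s₀ t 0)) * QN (slice s₀ t 0)) := by
    filter_upwards [hshift0 hfb'.eventually_nhds, hshift0 hfb.eventually_analyticAt] with t h1 h2
    have h3 := circleAverage_div_eq (H := fun u => Rf (slice s₀ t u)) (p := fun u => p u ^ 2)
      (F := fun u => κ * (absPow t a * fa (slice s₀ 0 u)) *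
        (fb (tildeS N (slice s₀ t u)) * QN (slice s₀ t u))) hδ (hsl hRfa t) (hpd.pow 2)
      (fun u hu huδ => pow_ne_zero 2 (hpδ u hu huδ)) ?_ ?_
    · simp only [slice_zero_zero] at h3
      exact h3
    · refine (DifferentiableAt.const_mul (DifferentiableAt.const_mul ?_ _) _).mul
        (DifferentiableAt.mul ?_ (hsl hQNa t 0))
      · refine DifferentiableAt.comp 0 ?_ (differentiable_slice s₀ 0 0)
        rw [slice_zero_zero]; exact hfa.differentiableAt
      · exact (h2.fun_comp (analyticAt_tildeS N _)).differentiableAt.comp 0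
          (differentiable_slice s₀ t 0)
    · filter_upwards [hslice0 hfa', (htilde t).eventually h1] with u h4 h5
      rw [hQN, gapProd_slice] at h5
      simp only [hRf, hp]
      rw [← h5, slice_eq_add s₀ t u, altNum_add _ _ ha, ← h4]
      ring
  -- `c` satisfies its defining identity up to the factor `gapProd`, which vanishes at most at `u = 0`
  have hcQ : ∀ᶠ t in nhds (0 : ℂ), c (tildeS N (slice s₀ t 0)) * Qm (slice s₀ t 0) =
      κ * QN (slice s₀ t 0) := by
    filter_upwards [hshift0 hc'.eventually_nhds, hshift0 hc.eventually_analyticAt] with t h1 h2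
    have hcont : ContinuousAt (fun u => c (tildeS N (slice s₀ t u)) * Qm (slice s₀ t u) -
        κ * QN (slice s₀ t u)) 0 := by
      refine ContinuousAt.sub (ContinuousAt.mul ?_ (hsl hQma t).continuous.continuousAt)
        (continuousAt_const.mul (hsl hQNa t).continuous.continuousAt)
      exact ((h2.fun_comp (analyticAt_tildeS N _)).differentiableAt.comp 0
          (differentiable_slice s₀ t 0)).continuousAt
    have h3 : ∀ᶠ u in nhdsWithin (0 : ℂ) {0}ᶜ, c (tildeS N (slice s₀ t u)) * Qm (slice s₀ t u) -
        κ * QN (slice s₀ t u) = 0 := by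
      filter_upwards [((htilde t).eventually h1).filter_mono nhdsWithin_le_nhds,
        eventually_gapProd_slice_ne_zero s₀] with u h4 h5
      rw [tildeS_tildeS hrN hNm, hQm, hQN, gapProd_slice] at h4
      refine mul_left_cancel₀ h5 ?_
      linear_combination h4
    have h4 := tendsto_nhds_unique (hcont.tendsto.mono_left nhdsWithin_le_nhds)
      ((Filter.tendsto_congr' h3).mpr tendsto_const_nhds)
    exact sub_eq_zero.mp h4
  -- letting `t` tend to zero
  have hreal : Filter.Tendsto (fun t : ℝ => (t : ℂ)) (nhdsWithin 0 (Set.Ioi 0)) (nhds 0) := by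
    have := Complex.continuous_ofReal.tendsto 0
    rw [Complex.ofReal_zero] at this
    exact this.mono_left nhdsWithin_le_nhds
  have hreal' : Filter.Tendsto (fun t : ℝ => (t : ℂ)) (nhdsWithin 0 (Set.Ioi 0))
      (nhdsWithin 0 {0}ᶜ) := by
    refine tendsto_nhdsWithin_iff.mpr ⟨hreal, ?_⟩
    filter_upwards [self_mem_nhdsWithin] with t ht
    simpa using (Set.mem_Ioi.mp ht).ne'
  have hAval : ∀ᶠ t : ℝ in nhdsWithin 0 (Set.Ioi 0), A t = c (tildeS N (slice s₀ t 0)) *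
      (absPow t a * fa s₀ * fb (tildeS N (slice s₀ t 0))) := by
    filter_upwards [hreal.eventually hsmall, hreal.eventually hcQ, hreal'.eventually (hQm0 s₀),
      self_mem_nhdsWithin] with t h1 h2 h3 h4
    have h5 := hhalf t (by simpa using h4)
    have h6 : Qm (slice s₀ t 0) ≠ 0 := by
      have e : slice s₀ (t : ℂ) 0 = fun j => s₀ j + t := by funext j; simp [slice]
      rw [e]; exact h3
    refine mul_left_cancel₀ h6 ?_
    rw [h5, h1]
    linear_combination -(absPow t a * fa s₀ * fb (tildeS N (slice s₀ t 0))) * h2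
  -- the averaged continuation is integrable, so that it dominates its twists for `0 < t ≤ 1`
  have hAlim : Filter.Tendsto (fun t : ℝ => A t) (nhdsWithin 0 (Set.Ioi 0))
      (nhds (∫ ω, F ω ∂μ)) := by
    refine tendsto_integral_filter_of_dominated_convergence
      (fun ω => ((1 + |ρ|) ^ (1 : ℝ)) ^ r * ‖F ω‖) ?_ ?_ (hF.norm.const_mul _) ?_
    · exact Filter.Eventually.of_forall fun t =>
        ((measurable_absPow _).comp hz).aestronglyMeasurable.mul hF.aestronglyMeasurable
    · have h1 : ∀ᶠ t : ℝ in nhdsWithin 0 (Set.Ioi 0), t ≤ 1 :=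
        (eventually_le_nhds one_pos).filter_mono nhdsWithin_le_nhds
      filter_upwards [self_mem_nhdsWithin, h1] with t ht ht1
      filter_upwards [hz0, hzρ] with ω h2 h3
      rw [norm_mul]
      exact mul_le_mul_of_nonneg_right (norm_absPow_le h2 h3 (by simpa using (Set.mem_Ioi.mp ht).le)
        (by simpa using ht1)) (norm_nonneg _)
    · filter_upwards [hz0] with ω h0
      have h2 := ((differentiable_absPow h0).continuous.tendsto 0).comp hreal
      have h3 : absPow 0 (z ω) = 1 := by simp [absPow]
      rw [h3] at h2
      simpa using h2.mul_const (F ω)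
  have hRlim : Filter.Tendsto (fun t : ℝ => c (tildeS N (slice s₀ t 0)) *
      (absPow t a * fa s₀ * fb (tildeS N (slice s₀ t 0)))) (nhdsWithin 0 (Set.Ioi 0))
      (nhds (c (tildeS N s₀) * (1 * fa s₀ * fb (tildeS N s₀)))) := by
    have h1 : Filter.Tendsto (fun t : ℝ => tildeS N (slice s₀ (t : ℂ) 0))
        (nhdsWithin 0 (Set.Ioi 0)) (nhds (tildeS N s₀)) := by
      have h1 := (analyticAt_tildeS N s₀).continuousAt.tendsto
      have h2 := (differentiable_slice_left s₀ 0).continuous.tendsto 0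
      rw [slice_zero_zero] at h2
      exact (h1.comp h2).comp hreal
    have h2 := ((differentiable_absPow ha).continuous.tendsto 0).comp hreal
    have h3 : absPow 0 a = 1 := by simp [absPow]
    rw [h3] at h2
    exact (hc.continuousAt.tendsto.comp h1).mul
      ((h2.mul_const _).mul (hfb.continuousAt.tendsto.comp h1))
  have := tendsto_nhds_unique ((Filter.tendsto_congr' hAval).mp hAlim) hRlim
  rw [this, one_mul]

end Extension

/-! ### The nonzero spectrum of Hermitian matrices of rank `n` -/

/-- The Hermitian matrix of rank at most `n` with eigenvectors given by `k` and with the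
eigenvalues `a`, completed by zeros. -/
def genMat {l n : ℕ} (k : K l) (a : Fin n → ℝ) : Matrix (Fin l) (Fin l) ℂ :=
  k.1 * (Proj l n * (diagonal fun i => (a i : ℂ)) * Proj n l) * k.1ᴴ

/-- The Hermitian `l × l` matrices of rank `n` whose nonzero eigenvalues are simple. -/
def GenH (l n : ℕ) : Set (Matrix (Fin l) (Fin l) ℂ) :=
  {x | ∃ (k : K l) (a : Fin n → ℝ), StrictMono a ∧ (∀ i, a i ≠ 0) ∧ x = genMat k a}

open Classical in
/-- The nonzero eigenvalues of an element of `GenH l n` in increasing order (and `0` outside of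
`GenH l n`). -/
def spec (l n : ℕ) (x : Matrix (Fin l) (Fin l) ℂ) : Fin n → ℝ :=
  if h : x ∈ GenH l n then h.choose_spec.choose else 0

lemma spec_spec {l n : ℕ} {x : Matrix (Fin l) (Fin l) ℂ} (h : x ∈ GenH l n) :
    ∃ k : K l, StrictMono (spec l n x) ∧ (∀ i, spec l n x i ≠ 0) ∧ x = genMat k (spec l n x) := by
  rw [spec, dif_pos h]
  exact ⟨h.choose, h.choose_spec.choose_spec⟩

lemma continuous_genMat {l n : ℕ} :
    Continuous fun p : K l × (Fin n → ℝ) => genMat p.1 p.2 := by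
  have h1 : Continuous fun p : K l × (Fin n → ℝ) => p.1.1 :=
    (continuous_coeK l).comp continuous_fst
  have h2 : Continuous fun p : K l × (Fin n → ℝ) => diagonal fun i => (p.2 i : ℂ) := by
    refine Continuous.matrix_diagonal ?_
    fun_prop
  unfold genMat
  exact (h1.matrix_mul ((continuous_const.matrix_mul h2).matrix_mul continuous_const)).matrix_mul
    h1.matrix_conjTranspose

lemma conj_genMat {l n : ℕ} (u k : K l) (a : Fin n → ℝ) :
    u.1 * genMat k a * u.1ᴴ = genMat (u * k) a := by
  simp only [genMat, coeK_mul, conjTranspose_mul, Matrix.mul_assoc]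

lemma det_sub_genMat {l n : ℕ} (hnl : n ≤ l) (k : K l) (a : Fin n → ℝ) {t : ℝ} (ht : t ≠ 0) :
    (scalar (Fin l) (t : ℂ) - genMat k a).det = 0 ↔ t ∈ Set.range a := by
  have h1 : scalar (Fin l) (t : ℂ) - genMat k a =
      k.1 * (diagonal fun i : Fin l => (t : ℂ) - if h : (i : ℕ) < n then (a ⟨i, h⟩ : ℂ) else 0) *
        k.1ᴴ := by
    have h2 : (diagonal fun i : Fin l => (t : ℂ) - if h : (i : ℕ) < n then (a ⟨i, h⟩ : ℂ) else 0) =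
        scalar (Fin l) (t : ℂ) - Proj l n * (diagonal fun i => (a i : ℂ)) * Proj n l := by
      rw [Proj_diagonal_Proj, scalar_apply, diagonal_sub]
    rw [h2, Matrix.mul_sub, Matrix.sub_mul, genMat]
    congr 1
    rw [← (scalar_commute (t : ℂ) (fun _ => Commute.all _ _) k.1).eq, Matrix.mul_assoc,
      coeK_mul_conjTranspose, Matrix.mul_one]
  have h3 : (k.1ᴴ).det ≠ 0 := by
    rw [← coeK_inv]; exact det_coeK_ne_zero _
  rw [h1, det_mul, det_mul, mul_eq_zero, mul_eq_zero, det_diagonal, Finset.prod_eq_zero_iff]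
  simp only [det_coeK_ne_zero, h3, false_or, or_false, Finset.mem_univ, true_and, Set.mem_range]
  constructor
  · rintro ⟨i, hi⟩
    by_cases h : (i : ℕ) < n
    · rw [dif_pos h, sub_eq_zero] at hi
      exact ⟨⟨i, h⟩, by exact_mod_cast hi.symm⟩
    · rw [dif_neg h, sub_zero] at hi
      exact absurd (by exact_mod_cast hi) ht
  · rintro ⟨i, rfl⟩
    refine ⟨Fin.castLE hnl i, ?_⟩
    rw [dif_pos (by simp)]
    simp

lemma range_eq_of_genMat {l n : ℕ} (hnl : n ≤ l) (k : K l) {a : Fin n → ℝ} (ha : ∀ i, a i ≠ 0) :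
    Set.range a = {t : ℝ | t ≠ 0 ∧ (scalar (Fin l) (t : ℂ) - genMat k a).det = 0} := by
  ext t
  constructor
  · intro h
    have ht : t ≠ 0 := by obtain ⟨i, rfl⟩ := h; exact ha i
    exact ⟨ht, (det_sub_genMat hnl k a ht).mpr h⟩
  · rintro ⟨ht, h⟩
    exact (det_sub_genMat hnl k a ht).mp h

lemma spec_genMat {l n : ℕ} (hnl : n ≤ l) (k : K l) {a : Fin n → ℝ} (ha : StrictMono a)
    (ha0 : ∀ i, a i ≠ 0) : spec l n (genMat k a) = a := by
  obtain ⟨k', h1, h2, h3⟩ := spec_spec (x := genMat k a) ⟨k, a, ha, ha0, rfl⟩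
  refine (StrictMono.range_inj h1 ha).mp ?_
  rw [range_eq_of_genMat hnl k' h2, range_eq_of_genMat hnl k ha0, ← h3]

lemma measurableSet_genMat_image {l n : ℕ} {C : Set (Fin n → ℝ)} (hC : IsClosed C) :
    MeasurableSet {x | ∃ (k : K l) (a : Fin n → ℝ), StrictMono a ∧ (∀ i, a i ≠ 0) ∧ a ∈ C ∧
      x = genMat k a} := by
  have hopen : IsOpen {a : Fin n → ℝ | StrictMono a ∧ ∀ i, a i ≠ 0} := by
    have : {a : Fin n → ℝ | StrictMono a ∧ ∀ i, a i ≠ 0} =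
        (⋂ i, ⋂ j, ⋂ _ : i < j, {a | a i < a j}) ∩ ⋂ i, {a | a i ≠ 0} := by
      ext p
      simp [StrictMono]
    rw [this]
    refine IsOpen.inter ?_ ?_
    · exact isOpen_iInter_of_finite fun i => isOpen_iInter_of_finite fun j =>
        isOpen_iInter_of_finite fun _ => isOpen_lt (by fun_prop) (by fun_prop)
    · exact isOpen_iInter_of_finite fun i => isOpen_ne_fun (by fun_prop) (by fun_prop)
  -- an open set of spectra is σ-compact, and so is its image under a continuous map
  obtain ⟨S, hS, -, hSU, -⟩ := hopen.exists_iUnion_isClosed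
  have h1 : ∀ i, IsSigmaCompact (Prod.snd ⁻¹' (S i ∩ C) : Set (K l × (Fin n → ℝ))) := fun i =>
    IsSigmaCompact.of_isClosed_subset isSigmaCompact_univ
      (((hS i).inter hC).preimage continuous_snd) (Set.subset_univ _)
  have h2 : IsSigmaCompact ((fun p : K l × (Fin n → ℝ) => genMat p.1 p.2) ''
      ⋃ i, Prod.snd ⁻¹' (S i ∩ C)) := (isSigmaCompact_iUnion _ h1).image continuous_genMat
  obtain ⟨Z, hZ, hZU⟩ := h2
  have h3 : {x | ∃ (k : K l) (a : Fin n → ℝ), StrictMono a ∧ (∀ i, a i ≠ 0) ∧ a ∈ C ∧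
      x = genMat k a} = ⋃ i, Z i := by
    rw [hZU, ← Set.preimage_iUnion, ← Set.iUnion_inter, hSU]
    ext x
    constructor
    · rintro ⟨k, a, h1, h2, h3, rfl⟩
      exact ⟨(k, a), ⟨⟨h1, h2⟩, h3⟩, rfl⟩
    · rintro ⟨⟨k, a⟩, ⟨⟨h1, h2⟩, h3⟩, rfl⟩
      exact ⟨k, a, h1, h2, h3, rfl⟩
  rw [h3]
  exact MeasurableSet.iUnion fun i => (hZ i).measurableSet

lemma measurableSet_GenH (l n : ℕ) : MeasurableSet (GenH l n) := by
  have := measurableSet_genMat_image (l := l) (n := n) isClosed_univ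
  simpa [GenH] using this

lemma measurable_spec {l n : ℕ} (hnl : n ≤ l) : Measurable (spec l n) := by
  refine measurable_of_isClosed fun C hC => ?_
  have h1 : spec l n ⁻¹' C = {x | ∃ (k : K l) (a : Fin n → ℝ), StrictMono a ∧ (∀ i, a i ≠ 0) ∧
      a ∈ C ∧ x = genMat k a} ∪ ((GenH l n)ᶜ ∩ {_x | (0 : Fin n → ℝ) ∈ C}) := by
    ext x
    by_cases hx : x ∈ GenH l n
    · simp only [Set.mem_preimage, Set.mem_union, Set.mem_ofPred_eq, Set.mem_inter_iff,
        Set.mem_compl_iff, hx, not_true, false_and, or_false]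
      constructor
      · intro h
        obtain ⟨k, h1, h2, h3⟩ := spec_spec hx
        exact ⟨k, _, h1, h2, h, h3⟩
      · rintro ⟨k, a, h1, h2, h3, rfl⟩
        rwa [spec_genMat hnl k h1 h2]
    · have h2 : ¬ ∃ (k : K l) (a : Fin n → ℝ), StrictMono a ∧ (∀ i, a i ≠ 0) ∧
          a ∈ C ∧ x = genMat k a := fun ⟨k, a, h1, h2, _, h3⟩ => hx ⟨k, a, h1, h2, h3⟩
      simp only [Set.mem_preimage, Set.mem_union, Set.mem_ofPred_eq, h2, Set.mem_inter_iff,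
        Set.mem_compl_iff, hx, not_false_eq_true, true_and, false_or]
      rw [spec, dif_neg hx]
  rw [h1]
  exact (measurableSet_genMat_image hC).union
    ((measurableSet_GenH l n).compl.inter (MeasurableSet.const _))

lemma abs_spec_le {l n : ℕ} (hnl : n ≤ l) {x : Matrix (Fin l) (Fin l) ℂ} (hx : x ∈ GenH l n)
    (i : Fin n) : |spec l n x i| ≤ ∑ p, ∑ q, ‖x p q‖ := by
  obtain ⟨k, -, -, h⟩ := spec_spec hx
  set a := spec l n x
  have h1 : k.1ᴴ * x * k.1 = Proj l n * (diagonal fun i => (a i : ℂ)) * Proj n l := by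
    rw [h, genMat]
    calc _ = (k.1ᴴ * k.1) * (Proj l n * (diagonal fun i => (a i : ℂ)) * Proj n l) *
          (k.1ᴴ * k.1) := by simp only [Matrix.mul_assoc]
      _ = _ := by rw [coeK_conjTranspose_mul, Matrix.one_mul, Matrix.mul_one]
  have h2 : (a i : ℂ) = ∑ q, (∑ p, (k.1ᴴ) (Fin.castLE hnl i) p * x p q) *
      k.1 q (Fin.castLE hnl i) := by
    have := congrFun (congrFun h1 (Fin.castLE hnl i)) (Fin.castLE hnl i)
    rw [Proj_diagonal_Proj] at this
    simpa [Matrix.mul_apply] using this.symm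
  have h3 : |a i| = ‖(a i : ℂ)‖ := by simp
  rw [h3, h2, Finset.sum_comm]
  refine (norm_sum_le _ _).trans (Finset.sum_le_sum fun q _ => ?_)
  rw [norm_mul]
  calc _ ≤ ‖∑ p, (k.1ᴴ) (Fin.castLE hnl i) p * x p q‖ * 1 :=
        mul_le_mul_of_nonneg_left (norm_coeK_le k _ _) (norm_nonneg _)
    _ ≤ ∑ p, ‖x p q‖ := by
        rw [mul_one]
        refine (norm_sum_le _ _).trans (Finset.sum_le_sum fun p _ => ?_)
        rw [norm_mul]
        have : ‖(k.1ᴴ) (Fin.castLE hnl i) p‖ ≤ 1 := by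
          rw [conjTranspose_apply, norm_star]; exact norm_coeK_le k _ _
        exact mul_le_of_le_one_left (norm_nonneg _) this

/-- A Hermitian matrix whose discriminant and determinant do not vanish has a simple nonzero
spectrum. -/
lemma conj_Proj_mem_GenH {l n : ℕ} (hnl : n ≤ l) (k : K l) {y : Matrix (Fin n) (Fin n) ℂ}
    (hy : yᴴ = y) (hh : hankel y ≠ 0) (hd : y.det ≠ 0) :
    k.1 * (Proj l n * y * Proj n l) * k.1ᴴ ∈ GenH l n := by
  have hy' : y.IsHermitian := hy
  set e := hy'.eigenvalues with he
  set u : K n := hy'.eigenvectorUnitary with hu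
  have h1 : y = u.1 * (diagonal fun i => (e i : ℂ)) * u.1ᴴ := by
    have h1 := hy'.spectral_theorem
    rw [Unitary.conjStarAlgAut_apply] at h1
    exact h1
  have he0 : ∀ i, e i ≠ 0 := by
    intro i hi
    apply hd
    rw [h1, det_mul, det_mul, det_diagonal, Finset.prod_eq_zero (Finset.mem_univ i)] <;> simp [hi]
  have hinj : Function.Injective e := by
    have h2 : hankel y = (vandermonde fun i => (e i : ℂ)).det ^ 2 := by
      rw [← hankel_diagonal, h1, hankel_conj]
    rw [h2] at hh
    have h3 := det_vandermonde_ne_zero_iff.mp (fun h => hh (by rw [h]; simp))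
    exact fun i j hij => h3 (by simp [hij])
  set σ := Tuple.sort e
  have hmono : StrictMono (e ∘ σ) :=
    (Tuple.monotone_sort e).strictMono_of_injective (hinj.comp σ.injective)
  have h2 : (diagonal fun i => (e i : ℂ)) =
      ((permK σ)⁻¹).1 * (diagonal fun i => (((e ∘ σ) i : ℝ) : ℂ)) * ((permK σ)⁻¹).1ᴴ := by
    have := permK_conj_diagonal σ fun i => (e i : ℂ)
    have h3 : (diagonal fun i => (((e ∘ σ) i : ℝ) : ℂ)) =
      diagonal ((fun i => (e i : ℂ)) ∘ σ) := rfl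
    rw [h3, ← this, coeK_inv, conjTranspose_conjTranspose]
    calc _ = 1 * (diagonal fun i => (e i : ℂ)) * 1 := by rw [Matrix.one_mul, Matrix.mul_one]
      _ = _ := by rw [← coeK_conjTranspose_mul (permK σ)]; simp only [Matrix.mul_assoc]
  refine ⟨k * extK hnl (u * (permK σ)⁻¹), e ∘ σ, hmono, fun i => he0 _, ?_⟩
  have h4 := extK_mul_Proj hnl (u * (permK σ)⁻¹)
  have h5 := congrArg conjTranspose h4
  simp only [conjTranspose_mul, Proj_conjTranspose] at h5
  rw [genMat, coeK_mul, conjTranspose_mul]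
  calc _ = k.1 * (Proj l n * (u * (permK σ)⁻¹ : K n).1 * (diagonal fun i => (((e ∘ σ) i : ℝ) : ℂ)) *
        ((u * (permK σ)⁻¹ : K n).1ᴴ * Proj n l)) * k.1ᴴ := by
        rw [h1, h2, coeK_mul, conjTranspose_mul]; simp only [Matrix.mul_assoc]
    _ = _ := by rw [← h4, ← h5]; simp only [Matrix.mul_assoc]

/-- The leading minors of order at most `n` of a generic rotation of a matrix of rank `n`. -/
lemma minor_conj_ae_ne_zero_of_mem_GenH {l n j : ℕ} (hnl : n ≤ l) (hj : j ≤ n)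
    {x : Matrix (Fin l) (Fin l) ℂ} (hx : x ∈ GenH l n) :
    ∀ᵐ u ∂(haarK l), minor j (u.1 * x * u.1ᴴ) ≠ 0 := by
  obtain ⟨k, a, -, h0, rfl⟩ := hx
  refine minor_conj_ae_ne_zero (hj.trans hnl) _ (k⁻¹).1 ?_
  rw [conj_genMat, inv_mul_cancel, genMat]
  have h1 : minor j ((1 : K l).1 * (Proj l n * (diagonal fun i => (a i : ℂ)) * Proj n l) *
      (1 : K l).1ᴴ) = ∏ i : Fin j, (a (Fin.castLE hj i) : ℂ) := by
    have h2 : ((1 : K l).1 : Matrix (Fin l) (Fin l) ℂ) = 1 := rfl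
    rw [h2, conjTranspose_one, Matrix.one_mul, Matrix.mul_one, minor]
    have h3 : Proj j l * (Proj l n * (diagonal fun i => (a i : ℂ)) * Proj n l) * Proj l j =
        (Proj j l * Proj l n) * (diagonal fun i => (a i : ℂ)) * (Proj n l * Proj l j) := by
      simp only [Matrix.mul_assoc]
    rw [h3, Proj_mul_Proj (Or.inr hnl), Proj_mul_Proj (Or.inl hnl)]
    have h4 : Proj j n * (diagonal fun i => (a i : ℂ)) * Proj n j =
        diagonal fun i => (a (Fin.castLE hj i) : ℂ) := by
      ext p q
      rw [mul_Proj_apply hj, Proj_mul_apply hj, diagonal_apply, diagonal_apply]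
      simp [Fin.ext_iff]
    rw [h4, det_diagonal]
  rw [h1]
  exact Finset.prod_ne_zero_iff.mpr fun i _ => Complex.ofReal_ne_zero.mpr (h0 _)

/-! ### The product formula for fixed factors -/

lemma sphInt_mul_gapProd_of_mem_GenH {l n : ℕ} (hnl : n ≤ l) {s : Fin n → ℂ}
    (hs : s ∈ baseDomain n) (L : Fin n → ZMod 2) {x : Matrix (Fin l) (Fin l) ℂ}
    (hx : x ∈ GenH l n) :
    sphInt s L x * gapProd s = normIntegral l n s * altNum s L (spec l n x) := by
  obtain ⟨k, h1, -, h3⟩ := spec_spec hx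
  conv_lhs => rw [h3, genMat, sphInt_conj_Proj_diagonal hnl hs L k]
  rw [mul_assoc, sphInt_mul_gapProd hs L h1.injective]

lemma sphNorm_gram_eq_sphInt {l m n r : ℕ} (hnl : n ≤ l) (hrn : r ≤ n)
    {g : Matrix (Fin l) (Fin m) ℂ} (hg : g * gᴴ ∈ GenH l n) (s : Fin r → ℂ) (L : Fin r → ZMod 2) :
    sphNorm s (g * gᴴ) = sphInt s L (g * gᴴ) :=
  (sphInt_gram s L g fun _ hj => minor_conj_ae_ne_zero_of_mem_GenH hnl (hj.trans hrn) hg).symm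

/-- The average over rotations of the second factor, in terms of the nonzero spectra. -/
lemma integral_altNum_spec {l m r : ℕ} (hrl : r ≤ l) (hrm : r ≤ m) {s : Fin r → ℂ}
    (hs : s ∈ baseDomain r) (L : Fin r → ZMod 2) {g : Matrix (Fin l) (Fin m) ℂ}
    {x : Matrix (Fin m) (Fin m) ℂ}
    (hg : ∀ᵐ u ∂(haarK l), minor r (u.1 * (g * gᴴ) * u.1ᴴ) ≠ 0)
    (hz : ∀ᵐ k ∂(haarK m), g * (k.1 * x * k.1ᴴ) * gᴴ ∈ GenH l r) :
    normIntegral l r s * ∫ k, altNum s L (spec l r (g * (k.1 * x * k.1ᴴ) * gᴴ)) ∂(haarK m) =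
      sphNorm s (g * gᴴ) * sphInt s L x * gapProd s := by
  rw [← integral_sphInt_conj hrm hs L g x hg, ← integral_mul_const, ← integral_const_mul]
  refine integral_congr_ae ?_
  filter_upwards [hz] with k hk
  exact (sphInt_mul_gapProd_of_mem_GenH hrl hs L hk).symm

lemma gapProd_tildeS_mul_sphInt {m N r : ℕ} (hrN : r ≤ N) (hNm : N ≤ m) {κ : ℂ}
    (hκ : ∀ s ∈ baseDomain N, normIntegral m N s * gapProd (tildeS m s) = κ * gapProd s)
    {s : Fin r → ℂ} (hs : s ∈ baseDomain r) (L : Fin N → ZMod 2) {p : ℕ} (hNp : N ≤ p)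
    {x : Matrix (Fin p) (Fin p) ℂ} (hx : x ∈ GenH p N) :
    gapProd (tildeS m s) * (normIntegral m N (tildeS N s) * sphInt (tildeS N s) L x) =
      κ * (normIntegral p N (tildeS N s) * altNum (tildeS N s) L (spec p N x)) := by
  have hs' := tildeS_mem_baseDomain hrN hs
  rw [← sphInt_mul_gapProd_of_mem_GenH hNp hs' L hx]
  have := hκ _ hs'
  rw [tildeS_tildeS hrN hNm] at this
  linear_combination sphInt (tildeS N s) L x * this

lemma base_identity_left {l m N r : ℕ} (hrN : r ≤ N) (hNm : N ≤ m) (hrl : r ≤ l) {κ : ℂ}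
    (hκ : ∀ s ∈ baseDomain N, normIntegral m N s * gapProd (tildeS m s) = κ * gapProd s)
    {s : Fin r → ℂ} (hs : s ∈ baseDomain r) (L : Fin r → ZMod 2) {g : Matrix (Fin l) (Fin m) ℂ}
    {x : Matrix (Fin m) (Fin m) ℂ} (hg : g * gᴴ ∈ GenH l r) (hx : x ∈ GenH m N)
    (hz : ∀ᵐ k ∂(haarK m), g * (k.1 * x * k.1ᴴ) * gᴴ ∈ GenH l r) :
    gapProd (tildeS m s) * ∫ k, altNum s L (spec l r (g * (k.1 * x * k.1ᴴ) * gᴴ)) ∂(haarK m) =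
      κ * (altNum s (Lstd r) (spec l r (g * gᴴ)) *
        altNum (tildeS N s) (tildeL N L) (spec m N x)) := by
  have h1 := integral_altNum_spec hrl (hrN.trans hNm) hs L
    (minor_conj_ae_ne_zero_of_mem_GenH hrl le_rfl hg) hz
  rw [sphNorm_gram_eq_sphInt hrl le_rfl hg s (Lstd r), ← sphInt_tilde hrN s L x] at h1
  have h2 := sphInt_mul_gapProd_of_mem_GenH hrl hs (Lstd r) hg
  have h3 := gapProd_tildeS_mul_sphInt hrN hNm hκ hs (tildeL N L) hNm hx
  have c1 := normIntegral_ne_zero hrl hs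
  have c2 := normIntegral_ne_zero hNm (tildeS_mem_baseDomain hrN hs)
  apply mul_left_cancel₀ (mul_ne_zero c1 c2)
  linear_combination gapProd (tildeS m s) * normIntegral m N (tildeS N s) * h1 +
    gapProd (tildeS m s) * normIntegral m N (tildeS N s) *
      sphInt (tildeS N s) (tildeL N L) x * h2 +
    normIntegral l r s * altNum s (Lstd r) (spec l r (g * gᴴ)) * h3

lemma base_identity_right {l m N r : ℕ} (hrN : r ≤ N) (hNm : N ≤ m) (hNl : N ≤ l) {κ : ℂ}
    (hκ : ∀ s ∈ baseDomain N, normIntegral m N s * gapProd (tildeS m s) = κ * gapProd s)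
    {s : Fin r → ℂ} (hs : s ∈ baseDomain r) (L : Fin r → ZMod 2) {g : Matrix (Fin l) (Fin m) ℂ}
    {x : Matrix (Fin m) (Fin m) ℂ} (hg : g * gᴴ ∈ GenH l N) (hx : x ∈ GenH m r)
    (hz : ∀ᵐ k ∂(haarK m), g * (k.1 * x * k.1ᴴ) * gᴴ ∈ GenH l r) :
    gapProd (tildeS m s) * ∫ k, altNum s L (spec l r (g * (k.1 * x * k.1ᴴ) * gᴴ)) ∂(haarK m) =
      κ * (altNum s L (spec m r x) *
        altNum (tildeS N s) (Lstd N) (spec l N (g * gᴴ))) := by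
  have h1 := integral_altNum_spec (hrN.trans hNl) (hrN.trans hNm) hs L
    (minor_conj_ae_ne_zero_of_mem_GenH hNl hrN hg) hz
  rw [sphNorm_gram_eq_sphInt hNl hrN hg s (Lstd r), ← sphInt_tilde hrN s (Lstd r),
    tildeL_Lstd hrN] at h1
  have h2 := sphInt_mul_gapProd_of_mem_GenH (hrN.trans hNm) hs L hx
  have h3 := gapProd_tildeS_mul_sphInt hrN hNm hκ hs (Lstd N) hNl hg
  have c1 := normIntegral_ne_zero (hrN.trans hNl) hs
  have e1 := normIntegral_chain hrN hNl hs
  have e2 := normIntegral_chain hrN hNm hs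
  apply mul_left_cancel₀ c1
  linear_combination gapProd (tildeS m s) * h1 +
    gapProd (tildeS m s) * sphInt (tildeS N s) (Lstd N) (g * gᴴ) * h2 +
    gapProd (tildeS m s) * sphInt (tildeS N s) (Lstd N) (g * gᴴ) * altNum s L (spec m r x) * e2 +
    normIntegral N r s * altNum s L (spec m r x) * h3 -
    κ * altNum s L (spec m r x) * altNum (tildeS N s) (Lstd N) (spec l N (g * gᴴ)) * e1

lemma exists_germ_Phi_spec {l n : ℕ} (hnl : n ≤ l) {s₀ : Fin n → ℂ} {L : Fin n → ZMod 2}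
    {x : Matrix (Fin l) (Fin l) ℂ} (hx : x ∈ GenH l n) (h : PhiDefined s₀ L x) :
    ∃ F : (Fin n → ℂ) → ℂ, AnalyticAt ℂ F s₀ ∧
      (∀ᶠ s in nhds s₀, F s * gapProd s = altNum s L (spec l n x)) ∧ F s₀ = Phi s₀ L x := by
  obtain ⟨k, h1, h2, h3⟩ := spec_spec hx
  rw [h3] at h
  obtain ⟨F, hF, hF', hF''⟩ := exists_germ_Phi hnl h1.injective h2 h
  exact ⟨F, hF, hF', hF''.trans (by rw [← genMat, ← h3])⟩

lemma exists_abs_spec_conj_le {l m r : ℕ} (hrl : r ≤ l) (g : Matrix (Fin l) (Fin m) ℂ)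
    (x : Matrix (Fin m) (Fin m) ℂ) : ∃ ρ : ℝ, ∀ k : K m, g * (k.1 * x * k.1ᴴ) * gᴴ ∈ GenH l r →
      ∀ i, |spec l r (g * (k.1 * x * k.1ᴴ) * gᴴ) i| ≤ ρ := by
  have hc : Continuous fun k : K m => ∑ p, ∑ q, ‖(g * (k.1 * x * k.1ᴴ) * gᴴ) p q‖ := by
    have h1 : Continuous fun k : K m => g * (k.1 * x * k.1ᴴ) * gᴴ :=
      (continuous_const.matrix_mul (((continuous_coeK m).matrix_mul continuous_const).matrix_mul
        (continuous_coeK m).matrix_conjTranspose)).matrix_mul continuous_const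
    exact continuous_finsetSum _ fun p _ => continuous_finsetSum _ fun q _ =>
      (h1.matrix_elem p q).norm
  obtain ⟨R, hR⟩ := isCompact_univ.exists_bound_of_continuousOn hc.continuousOn
  exact ⟨R, fun k hk i => (abs_spec_le hrl hk i).trans
    ((Real.le_norm_self _).trans (hR k (Set.mem_univ k)))⟩

lemma measurable_spec_conj {l m r : ℕ} (hrl : r ≤ l) (g : Matrix (Fin l) (Fin m) ℂ)
    (x : Matrix (Fin m) (Fin m) ℂ) :
    Measurable fun k : K m => spec l r (g * (k.1 * x * k.1ᴴ) * gᴴ) := by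
  have h1 : Continuous fun k : K m => g * (k.1 * x * k.1ᴴ) * gᴴ :=
    (continuous_const.matrix_mul (((continuous_coeK m).matrix_mul continuous_const).matrix_mul
      (continuous_coeK m).matrix_conjTranspose)).matrix_mul continuous_const
  exact (measurable_spec hrl).comp h1.measurable

/-- The product formula when the rank of the first factor is at most the rank of the second. -/
theorem integral_Phi_conj_left {l m N r : ℕ} (hrN : r ≤ N) (hNm : N ≤ m) (hrl : r ≤ l)
    {s : Fin r → ℂ} {L : Fin r → ZMod 2} {g : Matrix (Fin l) (Fin m) ℂ}
    {x : Matrix (Fin m) (Fin m) ℂ} (hg : g * gᴴ ∈ GenH l r) (hx : x ∈ GenH m N)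
    (hz : ∀ᵐ k ∂(haarK m), g * (k.1 * x * k.1ᴴ) * gᴴ ∈ GenH l r)
    (hzd : ∀ᵐ k ∂(haarK m), PhiDefined s L (g * (k.1 * x * k.1ᴴ) * gᴴ))
    (hzi : Integrable (fun k : K m => Phi s L (g * (k.1 * x * k.1ᴴ) * gᴴ)) (haarK m))
    (hgd : PhiDefined s (Lstd r) (g * gᴴ))
    (hxd : PhiDefined (tildeS N s) (tildeL N L) x) (hc : NormCDefined m N (tildeS N s)) :
    ∫ k : K m, Phi s L (g * (k.1 * x * k.1ᴴ) * gᴴ) ∂(haarK m) =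
      normC m N (tildeS N s) *
        (Phi s (Lstd r) (g * gᴴ) * Phi (tildeS N s) (tildeL N L) x) := by
  obtain ⟨κ, -, hκ⟩ := exists_normIntegral_eq hNm
  obtain ⟨ρ, hρ⟩ := exists_abs_spec_conj_le hrl g x
  obtain ⟨fa, hfa, hfa', hfa''⟩ := exists_germ_Phi_spec hrl hg hgd
  obtain ⟨fb, hfb, hfb', hfb''⟩ := exists_germ_Phi_spec hNm hx hxd
  obtain ⟨c, hc, hc', hc''⟩ := exists_germ_normC hκ hc
  rw [← hfa'', ← hfb'', ← hc'']
  obtain ⟨-, -, ha0, -⟩ := spec_spec hg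
  obtain ⟨-, -, hb0, -⟩ := spec_spec hx
  refine integral_germ_eq hrN (hrN.trans hNm) hNm (measurable_spec_conj hrl g x) (ρ := ρ)
    ?_ ?_ ?_ ha0 hb0 (fun s hs => base_identity_left hrN hNm hrl hκ hs L hg hx hz) hzi ?_
    hfa hfa' hfb hfb' hc hc'
  · filter_upwards [hz] with k hk using hρ k hk
  · filter_upwards [hz] with k hk
    obtain ⟨-, h, -, -⟩ := spec_spec hk
    exact h.injective
  · filter_upwards [hz] with k hk
    obtain ⟨-, -, h, -⟩ := spec_spec hk
    exact h
  · filter_upwards [hz, hzd] with k hk hkd using exists_germ_Phi_spec hrl hk hkd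

/-- The product formula when the rank of the second factor is at most the rank of the first. -/
theorem integral_Phi_conj_right {l m N r : ℕ} (hrN : r ≤ N) (hNm : N ≤ m) (hNl : N ≤ l)
    {s : Fin r → ℂ} {L : Fin r → ZMod 2} {g : Matrix (Fin l) (Fin m) ℂ}
    {x : Matrix (Fin m) (Fin m) ℂ} (hg : g * gᴴ ∈ GenH l N) (hx : x ∈ GenH m r)
    (hz : ∀ᵐ k ∂(haarK m), g * (k.1 * x * k.1ᴴ) * gᴴ ∈ GenH l r)
    (hzd : ∀ᵐ k ∂(haarK m), PhiDefined s L (g * (k.1 * x * k.1ᴴ) * gᴴ))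
    (hzi : Integrable (fun k : K m => Phi s L (g * (k.1 * x * k.1ᴴ) * gᴴ)) (haarK m))
    (hgd : PhiDefined (tildeS N s) (Lstd N) (g * gᴴ))
    (hxd : PhiDefined s L x) (hc : NormCDefined m N (tildeS N s)) :
    ∫ k : K m, Phi s L (g * (k.1 * x * k.1ᴴ) * gᴴ) ∂(haarK m) =
      normC m N (tildeS N s) * (Phi (tildeS N s) (Lstd N) (g * gᴴ) * Phi s L x) := by
  have hrl := hrN.trans hNl
  obtain ⟨κ, -, hκ⟩ := exists_normIntegral_eq hNm
  obtain ⟨ρ, hρ⟩ := exists_abs_spec_conj_le hrl g x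
  obtain ⟨fa, hfa, hfa', hfa''⟩ := exists_germ_Phi_spec (hrN.trans hNm) hx hxd
  obtain ⟨fb, hfb, hfb', hfb''⟩ := exists_germ_Phi_spec hNl hg hgd
  obtain ⟨c, hc, hc', hc''⟩ := exists_germ_normC hκ hc
  rw [← hfa'', ← hfb'', ← hc'', mul_comm (fb _)]
  obtain ⟨-, -, ha0, -⟩ := spec_spec hx
  obtain ⟨-, -, hb0, -⟩ := spec_spec hg
  refine integral_germ_eq hrN (hrN.trans hNm) hNm (measurable_spec_conj hrl g x) (ρ := ρ)
    ?_ ?_ ?_ ha0 hb0 (fun s hs => base_identity_right hrN hNm hNl hκ hs L hg hx hz) hzi ?_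
    hfa hfa' hfb hfb' hc hc'
  · filter_upwards [hz] with k hk using hρ k hk
  · filter_upwards [hz] with k hk
    obtain ⟨-, h, -, -⟩ := spec_spec hk
    exact h.injective
  · filter_upwards [hz] with k hk
    obtain ⟨-, -, h, -⟩ := spec_spec hk
    exact h
  · filter_upwards [hz, hzd] with k hk hkd using exists_germ_Phi_spec hrl hk hkd

/-! ### Densities of images of complex measures -/

section Density

variable {Ω Y : Type*} [MeasurableSpace Ω] [MeasurableSpace Y] {ρ : Measure Ω} {μ : Measure Y}

/-- `f` is a density, with respect to `μ`, of the image of `c ρ` under `T`: this is expressed by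
integrals of measurable functions, together with the fact that `f` vanishes where `c` forces it
to. -/
structure IsImageDensity (ρ : Measure Ω) (μ : Measure Y) (T : Ω → Y) (c : Ω → ℂ) (f : Y → ℂ) :
    Prop where
  integrable : Integrable f μ
  integrable_mul : ∀ φ : Y → ℂ, Measurable φ → Integrable (fun p => c p * φ (T p)) ρ →
    Integrable (fun y => f y * φ y) μ
  integral_mul : ∀ φ : Y → ℂ, Measurable φ → Integrable (fun p => c p * φ (T p)) ρ →
    ∫ y, f y * φ y ∂μ = ∫ p, c p * φ (T p) ∂ρ
  mem_of_ne_zero : ∀ A : Set Y, MeasurableSet A → (∀ᵐ p ∂ρ, c p ≠ 0 → T p ∈ A) →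
    ∀ᵐ y ∂μ, f y ≠ 0 → y ∈ A

lemma exists_isImageDensity_ofReal [SigmaFinite μ] {T : Ω → Y} (hT : Measurable T)
    (hac : ρ.map T ≪ μ) {u : Ω → ℝ} (hu : Integrable u ρ) (hu0 : ∀ p, 0 ≤ u p) :
    ∃ v : Y → ℝ, IsImageDensity ρ μ T (fun p => (u p : ℂ)) (fun y => (v y : ℂ)) := by
  set ν := ρ.withDensity fun p => ENNReal.ofReal (u p) with hν
  have hum : AEMeasurable (fun p => ENNReal.ofReal (u p)) ρ := hu.1.aemeasurable.ennreal_ofReal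
  have hutop : ∀ᵐ p ∂ρ, ENNReal.ofReal (u p) < ⊤ :=
    Filter.Eventually.of_forall fun _ => ENNReal.ofReal_lt_top
  have hfin : IsFiniteMeasure ν := isFiniteMeasure_withDensity_ofReal hu.2
  have hνT : ν.map T ≪ μ := ((withDensity_absolutelyContinuous _ _).map hT).trans hac
  set w := (ν.map T).rnDeriv μ with hw
  have hwd : μ.withDensity w = ν.map T := Measure.withDensity_rnDeriv_eq _ _ hνT
  have hwm : Measurable w := Measure.measurable_rnDeriv _ _
  have hwtop : ∀ᵐ y ∂μ, w y < ⊤ := Measure.rnDeriv_lt_top _ _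
  -- both sides are integrals with respect to the image of `u ρ`
  have hint : ∀ φ : Y → ℂ, Measurable φ → (Integrable (fun p => (u p : ℂ) * φ (T p)) ρ ↔
      Integrable (fun y => ((w y).toReal : ℂ) * φ y) μ) := by
    intro φ hφ
    have h1 := integrable_withDensity_iff_integrable_smul₀' (E := ℂ) hum hutop
      (g := fun p => φ (T p))
    have h2 := integrable_withDensity_iff_integrable_smul₀' (E := ℂ) hwm.aemeasurable hwtop
      (g := φ)
    rw [hwd, integrable_map_measure hφ.aestronglyMeasurable hT.aemeasurable] at h2
    simp only [ENNReal.toReal_ofReal (hu0 _), Complex.real_smul] at h1 h2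
    exact h1.symm.trans h2
  have hone : Integrable (fun y => ((w y).toReal : ℂ)) μ := by
    have h3 : Integrable (fun p => (u p : ℂ) * 1) ρ := by
      simp only [mul_one]
      exact hu.ofReal (𝕜 := ℂ)
    simpa only [mul_one] using (hint (fun _ => 1) measurable_const).mp h3
  refine ⟨fun y => (w y).toReal, hone, fun φ hφ h => (hint φ hφ).mp h, fun φ hφ _ => ?_,
    fun A hA h => ?_⟩
  · have h1 := integral_withDensity_eq_integral_toReal_smul₀ hum hutop fun p => φ (T p)
    have h2 := integral_withDensity_eq_integral_toReal_smul₀ hwm.aemeasurable hwtop φ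
    rw [hwd, integral_map hT.aemeasurable hφ.aestronglyMeasurable] at h2
    simp only [ENNReal.toReal_ofReal (hu0 _), Complex.real_smul] at h1 h2
    rw [← h1, ← h2]
  · have h1 : μ.withDensity w Aᶜ = 0 := by
      rw [hwd, Measure.map_apply hT hA.compl, hν, withDensity_apply _ (hT hA.compl),
        ← lintegral_indicator (hT hA.compl)]
      refine lintegral_eq_zero_of_ae_eq_zero ?_
      filter_upwards [h] with p hp
      by_cases hpA : T p ∈ A
      · exact Set.indicator_of_notMem (s := T ⁻¹' Aᶜ) (fun h' => h' hpA) _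
      · have h0 : u p = 0 := by
          by_contra h0
          exact hpA (hp (by exact_mod_cast h0))
        simp [Set.indicator, h0]
    rw [withDensity_apply_eq_zero hwm] at h1
    rw [ae_iff]
    refine measure_mono_null ?_ h1
    intro y hy
    simp only [Set.mem_ofPred_eq, Classical.not_imp] at hy
    exact ⟨fun h => hy.1 (by rw [h]; rfl), hy.2⟩

/-- A complex combination of images of positive measures. -/
lemma exists_isImageDensity [SigmaFinite μ] {T : Ω → Y} (hT : Measurable T)
    (hac : ρ.map T ≪ μ) {c : Ω → ℂ} (hc : Integrable c ρ) : ∃ f, IsImageDensity ρ μ T c f := by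
  obtain ⟨v₁, h₁⟩ := exists_isImageDensity_ofReal hT hac hc.re.pos_part fun _ => le_max_right _ _
  obtain ⟨v₂, h₂⟩ := exists_isImageDensity_ofReal hT hac hc.re.neg_part fun _ => le_max_right _ _
  obtain ⟨v₃, h₃⟩ := exists_isImageDensity_ofReal hT hac hc.im.pos_part fun _ => le_max_right _ _
  obtain ⟨v₄, h₄⟩ := exists_isImageDensity_ofReal hT hac hc.im.neg_part fun _ => le_max_right _ _
  simp only [RCLike.re_eq_complex_re, RCLike.im_eq_complex_im] at h₁ h₂ h₃ h₄
  have hdec : ∀ z : ℂ, z = ((max z.re 0 : ℝ) : ℂ) - ((max (-z.re) 0 : ℝ) : ℂ) +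
      Complex.I * (((max z.im 0 : ℝ) : ℂ) - ((max (-z.im) 0 : ℝ) : ℂ)) := by
    intro z
    have h : ∀ t : ℝ, max t 0 - max (-t) 0 = t := fun t => by
      rcases le_total 0 t with h | h <;> simp [h]
    apply Complex.ext <;> simp [h]
  -- each of the four parts is dominated by the function itself
  have hpart : ∀ {w : ℂ → ℝ}, Measurable w → (∀ z, |w z| ≤ ‖z‖) → ∀ φ : Y → ℂ, Measurable φ →
      Integrable (fun p => c p * φ (T p)) ρ →
      Integrable (fun p => ((w (c p) : ℝ) : ℂ) * φ (T p)) ρ := by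
    intro w hw hwz φ hφ h
    refine h.mono ?_ (Filter.Eventually.of_forall fun p => ?_)
    · exact ((Complex.measurable_ofReal.comp hw).comp_aemeasurable
        hc.1.aemeasurable).aestronglyMeasurable.mul (hφ.comp hT).aestronglyMeasurable
    · rw [norm_mul, norm_mul, Complex.norm_real]
      exact mul_le_mul_of_nonneg_right (hwz _) (norm_nonneg _)
  have hm : ∀ t : ℝ, |max t 0| ≤ |t| := fun t => by
    rw [abs_of_nonneg (le_max_right _ _)]; exact max_le (le_abs_self t) (abs_nonneg t)
  have p₁ := hpart (w := fun z => max z.re 0) (by fun_prop)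
    fun z => (hm _).trans (Complex.abs_re_le_norm z)
  have p₂ := hpart (w := fun z => max (-z.re) 0) (by fun_prop)
    fun z => (hm _).trans (by rw [abs_neg]; exact Complex.abs_re_le_norm z)
  have p₃ := hpart (w := fun z => max z.im 0) (by fun_prop)
    fun z => (hm _).trans (Complex.abs_im_le_norm z)
  have p₄ := hpart (w := fun z => max (-z.im) 0) (by fun_prop)
    fun z => (hm _).trans (by rw [abs_neg]; exact Complex.abs_im_le_norm z)
  have hfm : ∀ (φ : Y → ℂ) y, ((v₁ y : ℂ) - v₂ y + Complex.I * (v₃ y - v₄ y)) * φ y =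
      v₁ y * φ y - v₂ y * φ y + Complex.I * (v₃ y * φ y - v₄ y * φ y) := fun φ y => by ring
  refine ⟨fun y => v₁ y - v₂ y + Complex.I * (v₃ y - v₄ y),
    (h₁.1.sub h₂.1).add ((h₃.1.sub h₄.1).const_mul _), fun φ hφ h => ?_, fun φ hφ h => ?_,
    fun A hA h => ?_⟩
  · simp only [hfm]
    exact ((h₁.2 φ hφ (p₁ φ hφ h)).sub (h₂.2 φ hφ (p₂ φ hφ h))).add
      (((h₃.2 φ hφ (p₃ φ hφ h)).sub (h₄.2 φ hφ (p₄ φ hφ h))).const_mul _)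
  · have i₁ := h₁.2 φ hφ (p₁ φ hφ h)
    have i₂ := h₂.2 φ hφ (p₂ φ hφ h)
    have i₃ := h₃.2 φ hφ (p₃ φ hφ h)
    have i₄ := h₄.2 φ hφ (p₄ φ hφ h)
    simp only [hfm]
    have e₁ := integral_add (i₁.sub i₂) ((i₃.sub i₄).const_mul Complex.I)
    have e₂ := integral_add ((p₁ φ hφ h).sub (p₂ φ hφ h))
      (((p₃ φ hφ h).sub (p₄ φ hφ h)).const_mul Complex.I)
    simp only [Pi.sub_apply] at e₁ e₂
    rw [integral_const_mul, integral_sub i₁ i₂, integral_sub i₃ i₄, h₁.3 φ hφ (p₁ φ hφ h),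
      h₂.3 φ hφ (p₂ φ hφ h), h₃.3 φ hφ (p₃ φ hφ h), h₄.3 φ hφ (p₄ φ hφ h),
      ← integral_sub (p₁ φ hφ h) (p₂ φ hφ h), ← integral_sub (p₃ φ hφ h) (p₄ φ hφ h),
      ← integral_const_mul, ← e₂] at e₁
    rw [e₁]
    refine integral_congr_ae (Filter.Eventually.of_forall fun p => ?_)
    beta_reduce
    conv_rhs => rw [hdec (c p)]
    ring
  · have hA' : ∀ {w : ℂ → ℝ}, (w 0 = 0) → ∀ᵐ p ∂ρ, ((w (c p) : ℝ) : ℂ) ≠ 0 → T p ∈ A := by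
      intro w hw
      filter_upwards [h] with p hp hwp
      exact hp fun h0 => hwp (by rw [h0, hw]; simp)
    filter_upwards [h₁.4 A hA (hA' (w := fun z => max z.re 0) (by simp)),
      h₂.4 A hA (hA' (w := fun z => max (-z.re) 0) (by simp)),
      h₃.4 A hA (hA' (w := fun z => max z.im 0) (by simp)),
      h₄.4 A hA (hA' (w := fun z => max (-z.im) 0) (by simp))] with y a₁ a₂ a₃ a₄ hy
    by_contra hyA
    apply hy
    rw [not_not.mp fun h => hyA (a₁ h), not_not.mp fun h => hyA (a₂ h),
      not_not.mp fun h => hyA (a₃ h), not_not.mp fun h => hyA (a₄ h)]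
    ring

lemma IsImageDensity.withDensityᵥ_eq {T : Ω → Y} (hT : Measurable T) {c : Ω → ℂ}
    (hc : Integrable c ρ) {f : Y → ℂ} (h : IsImageDensity ρ μ T c f) :
    μ.withDensityᵥ f = (ρ.withDensityᵥ c).map T := by
  ext1 A hA
  rw [withDensityᵥ_apply h.integrable hA, VectorMeasure.map_apply _ hT hA,
    withDensityᵥ_apply hc (hT hA), ← integral_indicator hA, ← integral_indicator (hT hA)]
  have h1 : Measurable (A.indicator (fun _ => (1 : ℂ))) := measurable_const.indicator hA
  have e1 : ∀ p, c p * A.indicator (fun _ => (1 : ℂ)) (T p) = (T ⁻¹' A).indicator c p := by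
    intro p
    by_cases hp : T p ∈ A
    · rw [Set.indicator_of_mem hp, Set.indicator_of_mem (by exact hp), mul_one]
    · rw [Set.indicator_of_notMem hp, Set.indicator_of_notMem (by exact hp), mul_zero]
  have e2 : ∀ y, f y * A.indicator (fun _ => (1 : ℂ)) y = A.indicator f y := by
    intro y
    by_cases hy : y ∈ A
    · rw [Set.indicator_of_mem hy, Set.indicator_of_mem hy, mul_one]
    · rw [Set.indicator_of_notMem hy, Set.indicator_of_notMem hy, mul_zero]
  have h2 := h.integral_mul _ h1 (by simp only [e1]; exact hc.indicator (hT hA))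
  simpa only [e1, e2] using h2

lemma IsImageDensity.congr {T : Ω → Y} {c : Ω → ℂ} {f f' : Y → ℂ}
    (h : IsImageDensity ρ μ T c f) (hf : f =ᵐ[μ] f') : IsImageDensity ρ μ T c f' where
  integrable := h.integrable.congr hf
  integrable_mul φ hφ hi := (h.integrable_mul φ hφ hi).congr <| by
    filter_upwards [hf] with y hy; rw [hy]
  integral_mul φ hφ hi := by
    rw [← h.integral_mul φ hφ hi]
    refine integral_congr_ae ?_
    filter_upwards [hf] with y hy; rw [hy]
  mem_of_ne_zero A hA hp := by
    filter_upwards [hf, h.mem_of_ne_zero A hA hp] with y hy h1; rwa [← hy]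

/-- The Radon-Nikodym derivative of the image of `c ρ` under `T` is a density. -/
theorem isImageDensity_rnDeriv [SigmaFinite μ] {T : Ω → Y} (hT : Measurable T)
    (hac : ρ.map T ≪ μ) {c : Ω → ℂ} (hc : Integrable c ρ) :
    IsImageDensity ρ μ T c (ComplexMeasure.rnDeriv ((ρ.withDensityᵥ c).map T) μ) := by
  obtain ⟨f, hf⟩ := exists_isImageDensity hT hac hc
  refine hf.congr ?_
  rw [← hf.withDensityᵥ_eq hT hc]
  -- the real and imaginary parts of the image are the densities of `f`, so that the uniqueness of
  -- the Lebesgue decomposition applies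
  have h1 : (fun y => (f y).re) =ᵐ[μ]
      SignedMeasure.rnDeriv (ComplexMeasure.re (μ.withDensityᵥ f)) μ := by
    have hi : Integrable (fun y => (f y).re) μ := hf.integrable.re
    refine SignedMeasure.eq_rnDeriv 0 _ hi VectorMeasure.MutuallySingular.zero_left ?_
    rw [zero_add]
    ext1 A hA
    rw [withDensityᵥ_apply hi hA]
    change ((μ.withDensityᵥ f) A).re = _
    rw [withDensityᵥ_apply hf.integrable hA]
    exact (integral_re hf.integrable.integrableOn).symm
  have h2 : (fun y => (f y).im) =ᵐ[μ]
      SignedMeasure.rnDeriv (ComplexMeasure.im (μ.withDensityᵥ f)) μ := by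
    have hi : Integrable (fun y => (f y).im) μ := hf.integrable.im
    refine SignedMeasure.eq_rnDeriv 0 _ hi VectorMeasure.MutuallySingular.zero_left ?_
    rw [zero_add]
    ext1 A hA
    rw [withDensityᵥ_apply hi hA]
    change ((μ.withDensityᵥ f) A).im = _
    rw [withDensityᵥ_apply hf.integrable hA]
    exact (integral_im hf.integrable.integrableOn).symm
  filter_upwards [h1, h2] with y e1 e2
  exact Complex.ext e1 e2

end Density

/-! ### Integrals of kernels that are defined only partially -/

section Transfer

variable {Ω Y : Type*} [MeasurableSpace Ω] [MeasurableSpace Y] [TopologicalSpace Ω]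
  [TopologicalSpace Y]

/-- If the continuous image of almost every point lies in `A`, then it lies in a measurable
subset of `A`, whether or not `A` itself is measurable. -/
lemma exists_measurableSet_subset_of_ae_mem [BorelSpace Ω] [PolishSpace Ω]
    [T2Space Y] [OpensMeasurableSpace Y] {ρ : Measure Ω} [IsFiniteMeasure ρ] {T : Ω → Y}
    (hT : Continuous T) {A : Set Y} (hA : ∀ᵐ p ∂ρ, T p ∈ A) :
    ∃ A' ⊆ A, MeasurableSet A' ∧ ∀ᵐ p ∂ρ, T p ∈ A' := by
  obtain ⟨Z, hZ, hZm, hZ0⟩ := exists_measurable_superset_of_null (ae_iff.mp hA)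
  have hB : ∀ p ∈ Zᶜ, T p ∈ A := fun p hp => by
    by_contra h
    exact hp (hZ h)
  -- by inner regularity compact sets exhaust almost all of the space, and their images are compact
  have h1 : ∀ n : ℕ, ∃ C ⊆ Zᶜ, IsCompact C ∧ ρ Zᶜ < ρ C + ((n : ENNReal) + 1)⁻¹ := fun n =>
    hZm.compl.exists_isCompact_lt_add (measure_ne_top _ _) (by simp)
  choose C hCZ hC hCρ using h1
  refine ⟨⋃ n, T '' C n, ?_, MeasurableSet.iUnion fun n => ((hC n).image hT).measurableSet, ?_⟩
  · refine Set.iUnion_subset fun n => ?_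
    rintro _ ⟨p, hp, rfl⟩
    exact hB p (hCZ n hp)
  · have h2 : ρ Zᶜ ≤ ρ (⋃ n, C n) := by
      refine ENNReal.le_of_forall_pos_le_add fun ε hε _ => ?_
      obtain ⟨n, hn⟩ := ENNReal.exists_inv_nat_lt (ENNReal.coe_ne_zero.mpr hε.ne')
      refine (hCρ n).le.trans (add_le_add (measure_mono (Set.subset_iUnion C n)) ?_)
      refine le_trans ?_ hn.le
      exact ENNReal.inv_le_inv.mpr le_self_add
    have hCm : MeasurableSet (⋃ n, C n) := MeasurableSet.iUnion fun n => (hC n).measurableSet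
    have h3 : ρ (⋃ n, C n)ᶜ = 0 := by
      rw [measure_compl hCm (measure_ne_top _ _), tsub_eq_zero_iff_le]
      refine le_trans ?_ h2
      rw [measure_compl hZm (measure_ne_top _ _), hZ0, tsub_zero]
    have h4 : ∀ᵐ p ∂ρ, p ∈ ⋃ n, C n := by rw [ae_iff]; exact h3
    filter_upwards [h4] with p hp
    obtain ⟨n, hn⟩ := Set.mem_iUnion.mp hp
    exact Set.mem_iUnion.mpr ⟨n, p, hn, rfl⟩

/-- The integral of a kernel `φ` against a density unfolds, for a kernel that is a limit of
measurable functions where it is defined. -/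
theorem IsImageDensity.integral_kernel {Ω Y : Type} [MeasurableSpace Ω] [MeasurableSpace Y]
    [TopologicalSpace Ω] [TopologicalSpace Y] [BorelSpace Ω] [PolishSpace Ω]
    [T2Space Y] [OpensMeasurableSpace Y] {ρ : Measure Ω} {μ : Measure Y} {T : Ω → Y}
    (hT : Continuous T) {c : Ω → ℂ} (hc : Integrable c ρ) {f : Y → ℂ}
    (hf : IsImageDensity ρ μ T c f) {G : Set Y} {D : Y → Prop} {φ : Y → ℂ} {ψ : ℕ → Y → ℂ}
    (hψ : ∀ n, Measurable (ψ n))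
    (hψφ : ∀ y ∈ G, D y → Filter.Tendsto (fun n => ψ n y) Filter.atTop (nhds (φ y)))
    (hG : ∀ᵐ p ∂ρ, T p ∈ G) (hcφ : TransformExists ρ c (fun p => D (T p)) fun p => φ (T p)) :
    TransformExists μ f D φ ∧ ∫ y, f y * φ y ∂μ = ∫ p, c p * φ (T p) ∂ρ := by
  have hcm : AEMeasurable (fun p => ‖c p‖ₑ) ρ := hc.1.enorm
  have hfin : IsFiniteMeasure (ρ.withDensity fun p => ‖c p‖ₑ) := isFiniteMeasure_withDensity hc.2.ne
  have h1 : ∀ᵐ p ∂(ρ.withDensity fun p => ‖c p‖ₑ), T p ∈ {y | y ∈ G ∧ D y} := by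
    rw [ae_withDensity_iff' hcm]
    filter_upwards [hG, hcφ.1] with p h1 h2 h3
    exact ⟨h1, h2 (by simpa using h3)⟩
  obtain ⟨A, hAs, hAm, hA⟩ := exists_measurableSet_subset_of_ae_mem hT h1
  rw [ae_withDensity_iff' hcm] at hA
  have hA' : ∀ᵐ p ∂ρ, c p ≠ 0 → T p ∈ A := by
    filter_upwards [hA] with p hp h
    exact hp (by simpa using h)
  -- on the measurable set `A` the kernel is defined, and a limit of measurable functions
  have hφm : Measurable (A.indicator φ) := by
    refine measurable_of_tendsto_metrizable (f := fun n => A.indicator (ψ n))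
      (fun n => (hψ n).indicator hAm) ?_
    rw [tendsto_pi_nhds]
    intro y
    by_cases hy : y ∈ A
    · simp only [Set.indicator_of_mem hy]
      exact hψφ y (hAs hy).1 (hAs hy).2
    · simp only [Set.indicator_of_notMem hy]
      exact tendsto_const_nhds
  have e1 : (fun p => c p * φ (T p)) =ᵐ[ρ] fun p => c p * A.indicator φ (T p) := by
    filter_upwards [hA'] with p hp
    by_cases h : c p = 0
    · simp [h]
    · rw [Set.indicator_of_mem (hp h)]
  have hfA := hf.mem_of_ne_zero A hAm hA'
  have e2 : (fun y => f y * φ y) =ᵐ[μ] fun y => f y * A.indicator φ y := by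
    filter_upwards [hfA] with y hy
    by_cases h : f y = 0
    · simp [h]
    · rw [Set.indicator_of_mem (hy h)]
  have hi := hcφ.2.congr e1
  refine ⟨⟨?_, (hf.integrable_mul _ hφm hi).congr e2.symm⟩, ?_⟩
  · filter_upwards [hfA] with y hy h using (hAs (hy h)).2
  · rw [integral_congr_ae e2, integral_congr_ae e1, hf.integral_mul _ hφm hi]

end Transfer

/-- The spherical functions are limits of measurable functions of the spectrum. -/
lemma exists_measurable_tendsto_Phi {l n : ℕ} (hnl : n ≤ l) (s₀ : Fin n → ℂ)
    (L : Fin n → ZMod 2) : ∃ ψ : ℕ → Matrix (Fin l) (Fin l) ℂ → ℂ, (∀ i, Measurable (ψ i)) ∧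
      ∀ x ∈ GenH l n, PhiDefined s₀ L x →
        Filter.Tendsto (fun i => ψ i x) Filter.atTop (nhds (Phi s₀ L x)) := by
  have hu : Filter.Tendsto (fun i : ℕ => (((i : ℝ) + 1)⁻¹ : ℂ)) Filter.atTop
      (nhdsWithin 0 {0}ᶜ) := by
    rw [tendsto_nhdsWithin_iff]
    constructor
    · have h := (Complex.continuous_ofReal.tendsto 0).comp
        (tendsto_one_div_add_atTop_nhds_zero_nat (𝕜 := ℝ))
      simpa [Function.comp_def] using h
    · refine Filter.Eventually.of_forall fun i => ?_
      have : ((i : ℝ) + 1 : ℂ) ≠ 0 := by exact_mod_cast (Nat.succ_ne_zero i)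
      simpa using inv_ne_zero this
  -- the germ is continuous, and off its center it is the quotient of `altNum` by `gapProd`
  refine ⟨fun i x => altNum (slice s₀ 0 (((i : ℝ) + 1)⁻¹ : ℂ)) L (spec l n x) /
    gapProd (slice s₀ 0 (((i : ℝ) + 1)⁻¹ : ℂ)), fun i => ?_, fun x hx hd => ?_⟩
  · exact (measurable_altNum measurable_const (measurable_spec hnl) L).div_const _
  · obtain ⟨F, hF, hF', hF''⟩ := exists_germ_Phi_spec hnl hx hd
    have hsl := (differentiable_slice s₀ 0).continuous.tendsto 0
    rw [slice_zero_zero] at hsl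
    have h1 : Filter.Tendsto (fun u => F (slice s₀ 0 u)) (nhdsWithin 0 {0}ᶜ)
        (nhds (Phi s₀ L x)) := by
      rw [← hF'']
      exact (hF.continuousAt.tendsto.comp hsl).mono_left nhdsWithin_le_nhds
    refine Filter.Tendsto.congr' ?_ (h1.comp hu)
    have h2 := (hsl.eventually hF').filter_mono (nhdsWithin_le_nhds (s := {0}ᶜ))
    filter_upwards [hu.eventually h2, hu.eventually (eventually_gapProd_slice_ne_zero s₀)]
      with i h3 h4
    rw [← h3, Function.comp_apply, mul_div_cancel_right₀ _ h4]

instance instPolishSpaceMatrix (a b : ℕ) : PolishSpace (Matrix (Fin a) (Fin b) ℂ) :=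
  inferInstanceAs (PolishSpace (Fin a → Fin b → ℂ))

/-! ### Averaging over the unitary group between the factors -/

section Average

variable {m : ℕ} {Y : Type*} [MeasurableSpace Y] {ν : Measure Y} [SFinite ν] {act : K m → Y → Y}

lemma measurePreserving_act (hm : Measurable fun p : K m × Y => act p.1 p.2)
    (hp : ∀ k, MeasurePreserving (act k) ν ν) :
    MeasurePreserving (fun p : Y × K m => act p.2 p.1) (ν.prod (haarK m)) ν := by
  have h1 : MeasurePreserving (fun p : K m × Y => (p.1, act p.1 p.2)) ((haarK m).prod ν)
      ((haarK m).prod ν) :=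
    (MeasurePreserving.id (haarK m)).skew_product hm
      (Filter.Eventually.of_forall fun k => (hp k).map_eq)
  exact (measurePreserving_snd.comp h1).comp Measure.measurePreserving_swap

lemma ae_ae_act_eq (hm : Measurable fun p : K m × Y => act p.1 p.2)
    (hp : ∀ k, MeasurePreserving (act k) ν ν) {Q : Y → ℂ} (hQ : AEStronglyMeasurable Q ν)
    (hinv : ∀ k, ∀ᵐ y ∂ν, Q (act k y) = Q y) :
    ∀ᵐ y ∂ν, ∀ᵐ k ∂(haarK m), Q (act k y) = Q y := by
  have hQm : Measurable (hQ.mk Q) := hQ.stronglyMeasurable_mk.measurable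
  have h1 : ∀ᵐ k ∂(haarK m), ∀ᵐ y ∂ν, hQ.mk Q (act k y) = hQ.mk Q y := by
    refine Filter.Eventually.of_forall fun k => ?_
    filter_upwards [hinv k, hQ.ae_eq_mk, (hp k).quasiMeasurePreserving.ae hQ.ae_eq_mk]
      with y h1 h2 h3
    rw [← h2, ← h1, ← h3]
  have hset : MeasurableSet {p : K m × Y | hQ.mk Q (act p.1 p.2) = hQ.mk Q p.2} :=
    measurableSet_eq_fun (hQm.comp hm) (hQm.comp measurable_snd)
  have h2 := (Measure.ae_ae_comm (μ := haarK m) (ν := ν)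
    (p := fun k y => hQ.mk Q (act k y) = hQ.mk Q y) hset).mp h1
  have h3 := Measure.ae_ae_of_ae_prod
    ((measurePreserving_act hm hp).quasiMeasurePreserving.ae hQ.ae_eq_mk)
  filter_upwards [h2, h3, hQ.ae_eq_mk] with y e2 e3 e4
  filter_upwards [e2, e3] with k d2 d3
  rw [d3, d2, ← e4]

end Average

/-- A product formula for the averages over the unitary group between two factors gives the
factorization of double integrals, for densities that are invariant under the unitary group. -/
theorem integral_prod_of_average {l m : ℕ} {Y : Type} [MeasurableSpace Y] {ν : Measure Y}
    [SFinite ν] {act : K m → Y → Y} (hm : Measurable fun p : K m × Y => act p.1 p.2)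
    (hp : ∀ k, MeasurePreserving (act k) ν ν) {X : Y → Matrix (Fin m) (Fin m) ℂ}
    (hX : ∀ k y, X (act k y) = k.1 * X y * k.1ᴴ) {γ : Measure (Matrix (Fin l) (Fin m) ℂ)}
    [SFinite γ] {P : Matrix (Fin l) (Fin m) ℂ → ℂ} {Q : Y → ℂ}
    (hQ : AEStronglyMeasurable Q ν) (hinv : ∀ k, ∀ᵐ y ∂ν, Q (act k y) = Q y)
    {D : Matrix (Fin l) (Fin l) ℂ → Prop} {φ : Matrix (Fin l) (Fin l) ℂ → ℂ}
    (hφ : TransformExists (γ.prod ν) (fun p => P p.1 * Q p.2)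
      (fun p => D (p.1 * X p.2 * p.1ᴴ)) fun p => φ (p.1 * X p.2 * p.1ᴴ))
    {D₁ : Matrix (Fin l) (Fin m) ℂ → Prop} {D₂ : Y → Prop}
    (h₁ : ∀ᵐ g ∂γ, P g ≠ 0 → D₁ g) (h₂ : ∀ᵐ y ∂ν, Q y ≠ 0 → D₂ y)
    {φ₁ : Matrix (Fin l) (Fin m) ℂ → ℂ} {φ₂ : Y → ℂ} {C : ℂ}
    (hprod : ∀ g y, D₁ g → D₂ y → (∀ᵐ k ∂(haarK m), D (g * (k.1 * X y * k.1ᴴ) * gᴴ)) →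
      Integrable (fun k : K m => φ (g * (k.1 * X y * k.1ᴴ) * gᴴ)) (haarK m) →
      ∫ k : K m, φ (g * (k.1 * X y * k.1ᴴ) * gᴴ) ∂(haarK m) = C * (φ₁ g * φ₂ y)) :
    ∫ p, P p.1 * Q p.2 * φ (p.1 * X p.2 * p.1ᴴ) ∂(γ.prod ν) =
      C * ((∫ g, P g * φ₁ g ∂γ) * ∫ y, Q y * φ₂ y ∂ν) := by
  -- acting on the second variable by a random `k` preserves the product measure, and `Q`
  have hS : MeasurePreserving
      (fun q : (Matrix (Fin l) (Fin m) ℂ × Y) × K m => (q.1.1, act q.2 q.1.2))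
      ((γ.prod ν).prod (haarK m)) (γ.prod ν) :=
    measurePreserving_act (act := fun k p => (p.1, act k p.2))
      (measurable_snd.fst.prodMk (hm.comp (measurable_fst.prodMk measurable_snd.snd)))
      fun k => (MeasurePreserving.id γ).prod (hp k)
  have hi := hS.integrable_comp_of_integrable hφ.2
  have e1 : ∫ p, P p.1 * Q p.2 * φ (p.1 * X p.2 * p.1ᴴ) ∂(γ.prod ν) =
      ∫ p, ∫ k, P p.1 * Q (act k p.2) * φ (p.1 * X (act k p.2) * p.1ᴴ) ∂(haarK m)
        ∂(γ.prod ν) := by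
    conv_lhs => rw [← hS.map_eq]
    rw [integral_map hS.aemeasurable (by rw [hS.map_eq]; exact hφ.2.1)]
    exact integral_prod _ hi
  rw [e1, ← integral_prod_mul, ← integral_const_mul]
  refine integral_congr_ae ?_
  have a1 := (Measure.quasiMeasurePreserving_fst (μ := γ) (ν := ν)).ae h₁
  have a2 := (Measure.quasiMeasurePreserving_snd (μ := γ) (ν := ν)).ae h₂
  have a3 := (Measure.quasiMeasurePreserving_snd (μ := γ) (ν := ν)).ae (ae_ae_act_eq hm hp hQ hinv)
  have a4 := Measure.ae_ae_of_ae_prod (hS.quasiMeasurePreserving.ae hφ.1)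
  filter_upwards [a1, a2, a3, a4, hi.prod_right_ae] with p b1 b2 b3 b4 b5
  simp only [Function.comp_apply, hX] at b4 b5
  have e2 : ∫ k, P p.1 * Q (act k p.2) * φ (p.1 * X (act k p.2) * p.1ᴴ) ∂(haarK m) =
      P p.1 * Q p.2 * ∫ k, φ (p.1 * (k.1 * X p.2 * k.1ᴴ) * p.1ᴴ) ∂(haarK m) := by
    rw [← integral_const_mul]
    refine integral_congr_ae ?_
    filter_upwards [b3] with k hk
    rw [hk, hX]
  rw [e2]
  by_cases hP0 : P p.1 = 0
  · simp [hP0]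
  by_cases hQ0 : Q p.2 = 0
  · simp [hQ0]
  have hPQ : P p.1 * Q p.2 ≠ 0 := mul_ne_zero hP0 hQ0
  rw [hprod p.1 p.2 (b1 hP0) (b2 hQ0) ?_ ?_]
  · ring
  · filter_upwards [b3, b4] with k d3 d4
    exact d4 (by rw [d3]; exact hPQ)
  · have h6 : Integrable (fun k : K m => P p.1 * Q p.2 * φ (p.1 * (k.1 * X p.2 * k.1ᴴ) * p.1ᴴ))
        (haarK m) := by
      refine b5.congr ?_
      filter_upwards [b3] with k d3
      rw [d3]
    exact (integrable_const_mul_iff (isUnit_iff_ne_zero.mpr hPQ) _).mp h6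

/-! ### The reference measures -/

/-- The parametrization of the matrices of rank `n`. -/
def paramG (l m n : ℕ) (p : K l × Matrix (Fin n) (Fin n) ℂ × K m) : Matrix (Fin l) (Fin m) ℂ :=
  p.1.1 * Proj l n * p.2.1 * Proj n m * p.2.2.1ᴴ

/-- The parametrization of the Hermitian matrices of rank `n`. -/
def paramH (l n : ℕ) (p : K l × Matrix (Fin n) (Fin n) ℂ) : Matrix (Fin l) (Fin l) ℂ :=
  p.1.1 * Proj l n * p.2 * Proj n l * p.1.1ᴴ

lemma continuous_paramG (l m n : ℕ) : Continuous (paramG l m n) := by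
  have h1 : Continuous fun p : K l × Matrix (Fin n) (Fin n) ℂ × K m => p.1.1 :=
    (continuous_coeK l).comp continuous_fst
  have h2 : Continuous fun p : K l × Matrix (Fin n) (Fin n) ℂ × K m => p.2.2.1 :=
    (continuous_coeK m).comp continuous_snd.snd
  exact ((((h1.matrix_mul continuous_const).matrix_mul continuous_snd.fst).matrix_mul
    continuous_const).matrix_mul h2.matrix_conjTranspose)

lemma continuous_paramH (l n : ℕ) : Continuous (paramH l n) := by
  have h1 : Continuous fun p : K l × Matrix (Fin n) (Fin n) ℂ => p.1.1 :=
    (continuous_coeK l).comp continuous_fst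
  exact ((((h1.matrix_mul continuous_const).matrix_mul continuous_snd).matrix_mul
    continuous_const).matrix_mul h1.matrix_conjTranspose)

lemma measurable_paramG (l m n : ℕ) : Measurable (paramG l m n) := (continuous_paramG l m n).measurable

lemma measurable_paramH (l n : ℕ) : Measurable (paramH l n) := (continuous_paramH l n).measurable

instance instSFiniteVolH (n : ℕ) : SFinite (volH n) := by unfold volH; infer_instance

lemma measG_eq (l m n : ℕ) :
    measG l m n = ((haarK l).prod ((volG n).prod (haarK m))).map (paramG l m n) := by
  rw [← lebG_eq_volG]; rfl

lemma measH_eq (l n : ℕ) : measH l n = ((haarK l).prod (volH n)).map (paramH l n) := by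
  rw [← lebH_eq_volH]; rfl

instance instSFiniteMeasG (l m n : ℕ) : SFinite (measG l m n) := by
  rw [measG_eq]; infer_instance

instance instSFiniteMeasH (l n : ℕ) : SFinite (measH l n) := by
  rw [measH_eq]; infer_instance

lemma mul_paramG {l m n : ℕ} (u : K l) (p : K l × Matrix (Fin n) (Fin n) ℂ × K m) :
    u.1 * paramG l m n p = paramG l m n (u * p.1, p.2) := by
  simp only [paramG, coeK_mul, Matrix.mul_assoc]

lemma paramG_mul {l m n : ℕ} (u : K m) (p : K l × Matrix (Fin n) (Fin n) ℂ × K m) :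
    paramG l m n p * u.1 = paramG l m n (p.1, p.2.1, u⁻¹ * p.2.2) := by
  simp only [paramG, coeK_mul, coeK_inv, conjTranspose_mul, conjTranspose_conjTranspose,
    Matrix.mul_assoc]

lemma conj_paramH {l n : ℕ} (u : K l) (p : K l × Matrix (Fin n) (Fin n) ℂ) :
    u.1 * paramH l n p * u.1ᴴ = paramH l n (u * p.1, p.2) := by
  simp only [paramH, coeK_mul, conjTranspose_mul, Matrix.mul_assoc]

lemma paramG_gram {l m n : ℕ} (hnm : n ≤ m) (p : K l × Matrix (Fin n) (Fin n) ℂ × K m) :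
    paramG l m n p * (paramG l m n p)ᴴ = p.1.1 * (Proj l n * (p.2.1 * p.2.1ᴴ) * Proj n l) * p.1.1ᴴ := by
  simp only [paramG, conjTranspose_mul, conjTranspose_conjTranspose, Proj_conjTranspose]
  calc _ = p.1.1 * Proj l n * p.2.1 * (Proj n m * (p.2.2.1ᴴ * p.2.2.1) * Proj m n) * p.2.1ᴴ *
        Proj n l * p.1.1ᴴ := by simp only [Matrix.mul_assoc]
    _ = _ := by
        rw [coeK_conjTranspose_mul, Matrix.mul_one, Proj_mul_Proj (Or.inl hnm), Proj_self,
          Matrix.mul_one]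
        simp only [Matrix.mul_assoc]

lemma measurePreserving_mul_measG {l m n : ℕ} (u : K l) :
    MeasurePreserving (fun g : Matrix (Fin l) (Fin m) ℂ => u.1 * g) (measG l m n)
      (measG l m n) := by
  have hm : Measurable fun g : Matrix (Fin l) (Fin m) ℂ => u.1 * g :=
    (continuous_const.matrix_mul continuous_id).measurable
  refine ⟨hm, ?_⟩
  have h1 := (measurePreserving_mul_left (haarK l) u).prod
    (MeasurePreserving.id ((volG n).prod (haarK m)))
  rw [measG_eq, Measure.map_map hm (measurable_paramG l m n)]
  conv_rhs => rw [← h1.map_eq, Measure.map_map (measurable_paramG l m n) h1.measurable]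
  congr 1
  funext p
  exact mul_paramG u p

lemma measurePreserving_measG_mul {l m n : ℕ} (u : K m) :
    MeasurePreserving (fun g : Matrix (Fin l) (Fin m) ℂ => g * u.1) (measG l m n)
      (measG l m n) := by
  have hm : Measurable fun g : Matrix (Fin l) (Fin m) ℂ => g * u.1 :=
    (continuous_id.matrix_mul continuous_const).measurable
  refine ⟨hm, ?_⟩
  have h1 := (MeasurePreserving.id (haarK l)).prod ((MeasurePreserving.id (volG n)).prod
    (measurePreserving_mul_left (haarK m) u⁻¹))
  rw [measG_eq, Measure.map_map hm (measurable_paramG l m n)]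
  conv_rhs => rw [← h1.map_eq, Measure.map_map (measurable_paramG l m n) h1.measurable]
  congr 1
  funext p
  exact paramG_mul u p

lemma measurable_conj_const {l : ℕ} (A : Matrix (Fin l) (Fin l) ℂ) :
    Measurable fun x : Matrix (Fin l) (Fin l) ℂ => A * x * Aᴴ :=
  ((continuous_const.matrix_mul continuous_id).matrix_mul continuous_const).measurable

lemma measurePreserving_conj_measH {l n : ℕ} (u : K l) :
    MeasurePreserving (fun x : Matrix (Fin l) (Fin l) ℂ => u.1 * x * u.1ᴴ) (measH l n)
      (measH l n) := by
  refine ⟨measurable_conj_const _, ?_⟩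
  have h1 := (measurePreserving_mul_left (haarK l) u).prod (MeasurePreserving.id (volH n))
  rw [measH_eq, Measure.map_map (measurable_conj_const _) (measurable_paramH l n)]
  conv_rhs => rw [← h1.map_eq, Measure.map_map (measurable_paramH l n) h1.measurable]
  congr 1
  funext p
  exact conj_paramH u p

/-- The sum of the moduli of the entries of a matrix. -/
def entrySum {a b : ℕ} (x : Matrix (Fin a) (Fin b) ℂ) : ℝ := ∑ p, ∑ q, ‖x p q‖

lemma continuous_entrySum (a b : ℕ) :
    Continuous (entrySum : Matrix (Fin a) (Fin b) ℂ → ℝ) :=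
  continuous_finsetSum _ fun p _ => continuous_finsetSum _ fun q _ =>
    (continuous_id.matrix_elem p q).norm

lemma norm_mul_mul_apply_le {a b c d : ℕ} {A : Matrix (Fin a) (Fin b) ℂ}
    {B : Matrix (Fin c) (Fin d) ℂ} (hA : ∀ i j, ‖A i j‖ ≤ 1) (hB : ∀ i j, ‖B i j‖ ≤ 1)
    (x : Matrix (Fin b) (Fin c) ℂ) (i : Fin a) (j : Fin d) :
    ‖(A * x * B) i j‖ ≤ entrySum x := by
  rw [Matrix.mul_apply, entrySum, Finset.sum_comm]
  refine (norm_sum_le _ _).trans (Finset.sum_le_sum fun q _ => ?_)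
  rw [norm_mul, Matrix.mul_apply]
  refine (mul_le_of_le_one_right (norm_nonneg _) (hB _ _)).trans ?_
  refine (norm_sum_le _ _).trans (Finset.sum_le_sum fun p _ => ?_)
  rw [norm_mul]
  exact mul_le_of_le_one_left (norm_nonneg _) (hA _ _)

lemma norm_Proj_mul_coeK_le {l n : ℕ} (hnl : n ≤ l) (k : K l) (i : Fin n) (j : Fin l) :
    ‖(Proj n l * k.1) i j‖ ≤ 1 := by
  rw [Proj_mul_apply hnl]; exact norm_coeK_le k _ _

lemma norm_coeK_mul_Proj_le {l n : ℕ} (hnl : n ≤ l) (k : K l) (i : Fin l) (j : Fin n) :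
    ‖(k.1 * Proj l n) i j‖ ≤ 1 := by
  rw [mul_Proj_apply hnl]; exact norm_coeK_le k _ _

lemma norm_apply_le_entrySum_paramG {l m n : ℕ} (hnl : n ≤ l) (hnm : n ≤ m)
    (p : K l × Matrix (Fin n) (Fin n) ℂ × K m) (i j : Fin n) :
    ‖p.2.1 i j‖ ≤ entrySum (paramG l m n p) := by
  have h1 : p.2.1 = (Proj n l * (p.1⁻¹).1) * paramG l m n p * (p.2.2.1 * Proj m n) := by
    simp only [paramG, coeK_inv]
    calc _ = (Proj n l * Proj l n) * p.2.1 * (Proj n m * Proj m n) := by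
          rw [Proj_mul_Proj (Or.inl hnl), Proj_mul_Proj (Or.inl hnm), Proj_self, Matrix.one_mul,
            Matrix.mul_one]
      _ = (Proj n l * (1 : Matrix (Fin l) (Fin l) ℂ) * Proj l n) * p.2.1 *
          (Proj n m * (1 : Matrix (Fin m) (Fin m) ℂ) * Proj m n) := by
          simp only [Matrix.mul_one]
      _ = _ := by
          rw [← coeK_conjTranspose_mul p.1, ← coeK_conjTranspose_mul p.2.2]
          simp only [Matrix.mul_assoc]
  conv_lhs => rw [h1]
  exact norm_mul_mul_apply_le (norm_Proj_mul_coeK_le hnl _) (norm_coeK_mul_Proj_le hnm _) _ i j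

lemma norm_apply_le_entrySum_paramH {l n : ℕ} (hnl : n ≤ l)
    (p : K l × Matrix (Fin n) (Fin n) ℂ) (i j : Fin n) :
    ‖p.2 i j‖ ≤ entrySum (paramH l n p) :=
  norm_apply_le_entrySum_paramG hnl hnl (p.1, p.2, p.1) i j

lemma sigmaFinite_of_entrySum {a b : ℕ} {μ : Measure (Matrix (Fin a) (Fin b) ℂ)}
    (h : ∀ N : ℕ, μ {x | entrySum x ≤ N} < ⊤) : SigmaFinite μ :=
  ⟨⟨{ set := fun N => {x | entrySum x ≤ N}
      set_mem := fun _ => Set.mem_univ _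
      finite := h
      spanning := Set.eq_univ_of_forall fun x => Set.mem_iUnion.mpr (exists_nat_ge (entrySum x)) }⟩⟩

lemma measurableSet_norm_apply_le (n : ℕ) (N : ℝ) :
    MeasurableSet {y : Matrix (Fin n) (Fin n) ℂ | ∀ i j, ‖y i j‖ ≤ N} := by
  have : {y : Matrix (Fin n) (Fin n) ℂ | ∀ i j, ‖y i j‖ ≤ N} =
      ⋂ i, ⋂ j, {y | ‖y i j‖ ≤ N} := by ext; simp
  rw [this]
  exact MeasurableSet.iInter fun i => MeasurableSet.iInter fun j =>
    measurableSet_le (continuous_id.matrix_elem i j).norm.measurable measurable_const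

lemma sigmaFinite_measG {l m n : ℕ} (hnl : n ≤ l) (hnm : n ≤ m) : SigmaFinite (measG l m n) := by
  refine sigmaFinite_of_entrySum fun N => ?_
  rw [measG_eq, Measure.map_apply (measurable_paramG l m n)
    (measurableSet_le (continuous_entrySum l m).measurable measurable_const)]
  refine lt_of_le_of_lt (measure_mono
    (t := Set.univ ×ˢ {y | ∀ i j, ‖y i j‖ ≤ N} ×ˢ Set.univ) ?_) ?_
  · intro p hp
    exact ⟨Set.mem_univ _, fun i j => (norm_apply_le_entrySum_paramG hnl hnm p i j).trans hp,
      Set.mem_univ _⟩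
  · rw [Measure.prod_prod, Measure.prod_prod, measure_univ, measure_univ, one_mul, mul_one, volG,
      Measure.map_apply (measurable_matrixOf n) (measurableSet_norm_apply_le n N)]
    refine lt_of_le_of_lt (measure_mono (t := Metric.closedBall 0 N) ?_) measure_closedBall_lt_top
    intro t ht
    rw [mem_closedBall_zero_iff, pi_norm_le_iff_of_nonneg (Nat.cast_nonneg N)]
    intro i
    rw [pi_norm_le_iff_of_nonneg (Nat.cast_nonneg N)]
    exact fun j => ht i j

lemma norm_le_norm_hermOf {n : ℕ} (t : Fin n → Fin n → ℝ) (i j : Fin n) :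
    ‖t i j‖ ≤ ‖hermOf n t i j‖ := by
  simp only [hermOf, Matrix.of_apply]
  rcases lt_trichotomy i j with h | h | h
  · rw [if_neg h.ne, if_pos h]
    refine le_trans (le_of_eq ?_) (Complex.abs_re_le_norm _)
    simp
  · subst h; simp
  · rw [if_neg h.ne', if_neg h.not_gt]
    refine le_trans (le_of_eq ?_) (Complex.abs_im_le_norm _)
    simp

lemma sigmaFinite_measH {l n : ℕ} (hnl : n ≤ l) : SigmaFinite (measH l n) := by
  refine sigmaFinite_of_entrySum fun N => ?_
  rw [measH_eq, Measure.map_apply (measurable_paramH l n)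
    (measurableSet_le (continuous_entrySum l l).measurable measurable_const)]
  refine lt_of_le_of_lt (measure_mono (t := Set.univ ×ˢ {y | ∀ i j, ‖y i j‖ ≤ N}) ?_) ?_
  · intro p hp
    exact ⟨Set.mem_univ _, fun i j => (norm_apply_le_entrySum_paramH hnl p i j).trans hp⟩
  · rw [Measure.prod_prod, measure_univ, one_mul, volH,
      Measure.map_apply (measurable_hermOf n) (measurableSet_norm_apply_le n N)]
    refine lt_of_le_of_lt (measure_mono (t := Metric.closedBall 0 N) ?_) measure_closedBall_lt_top
    intro t ht
    rw [mem_closedBall_zero_iff, pi_norm_le_iff_of_nonneg (Nat.cast_nonneg N)]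
    intro i
    rw [pi_norm_le_iff_of_nonneg (Nat.cast_nonneg N)]
    exact fun j => (norm_le_norm_hermOf t i j).trans (ht i j)

/-- Almost every Hermitian matrix of rank `n` has simple nonzero spectrum. -/
lemma measH_ae_mem_GenH {l n : ℕ} (hnl : n ≤ l) : ∀ᵐ x ∂(measH l n), x ∈ GenH l n := by
  rw [measH_eq, ae_map_iff (p := fun x => x ∈ GenH l n) (measurable_paramH l n).aemeasurable
    (measurableSet_GenH l n)]
  have h0 : hankel (hermOf n (diagonal fun i : Fin n => (i : ℝ))) ≠ 0 := by
    rw [hermOf_diagonal, hankel_diagonal]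
    refine pow_ne_zero 2 (det_vandermonde_ne_zero_iff.mpr fun i j hij => ?_)
    simpa [Fin.ext_iff] using hij
  have h1 : ∀ᵐ y ∂(volH n), hankel y ≠ 0 :=
    volH_ae_ne_zero (continuous_hankel n) (fun _ hF => hF.hankel) _ h0
  have h2 : ∀ᵐ y ∂(volH n), yᴴ = y := by
    have hc : MeasurableSet {y : Matrix (Fin n) (Fin n) ℂ | yᴴ = y} :=
      (isClosed_eq (continuous_id.matrix_conjTranspose) continuous_id).measurableSet
    rw [volH, ae_map_iff (measurable_hermOf n).aemeasurable hc]
    exact Filter.Eventually.of_forall hermOf_isHermitian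
  have h3 : ∀ᵐ y ∂(volH n), hankel y ≠ 0 ∧ yᴴ = y ∧ IsUnit y.det := by
    filter_upwards [h1, h2, volH_ae_isUnit_det n] with y a b c using ⟨a, b, c⟩
  filter_upwards [(Measure.quasiMeasurePreserving_snd (μ := haarK l) (ν := volH n)).ae h3] with p hp
  have := conj_Proj_mem_GenH hnl p.1 hp.2.1 hp.1 hp.2.2.ne_zero
  simpa only [paramH, Matrix.mul_assoc] using this

/-- Almost every matrix of rank `n` has simple nonzero singular values. -/
lemma measG_ae_gram_mem_GenH {l m n : ℕ} (hnl : n ≤ l) (hnm : n ≤ m) :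
    ∀ᵐ g ∂(measG l m n), g * gᴴ ∈ GenH l n := by
  have hgr : Continuous fun g : Matrix (Fin l) (Fin m) ℂ => g * gᴴ :=
    continuous_id.matrix_mul continuous_id.matrix_conjTranspose
  have hgr' : Continuous fun g : Matrix (Fin n) (Fin n) ℂ => g * gᴴ :=
    continuous_id.matrix_mul continuous_id.matrix_conjTranspose
  rw [measG_eq, ae_map_iff (p := fun g => g * gᴴ ∈ GenH l n)
    (measurable_paramG l m n).aemeasurable (hgr.measurable (measurableSet_GenH l n))]
  set d : Matrix (Fin n) (Fin n) ℂ := diagonal fun i : Fin n => ((i : ℝ) : ℂ) with hd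
  -- the squares `0, 1, 4, …` on the diagonal of `d dᴴ` are distinct
  have h0 : hankel (d * dᴴ) ≠ 0 := by
    rw [hd, diagonal_conjTranspose, diagonal_mul_diagonal, hankel_diagonal]
    refine pow_ne_zero 2 (det_vandermonde_ne_zero_iff.mpr fun i j hij => ?_)
    have h1 : ((i : ℕ) : ℂ) * (i : ℕ) = (j : ℕ) * (j : ℕ) := by simpa using hij
    have h2 : (i : ℕ) * i = (j : ℕ) * j := by exact_mod_cast h1
    exact Fin.ext (Nat.mul_self_inj.mp h2)
  have h1 : ∀ᵐ g ∂(volG n), hankel (g * gᴴ) ≠ 0 :=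
    volG_ae_ne_zero (p := fun g => hankel (g * gᴴ)) ((continuous_hankel n).comp hgr')
      (fun _ hF => (hF.mul hF.conjTranspose).hankel) d h0
  have h3 : ∀ᵐ g ∂(volG n), hankel (g * gᴴ) ≠ 0 ∧ IsUnit g.det := by
    filter_upwards [h1, volG_ae_isUnit_det n] with y a b using ⟨a, b⟩
  have h4 := (Measure.quasiMeasurePreserving_snd (μ := haarK l)
    (ν := (volG n).prod (haarK m))).ae ((Measure.quasiMeasurePreserving_fst (μ := volG n)
      (ν := haarK m)).ae h3)
  filter_upwards [h4] with p hp
  rw [paramG_gram hnm]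
  refine conj_Proj_mem_GenH hnl p.1 ?_ hp.1 ?_
  · rw [conjTranspose_mul, conjTranspose_conjTranspose]
  · rw [det_mul, det_conjTranspose]
    exact mul_ne_zero hp.2.ne_zero (star_ne_zero.mpr hp.2.ne_zero)

/-! ### Absolute continuity of the images of the product measures -/

/-- Almost everywhere statements on a product of two products, with the outer variables of both
factors integrated last. -/
lemma ae_prod_prod_of_ae_ae {A X D E : Type*} [MeasurableSpace A] [MeasurableSpace X]
    [MeasurableSpace D] [MeasurableSpace E] {α : Measure A} {ξ : Measure X} {δ : Measure D}
    {ε : Measure E} [SFinite α] [SFinite ξ] [SFinite δ] [SFinite ε]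
    {p : (A × X) × (D × E) → Prop} (hp : MeasurableSet {z | p z})
    (h : ∀ᵐ w ∂(ξ.prod δ), ∀ᵐ v ∂(α.prod ε), p ((v.1, w.1), (w.2, v.2))) :
    ∀ᵐ z ∂((α.prod ξ).prod (δ.prod ε)), p z := by
  have m1 : MeasurePreserving (fun t : D × (A × E) => (t.2.1, (t.1, t.2.2)))
      (δ.prod (α.prod ε)) (α.prod (δ.prod ε)) :=
    (measurePreserving_prodAssoc α δ ε).comp ((Measure.measurePreserving_swap.prod
      (MeasurePreserving.id ε)).comp (measurePreserving_prodAssoc δ α ε).symm)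
  have m2 : MeasurePreserving (fun q : (X × D) × (A × E) => ((q.2.1, q.1.1), (q.1.2, q.2.2)))
      ((ξ.prod δ).prod (α.prod ε)) ((α.prod ξ).prod (δ.prod ε)) :=
    (Measure.measurePreserving_swap.prod (MeasurePreserving.id _)).comp
      ((measurePreserving_prodAssoc ξ α (δ.prod ε)).symm.comp
        (((MeasurePreserving.id ξ).prod m1).comp (measurePreserving_prodAssoc ξ δ (α.prod ε))))
  rw [← m2.map_eq, ae_map_iff m2.aemeasurable hp, Measure.ae_prod_iff_ae_ae
    (p := fun q : (X × D) × (A × E) => p ((q.2.1, q.1.1), (q.1.2, q.2.2))) (m2.measurable hp)]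
  exact h

/-- The coordinates of a Hermitian matrix, inverting `hermOf`. -/
def hermCoord (n : ℕ) (y : Matrix (Fin n) (Fin n) ℂ) : Fin n → Fin n → ℝ := fun i j =>
  if i ≤ j then (y i j).re else (y j i).im

lemma hermOf_hermCoord {n : ℕ} {y : Matrix (Fin n) (Fin n) ℂ} (hy : yᴴ = y) :
    hermOf n (hermCoord n y) = y := by
  have h : ∀ i j, star (y j i) = y i j := fun i j => by rw [← conjTranspose_apply, hy]
  ext i j
  simp only [hermOf, hermCoord, Matrix.of_apply]
  rcases lt_trichotomy i j with hij | hij | hij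
  · simp [hij.ne, hij, hij.le, hij.not_ge, Complex.re_add_im]
  · subst hij
    have := congrArg Complex.im (h i i)
    simp at this
    apply Complex.ext <;> simp
    linarith
  · rw [← h i j]
    simp only [hij.ne', hij.not_gt, hij.le, hij.not_ge, if_true, if_false]
    apply Complex.ext <;> simp

lemma hermOf_injective (n : ℕ) : Function.Injective (hermOf n) := by
  intro t t' h
  have h1 := sub_eq_zero.mpr h
  have h2 : hermOf n (t + (-1 : ℝ) • t') = 0 := by
    rw [hermOf_add_smul, h]; simp
  funext i j
  have h3 := norm_le_norm_hermOf (t + (-1 : ℝ) • t') i j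
  rw [h2] at h3
  have h4 : t i j + -t' i j = 0 := by simpa using h3
  linarith

/-- The compression `y ↦ C y Cᴴ` by a matrix `C` of full row rank maps null sets back to null
sets. -/
lemma volH_ae_conj {n r : ℕ} {C : Matrix (Fin r) (Fin n) ℂ} {D : Matrix (Fin n) (Fin r) ℂ}
    (hCD : C * D = 1) {S : Set (Matrix (Fin r) (Fin r) ℂ)} (hS : MeasurableSet S)
    (h : ∀ᵐ y ∂(volH r), y ∈ S) : ∀ᵐ y ∂(volH n), C * y * Cᴴ ∈ S := by
  have hc : Continuous fun y : Matrix (Fin n) (Fin n) ℂ => C * y * Cᴴ :=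
    (continuous_const.matrix_mul continuous_id).matrix_mul continuous_const
  rw [volH, ae_map_iff (p := fun y => y ∈ S) (measurable_hermOf _).aemeasurable hS] at h
  rw [volH, ae_map_iff (p := fun y => C * y * Cᴴ ∈ S) (measurable_hermOf _).aemeasurable
    (hc.measurable hS)]
  have hL : ∀ t, hermOf r (hermCoord r (C * hermOf n t * Cᴴ)) = C * hermOf n t * Cᴴ := fun t =>
    hermOf_hermCoord (isHermitian_conj C (hermOf_isHermitian t))
  -- in coordinates the compression is a surjective linear map; `y ↦ D y Dᴴ` is a right inverse
  have hlin : ∀ (t t' : Fin n → Fin n → ℝ) (c : ℝ),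
      hermCoord r (C * hermOf n (t + c • t') * Cᴴ) =
        hermCoord r (C * hermOf n t * Cᴴ) + c • hermCoord r (C * hermOf n t' * Cᴴ) := by
    intro t t' c
    apply hermOf_injective
    rw [hL, hermOf_add_smul, hermOf_add_smul, hL, hL, Matrix.mul_add, Matrix.add_mul,
      Matrix.mul_smul, Matrix.smul_mul]
  have h0 : hermCoord r (C * hermOf n 0 * Cᴴ) = 0 := by
    have := hlin 0 0 (-1)
    simpa using this
  let L : (Fin n → Fin n → ℝ) →ₗ[ℝ] (Fin r → Fin r → ℝ) :=
    { toFun := fun t => hermCoord r (C * hermOf n t * Cᴴ)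
      map_add' := fun t t' => by simpa using hlin t t' 1
      map_smul' := fun c t => by simpa [h0] using hlin 0 t c }
  have hsurj : Function.Surjective L := by
    intro t
    refine ⟨hermCoord n (D * hermOf r t * Dᴴ), hermOf_injective r ?_⟩
    change hermOf r (hermCoord r (C * hermOf n (hermCoord n (D * hermOf r t * Dᴴ)) * Cᴴ)) = _
    rw [hL, hermOf_hermCoord (isHermitian_conj D (hermOf_isHermitian t))]
    have hDC : Dᴴ * Cᴴ = 1 := by rw [← conjTranspose_mul, hCD, conjTranspose_one]
    calc _ = (C * D) * hermOf r t * (Dᴴ * Cᴴ) := by simp only [Matrix.mul_assoc]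
      _ = _ := by rw [hCD, hDC, Matrix.one_mul, Matrix.mul_one]
  have h1 := (ae_comp_linearMap_mem_iff L volume volume hsurj
    ((measurable_hermOf r) hS)).mpr h
  filter_upwards [h1] with t ht
  rw [← hL t]
  exact ht

/-- Surjective real linear maps of the square matrices map null sets back to null sets. -/
lemma quasiMeasurePreserving_volG_linear {r : ℕ}
    {L : Matrix (Fin r) (Fin r) ℂ →ₗ[ℝ] Matrix (Fin r) (Fin r) ℂ}
    (hL : Function.Surjective L) (hLc : Continuous L) :
    Measure.QuasiMeasurePreserving L (volG r) (volG r) := by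
  refine ⟨hLc.measurable, Measure.AbsolutelyContinuous.mk fun Z hZ hZ0 => ?_⟩
  have h : ∀ᵐ y ∂(volG r), y ∈ Zᶜ := by rw [ae_iff]; simpa using hZ0
  rw [volG, ae_map_iff (p := fun y => y ∈ Zᶜ) (measurable_matrixOf _).aemeasurable hZ.compl] at h
  let e : (Fin r → Fin r → ℂ) ≃ₗ[ℝ] Matrix (Fin r) (Fin r) ℂ := Matrix.ofLinearEquiv ℝ
  have h1 := (ae_comp_linearMap_mem_iff (e.symm.toLinearMap ∘ₗ L ∘ₗ e.toLinearMap) volume volume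
    (e.symm.surjective.comp (hL.comp e.surjective)) (measurable_matrixOf r hZ.compl)).mpr h
  have h2 : ∀ᵐ y ∂(volG r), L y ∈ Zᶜ := by
    rw [volG, ae_map_iff (p := fun y => L y ∈ Zᶜ) (measurable_matrixOf _).aemeasurable
      (hLc.measurable hZ.compl)]
    exact h1
  rw [Measure.map_apply hLc.measurable hZ]
  rw [ae_iff] at h2
  simp only [Set.mem_compl_iff, not_not] at h2
  exact h2

/-- Multiplication by an invertible matrix maps null sets back to null sets. -/
lemma quasiMeasurePreserving_volG_mul {r : ℕ} {A D : Matrix (Fin r) (Fin r) ℂ} (hAD : A * D = 1) :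
    Measure.QuasiMeasurePreserving (fun y : Matrix (Fin r) (Fin r) ℂ => A * y)
      (volG r) (volG r) := by
  refine quasiMeasurePreserving_volG_linear (L := LinearMap.mulLeft ℝ A) (fun y => ⟨D * y, ?_⟩)
    (continuous_const.matrix_mul continuous_id)
  change A * (D * y) = y
  rw [← Matrix.mul_assoc, hAD, Matrix.one_mul]

lemma quasiMeasurePreserving_volG_conjTranspose (r : ℕ) :
    Measure.QuasiMeasurePreserving (fun y : Matrix (Fin r) (Fin r) ℂ => yᴴ) (volG r) (volG r) :=
  quasiMeasurePreserving_volG_linear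
    (L := (Matrix.conjTransposeLinearEquiv (Fin r) (Fin r) ℝ ℂ).toLinearMap)
    (LinearEquiv.surjective _) continuous_id.matrix_conjTranspose

lemma minor_lower_mul_left {n j : ℕ} (hj : j ≤ n) {T : Matrix (Fin n) (Fin n) ℂ} (hT : IsLower T)
    (A : Matrix (Fin n) (Fin n) ℂ) : minor j (T * A) = minor j T * minor j A := by
  unfold minor
  have h : Proj j n * (T * A) * Proj n j = (Proj j n * T * Proj n j) * (Proj j n * A * Proj n j) := by
    calc _ = (Proj j n * T) * A * Proj n j := by simp only [Matrix.mul_assoc]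
      _ = ((Proj j n * T * Proj n j) * Proj j n) * A * Proj n j := by rw [← hT.Proj_mul hj]
      _ = _ := by simp only [Matrix.mul_assoc]
  rw [h, det_mul]

lemma haarK_ae_minor_ne_zero {m r : ℕ} (hr : r ≤ m) :
    ∀ᵐ u ∂(haarK m), minor r u.1 ≠ 0 := by
  refine haarK_ae_ne_zero (p := minor r) (continuous_minor r) ?_ ?_ 1 ?_
  · intro F hF
    exact (((isPolyCurve_const _).mul hF).mul (isPolyCurve_const _)).det
  · intro T A hT _ h h0
    rw [minor_lower_mul_left hr hT, h0, mul_zero] at h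
    exact h rfl
  · rw [minor_one hr]; exact one_ne_zero

lemma haarK_prod_ae_minor_ne_zero {m r : ℕ} (hr : r ≤ m) :
    ∀ᵐ w ∂((haarK m).prod (haarK m)), minor r (w.1.1ᴴ * w.2.1) ≠ 0 := by
  have hc : Continuous fun w : K m × K m => minor r (w.1.1ᴴ * w.2.1) :=
    (continuous_minor r).comp (((continuous_coeK m).comp continuous_fst).matrix_conjTranspose
      |>.matrix_mul ((continuous_coeK m).comp continuous_snd))
  rw [Measure.ae_prod_iff_ae_ae (p := fun w : K m × K m => minor r (w.1.1ᴴ * w.2.1) ≠ 0)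
    (hc.measurable (measurableSet_singleton 0)).compl]
  refine Filter.Eventually.of_forall fun k => ?_
  filter_upwards [(measurePreserving_mul_left (haarK m) k⁻¹).quasiMeasurePreserving.ae
    (haarK_ae_minor_ne_zero hr)] with u hu
  exact hu

lemma ae_isUnit_det_and_minor_ne_zero (n : ℕ) {m r : ℕ} (hr : r ≤ m) :
    ∀ᵐ w ∂(((volG n).prod (haarK m)).prod (haarK m)),
      IsUnit w.1.1.det ∧ minor r (w.1.2.1ᴴ * w.2.1) ≠ 0 := by
  have e1 := (Measure.quasiMeasurePreserving_fst (μ := (volG n).prod (haarK m))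
    (ν := haarK m)).ae ((Measure.quasiMeasurePreserving_fst (μ := volG n)
      (ν := haarK m)).ae (volG_ae_isUnit_det n))
  have e2 := (measurePreserving_prodAssoc (volG n) (haarK m)
    (haarK m)).quasiMeasurePreserving.ae ((Measure.quasiMeasurePreserving_snd (μ := volG n)
      (ν := (haarK m).prod (haarK m))).ae (haarK_prod_ae_minor_ne_zero hr))
  filter_upwards [e1, e2] with w a b using ⟨a, b⟩

/-- The middle factor of a generic product has full rank. -/
lemma exists_factor_of_minor_ne_zero {m n₁ n₂ r : ℕ} (hr : min n₁ n₂ = r) {g : Matrix (Fin n₁) (Fin n₁) ℂ} (hg : IsUnit g.det)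
    {U : Matrix (Fin m) (Fin m) ℂ} (hU : minor r U ≠ 0) :
    ∃ (W : K n₁) (C : Matrix (Fin r) (Fin n₂) ℂ) (D : Matrix (Fin n₂) (Fin r) ℂ),
      g * Proj n₁ m * U * Proj m n₂ = W.1 * Proj n₁ r * C ∧ C * D = 1 := by
  have hM : IsUnit (Proj r m * U * Proj m r).det := isUnit_iff_ne_zero.mpr hU
  rcases le_total n₁ n₂ with h | h
  · rw [min_eq_left h] at hr
    subst hr
    refine ⟨1, g * Proj n₁ m * U * Proj m n₂, Proj n₂ n₁ * ((Proj n₁ m * U * Proj m n₁)⁻¹ * g⁻¹),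
      ?_, ?_⟩
    · rw [Proj_self, Matrix.mul_one]
      exact (Matrix.one_mul _).symm
    · calc _ = g * ((Proj n₁ m * U * (Proj m n₂ * Proj n₂ n₁)) *
            (Proj n₁ m * U * Proj m n₁)⁻¹) * g⁻¹ := by simp only [Matrix.mul_assoc]
        _ = 1 := by
            rw [Proj_mul_Proj (Or.inr h), Matrix.mul_nonsing_inv _ hM, Matrix.mul_one,
              Matrix.mul_nonsing_inv _ hg]
  · rw [min_eq_right h] at hr
    subst hr
    obtain ⟨W, C, hS⟩ := exists_unitary_mul_Proj_mul h (g * Proj n₁ m * U * Proj m n₂)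
    set E := (Proj n₂ m * U * Proj m n₂)⁻¹ * Proj n₂ n₁ * g⁻¹ with hE
    have hES : E * (g * Proj n₁ m * U * Proj m n₂) = 1 := by
      calc _ = (Proj n₂ m * U * Proj m n₂)⁻¹ * (Proj n₂ n₁ * (g⁻¹ * g) * Proj n₁ m * U *
            Proj m n₂) := by rw [hE]; simp only [Matrix.mul_assoc]
        _ = 1 := by
            rw [Matrix.nonsing_inv_mul _ hg, Matrix.mul_one, Proj_mul_Proj (Or.inl h),
              Matrix.nonsing_inv_mul _ hM]
    refine ⟨W, C, E * (W.1 * Proj n₁ n₂), hS, ?_⟩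
    rw [mul_eq_one_comm, Matrix.mul_assoc, ← hS, hES]

lemma coeK_mul_Proj_mul_coeK {l n r : ℕ} (hnl : n ≤ l) (hrn : r ≤ n) (k : K l) (W : K n) :
    k.1 * Proj l n * (W.1 * Proj n r) = (k * extK hnl W).1 * Proj l r := by
  rw [coeK_mul]
  have := extK_mul_Proj hnl W
  calc _ = k.1 * (Proj l n * W.1) * Proj n r := by simp only [Matrix.mul_assoc]
    _ = k.1 * (extK hnl W).1 * (Proj l n * Proj n r) := by rw [← this]; simp only [Matrix.mul_assoc]
    _ = _ := by rw [Proj_mul_Proj (Or.inr hrn)]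

/-- The image of the product of the reference measures under `(g, x) ↦ g x gᴴ` is absolutely
continuous. -/
theorem map_conj_absolutelyContinuous {l m n₁ n₂ r : ℕ} (hr : min n₁ n₂ = r) (h₁l : n₁ ≤ l)
    (h₁m : n₁ ≤ m) :
    ((measG l m n₁).prod (measH m n₂)).map (fun p => p.1 * p.2 * p.1ᴴ) ≪ measH l r := by
  have hr₁ : r ≤ n₁ := hr ▸ min_le_left _ _
  have hTc : Continuous fun p : Matrix (Fin l) (Fin m) ℂ × Matrix (Fin m) (Fin m) ℂ =>
      p.1 * p.2 * p.1ᴴ :=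
    (continuous_fst.matrix_mul continuous_snd).matrix_mul continuous_fst.matrix_conjTranspose
  refine Measure.AbsolutelyContinuous.mk fun Z hZ hZ0 => ?_
  have hA : ∀ᵐ x ∂(measH l r), x ∈ Zᶜ := by rw [ae_iff]; simpa using hZ0
  rw [measH_eq, ae_map_iff (p := fun x => x ∈ Zᶜ) (measurable_paramH l r).aemeasurable hZ.compl]
    at hA
  have hgoal : ∀ᵐ x ∂(((measG l m n₁).prod (measH m n₂)).map fun p => p.1 * p.2 * p.1ᴴ),
      x ∈ Zᶜ := by
    have hm1 := (measurable_paramG l m n₁).prodMap (measurable_paramH m n₂)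
    rw [ae_map_iff (p := fun x => x ∈ Zᶜ) hTc.aemeasurable hZ.compl, measG_eq, measH_eq,
      Measure.map_prod_map _ _ (measurable_paramG l m n₁) (measurable_paramH m n₂),
      ae_map_iff (p := fun p : Matrix (Fin l) (Fin m) ℂ × Matrix (Fin m) (Fin m) ℂ =>
        p.1 * p.2 * p.1ᴴ ∈ Zᶜ) hm1.aemeasurable (hTc.measurable hZ.compl)]
    refine ae_prod_prod_of_ae_ae (hm1 (hTc.measurable hZ.compl)) ?_
    -- for almost all values `w` of the middle variables `g x gᴴ` is parametrized by the outer
    -- unitary factor and a compression of the Hermitian factor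
    filter_upwards [ae_isUnit_det_and_minor_ne_zero n₁ (hr₁.trans h₁m)] with w hw
    obtain ⟨W, C, D, hS, hCD⟩ := exists_factor_of_minor_ne_zero hr hw.1 hw.2
    have hprod : ∀ v : K l × Matrix (Fin n₂) (Fin n₂) ℂ,
        paramG l m n₁ (v.1, w.1) * paramH m n₂ (w.2, v.2) * (paramG l m n₁ (v.1, w.1))ᴴ =
        paramH l r (v.1 * extK h₁l W, C * v.2 * Cᴴ) := by
      intro v
      have e1 : paramG l m n₁ (v.1, w.1) * w.2.1 * Proj m n₂ =
          (v.1 * extK h₁l W).1 * Proj l r * C := by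
        rw [← coeK_mul_Proj_mul_coeK h₁l hr₁, Matrix.mul_assoc (v.1.1 * Proj l n₁), ← hS]
        simp only [paramG, Matrix.mul_assoc]
      have e2 := congrArg conjTranspose e1
      simp only [conjTranspose_mul, Proj_conjTranspose] at e2
      calc _ = (paramG l m n₁ (v.1, w.1) * w.2.1 * Proj m n₂) * v.2 *
            (Proj n₂ m * (w.2.1ᴴ * (paramG l m n₁ (v.1, w.1))ᴴ)) := by
            simp only [paramH, Matrix.mul_assoc]
        _ = _ := by rw [e1, e2]; simp only [paramH, Matrix.mul_assoc]
    have hA2 : ∀ᵐ v ∂((haarK l).prod (volH n₂)),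
        paramH l r (v.1 * extK h₁l W, C * v.2 * Cᴴ) ∈ Zᶜ := by
      have hc : Continuous fun v : K l × Matrix (Fin n₂) (Fin n₂) ℂ =>
          paramH l r (v.1 * extK h₁l W, C * v.2 * Cᴴ) :=
        (continuous_paramH l r).comp ((continuous_fst.mul continuous_const).prodMk
          ((continuous_const.matrix_mul continuous_snd).matrix_mul continuous_const))
      rw [Measure.ae_prod_iff_ae_ae (hc.measurable hZ.compl)]
      filter_upwards [(measurePreserving_mul_right (haarK l)
        (extK h₁l W)).quasiMeasurePreserving.ae (Measure.ae_ae_of_ae_prod hA)] with k hk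
      exact volH_ae_conj hCD (S := {y | paramH l r (k * extK h₁l W, y) ∈ Zᶜ})
        (((continuous_paramH l r).comp (continuous_const.prodMk continuous_id)).measurable
          hZ.compl) hk
    filter_upwards [hA2] with v hv
    rw [← hprod v] at hv
    exact hv
  rw [ae_iff] at hgoal
  simpa using hgoal

lemma conjTranspose_paramG {l m n : ℕ} (p : K l × Matrix (Fin n) (Fin n) ℂ × K m) :
    (paramG l m n p)ᴴ = paramG m l n (p.2.2, p.2.1ᴴ, p.1) := by
  simp only [paramG, conjTranspose_mul, conjTranspose_conjTranspose, Proj_conjTranspose,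
    Matrix.mul_assoc]

lemma quasiMeasurePreserving_measG_conjTranspose (l m n : ℕ) :
    Measure.QuasiMeasurePreserving (fun g : Matrix (Fin l) (Fin m) ℂ => gᴴ) (measG l m n)
      (measG m l n) := by
  have hc : Measurable fun g : Matrix (Fin l) (Fin m) ℂ => gᴴ :=
    continuous_id.matrix_conjTranspose.measurable
  have h1 : Measure.QuasiMeasurePreserving
      (fun p : K l × Matrix (Fin n) (Fin n) ℂ × K m => (p.2.2, p.2.1ᴴ, p.1))
      ((haarK l).prod ((volG n).prod (haarK m))) ((haarK m).prod ((volG n).prod (haarK l))) := by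
    have e1 := QuasiMeasurePreserving.prodMap (quasiMeasurePreserving_volG_conjTranspose n)
      (Measure.QuasiMeasurePreserving.id (haarK m))
    have e2 := QuasiMeasurePreserving.prodMap (Measure.QuasiMeasurePreserving.id (haarK l)) e1
    have e3 := (Measure.measurePreserving_swap (μ := haarK l)
      (ν := (volG n).prod (haarK m))).quasiMeasurePreserving.comp e2
    have e4 := ((Measure.measurePreserving_swap (μ := volG n)
      (ν := haarK m)).prod (MeasurePreserving.id (haarK l))).quasiMeasurePreserving.comp e3
    exact (measurePreserving_prodAssoc (haarK m) (volG n)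
      (haarK l)).quasiMeasurePreserving.comp e4
  refine ⟨hc, ?_⟩
  rw [measG_eq, measG_eq, Measure.map_map hc (measurable_paramG l m n)]
  have h2 := h1.absolutelyContinuous.map (measurable_paramG m l n)
  rw [Measure.map_map (measurable_paramG m l n) h1.measurable] at h2
  have h3 : (fun g : Matrix (Fin l) (Fin m) ℂ => gᴴ) ∘ paramG l m n = paramG m l n ∘
      fun p : K l × Matrix (Fin n) (Fin n) ℂ × K m => (p.2.2, p.2.1ᴴ, p.1) :=
    funext conjTranspose_paramG
  rwa [h3]

lemma continuous_matrix_mul_prod (a b c : ℕ) :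
    Continuous fun p : Matrix (Fin a) (Fin b) ℂ × Matrix (Fin b) (Fin c) ℂ => p.1 * p.2 :=
  continuous_fst.matrix_mul continuous_snd

/-- The image of the product of the reference measures under `(g₁, g₂) ↦ g₁ g₂` is absolutely
continuous, when the rank of the second factor is at most the rank of the first. -/
lemma map_mul_absolutelyContinuous_of_le {l m o n r : ℕ} (hrn : r ≤ n) (hnl : n ≤ l)
    (hnm : n ≤ m) :
    ((measG l m n).prod (measG m o r)).map (fun p => p.1 * p.2) ≪ measG l o r := by
  refine Measure.AbsolutelyContinuous.mk fun Z hZ hZ0 => ?_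
  have hTc := continuous_matrix_mul_prod l m o
  have hA : ∀ᵐ x ∂(measG l o r), x ∈ Zᶜ := by rw [ae_iff]; simpa using hZ0
  rw [measG_eq, ae_map_iff (p := fun x => x ∈ Zᶜ) (measurable_paramG l o r).aemeasurable hZ.compl]
    at hA
  have hgoal : ∀ᵐ x ∂(((measG l m n).prod (measG m o r)).map fun p => p.1 * p.2), x ∈ Zᶜ := by
    have hm1 := (measurable_paramG l m n).prodMap (measurable_paramG m o r)
    rw [ae_map_iff (p := fun x => x ∈ Zᶜ) hTc.aemeasurable hZ.compl, measG_eq, measG_eq,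
      Measure.map_prod_map _ _ (measurable_paramG l m n) (measurable_paramG m o r),
      ae_map_iff (p := fun p : Matrix (Fin l) (Fin m) ℂ × Matrix (Fin m) (Fin o) ℂ =>
        p.1 * p.2 ∈ Zᶜ) hm1.aemeasurable (hTc.measurable hZ.compl)]
    refine ae_prod_prod_of_ae_ae (hm1 (hTc.measurable hZ.compl)) ?_
    -- for almost all values `w` of the middle variables the product is parametrized by the outer
    -- unitary factors and an invertible multiple of the square factor
    filter_upwards [ae_isUnit_det_and_minor_ne_zero n (hrn.trans hnm)] with w hw
    obtain ⟨W, C, D, hS, hCD⟩ := exists_factor_of_minor_ne_zero (min_eq_right hrn) hw.1 hw.2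
    have hprod : ∀ v : K l × Matrix (Fin r) (Fin r) ℂ × K o,
        paramG l m n (v.1, w.1) * paramG m o r (w.2, v.2) =
        paramG l o r (v.1 * extK hnl W, C * v.2.1, v.2.2) := by
      intro v
      have e1 : paramG l m n (v.1, w.1) * w.2.1 * Proj m r =
          (v.1 * extK hnl W).1 * Proj l r * C := by
        rw [← coeK_mul_Proj_mul_coeK hnl hrn, Matrix.mul_assoc (v.1.1 * Proj l n), ← hS]
        simp only [paramG, Matrix.mul_assoc]
      calc _ = (paramG l m n (v.1, w.1) * w.2.1 * Proj m r) * v.2.1 * Proj r o * v.2.2.1ᴴ := by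
            simp only [paramG, Matrix.mul_assoc]
        _ = _ := by rw [e1]; simp only [paramG, Matrix.mul_assoc]
    have hA2 : ∀ᵐ v ∂((haarK l).prod ((volG r).prod (haarK o))),
        paramG l o r (v.1 * extK hnl W, C * v.2.1, v.2.2) ∈ Zᶜ := by
      exact (QuasiMeasurePreserving.prodMap (measurePreserving_mul_right (haarK l)
        (extK hnl W)).quasiMeasurePreserving (QuasiMeasurePreserving.prodMap
          (quasiMeasurePreserving_volG_mul hCD)
          (Measure.QuasiMeasurePreserving.id (haarK o)))).ae hA
    filter_upwards [hA2] with v hv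
    rw [← hprod v] at hv
    exact hv
  rw [ae_iff] at hgoal
  simpa using hgoal

/-- The image of the product of the reference measures under `(g₁, g₂) ↦ g₁ g₂` is absolutely
continuous. -/
theorem map_mul_absolutelyContinuous {l m o n₁ n₂ r : ℕ} (hr : min n₁ n₂ = r) (h₁l : n₁ ≤ l)
    (h₁m : n₁ ≤ m) (h₂m : n₂ ≤ m) (h₂o : n₂ ≤ o) :
    ((measG l m n₁).prod (measG m o n₂)).map (fun p => p.1 * p.2) ≪ measG l o r := by
  rcases le_total n₂ n₁ with h | h
  · rw [min_eq_right h] at hr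
    subst hr
    exact map_mul_absolutelyContinuous_of_le h h₁l h₁m
  -- the other case follows by passing to adjoints
  rw [min_eq_left h] at hr
  subst hr
  have h1 := map_mul_absolutelyContinuous_of_le (o := l) h h₂o h₂m
  have h2 : Measure.QuasiMeasurePreserving
      (fun p : Matrix (Fin l) (Fin m) ℂ × Matrix (Fin m) (Fin o) ℂ => (p.2ᴴ, p.1ᴴ))
      ((measG l m n₁).prod (measG m o n₂)) ((measG o m n₂).prod (measG m l n₁)) :=
    (QuasiMeasurePreserving.prodMap (quasiMeasurePreserving_measG_conjTranspose m o n₂)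
      (quasiMeasurePreserving_measG_conjTranspose l m n₁)).comp
      Measure.measurePreserving_swap.quasiMeasurePreserving
  have h3 : Measure.QuasiMeasurePreserving
      (fun p : Matrix (Fin o) (Fin m) ℂ × Matrix (Fin m) (Fin l) ℂ => p.1 * p.2)
      ((measG o m n₂).prod (measG m l n₁)) (measG o l n₁) :=
    ⟨(continuous_matrix_mul_prod o m l).measurable, h1⟩
  have h4 := ((quasiMeasurePreserving_measG_conjTranspose o l n₁).comp (h3.comp h2))
  have h5 : (fun p : Matrix (Fin l) (Fin m) ℂ × Matrix (Fin m) (Fin o) ℂ => p.1 * p.2) =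
      (fun g : Matrix (Fin o) (Fin l) ℂ => gᴴ) ∘
      (fun p : Matrix (Fin o) (Fin m) ℂ × Matrix (Fin m) (Fin l) ℂ => p.1 * p.2) ∘
      (fun p : Matrix (Fin l) (Fin m) ℂ × Matrix (Fin m) (Fin o) ℂ => (p.2ᴴ, p.1ᴴ)) := by
    funext p
    simp only [Function.comp_apply, conjTranspose_mul, conjTranspose_conjTranspose]
  rw [h5]
  exact h4.absolutelyContinuous

/-! ### The convolutions and their transforms -/

lemma integral_comp_of_measurePreserving {α β : Type*} [MeasurableSpace α] [MeasurableSpace β]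
    {μ : Measure α} {ν : Measure β} {f : α → β} (hf : MeasurePreserving f μ ν) {g : β → ℂ}
    (hg : AEStronglyMeasurable g ν) : ∫ x, g (f x) ∂μ = ∫ y, g y ∂ν := by
  have hg' := hg
  rw [← hf.map_eq] at hg'
  conv_rhs => rw [← hf.map_eq]
  exact (integral_map hf.aemeasurable hg').symm

/-- Symmetries of `T` that preserve `c` are symmetries of the density. -/
lemma IsImageDensity.ae_comp_eq {Ω Y : Type*} [MeasurableSpace Ω] [MeasurableSpace Y]
    {ρ : Measure Ω} {μ : Measure Y} {T : Ω → Y} (hT : Measurable T) {c : Ω → ℂ}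
    (hc : Integrable c ρ) {f : Y → ℂ} (hf : IsImageDensity ρ μ T c f) {σ : Ω → Ω}
    (hσ : MeasurePreserving σ ρ ρ) {τ τ' : Y → Y} (hτ : MeasurePreserving τ μ μ)
    (hτ'm : Measurable τ') (hτ' : ∀ y, τ' (τ y) = y) (hTσ : ∀ p, T (σ p) = τ (T p))
    (hcσ : ∀ᵐ p ∂ρ, c (σ p) = c p) : ∀ᵐ y ∂μ, f (τ y) = f y := by
  have hfτ := hτ.integrable_comp_of_integrable hf.integrable
  -- both functions have the same integrals over all measurable sets `A`
  refine hfτ.ae_eq_of_withDensityᵥ_eq hf.integrable ?_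
  ext1 A hA
  rw [withDensityᵥ_apply hfτ hA, withDensityᵥ_apply hf.integrable hA, ← integral_indicator hA,
    ← integral_indicator hA]
  have h1 : Measurable (A.indicator (fun _ => (1 : ℂ))) := measurable_const.indicator hA
  have hmul : ∀ (q : Y → ℂ) (B : Set Y) y, B.indicator q y = q y * B.indicator (fun _ => (1 : ℂ)) y := by
    intro q B y
    by_cases hy : y ∈ B
    · rw [Set.indicator_of_mem hy, Set.indicator_of_mem hy, mul_one]
    · rw [Set.indicator_of_notMem hy, Set.indicator_of_notMem hy, mul_zero]
  have hbd : ∀ φ : Y → ℂ, Measurable φ → (∀ y, ‖φ y‖ ≤ 1) →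
      Integrable (fun p => c p * φ (T p)) ρ := fun φ hφ hb =>
    hc.mul_bdd (c := 1) (hφ.comp hT).aestronglyMeasurable (Filter.Eventually.of_forall fun p => hb _)
  have hind : ∀ y, ‖A.indicator (fun _ => (1 : ℂ)) y‖ ≤ 1 := fun y => by
    by_cases hy : y ∈ A
    · rw [Set.indicator_of_mem hy, norm_one]
    · rw [Set.indicator_of_notMem hy, norm_zero]; exact zero_le_one
  set φ := A.indicator (fun _ => (1 : ℂ)) with hφ
  have i1 := hbd (fun y => φ (τ' y)) (h1.comp hτ'm) fun y => hind _
  have i2 := hbd φ h1 hind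
  calc ∫ y, A.indicator (f ∘ τ) y ∂μ = ∫ y, f (τ y) * φ (τ' (τ y)) ∂μ := by
        refine integral_congr_ae (Filter.Eventually.of_forall fun y => ?_)
        beta_reduce
        rw [hmul, hτ']; rfl
    _ = ∫ y, f y * φ (τ' y) ∂μ := integral_comp_of_measurePreserving hτ
        (hf.integrable_mul _ (h1.comp hτ'm) i1).1
    _ = ∫ p, c p * φ (τ' (T p)) ∂ρ := hf.integral_mul _ (h1.comp hτ'm) i1
    _ = ∫ p, c (σ p) * φ (τ' (T (σ p))) ∂ρ :=
        (integral_comp_of_measurePreserving hσ i1.1).symm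
    _ = ∫ p, c p * φ (T p) ∂ρ := by
        refine integral_congr_ae ?_
        filter_upwards [hcσ] with p hp
        rw [hp, hTσ, hτ']
    _ = ∫ y, f y * φ y ∂μ := (hf.integral_mul _ h1 i2).symm
    _ = _ := integral_congr_ae (Filter.Eventually.of_forall fun y => (hmul f A y).symm)

lemma continuous_conj_prod (l m : ℕ) :
    Continuous fun p : Matrix (Fin l) (Fin m) ℂ × Matrix (Fin m) (Fin m) ℂ =>
      p.1 * p.2 * p.1ᴴ :=
  (continuous_fst.matrix_mul continuous_snd).matrix_mul continuous_fst.matrix_conjTranspose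

variable {l m o n₁ n₂ r : ℕ}

lemma isImageDensity_convH (hr : min n₁ n₂ = r) (h₁l : n₁ ≤ l) (h₁m : n₁ ≤ m)
    {P : Matrix (Fin l) (Fin m) ℂ → ℂ} (hP : Integrable P (measG l m n₁))
    {Q : Matrix (Fin m) (Fin m) ℂ → ℂ} (hQ : Integrable Q (measH m n₂)) :
    IsImageDensity ((measG l m n₁).prod (measH m n₂)) (measH l r) (fun p => p.1 * p.2 * p.1ᴴ)
      (fun p => P p.1 * Q p.2) (convH l m n₁ n₂ P Q) := by
  have hac := map_conj_absolutelyContinuous (n₂ := n₂) hr h₁l h₁m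
  subst hr
  have := sigmaFinite_measH ((min_le_left n₁ n₂).trans h₁l)
  exact isImageDensity_rnDeriv (continuous_conj_prod l m).measurable hac (hP.mul_prod hQ)

lemma isImageDensity_convG (hr : min n₁ n₂ = r) (h₁l : n₁ ≤ l) (h₁m : n₁ ≤ m) (h₂m : n₂ ≤ m)
    (h₂o : n₂ ≤ o) {P : Matrix (Fin l) (Fin m) ℂ → ℂ} (hP : Integrable P (measG l m n₁))
    {Q : Matrix (Fin m) (Fin o) ℂ → ℂ} (hQ : Integrable Q (measG m o n₂)) :
    IsImageDensity ((measG l m n₁).prod (measG m o n₂)) (measG l o r) (fun p => p.1 * p.2)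
      (fun p => P p.1 * Q p.2) (convG l m o n₁ n₂ P Q) := by
  have hac := map_mul_absolutelyContinuous hr h₁l h₁m h₂m h₂o
  subst hr
  have := sigmaFinite_measG ((min_le_left n₁ n₂).trans h₁l) ((min_le_right n₁ n₂).trans h₂o)
  exact isImageDensity_rnDeriv (continuous_matrix_mul_prod l m o).measurable hac (hP.mul_prod hQ)

lemma isL1KH_convH (h₁l : n₁ ≤ l) (h₁m : n₁ ≤ m) {P : Matrix (Fin l) (Fin m) ℂ → ℂ}
    (hP : IsL1KG l m n₁ P) {Q : Matrix (Fin m) (Fin m) ℂ → ℂ} (hQ : IsL1KH m n₂ Q) :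
    IsL1KH l (min n₁ n₂) (convH l m n₁ n₂ P Q) := by
  have hf := isImageDensity_convH rfl h₁l h₁m hP.integrable hQ.integrable
  refine ⟨hf.integrable, fun k => ?_⟩
  refine hf.ae_comp_eq (continuous_conj_prod l m).measurable (hP.integrable.mul_prod hQ.integrable)
    ((measurePreserving_mul_measG k).prod (MeasurePreserving.id _)) (measurePreserving_conj_measH k)
    (τ' := fun x => (k⁻¹).1 * x * (k⁻¹).1ᴴ) (measurable_conj_const _) (fun y => ?_) (fun p => ?_) ?_
  · rw [coeK_inv, conjTranspose_conjTranspose]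
    calc _ = (k.1ᴴ * k.1) * y * (k.1ᴴ * k.1) := by simp only [Matrix.mul_assoc]
      _ = y := by rw [coeK_conjTranspose_mul, Matrix.one_mul, Matrix.mul_one]
  · simp only [Prod.map, id, conjTranspose_mul, Matrix.mul_assoc]
  · filter_upwards [(Measure.quasiMeasurePreserving_fst (μ := measG l m n₁)
      (ν := measH m n₂)).ae (hP.invariant k 1)] with p hp
    have h1 : ((1 : K m) : Matrix (Fin m) (Fin m) ℂ) = 1 := rfl
    rw [h1, Matrix.mul_one] at hp
    simp only [Prod.map, id, hp]

lemma isL1KG_convG (h₁l : n₁ ≤ l) (h₁m : n₁ ≤ m) (h₂m : n₂ ≤ m) (h₂o : n₂ ≤ o)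
    {P : Matrix (Fin l) (Fin m) ℂ → ℂ} (hP : IsL1KG l m n₁ P)
    {Q : Matrix (Fin m) (Fin o) ℂ → ℂ} (hQ : IsL1KG m o n₂ Q) :
    IsL1KG l o (min n₁ n₂) (convG l m o n₁ n₂ P Q) := by
  have hf := isImageDensity_convG rfl h₁l h₁m h₂m h₂o hP.integrable hQ.integrable
  refine ⟨hf.integrable, fun k₁ k₂ => ?_⟩
  refine hf.ae_comp_eq (continuous_matrix_mul_prod l m o).measurable
    (hP.integrable.mul_prod hQ.integrable)
    ((measurePreserving_mul_measG k₁).prod (measurePreserving_measG_mul k₂))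
    ((measurePreserving_measG_mul k₂).comp (measurePreserving_mul_measG k₁))
    (τ' := fun x => (k₁⁻¹).1 * x * (k₂⁻¹).1)
    ((continuous_const.matrix_mul continuous_id).matrix_mul continuous_const).measurable
    (fun y => ?_) (fun p => ?_) ?_
  · rw [coeK_inv, coeK_inv]
    calc _ = (k₁.1ᴴ * k₁.1) * y * (k₂.1 * k₂.1ᴴ) := by
          simp only [Matrix.mul_assoc]
      _ = y := by rw [coeK_conjTranspose_mul, coeK_mul_conjTranspose, Matrix.one_mul, Matrix.mul_one]
  · simp only [Prod.map, Matrix.mul_assoc]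
  · filter_upwards [(Measure.quasiMeasurePreserving_fst (μ := measG l m n₁)
      (ν := measG m o n₂)).ae (hP.invariant k₁ 1), (Measure.quasiMeasurePreserving_snd
      (μ := measG l m n₁) (ν := measG m o n₂)).ae (hQ.invariant 1 k₂)] with p hp hq
    have h1 : ((1 : K m) : Matrix (Fin m) (Fin m) ℂ) = 1 := rfl
    rw [h1, Matrix.mul_one] at hp
    rw [h1, Matrix.one_mul] at hq
    simp only [Prod.map, hp, hq]

lemma ae_conj_mem_GenH (hr : min n₁ n₂ = r) (h₁l : n₁ ≤ l) (h₁m : n₁ ≤ m) :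
    ∀ᵐ p ∂((measG l m n₁).prod (measH m n₂)), p.1 * p.2 * p.1ᴴ ∈ GenH l r :=
  Measure.QuasiMeasurePreserving.ae ⟨(continuous_conj_prod l m).measurable,
    map_conj_absolutelyContinuous hr h₁l h₁m⟩
    (measH_ae_mem_GenH ((hr ▸ min_le_left n₁ n₂ : r ≤ n₁).trans h₁l))

lemma mul_gram (g : Matrix (Fin l) (Fin m) ℂ) (y : Matrix (Fin m) (Fin o) ℂ) :
    g * y * (g * y)ᴴ = g * (y * yᴴ) * gᴴ := by
  simp only [conjTranspose_mul, Matrix.mul_assoc]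

lemma ae_mul_gram_mem_GenH (hr : min n₁ n₂ = r) (h₁l : n₁ ≤ l) (h₁m : n₁ ≤ m) (h₂m : n₂ ≤ m)
    (h₂o : n₂ ≤ o) :
    ∀ᵐ p ∂((measG l m n₁).prod (measG m o n₂)), p.1 * p.2 * (p.1 * p.2)ᴴ ∈ GenH l r :=
  Measure.QuasiMeasurePreserving.ae ⟨(continuous_matrix_mul_prod l m o).measurable,
    map_mul_absolutelyContinuous hr h₁l h₁m h₂m h₂o⟩
    (measG_ae_gram_mem_GenH ((hr ▸ min_le_left n₁ n₂ : r ≤ n₁).trans h₁l)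
      ((hr ▸ min_le_right n₁ n₂ : r ≤ n₂).trans h₂o))

/-- The transform of a convolution on Hermitian matrices unfolds. -/
lemma SPhi_convH (hr : min n₁ n₂ = r) (h₁l : n₁ ≤ l) (h₁m : n₁ ≤ m)
    {P : Matrix (Fin l) (Fin m) ℂ → ℂ} (hP : Integrable P (measG l m n₁))
    {Q : Matrix (Fin m) (Fin m) ℂ → ℂ} (hQ : Integrable Q (measH m n₂)) {s : Fin r → ℂ}
    {L : Fin r → ZMod 2} (h : SPhiConvExists l m n₁ n₂ P Q s L) :
    SPhiExists l (convH l m n₁ n₂ P Q) s L ∧ SPhi l (convH l m n₁ n₂ P Q) s L =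
      ∫ p, P p.1 * Q p.2 * Phi s L (p.1 * p.2 * p.1ᴴ) ∂((measG l m n₁).prod (measH m n₂)) := by
  obtain ⟨ψ, hψ, hψφ⟩ := exists_measurable_tendsto_Phi
    ((hr ▸ min_le_left n₁ n₂ : r ≤ n₁).trans h₁l) s L
  exact (isImageDensity_convH hr h₁l h₁m hP hQ).integral_kernel (continuous_conj_prod l m)
    (hP.mul_prod hQ) hψ hψφ (ae_conj_mem_GenH hr h₁l h₁m) h

/-- The transform of a convolution on rectangular matrices unfolds. -/
lemma SPsi_convG (hr : min n₁ n₂ = r) (h₁l : n₁ ≤ l) (h₁m : n₁ ≤ m) (h₂m : n₂ ≤ m)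
    (h₂o : n₂ ≤ o) {P : Matrix (Fin l) (Fin m) ℂ → ℂ} (hP : Integrable P (measG l m n₁))
    {Q : Matrix (Fin m) (Fin o) ℂ → ℂ} (hQ : Integrable Q (measG m o n₂)) {s : Fin r → ℂ}
    (h : SPsiConvExists l m o n₁ n₂ P Q s) :
    SPsiExists l o (convG l m o n₁ n₂ P Q) s ∧ SPsi l o (convG l m o n₁ n₂ P Q) s =
      ∫ p, P p.1 * Q p.2 * Psi s (p.1 * p.2) ∂((measG l m n₁).prod (measG m o n₂)) := by
  obtain ⟨ψ, hψ, hψφ⟩ := exists_measurable_tendsto_Phi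
    ((hr ▸ min_le_left n₁ n₂ : r ≤ n₁).trans h₁l) s (Lstd r)
  have hgr : Continuous fun g : Matrix (Fin l) (Fin o) ℂ => g * gᴴ :=
    continuous_id.matrix_mul continuous_id.matrix_conjTranspose
  exact (isImageDensity_convG hr h₁l h₁m h₂m h₂o hP hQ).integral_kernel
    (G := {g | g * gᴴ ∈ GenH l r}) (continuous_matrix_mul_prod l m o)
    (hP.mul_prod hQ) (ψ := fun i g => ψ i (g * gᴴ)) (fun i => (hψ i).comp hgr.measurable)
    (fun g hg hd => hψφ _ hg hd) (ae_mul_gram_mem_GenH hr h₁l h₁m h₂m h₂o) h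

section Factorization

variable {N : ℕ} {Y : Type} [MeasurableSpace Y] {ν : Measure Y} [SFinite ν] {act : K m → Y → Y}
  {X : Y → Matrix (Fin m) (Fin m) ℂ} {P : Matrix (Fin l) (Fin m) ℂ → ℂ} {Q : Y → ℂ}
  {s : Fin r → ℂ} {L : Fin r → ZMod 2}

/-- Factorization of the double integral when the rank of the first factor is at most the rank of
the second. The second variable `y` acts through the Hermitian matrix `X y`. -/
lemma integral_Phi_prod_left (hrN : r ≤ N) (hNm : N ≤ m) (hrl : r ≤ l)
    (hm : Measurable fun p : K m × Y => act p.1 p.2) (hp : ∀ k, MeasurePreserving (act k) ν ν)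
    (hX : ∀ k y, X (act k y) = k.1 * X y * k.1ᴴ) (hQ : AEStronglyMeasurable Q ν)
    (hinv : ∀ k, ∀ᵐ y ∂ν, Q (act k y) = Q y) (hXg : ∀ᵐ y ∂ν, X y ∈ GenH m N)
    (hg : ∀ᵐ p ∂((measG l m r).prod ν), p.1 * X p.2 * p.1ᴴ ∈ GenH l r)
    (hφ : TransformExists ((measG l m r).prod ν) (fun p => P p.1 * Q p.2)
      (fun p => PhiDefined s L (p.1 * X p.2 * p.1ᴴ)) fun p => Phi s L (p.1 * X p.2 * p.1ᴴ))
    (h₁ : ∀ᵐ g ∂(measG l m r), P g ≠ 0 → PsiDefined s g)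
    (h₂ : ∀ᵐ y ∂ν, Q y ≠ 0 → PhiDefined (tildeS N s) (tildeL N L) (X y))
    (hc : NormCDefined m N (tildeS N s)) :
    ∫ p, P p.1 * Q p.2 * Phi s L (p.1 * X p.2 * p.1ᴴ) ∂((measG l m r).prod ν) =
      normC m N (tildeS N s) * ((∫ g, P g * Psi s g ∂(measG l m r)) *
        ∫ y, Q y * Phi (tildeS N s) (tildeL N L) (X y) ∂ν) := by
  refine integral_prod_of_average hm hp hX hQ hinv
    (D := fun x => x ∈ GenH l r ∧ PhiDefined s L x) ⟨?_, hφ.2⟩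
    (D₁ := fun g => g * gᴴ ∈ GenH l r ∧ PsiDefined s g)
    (D₂ := fun y => X y ∈ GenH m N ∧ PhiDefined (tildeS N s) (tildeL N L) (X y)) ?_ ?_ ?_
  · filter_upwards [hg, hφ.1] with p a b c using ⟨a, b c⟩
  · filter_upwards [measG_ae_gram_mem_GenH hrl (hrN.trans hNm), h₁] with g a b c using ⟨a, b c⟩
  · filter_upwards [hXg, h₂] with y a b c using ⟨a, b c⟩
  · intro g y hg hy hz hzi
    exact integral_Phi_conj_left hrN hNm hrl hg.1 hy.1 (hz.mono fun _ h => h.1)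
      (hz.mono fun _ h => h.2) hzi hg.2 hy.2 hc

/-- Factorization of the double integral when the rank of the second factor is at most the rank of
the first. The second variable `y` acts through the Hermitian matrix `X y`. -/
lemma integral_Phi_prod_right (hrN : r ≤ N) (hNm : N ≤ m) (hNl : N ≤ l)
    (hm : Measurable fun p : K m × Y => act p.1 p.2) (hp : ∀ k, MeasurePreserving (act k) ν ν)
    (hX : ∀ k y, X (act k y) = k.1 * X y * k.1ᴴ) (hQ : AEStronglyMeasurable Q ν)
    (hinv : ∀ k, ∀ᵐ y ∂ν, Q (act k y) = Q y) (hXg : ∀ᵐ y ∂ν, X y ∈ GenH m r)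
    (hg : ∀ᵐ p ∂((measG l m N).prod ν), p.1 * X p.2 * p.1ᴴ ∈ GenH l r)
    (hφ : TransformExists ((measG l m N).prod ν) (fun p => P p.1 * Q p.2)
      (fun p => PhiDefined s L (p.1 * X p.2 * p.1ᴴ)) fun p => Phi s L (p.1 * X p.2 * p.1ᴴ))
    (h₁ : ∀ᵐ g ∂(measG l m N), P g ≠ 0 → PsiDefined (tildeS N s) g)
    (h₂ : ∀ᵐ y ∂ν, Q y ≠ 0 → PhiDefined s L (X y)) (hc : NormCDefined m N (tildeS N s)) :
    ∫ p, P p.1 * Q p.2 * Phi s L (p.1 * X p.2 * p.1ᴴ) ∂((measG l m N).prod ν) =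
      normC m N (tildeS N s) * ((∫ g, P g * Psi (tildeS N s) g ∂(measG l m N)) *
        ∫ y, Q y * Phi s L (X y) ∂ν) := by
  refine integral_prod_of_average hm hp hX hQ hinv
    (D := fun x => x ∈ GenH l r ∧ PhiDefined s L x) ⟨?_, hφ.2⟩
    (D₁ := fun g => g * gᴴ ∈ GenH l N ∧ PsiDefined (tildeS N s) g)
    (D₂ := fun y => X y ∈ GenH m r ∧ PhiDefined s L (X y)) ?_ ?_ ?_
  · filter_upwards [hg, hφ.1] with p a b c using ⟨a, b c⟩
  · filter_upwards [measG_ae_gram_mem_GenH hNl hNm, h₁] with g a b c using ⟨a, b c⟩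
  · filter_upwards [hXg, h₂] with y a b c using ⟨a, b c⟩
  · intro g y hg hy hz hzi
    exact integral_Phi_conj_right hrN hNm hNl hg.1 hy.1 (hz.mono fun _ h => h.1)
      (hz.mono fun _ h => h.2) hzi hg.2 hy.2 hc

end Factorization

lemma measurable_conj_act (m : ℕ) :
    Measurable fun p : K m × Matrix (Fin m) (Fin m) ℂ => p.1.1 * p.2 * p.1.1ᴴ :=
  (((continuous_coeK m).comp continuous_fst).matrix_mul continuous_snd |>.matrix_mul
    ((continuous_coeK m).comp continuous_fst).matrix_conjTranspose).measurable

lemma measurable_mul_act (m o : ℕ) :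
    Measurable fun p : K m × Matrix (Fin m) (Fin o) ℂ => p.1.1 * p.2 :=
  (((continuous_coeK m).comp continuous_fst).matrix_mul continuous_snd).measurable

lemma IsL1KG.ae_mul_eq {Q : Matrix (Fin m) (Fin o) ℂ → ℂ} (hQ : IsL1KG m o n₂ Q) (k : K m) :
    ∀ᵐ y ∂(measG m o n₂), Q (k.1 * y) = Q y := by
  have h1 : ((1 : K o) : Matrix (Fin o) (Fin o) ℂ) = 1 := rfl
  filter_upwards [hQ.invariant k 1] with y hy
  rwa [h1, Matrix.mul_one] at hy

/-- The hypothesis on the double integral, in terms of Gram matrices. -/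
lemma SPsiConvExists.gram {P : Matrix (Fin l) (Fin m) ℂ → ℂ} {Q : Matrix (Fin m) (Fin o) ℂ → ℂ}
    {s : Fin r → ℂ} (h : SPsiConvExists l m o n₁ n₂ P Q s) :
    TransformExists ((measG l m n₁).prod (measG m o n₂)) (fun p => P p.1 * Q p.2)
      (fun p => PhiDefined s (Lstd r) (p.1 * (p.2 * p.2ᴴ) * p.1ᴴ))
      fun p => Phi s (Lstd r) (p.1 * (p.2 * p.2ᴴ) * p.1ᴴ) := by
  simpa only [SPsiConvExists, PsiDefined, Psi, mul_gram] using h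

end SphericalTransform

end

theorem corollary1 (l m o n₁ n₂ : ℕ) (hn₁ : 1 ≤ n₁) (hn₂ : 1 ≤ n₂)
    (hn₁l : n₁ ≤ l) (hn₁m : n₁ ≤ m) (hn₂m : n₂ ≤ m)
    (P : Matrix (Fin l) (Fin m) ℂ → ℂ) (hP : IsL1KG l m n₁ P) :
    (∀ Q : Matrix (Fin m) (Fin m) ℂ → ℂ, IsL1KH m n₂ Q →
      IsL1KH l (min n₁ n₂) (convH l m n₁ n₂ P Q) ∧
      (measH l (min n₁ n₂)).withDensityᵥ (convH l m n₁ n₂ P Q) = convMeasH l m n₁ n₂ P Q ∧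
      (n₁ ≤ n₂ → ∀ (s : Fin n₁ → ℂ) (L : Fin n₁ → ZMod 2),
        SPhiConvExists l m n₁ n₂ P Q s L →
        SPsiExists l m P s →
        SPhiExists m Q (tildeS n₂ s) (tildeL n₂ L) →
        NormCDefined m n₂ (tildeS n₂ s) →
        SPhiExists l (convH l m n₁ n₂ P Q) s L ∧
        SPhi l (convH l m n₁ n₂ P Q) s L =
          normC m n₂ (tildeS n₂ s) *
            (SPsi l m P s * SPhi m Q (tildeS n₂ s) (tildeL n₂ L))) ∧
      (n₂ ≤ n₁ → ∀ (s : Fin n₂ → ℂ) (L : Fin n₂ → ZMod 2),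
        SPhiConvExists l m n₁ n₂ P Q s L →
        SPsiExists l m P (tildeS n₁ s) →
        SPhiExists m Q s L →
        NormCDefined m n₁ (tildeS n₁ s) →
        SPhiExists l (convH l m n₁ n₂ P Q) s L ∧
        SPhi l (convH l m n₁ n₂ P Q) s L =
          normC m n₁ (tildeS n₁ s) *
            (SPsi l m P (tildeS n₁ s) * SPhi m Q s L))) ∧
    (n₂ ≤ o → ∀ Q : Matrix (Fin m) (Fin o) ℂ → ℂ, IsL1KG m o n₂ Q →
      IsL1KG l o (min n₁ n₂) (convG l m o n₁ n₂ P Q) ∧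
      (measG l o (min n₁ n₂)).withDensityᵥ (convG l m o n₁ n₂ P Q) =
        convMeasG l m o n₁ n₂ P Q ∧
      (n₁ ≤ n₂ → ∀ s : Fin n₁ → ℂ,
        SPsiConvExists l m o n₁ n₂ P Q s →
        SPsiExists l m P s →
        SPsiExists m o Q (tildeS n₂ s) →
        NormCDefined m n₂ (tildeS n₂ s) →
        SPsiExists l o (convG l m o n₁ n₂ P Q) s ∧
        SPsi l o (convG l m o n₁ n₂ P Q) s =
          normC m n₂ (tildeS n₂ s) * (SPsi l m P s * SPsi m o Q (tildeS n₂ s))) ∧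
      (n₂ ≤ n₁ → ∀ s : Fin n₂ → ℂ,
        SPsiConvExists l m o n₁ n₂ P Q s →
        SPsiExists l m P (tildeS n₁ s) →
        SPsiExists m o Q s →
        NormCDefined m n₁ (tildeS n₁ s) →
        SPsiExists l o (convG l m o n₁ n₂ P Q) s ∧
        SPsi l o (convG l m o n₁ n₂ P Q) s =
          normC m n₁ (tildeS n₁ s) * (SPsi l m P (tildeS n₁ s) * SPsi m o Q s))) := by
  refine ⟨fun Q hQ => ⟨isL1KH_convH hn₁l hn₁m hP hQ, ?_, fun h s L hd hP' hQ' hc => ?_,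
    fun h s L hd hP' hQ' hc => ?_⟩, fun hn₂o Q hQ => ⟨isL1KG_convG hn₁l hn₁m hn₂m hn₂o hP hQ, ?_,
    fun h s hd hP' hQ' hc => ?_, fun h s hd hP' hQ' hc => ?_⟩⟩
  · exact (isImageDensity_convH rfl hn₁l hn₁m hP.integrable hQ.integrable).withDensityᵥ_eq
      (continuous_conj_prod l m).measurable (hP.integrable.mul_prod hQ.integrable)
  · obtain ⟨h1, h2⟩ := SPhi_convH (min_eq_left h) hn₁l hn₁m hP.integrable hQ.integrable hd
    refine ⟨h1, h2.trans ?_⟩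
    exact integral_Phi_prod_left (X := fun y => y) (act := fun k y => k.1 * y * k.1ᴴ) h hn₂m hn₁l
      (measurable_conj_act m) measurePreserving_conj_measH (fun _ _ => rfl) hQ.integrable.1
      hQ.invariant (measH_ae_mem_GenH hn₂m) (ae_conj_mem_GenH (min_eq_left h) hn₁l hn₁m) hd
      hP'.1 hQ'.1 hc
  · obtain ⟨h1, h2⟩ := SPhi_convH (min_eq_right h) hn₁l hn₁m hP.integrable hQ.integrable hd
    refine ⟨h1, h2.trans ?_⟩
    exact integral_Phi_prod_right (X := fun y => y) (act := fun k y => k.1 * y * k.1ᴴ) h hn₁m hn₁l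
      (measurable_conj_act m) measurePreserving_conj_measH (fun _ _ => rfl) hQ.integrable.1
      hQ.invariant (measH_ae_mem_GenH hn₂m) (ae_conj_mem_GenH (min_eq_right h) hn₁l hn₁m) hd
      hP'.1 hQ'.1 hc
  · exact (isImageDensity_convG rfl hn₁l hn₁m hn₂m hn₂o hP.integrable
      hQ.integrable).withDensityᵥ_eq (continuous_matrix_mul_prod l m o).measurable
      (hP.integrable.mul_prod hQ.integrable)
  · obtain ⟨h1, h2⟩ := SPsi_convG (min_eq_left h) hn₁l hn₁m hn₂m hn₂o hP.integrable
      hQ.integrable hd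
    refine ⟨h1, h2.trans ?_⟩
    have hg := ae_mul_gram_mem_GenH (min_eq_left h) hn₁l hn₁m hn₂m hn₂o
    simp only [mul_gram] at hg
    have := integral_Phi_prod_left (X := fun y => y * yᴴ) (act := fun k y => k.1 * y) h hn₂m hn₁l
      (measurable_mul_act m o) measurePreserving_mul_measG
      (fun k y => by rw [conjTranspose_mul]; simp only [Matrix.mul_assoc]) hQ.integrable.1
      hQ.ae_mul_eq (measG_ae_gram_mem_GenH hn₂m hn₂o) hg (SPsiConvExists.gram hd) hP'.1
      (by rw [tildeL_Lstd h]; exact hQ'.1) hc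
    rw [tildeL_Lstd h] at this
    simp only [Psi, mul_gram] at this ⊢
    exact this
  · obtain ⟨h1, h2⟩ := SPsi_convG (min_eq_right h) hn₁l hn₁m hn₂m hn₂o hP.integrable
      hQ.integrable hd
    refine ⟨h1, h2.trans ?_⟩
    have hg := ae_mul_gram_mem_GenH (min_eq_right h) hn₁l hn₁m hn₂m hn₂o
    simp only [mul_gram] at hg
    have := integral_Phi_prod_right (X := fun y => y * yᴴ) (act := fun k y => k.1 * y) h hn₁m hn₁l
      (measurable_mul_act m o) measurePreserving_mul_measG
      (fun k y => by rw [conjTranspose_mul]; simp only [Matrix.mul_assoc]) hQ.integrable.1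
      hQ.ae_mul_eq (measG_ae_gram_mem_GenH hn₂m hn₂o) hg (SPsiConvExists.gram hd) hP'.1
      hQ'.1 hc
    simp only [Psi, SPsi, mul_gram] at this ⊢
    exact this
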